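/- Let $M$ be a smooth $n$-manifold with tangent bundle $TM$, let $V=\widetilde{TM}$ be $TM$ without its null section, and let $L:TM\to\mathbb R$ be a regular Lagrangian: $L$ is continuous, smooth on $V$, and its Hessian $g_{ij}=\frac12\,\partial^2L/\partial y^i\partial y^j$ is nondegenerate and of constant signature on $V$. The Finsler case is $L=F^2$, with $F$ continuous on $TM$, smooth on $V$ and positively homogeneous of degree one in $y$. *Canonical structures.* In natural coordinates $(x^i,y^a)$ put $$G^i=\tfrac14g^{ij}\Big(\frac{\partial^2L}{\partial y^j\partial x^k}y^k-\frac{\partial L}{\partial x^j}\Big),\quad N^a_j=\frac{\partial G^a}{\partial y^j},\quad e_i=\partial_{x^i}-N^a_i\partial_{y^a},\quad e_a=\partial_{y^a},\quad e^a=dy^a+N^a_i\,dx^i,$$ $${}^L\mathbf g=g_{ij}\,dx^i\otimes dx^j+h_{ab}\,e^a\otimes e^b,\qquad h_{ab}=g_{ab},$$ and let ${}^L\widehat{\mathbf D}$ be the connection on $TV$ with $\widehat{\mathbf D}_{e_k}e_j=L^i_{jk}e_i$, $\widehat{\mathbf D}_{e_k}e_b=L^a_{bk}e_a$, $\widehat{\mathbf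 D}_{e_c}e_j=C^i_{jc}e_i$, $\widehat{\mathbf D}_{e_c}e_b=C^a_{bc}e_a$, where $$L^i_{jk}=\tfrac12g^{ir}(e_kg_{jr}+e_jg_{kr}-e_rg_{jk}),\qquad C^i_{jc}=\tfrac12g^{ik}e_cg_{jk},\qquad C^a_{bc}=\tfrac12h^{ad}(e_ch_{bd}+e_bh_{cd}-e_dh_{bc}),$$ $$L^a_{bk}=e_b(N^a_k)+\tfrac12h^{ac}\big(e_kh_{bc}-h_{dc}\,e_bN^d_k-h_{db}\,e_cN^d_k\big).$$ These formulas define on $V$ a global smooth N-connection ${}^L\mathbf N$ (a splitting $TV=hV\oplus vV$, with $vV$ the vertical bundle), a global d-metric ${}^L\mathbf g$, and a global smooth d-connection ${}^L\widehat{\mathbf D}$ (a linear connection preserving the splitting) with ${}^L\widehat{\mathbf D}\,{}^L\mathbf g=0$. Let $\widehat{\mathbf R}(X,Y)=[\widehat{\mathbf D}_X,\widehat{\mathbf D}_Y]-\widehat{\mathbf D}_{[X,Y]}$ be its curvature. *Untwisted character.* The form $\mathrm{tr}\exp(\widehat{\mathbf R}/2\pi i)$ on $V$ is smooth and closed. For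 any other smooth d-connection on $TV$ the corresponding form is closed and differs from it by an exact form on $V$. *Gerbe modules.* Let $0\to\mathbb Z_k\to\check G_j\to G_j\to1$ ($j=1,2$, $k\ge1$) be central extensions of finite-dimensional Lie groups (with $\check G_j\to G_j$ a covering), $G=G_1\times G_2$, $\check G=\check G_1\times\check G_2$, and let $B\to V$ be a smooth principal $G$-bundle, with lifting bundle gerbe $\Psi$. For $q\in\mathbb Z$, a $\Psi^q$-module is a smooth complex vector bundle of finite rank $W=hW\oplus vW\to B$ with a smooth fibrewise complex linear $\check G$-action that covers the action on $B$, preserves the splitting, and for which $(z_1,z_2)\in\mathbb Z_k\times\mathbb Z_k$ acts on $hW$ as $z_1^q$ and on $vW$ as $z_2^q$ ($\mathbb Z_k\subset U(1)$). A $\Psi^q$-module d-connection is a smooth complex linear $\check G$-equivariant connection on $W$ which preserves $hW\oplus vW$ and which, along the fibres of $B$, is the flat connection whose local parallel sections are given by the $\check G$-action. Then: 1. For every $\Psi^q$-module d-connection $D$ on $W$, with curvature $R$, there is a smooth form $ch(D)$ on $V$ whose pull-back to $B$ is $\mathrm{tr}\exp(R/2\pi i)$. This form is closed, and its de Rham class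 on $V$ does not depend on the choice of $D$. 2. Suppose that $B$ is a bundle of N-adapted orthonormal frames of $({}^L\mathbf N,{}^L\mathbf g)$: each $b\in B$ gives a frame, orthonormal up to fixed signs, of $hV\oplus vV$ at its base point, smoothly and equivariantly for smooth homomorphisms from $G_1$ and $G_2$ to the pseudo-orthogonal group that are isomorphisms on Lie algebras. Let $\rho=\rho_1\oplus\rho_2$, with $\rho_j$ a smooth complex representation of $\check G_j$ on $\mathbb C^{r_j}$ on which $\mathbb Z_k$ acts with weight $q$, and let $W_\rho=B\times(\mathbb C^{r_1}\oplus\mathbb C^{r_2})$ be the associated $\Psi^q$-module. Then ${}^L\widehat{\mathbf D}$ induces a $\Psi^q$-module d-connection on $W_\rho$. Its curvature ${}^LR$ is obtained by applying the infinitesimal representation of $\rho$ to the matrix of $\widehat{\mathbf R}$ in the frames. The canonical twisted Chern character $ch=\mathrm{tr}\exp({}^LR/2\pi i)$ is a smooth closed form on $V$. Its de Rham class equals that of $ch(D)$ for every $\Psi^q$-module d-connection $D$ on $W_\rho$; thus it is a topological invariant of the configuration. -/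

import Mathlib

open scoped Manifold ContDiff Topology
open Bundle

noncomputable section

namespace NAnholonomic

/-! ## Lagrange geometry in natural coordinates `(x, y)` of a tangent bundle -/

/-- The coordinate space `ℝⁿ`. -/
abbrev Eu (n : ℕ) : Type := EuclideanSpace ℝ (Fin n)

section Local

variable {n : ℕ}

/-- The partial derivative `∂f/∂xⁱ`. -/
def pdx (i : Fin n) (f : Eu n × Eu n → ℝ) (z : Eu n × Eu n) : ℝ :=
  fderiv ℝ f z (EuclideanSpace.single i 1, 0)

/-- The partial derivative `∂f/∂yᵃ`. -/
def pdy (a : Fin n) (f : Eu n × Eu n → ℝ) (z : Eu n × Eu n) : ℝ :=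
  fderiv ℝ f z (0, EuclideanSpace.single a 1)

/-- The Hessian `g_ij = (1/2) ∂²L/∂yⁱ∂yʲ`. -/
def hessLoc (l : Eu n × Eu n → ℝ) (z : Eu n × Eu n) : Matrix (Fin n) (Fin n) ℝ :=
  Matrix.of fun i j => (1 / 2) * pdy i (pdy j l) z

/-- The coefficients `Gⁱ` of the canonical semispray `yⁱ ∂/∂xⁱ - 2 Gⁱ ∂/∂yⁱ`, that is
`2 Gⁱ = (1/2) gⁱʲ (∂²L/∂yʲ∂xᵏ yᵏ - ∂L/∂xʲ)`. -/
def sprayLoc (l : Eu n × Eu n → ℝ) (i : Fin n) (z : Eu n × Eu n) : ℝ :=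
  (1 / 4) * ∑ j, (hessLoc l z)⁻¹ i j * ((∑ k, pdx k (pdy j l) z * z.2 k) - pdx j l z)

/-- The coefficients `Nᵃ_j = ∂Gᵃ/∂yʲ` of the canonical N-connection. -/
def nLoc (l : Eu n × Eu n → ℝ) (z : Eu n × Eu n) : Matrix (Fin n) (Fin n) ℝ :=
  Matrix.of fun a j => pdy j (sprayLoc l a) z

/-- The N-elongated derivative `e_k = ∂_k - Nᵃ_k ∂_a`. -/
def elong (N : Eu n × Eu n → Matrix (Fin n) (Fin n) ℝ) (k : Fin n) (f : Eu n × Eu n → ℝ)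
    (z : Eu n × Eu n) : ℝ :=
  pdx k f z - ∑ a, N z a k * pdy a f z

/-- The v-components `eᵃ(X) = Xᵃ + Nᵃ_i Xⁱ` of a vector in the N-adapted frame `(e_i, ∂_a)`;
its h-components are `X.1`. -/
def vcomp (N : Matrix (Fin n) (Fin n) ℝ) : (Eu n × Eu n) →L[ℝ] Eu n :=
  ContinuousLinearMap.snd ℝ (Eu n) (Eu n)
    + (Matrix.toEuclideanCLM (𝕜 := ℝ) N).comp (ContinuousLinearMap.fst ℝ (Eu n) (Eu n))

/-- The vector `Aⁱ e_i + Bᵃ ∂_a`, in coordinates. -/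
def fromAdapted (N : Matrix (Fin n) (Fin n) ℝ) : (Eu n × Eu n) →L[ℝ] (Eu n × Eu n) :=
  (ContinuousLinearMap.fst ℝ (Eu n) (Eu n)).prod (ContinuousLinearMap.snd ℝ (Eu n) (Eu n)
    - (Matrix.toEuclideanCLM (𝕜 := ℝ) N).comp (ContinuousLinearMap.fst ℝ (Eu n) (Eu n)))

section CanonicalDConnection

variable (N g h : Eu n × Eu n → Matrix (Fin n) (Fin n) ℝ)

/-- `Lⁱ_jk = (1/2) gⁱʳ (e_k g_jr + e_j g_kr - e_r g_jk)`. -/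
def coefLh (z : Eu n × Eu n) (i j k : Fin n) : ℝ :=
  (1 / 2) * ∑ r, (g z)⁻¹ i r * (elong N k (fun w => g w j r) z
    + elong N j (fun w => g w k r) z - elong N r (fun w => g w j k) z)

/-- `Lᵃ_bk = ∂_b Nᵃ_k + (1/2) hᵃᶜ (e_k h_bc - h_dc ∂_b Nᵈ_k - h_db ∂_c Nᵈ_k)`. -/
def coefLv (z : Eu n × Eu n) (a b k : Fin n) : ℝ :=
  pdy b (fun w => N w a k) z + (1 / 2) * ∑ c, (h z)⁻¹ a c * (elong N k (fun w => h w b c) z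
    - (∑ d, h z d c * pdy b (fun w => N w d k) z)
    - ∑ d, h z d b * pdy c (fun w => N w d k) z)

/-- `Cⁱ_jc = (1/2) gⁱᵏ ∂_c g_jk`. -/
def coefCh (z : Eu n × Eu n) (i j c : Fin n) : ℝ :=
  (1 / 2) * ∑ k, (g z)⁻¹ i k * pdy c (fun w => g w j k) z

/-- `Cᵃ_bc = (1/2) hᵃᵈ (∂_c h_bd + ∂_b h_cd - ∂_d h_bc)`. -/
def coefCv (z : Eu n × Eu n) (a b c : Fin n) : ℝ :=
  (1 / 2) * ∑ d, (h z)⁻¹ a d * (pdy c (fun w => h w b d) z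
    + pdy b (fun w => h w c d) z - pdy d (fun w => h w b c) z)

/-- The derivative `D_X Y` for the canonical d-connection of the d-metric
`g_ij eⁱ ⊗ eʲ + h_ab eᵃ ⊗ eᵇ` and the N-connection `N`. In the N-adapted frame
`D_{e_k} e_j = Lⁱ_jk e_i`, `D_{∂_c} e_j = Cⁱ_jc e_i`, `D_{e_k} ∂_b = Lᵃ_bk ∂_a` and
`D_{∂_c} ∂_b = Cᵃ_bc ∂_a`. -/
def covLoc (Y : Eu n × Eu n → Eu n × Eu n) (z : Eu n × Eu n) :
    (Eu n × Eu n) →L[ℝ] (Eu n × Eu n) :=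
  let Yh : Eu n × Eu n → Eu n := fun w => (Y w).1
  let Yv : Eu n × Eu n → Eu n := fun w => vcomp (N w) (Y w)
  let e : Fin n → (Eu n × Eu n) →L[ℝ] ℝ := fun k =>
    (EuclideanSpace.proj k).comp (ContinuousLinearMap.fst ℝ (Eu n) (Eu n))
  let e' : Fin n → (Eu n × Eu n) →L[ℝ] ℝ := fun c => (EuclideanSpace.proj c).comp (vcomp (N z))
  (fromAdapted (N z)).comp (ContinuousLinearMap.prod
    (fderiv ℝ Yh z
      + ∑ k, (e k).smulRight (WithLp.toLp 2 fun i => ∑ j, coefLh N g z i j k * Yh z j : Eu n)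
      + ∑ c, (e' c).smulRight (WithLp.toLp 2 fun i => ∑ j, coefCh g z i j c * Yh z j : Eu n))
    (fderiv ℝ Yv z
      + ∑ k, (e k).smulRight (WithLp.toLp 2 fun a => ∑ b, coefLv N h z a b k * Yv z b : Eu n)
      + ∑ c, (e' c).smulRight (WithLp.toLp 2 fun a => ∑ b, coefCv h z a b c * Yv z b : Eu n)))

end CanonicalDConnection

/-- The Sasaki type d-metric `g_ij eⁱ ⊗ eʲ + g_ij eᵃ ⊗ eᵇ`. -/
def sasakiLoc (N g : Matrix (Fin n) (Fin n) ℝ) (X Y : Eu n × Eu n) : ℝ :=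
  ∑ i, ∑ j, g i j * X.1 i * Y.1 j + ∑ a, ∑ b, g a b * vcomp N X a * vcomp N Y b

end Local

/-! ## Connections, curvature and differential forms on an open subset of a manifold -/

section Manifold

variable {E : Type*} [NormedAddCommGroup E] [NormedSpace ℝ E]
  {H : Type*} [TopologicalSpace H] {I : ModelWithCorners ℝ E H}
  {X : Type*} [TopologicalSpace X] [ChartedSpace H X] [IsManifold I 1 X]

/-- Smooth vector fields on `U` (with arbitrary values outside `U`). -/
def SmoothFieldOn (U : Set X) (Y : Π x : X, TangentSpace I x) : Prop :=
  ContMDiffOn I I.tangent ∞ (fun x => (⟨x, Y x⟩ : TangentBundle I X)) U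

section Connection

variable (F : Type*) [NormedAddCommGroup F] [NormedSpace ℝ F]
  {W : X → Type*} [TopologicalSpace (TotalSpace F W)]
  [∀ x, AddCommGroup (W x)] [∀ x, Module ℝ (W x)] [∀ x, TopologicalSpace (W x)]
  [∀ x, IsTopologicalAddGroup (W x)] [∀ x, ContinuousSMul ℝ (W x)] [FiberBundle F W]

/-- Smooth sections of a vector bundle on `U` (with arbitrary values outside `U`). -/
def SmoothSectionOn (U : Set X) (s : Π x : X, W x) : Prop :=
  ContMDiffOn I (I.prod 𝓘(ℝ, F)) ∞ (fun x => TotalSpace.mk' F x (s x)) U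

/-- Smooth linear connections over the open set `V`; `D s x v` is `(D_v s)(x)`. -/
structure IsSmoothConnectionOn [VectorBundle ℝ F W] (V : Set X)
    (D : (Π x : X, W x) → (Π x : X, TangentSpace I x →L[ℝ] W x)) : Prop where
  isCov : IsCovariantDerivativeOn F D V
  smooth : ∀ U ⊆ V, IsOpen U → ContMDiffCovariantDerivativeOn F ∞ D U

/-- `R(Y, Z) = D_Y D_Z - D_Z D_Y - D_[Y, Z]` on `V`. -/
def IsCurvatureOn (V : Set X) (D : (Π x : X, W x) → (Π x : X, TangentSpace I x →L[ℝ] W x))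
    (R : Π x : X, TangentSpace I x → TangentSpace I x → W x → W x) : Prop :=
  ∀ U ⊆ V, IsOpen U → ∀ (Y Z : Π x : X, TangentSpace I x) (s : Π x : X, W x),
    SmoothFieldOn U Y → SmoothFieldOn U Z → SmoothSectionOn (I := I) F U s → ∀ x ∈ U,
      R x (Y x) (Z x) (s x) = D (fun y => D s y (Z y)) x (Y x) - D (fun y => D s y (Y y)) x (Z x)
        - D s x (VectorField.mlieBracket I Y Z x)

end Connection

variable (I X) in
/-- Complex valued (non-homogeneous) differential forms: `c x m` is the component of degree `m`
at `x`. -/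
abbrev TotalForm : Type _ := Π (x : X) (m : ℕ), TangentSpace I x [⋀^Fin m]→L[ℝ] ℂ

/-- The expression of the degree `m` component of `c` in the chart centred at `w`. -/
def formRep (c : TotalForm I X) (m : ℕ) (w : X) (z : E) : E [⋀^Fin m]→L[ℝ] ℂ :=
  (c ((extChartAt I w).symm z) m).compContinuousLinearMap
    (mfderiv 𝓘(ℝ, E) I (extChartAt I w).symm z)

/-- Smoothness of a differential form on `V`. -/
def SmoothFormOn (V : Set X) (c : TotalForm I X) : Prop :=
  ∀ (m : ℕ) (w : X), ContDiffOn ℝ ∞ (formRep c m w)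
    ((extChartAt I w).target ∩ (extChartAt I w).symm ⁻¹' V)

/-- The exterior derivative, at `x`, of the degree `m` component of `c`. It is computed in the
chart centred at `x`, whose derivative at `x` is the identification `TangentSpace I x = E`. -/
def dForm (c : TotalForm I X) (m : ℕ) (x : X) : TangentSpace I x [⋀^Fin (m + 1)]→L[ℝ] ℂ :=
  extDeriv (E := E) (F := ℂ) (formRep c m x) (extChartAt I x x)

/-- Closed forms on `V`. -/
def IsClosedFormOn (V : Set X) (c : TotalForm I X) : Prop :=
  ∀ x ∈ V, ∀ m : ℕ, dForm c m x = 0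

/-- `c` and `c'` have the same de Rham cohomology class on `V`: `c - c' = dη`. -/
def CohomologousOn (V : Set X) (c c' : TotalForm I X) : Prop :=
  ∃ η : TotalForm I X, SmoothFormOn V η ∧
    ∀ x ∈ V, c x 0 = c' x 0 ∧ ∀ m : ℕ, c x (m + 1) - c' x (m + 1) = dForm η m x

end Manifold

/-- The component of degree `2k` of `tr exp (R / 2πi)`, that is `tr (R ∧ ⋯ ∧ R) / (k! (2πi)ᵏ)`,
for an alternating endomorphism valued 2-form `R` on a vector space `T`. -/
def chernIntegrand {T W : Type*} [AddCommGroup W] [Module ℂ W] (R : T → T → W →ₗ[ℂ] W) (k : ℕ)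
    (Y : Fin (2 * k) → T) : ℂ :=
  (1 / (k.factorial : ℂ)) * (1 / (2 * (Real.pi : ℂ) * Complex.I)) ^ k * ((1 / 2 : ℂ) ^ k
    * ∑ σ : Equiv.Perm (Fin (2 * k)), ((Equiv.Perm.sign σ : ℤ) : ℂ) * LinearMap.trace ℂ W
      (List.ofFn fun j : Fin k =>
        (R (Y (σ ⟨2 * j.1, by omega⟩)) (Y (σ ⟨2 * j.1 + 1, by omega⟩)) : Module.End ℂ W)).prod)

/-! ## Lagrange and Finsler spaces -/

section Lagrange

variable {n : ℕ} {M : Type*} [TopologicalSpace M] [ChartedSpace (Eu n) M]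
  [IsManifold (𝓡 n) ∞ M]

variable (n M) in
/-- The total space `TM`. -/
abbrev TM : Type _ := TangentBundle (𝓡 n) M

variable (n) in
/-- The model of the manifold `TM`; tangent spaces of `TM` are `ℝⁿ × ℝⁿ`, the identification at
`u` being the derivative of the natural chart centred at `u`. -/
abbrev IT : ModelWithCorners ℝ (Eu n × Eu n) (ModelProd (Eu n) (Eu n)) := (𝓡 n).tangent

variable (n M) in
/-- The tangent bundle without its null section. -/
def slit : Set (TM n M) := {u | u.2 ≠ 0}

/-- The natural coordinates `(x, y)` on `TM` centred at `w`. -/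
abbrev coord (w : TM n M) : PartialEquiv (TM n M) (Eu n × Eu n) := extChartAt (IT n) w

/-- The derivative at `u` of the natural coordinates centred at `w`. -/
abbrev dcoord (w u : TM n M) : TangentSpace (IT n) u →L[ℝ] (Eu n × Eu n) :=
  mfderiv (IT n) 𝓘(ℝ, Eu n × Eu n) (coord w) u

/-- A function in natural coordinates. -/
def funRep (L : TM n M → ℝ) (w : TM n M) (z : Eu n × Eu n) : ℝ := L ((coord w).symm z)

/-- A vector field in natural coordinates. -/
def fieldRep (Y : Π u : TM n M, TangentSpace (IT n) u) (w : TM n M) (z : Eu n × Eu n) :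
    Eu n × Eu n :=
  dcoord w ((coord w).symm z) (Y ((coord w).symm z))

/-- The Lagrange Hessian at `u`, in the natural coordinates centred at `u`. -/
def hessian (L : TM n M → ℝ) (u : TM n M) : Matrix (Fin n) (Fin n) ℝ :=
  hessLoc (funRep L u) (coord u u)

/-- Regular Lagrange spaces `(M, L)`. -/
structure IsLagrangeSpace (L : TM n M → ℝ) : Prop where
  continuous : Continuous L
  smooth : ContMDiffOn (IT n) 𝓘(ℝ, ℝ) ∞ L (slit n M)
  regular : ∀ u ∈ slit n M, (hessian L u).det ≠ 0
  signature : ∃ ε : Fin n → ℝ, (∀ i, ε i = 1 ∨ ε i = -1) ∧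
    ∀ u ∈ slit n M, ∃ A : Matrix (Fin n) (Fin n) ℝ,
      A.det ≠ 0 ∧ A.transpose * hessian L u * A = Matrix.diagonal ε

/-- Finsler spaces `(M, F)`: `F` is homogeneous and `F²` is a regular Lagrangian. -/
structure IsFinslerSpace (F : TM n M → ℝ) : Prop where
  continuous : Continuous F
  smooth : ContMDiffOn (IT n) 𝓘(ℝ, ℝ) ∞ F (slit n M)
  homogeneous : ∀ (u : TM n M) (t : ℝ), 0 < t → F ⟨u.1, t • u.2⟩ = t * F u
  lagrange : IsLagrangeSpace fun u => F u ^ 2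

/-- The canonical N-connection of `L` at `u`, as the projection of the tangent space of `TM` onto
its vertical subspace. -/
def lagN (L : TM n M → ℝ) (u : TM n M) : TangentSpace (IT n) u →L[ℝ] TangentSpace (IT n) u :=
  (ContinuousLinearMap.inr ℝ (Eu n) (Eu n)).comp (vcomp (nLoc (funRep L u) (coord u u)))

/-- The canonical d-metric of `L`. -/
def lagG (L : TM n M → ℝ) (u : TM n M) (Y Z : TangentSpace (IT n) u) : ℝ :=
  sasakiLoc (nLoc (funRep L u) (coord u u)) (hessian L u) Y Z

/-- The canonical d-connection of `L`. -/
def lagD (L : TM n M → ℝ) (Y : Π u : TM n M, TangentSpace (IT n) u) (u : TM n M) :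
    TangentSpace (IT n) u →L[ℝ] TangentSpace (IT n) u :=
  covLoc (nLoc (funRep L u)) (hessLoc (funRep L u)) (hessLoc (funRep L u)) (fieldRep Y u)
    (coord u u)

/-- The canonical N-connection, d-metric and d-connection of `L` are given by their coordinate
formulas in all natural coordinates, that is, they are globally defined on the slit tangent
bundle. -/
structure IsGloballyDefined (L : TM n M → ℝ) : Prop where
  nconn : ∀ w, ∀ u ∈ slit n M, u ∈ (coord w).source → ∀ Y : TangentSpace (IT n) u,
    dcoord w u (lagN L u Y)
      = (0, vcomp (nLoc (funRep L w) (coord w u)) (dcoord w u Y))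
  dmetric : ∀ w, ∀ u ∈ slit n M, u ∈ (coord w).source → ∀ Y Z : TangentSpace (IT n) u,
    lagG L u Y Z = sasakiLoc (nLoc (funRep L w) (coord w u)) (hessLoc (funRep L w) (coord w u))
      (dcoord w u Y) (dcoord w u Z)
  dconn : ∀ w, ∀ U ⊆ slit n M, IsOpen U → ∀ Y, SmoothFieldOn U Y → ∀ u ∈ U,
    u ∈ (coord w).source → ∀ Z : TangentSpace (IT n) u,
      dcoord w u (lagD L Y u Z) = covLoc (nLoc (funRep L w)) (hessLoc (funRep L w))
        (hessLoc (funRep L w)) (fieldRep Y w) (coord w u) (dcoord w u Z)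

/-- `N` is a smooth N-connection on the slit tangent bundle: a left splitting of
`0 → vTM → TTM → TTM / vTM → 0`, where the vertical subspace is the kernel of the derivative of
`TM → M`. -/
structure IsNConnection (N : Π u : TM n M, TangentSpace (IT n) u →L[ℝ] TangentSpace (IT n) u) :
    Prop where
  vertical : ∀ u ∈ slit n M, ∀ Y,
    mfderiv (IT n) (𝓡 n) (fun w : TM n M => w.1) u (N u Y) = 0
  splits : ∀ u ∈ slit n M, ∀ Y,
    mfderiv (IT n) (𝓡 n) (fun w : TM n M => w.1) u Y = 0 → N u Y = Y
  smooth : ∀ U ⊆ slit n M, IsOpen U → ∀ Y, SmoothFieldOn U Y →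
    SmoothFieldOn U fun u => N u (Y u)

/-- `D` is a smooth d-connection on the slit tangent bundle: a linear connection which preserves
the splitting of the tangent bundle by the N-connection `N`. -/
structure IsDConnection
    (N : Π u : TM n M, TangentSpace (IT n) u →L[ℝ] TangentSpace (IT n) u)
    (D : (Π u : TM n M, TangentSpace (IT n) u) →
      (Π u : TM n M, TangentSpace (IT n) u →L[ℝ] TangentSpace (IT n) u)) : Prop where
  isConnection : IsSmoothConnectionOn (Eu n × Eu n) (slit n M) D
  adapted : ∀ U ⊆ slit n M, IsOpen U → ∀ Y, SmoothFieldOn U Y → ∀ u ∈ U, ∀ Z,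
    D (fun w => N w (Y w)) u Z = N u (D Y u Z)

/-- `D` is compatible with the metric `g` on the slit tangent bundle. -/
def IsMetricCompatible
    (g : Π u : TM n M, TangentSpace (IT n) u → TangentSpace (IT n) u → ℝ)
    (D : (Π u : TM n M, TangentSpace (IT n) u) →
      (Π u : TM n M, TangentSpace (IT n) u →L[ℝ] TangentSpace (IT n) u)) : Prop :=
  ∀ U ⊆ slit n M, IsOpen U → ∀ Y Y', SmoothFieldOn U Y → SmoothFieldOn U Y' →
    ∀ u ∈ U, ∀ Z, mfderiv (IT n) 𝓘(ℝ, ℝ) (fun w => g w (Y w) (Y' w)) u Z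
      = g u (D Y u Z) (Y' u) + g u (Y u) (D Y' u Z)

/-- `c` is the Chern character form `tr exp (R / 2πi)`, on the slit tangent bundle, of a 2-form `R`
with values in the endomorphisms of its (complexified) tangent bundle. -/
structure IsTangentChernCharacter
    (R : Π u : TM n M, TangentSpace (IT n) u → TangentSpace (IT n) u →
      (TangentSpace (IT n) u →ₗ[ℝ] TangentSpace (IT n) u))
    (c : TotalForm (IT n) (TM n M)) : Prop where
  smooth : SmoothFormOn (slit n M) c
  even : ∀ u ∈ slit n M, ∀ (k : ℕ) (Y : Fin (2 * k) → TangentSpace (IT n) u),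
    c u (2 * k) Y = chernIntegrand (fun Y Z => (R u Y Z).baseChange ℂ) k Y
  odd : ∀ u ∈ slit n M, ∀ k : ℕ, c u (2 * k + 1) = 0

end Lagrange

/-! ## Lifting bundle gerbes and their modules -/

section Gerbe

set_option linter.unusedSectionVars false

/-- A central extension `0 → ℤ_k → Ǧ → G → 1` of Lie groups by the finite cyclic group `ℤ_k`;
the projection is a covering of Lie groups. -/
structure CentralExtension (k : ℕ) (𝔤 : Type*) [NormedAddCommGroup 𝔤] [NormedSpace ℝ 𝔤]
    (Gc G : Type*) [TopologicalSpace Gc] [ChartedSpace 𝔤 Gc] [Group Gc]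
    [TopologicalSpace G] [ChartedSpace 𝔤 G] [Group G] where
  proj : Gc →* G
  incl : Multiplicative (ZMod k) →* Gc
  incl_injective : Function.Injective incl
  proj_surjective : Function.Surjective proj
  ker_proj : proj.ker = incl.range
  central : ∀ z x, incl z * x = x * incl z
  isLocalDiffeomorph : IsLocalDiffeomorph 𝓘(ℝ, 𝔤) 𝓘(ℝ, 𝔤) ∞ proj

/-- The character `z ↦ exp (2πi q z / k)` of weight `q` of `ℤ_k ⊂ U(1)`. -/
def weightChar (k : ℕ) [NeZero k] (q : ℤ) (z : Multiplicative (ZMod k)) : ℂ :=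
  ZMod.stdAddChar (Multiplicative.toAdd z) ^ q

/-- `B` is a smooth principal bundle, with structure group `G`, over the open subset `V` of the
manifold `X`, with projection `pr`. The group acts from the left; the right action is
`b · g = g⁻¹ • b`. -/
structure IsPrincipalBundle {E H EG HG EB : Type*} [NormedAddCommGroup E] [NormedSpace ℝ E]
    [TopologicalSpace H] (I : ModelWithCorners ℝ E H)
    [NormedAddCommGroup EG] [NormedSpace ℝ EG] [TopologicalSpace HG]
    (IG : ModelWithCorners ℝ EG HG) [NormedAddCommGroup EB] [NormedSpace ℝ EB]
    {X G B : Type*} [TopologicalSpace X] [ChartedSpace H X] [TopologicalSpace G]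
    [ChartedSpace HG G] [Group G] [TopologicalSpace B] [ChartedSpace EB B] [MulAction G B]
    (V : Set X) (pr : B → X) : Prop where
  smooth_smul : ContMDiff (IG.prod 𝓘(ℝ, EB)) 𝓘(ℝ, EB) ∞ (fun p : G × B => p.1 • p.2)
  smooth_proj : ContMDiff 𝓘(ℝ, EB) I ∞ pr
  range_proj : Set.range pr = V
  free : ∀ (g : G) (b : B), g • b = b → g = 1
  proj_eq_iff : ∀ b b', pr b = pr b' ↔ ∃ g : G, g • b = b'
  locally_trivial : ∀ u ∈ V, ∃ U ⊆ V, IsOpen U ∧ u ∈ U ∧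
    ∃ (s : X → B) (τ : B → G), ContMDiffOn I 𝓘(ℝ, EB) ∞ s U ∧ (∀ w ∈ U, pr (s w) = w) ∧
      ContMDiffOn 𝓘(ℝ, EB) IG ∞ τ (pr ⁻¹' U) ∧ ∀ b ∈ pr ⁻¹' U, τ b • s (pr b) = b

variable {k : ℕ} [NeZero k]
  {𝔤₁ : Type*} [NormedAddCommGroup 𝔤₁] [NormedSpace ℝ 𝔤₁]
  {𝔤₂ : Type*} [NormedAddCommGroup 𝔤₂] [NormedSpace ℝ 𝔤₂]
  {Gc₁ : Type*} [TopologicalSpace Gc₁] [ChartedSpace 𝔤₁ Gc₁] [Group Gc₁]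
  {G₁ : Type*} [TopologicalSpace G₁] [ChartedSpace 𝔤₁ G₁] [Group G₁]
  {Gc₂ : Type*} [TopologicalSpace Gc₂] [ChartedSpace 𝔤₂ Gc₂] [Group Gc₂]
  {G₂ : Type*} [TopologicalSpace G₂] [ChartedSpace 𝔤₂ G₂] [Group G₂]

/-- The projection `Ǧ → G` of Lie d-groups, that is of pairs of Lie groups (the first one for the
h-components, the second one for the v-components). -/
def dProj (ext₁ : CentralExtension k 𝔤₁ Gc₁ G₁) (ext₂ : CentralExtension k 𝔤₂ Gc₂ G₂) :
    Gc₁ × Gc₂ →* G₁ × G₂ :=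
  ext₁.proj.prodMap ext₂.proj

variable {EB : Type*} [NormedAddCommGroup EB] [NormedSpace ℝ EB]
  {B : Type*} [TopologicalSpace B] [ChartedSpace EB B] [IsManifold 𝓘(ℝ, EB) ∞ B]
  [MulAction (G₁ × G₂) B]

/-- A `Ψ^q`-module for the lifting bundle gerbe `Ψ` of the principal bundle `B` and of the central
extension `Ǧ → G` (the fibre of `Ψ` over a pair `(b, b')` of points of the same fibre of `B` is the
set of the `g` in `Ǧ` whose image in `G` maps `b` to `b'`): a `Ǧ`-equivariant complex vector bundle `W = hW ⊕ vW` over `B` on which the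
isotropy group `ℤ_k × ℤ_k` acts with weight `q`, the first factor on `hW` and the second factor
on `vW`. The splitting is given by the projection `hpart` onto `hW`. -/
structure PsiModule (q : ℤ)
    (ext₁ : CentralExtension k 𝔤₁ Gc₁ G₁) (ext₂ : CentralExtension k 𝔤₂ Gc₂ G₂)
    (EB : Type*) [NormedAddCommGroup EB] [NormedSpace ℝ EB]
    {B : Type*} [TopologicalSpace B] [ChartedSpace EB B] [IsManifold 𝓘(ℝ, EB) ∞ B]
    [MulAction (G₁ × G₂) B]
    (F : Type*) [NormedAddCommGroup F] [NormedSpace ℝ F]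
    (W : B → Type*) [TopologicalSpace (TotalSpace F W)]
    [∀ b, AddCommGroup (W b)] [∀ b, Module ℝ (W b)] [∀ b, Module ℂ (W b)]
    [∀ b, TopologicalSpace (W b)] [FiberBundle F W] where
  act : ∀ (g : Gc₁ × Gc₂) (b : B), W b →ₗ[ℂ] W (dProj ext₁ ext₂ g • b)
  act_one : ∀ (b : B) (w : W b), TotalSpace.mk' F _ (act 1 b w) = TotalSpace.mk' F b w
  act_mul : ∀ (g g' : Gc₁ × Gc₂) (b : B) (w : W b),
    TotalSpace.mk' F _ (act (g * g') b w) = TotalSpace.mk' F _ (act g _ (act g' b w))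
  smooth_act : ContMDiff ((𝓘(ℝ, 𝔤₁).prod 𝓘(ℝ, 𝔤₂)).prod (𝓘(ℝ, EB).prod 𝓘(ℝ, F)))
    (𝓘(ℝ, EB).prod 𝓘(ℝ, F)) ∞ (fun p : (Gc₁ × Gc₂) × TotalSpace F W =>
      TotalSpace.mk' F (dProj ext₁ ext₂ p.1 • p.2.1) (act p.1 p.2.1 p.2.2))
  hpart : ∀ b, W b →ₗ[ℂ] W b
  hpart_idem : ∀ b w, hpart b (hpart b w) = hpart b w
  smooth_hpart : ContMDiff (𝓘(ℝ, EB).prod 𝓘(ℝ, F)) (𝓘(ℝ, EB).prod 𝓘(ℝ, F)) ∞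
    (fun w : TotalSpace F W => TotalSpace.mk' F w.1 (hpart w.1 w.2))
  act_hpart : ∀ g b w, act g b (hpart b w) = hpart _ (act g b w)
  weight : ∀ (z₁ z₂ : Multiplicative (ZMod k)) (b : B) (w : W b),
    TotalSpace.mk' F _ (act (ext₁.incl z₁, ext₂.incl z₂) b w)
      = TotalSpace.mk' F b (weightChar k q z₁ • hpart b w
        + weightChar k q z₂ • (w - hpart b w))

variable {ext₁ : CentralExtension k 𝔤₁ Gc₁ G₁} {ext₂ : CentralExtension k 𝔤₂ Gc₂ G₂} {q : ℤ}
  {F : Type*} [NormedAddCommGroup F] [NormedSpace ℝ F]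
  {W : B → Type*} [TopologicalSpace (TotalSpace F W)]
  [∀ b, AddCommGroup (W b)] [∀ b, Module ℝ (W b)] [∀ b, Module ℂ (W b)]
  [∀ b, TopologicalSpace (W b)] [∀ b, IsTopologicalAddGroup (W b)]
  [∀ b, ContinuousSMul ℝ (W b)] [FiberBundle F W] [VectorBundle ℝ F W]

/-- A `Ψ^q`-module d-connection: a smooth complex linear connection on `W` which preserves the
splitting `W = hW ⊕ vW`, is equivariant (being complex linear, it is then equivariant for
`(U(1) × Ǧ) / ℤ_k`), and coincides along the orbits of `Ǧ`, that is along the fibres of `B`, with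
the canonical flat connection, whose parallel sections are `g • b ↦ g • w`. -/
structure IsPsiConnection (P : PsiModule q ext₁ ext₂ EB F W)
    (D : (Π b : B, W b) → (Π b : B, TangentSpace 𝓘(ℝ, EB) b →L[ℝ] W b)) : Prop where
  isConnection : IsSmoothConnectionOn F Set.univ D
  complex : ∀ (s : Π b : B, W b) (b : B),
    MDifferentiableAt 𝓘(ℝ, EB) (𝓘(ℝ, EB).prod 𝓘(ℝ, F)) (fun b => TotalSpace.mk' F b (s b)) b →
      ∀ Y, D (fun b => Complex.I • s b) b Y = Complex.I • D s b Y
  adapted : ∀ (s : Π b : B, W b) (b : B),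
    MDifferentiableAt 𝓘(ℝ, EB) (𝓘(ℝ, EB).prod 𝓘(ℝ, F)) (fun b => TotalSpace.mk' F b (s b)) b →
      ∀ Y, D (fun b => P.hpart b (s b)) b Y = P.hpart b (D s b Y)
  equivariant : ∀ (g : Gc₁ × Gc₂) (s s' : Π b : B, W b),
    (∀ b, P.act g b (s b) = s' (dProj ext₁ ext₂ g • b)) → ∀ b : B,
    MDifferentiableAt 𝓘(ℝ, EB) (𝓘(ℝ, EB).prod 𝓘(ℝ, F)) (fun b => TotalSpace.mk' F b (s b)) b →
      ∀ Y, P.act g b (D s b Y) = D s' (dProj ext₁ ext₂ g • b)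
        (mfderiv 𝓘(ℝ, EB) 𝓘(ℝ, EB) (fun c : B => dProj ext₁ ext₂ g • c) b Y)
  flat : ∀ (s : Π b : B, W b) (b : B),
    MDifferentiableAt 𝓘(ℝ, EB) (𝓘(ℝ, EB).prod 𝓘(ℝ, F)) (fun b => TotalSpace.mk' F b (s b)) b →
      (∀ᶠ g in 𝓝 (1 : Gc₁ × Gc₂), P.act g b (s b) = s (dProj ext₁ ext₂ g • b)) →
      ∀ ξ, D s (dProj ext₁ ext₂ 1 • b) (mfderiv (𝓘(ℝ, 𝔤₁).prod 𝓘(ℝ, 𝔤₂)) 𝓘(ℝ, EB)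
        (fun g : Gc₁ × Gc₂ => dProj ext₁ ext₂ g • b) 1 ξ) = 0

/-- `c` is the (twisted) Chern character form, on the open subset `V` of the base `X`, of an
endomorphism valued 2-form `R` on `B` which descends to the base: the pull-back of `c` to `B` is
`tr exp (R / 2πi)`. -/
structure IsChernCharacter {E H : Type*} [NormedAddCommGroup E] [NormedSpace ℝ E]
    [TopologicalSpace H] {I : ModelWithCorners ℝ E H} {X : Type*} [TopologicalSpace X]
    [ChartedSpace H X] [IsManifold I 1 X] (V : Set X) (pr : B → X)
    (R : Π b : B, TangentSpace 𝓘(ℝ, EB) b → TangentSpace 𝓘(ℝ, EB) b → (W b →ₗ[ℂ] W b))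
    (c : TotalForm I X) : Prop where
  smooth : SmoothFormOn V c
  even : ∀ b (k : ℕ) (Y : Fin (2 * k) → TangentSpace 𝓘(ℝ, EB) b),
    c (pr b) (2 * k) (fun j => mfderiv 𝓘(ℝ, EB) I pr b (Y j)) = chernIntegrand (R b) k Y
  odd : ∀ x ∈ V, ∀ k : ℕ, c x (2 * k + 1) = 0

variable (F) in
/-- `c` is the (twisted) Chern character form of the connection `D`. -/
def IsChernCharacterOf {E H : Type*} [NormedAddCommGroup E] [NormedSpace ℝ E]
    [TopologicalSpace H] {I : ModelWithCorners ℝ E H} {X : Type*} [TopologicalSpace X]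
    [ChartedSpace H X] [IsManifold I 1 X] (V : Set X) (pr : B → X)
    (D : (Π b : B, W b) → (Π b : B, TangentSpace 𝓘(ℝ, EB) b →L[ℝ] W b))
    (c : TotalForm I X) : Prop :=
  ∃ R : Π b : B, TangentSpace 𝓘(ℝ, EB) b → TangentSpace 𝓘(ℝ, EB) b → (W b →ₗ[ℂ] W b),
    IsCurvatureOn F Set.univ D (fun b Y Z => R b Y Z) ∧ IsChernCharacter V pr R c

/-- A representation of weight `q` of the Lie d-group `Ǧ` on the complex d-vector space
`ℂ^r₁ ⊕ ℂ^r₂`: the h-group acts on the h-part and the v-group on the v-part. -/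
structure DRep (q : ℤ) (ext₁ : CentralExtension k 𝔤₁ Gc₁ G₁)
    (ext₂ : CentralExtension k 𝔤₂ Gc₂ G₂) (r₁ r₂ : ℕ) where
  rep₁ : Gc₁ →* ((Fin r₁ → ℂ) →L[ℂ] (Fin r₁ → ℂ))
  rep₂ : Gc₂ →* ((Fin r₂ → ℂ) →L[ℂ] (Fin r₂ → ℂ))
  smooth₁ : ContMDiff 𝓘(ℝ, 𝔤₁) 𝓘(ℝ, (Fin r₁ → ℂ) →L[ℂ] (Fin r₁ → ℂ)) ∞ rep₁
  smooth₂ : ContMDiff 𝓘(ℝ, 𝔤₂) 𝓘(ℝ, (Fin r₂ → ℂ) →L[ℂ] (Fin r₂ → ℂ)) ∞ rep₂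
  weight₁ : ∀ z w, rep₁ (ext₁.incl z) w = weightChar k q z • w
  weight₂ : ∀ z w, rep₂ (ext₂.incl z) w = weightChar k q z • w

variable {r₁ r₂ : ℕ}

/-- The differential at `1` of a map from a Lie group to a normed space. -/
def diffOne {𝔤 G A : Type*} [NormedAddCommGroup 𝔤] [NormedSpace ℝ 𝔤] [TopologicalSpace G]
    [ChartedSpace 𝔤 G] [Group G] [NormedAddCommGroup A] [NormedSpace ℝ A] (f : G → A) (a : 𝔤) : A :=
  mfderiv 𝓘(ℝ, 𝔤) 𝓘(ℝ, A) f 1 a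

/-- The infinitesimal action of an element of the Lie algebra of `Ǧ`. -/
def DRep.infinitesimal (ρ : DRep q ext₁ ext₂ r₁ r₂) (a : 𝔤₁ × 𝔤₂)
    (w : Fin r₁ ⊕ Fin r₂ → ℂ) : Fin r₁ ⊕ Fin r₂ → ℂ :=
  Sum.elim (diffOne ρ.rep₁ a.1 (w ∘ Sum.inl)) (diffOne ρ.rep₂ a.2 (w ∘ Sum.inr))

variable (B) in
/-- The trivial bundle `B × (ℂ^r₁ ⊕ ℂ^r₂)`. -/
abbrev AssocBundle (r₁ r₂ : ℕ) : B → Type := Bundle.Trivial B (Fin r₁ ⊕ Fin r₂ → ℂ)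

/-- The representation `ρ₁ ⊕ ρ₂` of `Ǧ`. -/
def DRep.act (ρ : DRep q ext₁ ext₂ r₁ r₂) (g : Gc₁ × Gc₂) :
    (Fin r₁ ⊕ Fin r₂ → ℂ) →ₗ[ℂ] (Fin r₁ ⊕ Fin r₂ → ℂ) where
  toFun w := Sum.elim (ρ.rep₁ g.1 (w ∘ Sum.inl)) (ρ.rep₂ g.2 (w ∘ Sum.inr))
  map_add' w w' := by
    ext (i | i)
    · simp [Pi.add_comp]
    · simp [Pi.add_comp]
  map_smul' c w := by
    ext (i | i)
    · simp [Pi.smul_comp]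
    · simp [Pi.smul_comp]

/-- The projection of `ℂ^r₁ ⊕ ℂ^r₂` onto its h-part. -/
def hProj (r₁ r₂ : ℕ) : (Fin r₁ ⊕ Fin r₂ → ℂ) →ₗ[ℂ] (Fin r₁ ⊕ Fin r₂ → ℂ) where
  toFun w := Sum.elim (w ∘ Sum.inl) 0
  map_add' w w' := by
    ext (i | i)
    · simp
    · simp
  map_smul' c w := by
    ext (i | i)
    · simp
    · simp

theorem contMDiff_dProj (ext₁ : CentralExtension k 𝔤₁ Gc₁ G₁)
    (ext₂ : CentralExtension k 𝔤₂ Gc₂ G₂) :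
    ContMDiff (𝓘(ℝ, 𝔤₁).prod 𝓘(ℝ, 𝔤₂)) (𝓘(ℝ, 𝔤₁).prod 𝓘(ℝ, 𝔤₂)) ∞ (dProj ext₁ ext₂) :=
  ext₁.isLocalDiffeomorph.contMDiff.prodMap ext₂.isLocalDiffeomorph.contMDiff

/-- Complex linear maps as real linear maps. -/
def restrictCLM (r : ℕ) :
    ((Fin r → ℂ) →L[ℂ] (Fin r → ℂ)) →L[ℝ] ((Fin r → ℂ) →L[ℝ] (Fin r → ℂ)) :=
  ContinuousLinearMap.restrictScalarsL ℂ (Fin r → ℂ) (Fin r → ℂ) ℝ ℝ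

theorem contMDiff_snd_trivial {A : Type*} [NormedAddCommGroup A] [NormedSpace ℝ A] :
    ContMDiff (𝓘(ℝ, EB).prod 𝓘(ℝ, A)) 𝓘(ℝ, A) ∞
      (fun w : TotalSpace A (Bundle.Trivial B A) => w.2) :=
  fun w => ((Bundle.contMDiffAt_totalSpace).1 (contMDiffAt_id (x := w))).2

/-- The `Ψ^q`-module `B × (ℂ^r₁ ⊕ ℂ^r₂)` associated with a representation of weight `q`, with the
action `g (b, w) = (g • b, ρ(g) w)`. -/
def assocModule (hB : ContMDiff ((𝓘(ℝ, 𝔤₁).prod 𝓘(ℝ, 𝔤₂)).prod 𝓘(ℝ, EB)) 𝓘(ℝ, EB) ∞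
      (fun p : (G₁ × G₂) × B => p.1 • p.2))
    (ρ : DRep q ext₁ ext₂ r₁ r₂) :
    PsiModule q ext₁ ext₂ EB (Fin r₁ ⊕ Fin r₂ → ℂ) (AssocBundle B r₁ r₂) where
  act g _ := ρ.act g
  act_one b w := by
    have h1 : dProj ext₁ ext₂ 1 • b = b := by rw [map_one, one_smul]
    have h2 : ρ.act 1 w = w := by
      ext (i | i)
      · simp [DRep.act]
      · simp [DRep.act]
    rw [h2, h1]
  act_mul g g' b w := by
    have h1 : dProj ext₁ ext₂ (g * g') • b = dProj ext₁ ext₂ g • dProj ext₁ ext₂ g' • b := by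
      rw [map_mul, mul_smul]
    have h2 : ρ.act (g * g') w = ρ.act g (ρ.act g' w) := by
      ext (i | i)
      · simp [DRep.act]
      · simp [DRep.act]
    rw [h2, h1]
  smooth_act := by
    have h0 := contMDiff_snd_trivial (B := B) (EB := EB) (A := Fin r₁ ⊕ Fin r₂ → ℂ)
    intro p
    refine (Bundle.contMDiffAt_totalSpace).2 ⟨?_, ?_⟩
    · exact hB.comp (((contMDiff_dProj ext₁ ext₂).comp contMDiff_fst).prodMk
        ((Bundle.contMDiff_proj _).comp contMDiff_snd)) p
    · have hw := h0.comp (contMDiff_snd (I := 𝓘(ℝ, 𝔤₁).prod 𝓘(ℝ, 𝔤₂)) (M := Gc₁ × Gc₂)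
        (J := 𝓘(ℝ, EB).prod 𝓘(ℝ, Fin r₁ ⊕ Fin r₂ → ℂ))
        (N := TotalSpace (Fin r₁ ⊕ Fin r₂ → ℂ) (AssocBundle B r₁ r₂)))
      have hg := contMDiff_fst (I := 𝓘(ℝ, 𝔤₁).prod 𝓘(ℝ, 𝔤₂)) (M := Gc₁ × Gc₂)
        (J := 𝓘(ℝ, EB).prod 𝓘(ℝ, Fin r₁ ⊕ Fin r₂ → ℂ))
        (N := TotalSpace (Fin r₁ ⊕ Fin r₂ → ℂ) (AssocBundle B r₁ r₂)) (n := ∞)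
      have k₁ := (restrictCLM r₁).contMDiff.comp (ρ.smooth₁.comp (contMDiff_fst.comp hg))
      have k₂ := (restrictCLM r₂).contMDiff.comp (ρ.smooth₂.comp (contMDiff_snd.comp hg))
      have hw' := contMDiff_pi_space.1 hw
      have hw₁ := contMDiff_pi_space.2 fun i : Fin r₁ => hw' (Sum.inl i)
      have hw₂ := contMDiff_pi_space.2 fun i : Fin r₂ => hw' (Sum.inr i)
      have m₁ := contMDiff_pi_space.1 (k₁.clm_apply hw₁)
      have m₂ := contMDiff_pi_space.1 (k₂.clm_apply hw₂)
      refine contMDiff_pi_space.2 ?_ p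
      rintro (i | i)
      · exact m₁ i
      · exact m₂ i
  hpart _ := hProj r₁ r₂
  hpart_idem b w := by
    ext (i | i)
    · simp [hProj]
    · simp [hProj]
  smooth_hpart := by
    have h0 := contMDiff_snd_trivial (B := B) (EB := EB) (A := Fin r₁ ⊕ Fin r₂ → ℂ)
    intro p
    refine (Bundle.contMDiffAt_totalSpace).2 ⟨Bundle.contMDiff_proj _ p, ?_⟩
    refine contMDiff_pi_space.2 ?_ p
    rintro (i | i)
    · exact contMDiff_pi_space.1 h0 (Sum.inl i)
    · exact contMDiff_const
  act_hpart g b w := by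
    ext (i | i)
    · simp [hProj, DRep.act]
    · simp [hProj, DRep.act]
  weight z₁ z₂ b w := by
    have h1 : dProj ext₁ ext₂ (ext₁.incl z₁, ext₂.incl z₂) • b = b := by
      have e₁ : ext₁.proj (ext₁.incl z₁) = 1 := by
        rw [← MonoidHom.mem_ker, ext₁.ker_proj]
        exact ⟨z₁, rfl⟩
      have e₂ : ext₂.proj (ext₂.incl z₂) = 1 := by
        rw [← MonoidHom.mem_ker, ext₂.ker_proj]
        exact ⟨z₂, rfl⟩
      have e : dProj ext₁ ext₂ (ext₁.incl z₁, ext₂.incl z₂) = 1 := Prod.ext e₁ e₂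
      rw [e, one_smul]
    have h2 : ρ.act (ext₁.incl z₁, ext₂.incl z₂) w
        = weightChar k q z₁ • hProj r₁ r₂ w + weightChar k q z₂ • (w - hProj r₁ r₂ w) := by
      ext (i | i)
      · simp [DRep.act, hProj, ρ.weight₁]
      · simp [DRep.act, hProj, ρ.weight₂]
    rw [h2, h1]

/-- A bundle of N-adapted orthonormal frames for the canonical N-connection and d-metric of `L`:
every `b : B` determines an N-adapted orthonormal frame `frame b` at `pr b`, equivariantly for
homomorphisms `σ₁`, `σ₂` of the structure group to the pseudo-orthogonal group which induce
isomorphisms of Lie algebras. Examples are the bundle of all such frames, with group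
`O(p, q) × O(p, q)`, and, when it exists, a reduction to oriented frames. -/
structure AdaptedFrames {n : ℕ} {M : Type*} [TopologicalSpace M] [ChartedSpace (Eu n) M]
    [IsManifold (𝓡 n) ∞ M] (L : TM n M → ℝ)
    (𝔤₁ : Type*) [NormedAddCommGroup 𝔤₁] [NormedSpace ℝ 𝔤₁]
    (𝔤₂ : Type*) [NormedAddCommGroup 𝔤₂] [NormedSpace ℝ 𝔤₂]
    (G₁ : Type*) [TopologicalSpace G₁] [ChartedSpace 𝔤₁ G₁] [Group G₁]
    (G₂ : Type*) [TopologicalSpace G₂] [ChartedSpace 𝔤₂ G₂] [Group G₂]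
    (EB : Type*) [NormedAddCommGroup EB] [NormedSpace ℝ EB]
    {B : Type*} [TopologicalSpace B] [ChartedSpace EB B] [MulAction (G₁ × G₂) B]
    (pr : B → TM n M) where
  ε : Fin n → ℝ
  sign_ε : ∀ i, ε i = 1 ∨ ε i = -1
  σ₁ : G₁ →* (Eu n →L[ℝ] Eu n)
  σ₂ : G₂ →* (Eu n →L[ℝ] Eu n)
  smooth_σ₁ : ContMDiff 𝓘(ℝ, 𝔤₁) 𝓘(ℝ, Eu n →L[ℝ] Eu n) ∞ σ₁
  smooth_σ₂ : ContMDiff 𝓘(ℝ, 𝔤₂) 𝓘(ℝ, Eu n →L[ℝ] Eu n) ∞ σ₂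
  injective_σ₁ : Function.Injective (diffOne (𝔤 := 𝔤₁) σ₁)
  injective_σ₂ : Function.Injective (diffOne (𝔤 := 𝔤₂) σ₂)
  range_σ₁ : Set.range (diffOne (𝔤 := 𝔤₁) σ₁) =
    {A | ∀ x y : Eu n, ∑ i, ε i * A x i * y i + ∑ i, ε i * x i * A y i = 0}
  range_σ₂ : Set.range (diffOne (𝔤 := 𝔤₂) σ₂) =
    {A | ∀ x y : Eu n, ∑ i, ε i * A x i * y i + ∑ i, ε i * x i * A y i = 0}
  frame : Π b : B, (Eu n × Eu n) →L[ℝ] TangentSpace (IT n) (pr b)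
  horizontal : ∀ b x, lagN L (pr b) (frame b (x, 0)) = 0
  vertical : ∀ b y, lagN L (pr b) (frame b (0, y)) = frame b (0, y)
  orthonormal_h : ∀ b (x y : Eu n),
    lagG L (pr b) (frame b (x, 0)) (frame b (y, 0)) = ∑ i, ε i * x i * y i
  orthonormal_v : ∀ b (x y : Eu n),
    lagG L (pr b) (frame b (0, x)) (frame b (0, y)) = ∑ i, ε i * x i * y i
  smooth : ∀ x, ContMDiff 𝓘(ℝ, EB) (IT n).tangent ∞
    (fun b => (⟨pr b, frame b x⟩ : TangentBundle (IT n) (TM n M)))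
  equivariant : ∀ (g : G₁ × G₂) (b : B) (x y : Eu n),
    (⟨pr (g • b), frame (g • b) (σ₁ g.1 x, σ₂ g.2 y)⟩ : TangentBundle (IT n) (TM n M))
      = ⟨pr b, frame b (x, y)⟩

section Induced

variable {n : ℕ} {M : Type*} [TopologicalSpace M] [ChartedSpace (Eu n) M]
    [IsManifold (𝓡 n) ∞ M] {L : TM n M → ℝ} {pr : B → TM n M}

/-- The infinitesimal action on `ℝⁿ ⊕ ℝⁿ` of an element of the Lie algebra of `Ǧ`. -/
def AdaptedFrames.infinitesimal (fr : AdaptedFrames L 𝔤₁ 𝔤₂ G₁ G₂ EB pr)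
    (ext₁ : CentralExtension k 𝔤₁ Gc₁ G₁) (ext₂ : CentralExtension k 𝔤₂ Gc₂ G₂)
    (a : 𝔤₁ × 𝔤₂) (x : Eu n × Eu n) : Eu n × Eu n :=
  (diffOne (fun g => fr.σ₁ (ext₁.proj g)) a.1 x.1, diffOne (fun g => fr.σ₂ (ext₂.proj g)) a.2 x.2)

/-- The connection `D` on the module associated with `ρ` is induced by the canonical d-connection
of `L`: if, along a local section `s` of the frame bundle, the matrix of the canonical d-connection
in the frame `s` is the element `a` of the Lie algebra, then that of `D` is `ρ(a)`. -/
def IsInducedConnection (fr : AdaptedFrames L 𝔤₁ 𝔤₂ G₁ G₂ EB pr)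
    (ρ : DRep q ext₁ ext₂ r₁ r₂)
    (D : (Π b : B, AssocBundle B r₁ r₂ b) →
      (Π b : B, TangentSpace 𝓘(ℝ, EB) b →L[ℝ] AssocBundle B r₁ r₂ b)) : Prop :=
  ∀ U ⊆ slit n M, IsOpen U → ∀ s : TM n M → B, ContMDiffOn (IT n) 𝓘(ℝ, EB) ∞ s U →
    (∀ u ∈ U, pr (s u) = u) → ∀ u ∈ U, ∀ Y : TangentSpace (IT n) u, ∃ a : 𝔤₁ × 𝔤₂,
      (∀ x, lagD L (fun v => (fr.frame (s v) x : Eu n × Eu n)) u Y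
        = fr.frame (s u) (fr.infinitesimal ext₁ ext₂ a x)) ∧
      ∀ w : Fin r₁ ⊕ Fin r₂ → ℂ,
        D (fun _ => w) (s u) (mfderiv (IT n) 𝓘(ℝ, EB) s u Y) = ρ.infinitesimal a w

/-- The endomorphism valued 2-form `R` on the module associated with `ρ` is induced by the
curvature `R₀` of the canonical d-connection: if the matrix of `R₀` in the frame `b` is the element
`a` of the Lie algebra, then `R` is `ρ(a)` at `b`. -/
def IsInducedCurvature (fr : AdaptedFrames L 𝔤₁ 𝔤₂ G₁ G₂ EB pr)
    (ρ : DRep q ext₁ ext₂ r₁ r₂)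
    (R₀ : Π u : TM n M, TangentSpace (IT n) u → TangentSpace (IT n) u →
      (TangentSpace (IT n) u →ₗ[ℝ] TangentSpace (IT n) u))
    (R : Π b : B, TangentSpace 𝓘(ℝ, EB) b → TangentSpace 𝓘(ℝ, EB) b →
      (AssocBundle B r₁ r₂ b →ₗ[ℂ] AssocBundle B r₁ r₂ b)) : Prop :=
  ∀ (b : B) (Y Z : TangentSpace 𝓘(ℝ, EB) b), ∃ a : 𝔤₁ × 𝔤₂,
    (∀ x, R₀ (pr b) (mfderiv 𝓘(ℝ, EB) (IT n) pr b Y) (mfderiv 𝓘(ℝ, EB) (IT n) pr b Z)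
      (fr.frame b x) = fr.frame b (fr.infinitesimal ext₁ ext₂ a x)) ∧
    ∀ w : Fin r₁ ⊕ Fin r₂ → ℂ, R b Y Z w = ρ.infinitesimal a w

end Induced

end Gerbe

end NAnholonomic

end

open NAnholonomic

noncomputable section

namespace NAnholonomic

set_option linter.unusedSectionVars false

/-! ## Chern forms of algebra valued 2-forms on a vector space -/

section PermSum

theorem sum_sign_smul_eq_zero_of_cyclic {m : ℕ} {T : Type*} {F : (Fin m → T) → ℂ}
    {a b d : Fin m} (hab : a ≠ b) (hbd : b ≠ d)
    (hF : ∀ v, F v + F (v ∘ (Equiv.swap a b * Equiv.swap b d : Equiv.Perm (Fin m)))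
      + F (v ∘ (Equiv.swap b d * Equiv.swap a b : Equiv.Perm (Fin m))) = 0) (v : Fin m → T) :
    ∑ σ : Equiv.Perm (Fin m), ((Equiv.Perm.sign σ : ℤ) : ℂ) * F (v ∘ σ) = 0 := by
  have key : ∀ c : Equiv.Perm (Fin m), Equiv.Perm.sign c = 1 →
      ∑ σ : Equiv.Perm (Fin m), ((Equiv.Perm.sign σ : ℤ) : ℂ) * F (v ∘ σ)
        = ∑ σ : Equiv.Perm (Fin m), ((Equiv.Perm.sign σ : ℤ) : ℂ) * F ((v ∘ σ) ∘ c) := by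
    intro c hc
    rw [← Equiv.sum_comp (Equiv.mulRight c)]
    refine Finset.sum_congr rfl fun σ _ => ?_
    simp [Equiv.Perm.sign_mul, hc, Function.comp_assoc, Equiv.Perm.coe_mul]
  have h1 := key (Equiv.swap a b * Equiv.swap b d) (by
    simp [Equiv.Perm.sign_mul, hab, hbd])
  have h2 := key (Equiv.swap b d * Equiv.swap a b) (by
    simp [Equiv.Perm.sign_mul, hab, hbd])
  set S := ∑ σ : Equiv.Perm (Fin m), ((Equiv.Perm.sign σ : ℤ) : ℂ) * F (v ∘ σ) with hS
  have h3 : S + S + S = 0 := by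
    conv_lhs => arg 1; arg 2; rw [h1]
    conv_lhs => arg 2; rw [h2]
    rw [hS, ← Finset.sum_add_distrib, ← Finset.sum_add_distrib]
    refine Finset.sum_eq_zero fun σ _ => ?_
    rw [← mul_add, ← mul_add, hF, mul_zero]
  have h4 : (3 : ℂ) * S = 0 := by linear_combination h3
  simpa using h4

theorem sum_succAbove_perm {m : ℕ} {T : Type*} (F : (Fin (m + 1) → T) → ℂ)
    (v : Fin (m + 1) → T) :
    ∑ i : Fin (m + 1), (-1 : ℤ) ^ (i : ℕ) • ∑ σ : Equiv.Perm (Fin m),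
        ((Equiv.Perm.sign σ : ℤ) : ℂ) * F (Fin.cons (v i) ((i.removeNth v) ∘ σ))
      = ∑ σ : Equiv.Perm (Fin (m + 1)), ((Equiv.Perm.sign σ : ℤ) : ℂ) * F (v ∘ σ) := by
  simp_rw [Finset.smul_sum]
  rw [← Fintype.sum_prod_type']
  let f : Fin (m + 1) × Equiv.Perm (Fin m) → Equiv.Perm (Fin (m + 1)) := fun p =>
    p.1.cycleRange.symm * Equiv.Perm.decomposeFin.symm (0, p.2)
  have f0 : ∀ p, f p 0 = p.1 := fun p => by simp [f, Fin.cycleRange_symm_zero]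
  have fs : ∀ p j, f p (Fin.succ j) = p.1.succAbove (p.2 j) := fun p j => by
    simp [f, Equiv.Perm.decomposeFin_symm_apply_succ, Fin.cycleRange_symm_succ]
  have hf : Function.Bijective f := by
    rw [Fintype.bijective_iff_injective_and_card]
    constructor
    · rintro ⟨i, σ⟩ ⟨j, τ⟩ h
      have hi : i = j := by
        have := f0 (i, σ)
        rw [h, f0] at this
        exact this.symm
      subst hi
      congr 1
      ext l
      have := fs (i, σ) l
      rw [h, fs] at this
      exact congrArg _ (Fin.succAbove_right_injective this.symm)
    · simp [Fintype.card_perm, Nat.factorial_succ]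
  rw [← Function.Bijective.sum_comp hf]
  refine Finset.sum_congr rfl fun p _ => ?_
  have hs : ((Equiv.Perm.sign (f p) : ℤ) : ℂ) = (-1) ^ (p.1 : ℕ) * ((Equiv.Perm.sign p.2 : ℤ) : ℂ) := by
    simp [f, Equiv.Perm.sign_mul, Equiv.Perm.sign_symm, Fin.sign_cycleRange, Equiv.Perm.decomposeFin.symm_sign]
  have hv : v ∘ f p = Fin.cons (v p.1) ((p.1.removeNth v) ∘ p.2) := by
    ext j
    refine Fin.cases ?_ (fun j => ?_) j
    · simp [f0]
    · simp [fs, Fin.removeNth]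
  rw [hs, hv]
  simp [mul_assoc]

end PermSum

section ChernForm

set_option synthInstance.maxHeartbeats 400000
set_option maxHeartbeats 1000000

theorem two_le_infty : (2 : WithTop ℕ∞) ≤ ∞ := by
  exact WithTop.coe_le_coe.2 (le_top : (2 : ℕ∞) ≤ ⊤)

variable {E : Type*} [NormedAddCommGroup E] [NormedSpace ℝ E]
  {𝔸 : Type*} [NormedRing 𝔸] [NormedAlgebra ℝ 𝔸]

instance instNormedAddCommGroupCLM : NormedAddCommGroup (E →L[ℝ] 𝔸) := inferInstance
instance instNormedSpaceCLM : NormedSpace ℝ (E →L[ℝ] 𝔸) := inferInstance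
instance instNormedAddCommGroupCLM₂ : NormedAddCommGroup (E →L[ℝ] E →L[ℝ] 𝔸) := inferInstance
instance instNormedSpaceCLM₂ : NormedSpace ℝ (E →L[ℝ] E →L[ℝ] 𝔸) := inferInstance
instance instAddCommGroupCLM₂ : AddCommGroup (E →L[ℝ] E →L[ℝ] 𝔸) := inferInstance

/-- The values of a 2-form on consecutive pairs of vectors. -/
def pairs (Ω : E →L[ℝ] E →L[ℝ] 𝔸) {k : ℕ} (v : Fin (2 * k) → E) (j : Fin k) : 𝔸 :=
  Ω (v ⟨2 * j.1, by omega⟩) (v ⟨2 * j.1 + 1, by omega⟩)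

theorem pairs_update {k : ℕ} (Ω : E →L[ℝ] E →L[ℝ] 𝔸)
    [DecidableEq (Fin (2 * k))] (v : Fin (2 * k) → E) (i : Fin (2 * k)) (x : E) :
    pairs Ω (Function.update v i x) = Function.update (pairs Ω v) ⟨i.1 / 2, by omega⟩
      (if i.1 % 2 = 0 then Ω x (v ⟨2 * (i.1 / 2) + 1, by omega⟩)
        else Ω (v ⟨2 * (i.1 / 2), by omega⟩) x) := by
  ext j
  rcases eq_or_ne j ⟨i.1 / 2, by omega⟩ with rfl | hj
  · simp only [Function.update_self, pairs]
    split_ifs with h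
    · have e1 : (⟨2 * (i.1 / 2), by omega⟩ : Fin (2 * k)) = i := Fin.ext (by simp; omega)
      have e2 : (⟨2 * (i.1 / 2) + 1, by omega⟩ : Fin (2 * k)) ≠ i := by
        intro e; have := congrArg Fin.val e; simp at this; omega
      rw [e1, Function.update_self, Function.update_of_ne e2]
    · have e1 : (⟨2 * (i.1 / 2) + 1, by omega⟩ : Fin (2 * k)) = i := Fin.ext (by simp; omega)
      have e2 : (⟨2 * (i.1 / 2), by omega⟩ : Fin (2 * k)) ≠ i := by
        intro e; have := congrArg Fin.val e; simp at this; omega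
      rw [e1, Function.update_self, Function.update_of_ne e2]
  · rw [Function.update_of_ne hj, pairs, pairs]
    have hj' : j.1 ≠ i.1 / 2 := fun h => hj (Fin.ext h)
    rw [Function.update_of_ne, Function.update_of_ne] <;>
    · intro e; have := congrArg Fin.val e; simp at this; omega

/-- The multilinear map `Ω(v₀, v₁) Ω(v₂, v₃) ⋯`. -/
def pairProd (Ω : E →L[ℝ] E →L[ℝ] 𝔸) (k : ℕ) :
    ContinuousMultilinearMap ℝ (fun _ : Fin (2 * k) => E) 𝔸 where
  toFun v := ContinuousMultilinearMap.mkPiAlgebraFin ℝ k 𝔸 (pairs Ω v)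
  map_update_add' v i x y := by
    classical
    simp only [pairs_update]
    split_ifs with h
    · rw [map_add, add_apply, ContinuousMultilinearMap.map_update_add]
    · rw [map_add, ContinuousMultilinearMap.map_update_add]
  map_update_smul' v i c x := by
    classical
    simp only [pairs_update]
    split_ifs with h
    · rw [map_smul, smul_apply, ContinuousMultilinearMap.map_update_smul]
    · rw [map_smul, ContinuousMultilinearMap.map_update_smul]
  cont := by
    refine (ContinuousMultilinearMap.cont _).comp (continuous_pi fun j => ?_)
    exact (Ω.continuous.comp (continuous_apply _)).clm_apply (continuous_apply _)

/-- The normalization of the component of degree `2k` of the Chern character. -/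
def chernConst (k : ℕ) : ℂ :=
  (1 / (k.factorial : ℂ)) * (1 / (2 * (Real.pi : ℂ) * Complex.I)) ^ k * (1 / 2 : ℂ) ^ k

/-- The component of degree `2k` of `τ (exp (Ω / 2πi))`. -/
def chernForm (τ : 𝔸 →L[ℝ] ℂ) (Ω : E →L[ℝ] E →L[ℝ] 𝔸) (k : ℕ) : E [⋀^Fin (2 * k)]→L[ℝ] ℂ :=
  chernConst k • (τ.compContinuousMultilinearMap (pairProd Ω k)).alternatization

theorem chernForm_apply (τ : 𝔸 →L[ℝ] ℂ) (Ω : E →L[ℝ] E →L[ℝ] 𝔸) (k : ℕ) (v : Fin (2 * k) → E) :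
    chernForm τ Ω k v = chernConst k * ∑ σ : Equiv.Perm (Fin (2 * k)),
      ((Equiv.Perm.sign σ : ℤ) : ℂ) * τ (List.ofFn (pairs Ω (v ∘ σ))).prod := by
  simp only [chernForm, ContinuousAlternatingMap.smul_apply, smul_eq_mul,
    ContinuousMultilinearMap.alternatization_apply_apply]
  congr 1
  refine Finset.sum_congr rfl fun σ _ => ?_
  rw [Units.smul_def, zsmul_eq_mul]
  congr 2

theorem sum_update_commutator {R : Type*} [Ring R] {k : ℕ} (w : R) (g : Fin k → R) :
    ∑ j, (List.ofFn (Function.update g j (w * g j - g j * w))).prod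
      = w * (List.ofFn g).prod - (List.ofFn g).prod * w := by
  induction k with
  | zero => simp
  | succ k ih =>
    rw [Fin.sum_univ_succ]
    have h : ∀ j : Fin k, (List.ofFn (Function.update g j.succ
        (w * g j.succ - g j.succ * w))).prod = g 0 * (List.ofFn (Function.update
          (fun i : Fin k => g i.succ) j (w * g j.succ - g j.succ * w))).prod := by
      intro j
      rw [List.ofFn_succ, List.prod_cons, Function.update_of_ne (Fin.succ_ne_zero j).symm]
      congr 3
      ext i
      rcases eq_or_ne i j with rfl | hij
      · simp
      · rw [Function.update_of_ne (by simpa using hij), Function.update_of_ne hij]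
    simp_rw [h]
    rw [← Finset.mul_sum, ih fun i => g i.succ]
    rw [List.ofFn_succ, List.ofFn_succ, List.prod_cons, List.prod_cons, Function.update_self]
    have : (fun i : Fin k => Function.update g 0 (w * g 0 - g 0 * w) i.succ)
        = fun i => g i.succ := by
      ext i; rw [Function.update_of_ne (Fin.succ_ne_zero i)]
    rw [this]
    noncomm_ring

/-- A map to a space of alternating forms is smooth if its values on all vectors are. -/
theorem contDiffAt_alternatingMap [FiniteDimensional ℝ E] {D : Type*} [NormedAddCommGroup D]
    [NormedSpace ℝ D] {m : ℕ} {N : WithTop ℕ∞} {f : D → E [⋀^Fin m]→L[ℝ] ℂ} {z : D}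
    (h : ∀ v, ContDiffAt ℝ N (fun w => f w v) z) : ContDiffAt ℝ N f z := by
  let b := Module.finBasis ℝ E
  let Φ : (E [⋀^Fin m]→L[ℝ] ℂ) →ₗ[ℝ] ((Fin m → Fin (Module.finrank ℝ E)) → ℂ) :=
    { toFun := fun φ s => φ fun i => b (s i)
      map_add' := fun _ _ => rfl
      map_smul' := fun _ _ => rfl }
  have hΦ : Function.Injective Φ := by
    intro φ ψ hφ
    apply ContinuousAlternatingMap.toContinuousMultilinearMap_injective
    apply ContinuousMultilinearMap.toMultilinearMap_injective
    exact Module.Basis.ext_multilinear (fun _ => b) fun s => congrFun hφ s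
  obtain ⟨Ψ, hΨ⟩ := Φ.exists_leftInverse_of_injective (LinearMap.ker_eq_bot.2 hΦ)
  have hf : f = fun w => Ψ.toContinuousLinearMap (Φ (f w)) := by
    ext1 w
    exact (LinearMap.congr_fun hΨ (f w)).symm
  rw [hf]
  refine Ψ.toContinuousLinearMap.contDiff.contDiffAt.comp z ?_
  exact contDiffAt_pi.2 fun s => h _

theorem contDiffAt_chernForm_apply (τ : 𝔸 →L[ℝ] ℂ) {D : Type*} [NormedAddCommGroup D]
    [NormedSpace ℝ D] {N : WithTop ℕ∞} {Ω : D → E →L[ℝ] E →L[ℝ] 𝔸} {z : D}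
    (h : ContDiffAt ℝ N Ω z) (k : ℕ) (v : Fin (2 * k) → E) :
    ContDiffAt ℝ N (fun w => chernForm τ (Ω w) k v) z := by
  simp only [chernForm_apply]
  refine contDiffAt_const.mul (ContDiffAt.sum fun σ _ => contDiffAt_const.mul ?_)
  refine τ.contDiff.contDiffAt.comp z ?_
  simp only [← ContinuousMultilinearMap.mkPiAlgebraFin_apply (R := ℝ)]
  refine (ContinuousMultilinearMap.contDiff _).contDiffAt.comp z (contDiffAt_pi.2 fun j => ?_)
  exact (h.clm_apply contDiffAt_const).clm_apply contDiffAt_const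

theorem contDiffAt_chernForm [FiniteDimensional ℝ E] (τ : 𝔸 →L[ℝ] ℂ) {D : Type*}
    [NormedAddCommGroup D] [NormedSpace ℝ D] {N : WithTop ℕ∞} {Ω : D → E →L[ℝ] E →L[ℝ] 𝔸} {z : D}
    (h : ContDiffAt ℝ N Ω z) (k : ℕ) :
    ContDiffAt ℝ N (fun w => chernForm τ (Ω w) k) z :=
  contDiffAt_alternatingMap fun v => contDiffAt_chernForm_apply τ h k v

/-- The curvature `dA + A ∧ A` of a connection form. -/
def curvForm (A : E → E →L[ℝ] 𝔸) (z : E) : E →L[ℝ] E →L[ℝ] 𝔸 :=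
  fderiv ℝ A z - (fderiv ℝ A z).flip
    + ((ContinuousLinearMap.mul ℝ 𝔸).bilinearComp (A z) (A z)
      - ((ContinuousLinearMap.mul ℝ 𝔸).bilinearComp (A z) (A z)).flip)

theorem curvForm_apply (A : E → E →L[ℝ] 𝔸) (z a b : E) :
    curvForm A z a b = fderiv ℝ A z a b - fderiv ℝ A z b a + (A z a * A z b - A z b * A z a) := by
  simp [curvForm]

theorem contDiffAt_curvForm {A : E → E →L[ℝ] 𝔸} {z : E} (h : ContDiffAt ℝ ∞ A z) :
    ContDiffAt ℝ ∞ (curvForm A) z := by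
  have h1 : ContDiffAt ℝ ∞ (fderiv ℝ A) z := h.fderiv_right (m := ∞) (by simp)
  have h2 : ContDiffAt ℝ ∞ (fun w => (ContinuousLinearMap.mul ℝ 𝔸).bilinearComp (A w) (A w)) z := by
    have : (fun w => (ContinuousLinearMap.mul ℝ 𝔸).bilinearComp (A w) (A w))
      = fun w => ((ContinuousLinearMap.compL ℝ E 𝔸 𝔸).flip (A w)).comp
          ((ContinuousLinearMap.mul ℝ 𝔸).comp (A w)) := by
      ext w a b; simp
    rw [this]
    exact ((ContinuousLinearMap.contDiff _).contDiffAt.comp z h).clm_comp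
      (contDiffAt_const.clm_comp h)
  have hfl : ∀ {f : E → E →L[ℝ] E →L[ℝ] 𝔸}, ContDiffAt ℝ ∞ f z →
      ContDiffAt ℝ ∞ (fun w => (f w).flip) z := fun hf =>
    (ContinuousLinearMap.flipₗᵢ ℝ E E 𝔸).toContinuousLinearEquiv.toContinuousLinearMap.contDiff.contDiffAt.comp z hf
  exact (h1.sub (hfl h1)).add (h2.sub (hfl h2))

theorem fderiv_curvForm_apply {A : E → E →L[ℝ] 𝔸} {z : E} (h : ContDiffAt ℝ ∞ A z) (v a b : E) :
    fderiv ℝ (curvForm A) z v a b = fderiv ℝ (fderiv ℝ A) z v a b - fderiv ℝ (fderiv ℝ A) z v b a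
      + (fderiv ℝ A z v a * A z b + A z a * fderiv ℝ A z v b
        - (fderiv ℝ A z v b * A z a + A z b * fderiv ℝ A z v a)) := by
  have h0 : HasFDerivAt A (fderiv ℝ A z) z := (h.differentiableAt (by simp)).hasFDerivAt
  have h1 : HasFDerivAt (fderiv ℝ A) (fderiv ℝ (fderiv ℝ A) z) z :=
    ((h.fderiv_right (m := ∞) (by simp)).differentiableAt (by simp)).hasFDerivAt
  have h2 : HasFDerivAt (curvForm A) (fderiv ℝ (curvForm A) z) z :=
    ((contDiffAt_curvForm h).differentiableAt (by simp)).hasFDerivAt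
  have e1 := ((h2.clm_apply (hasFDerivAt_const a z)).clm_apply (hasFDerivAt_const b z))
  have d1 : ∀ a b, HasFDerivAt (fun w => fderiv ℝ A w a b) _ z := fun a b =>
    (h1.clm_apply (hasFDerivAt_const a z)).clm_apply (hasFDerivAt_const b z)
  have d0 : ∀ a, HasFDerivAt (fun w => A w a) _ z := fun a => h0.clm_apply (hasFDerivAt_const a z)
  have e2 := ((d1 a b).sub (d1 b a)).add (((d0 a).mul' (d0 b)).sub ((d0 b).mul' (d0 a)))
  have e3 : (fun w => curvForm A w a b) = ((fun w => fderiv ℝ A w a b) - fun w => fderiv ℝ A w b a)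
      + (((fun w => A w a) * fun w => A w b) - (fun w => A w b) * fun w => A w a) := by
    ext w; simp [curvForm_apply]
  rw [← e3] at e2
  have := DFunLike.congr_fun (e1.unique e2) v
  simp at this
  rw [this]
  abel

/-- The second Bianchi identity. -/
theorem bianchi {A : E → E →L[ℝ] 𝔸} {z : E} (h : ContDiffAt ℝ ∞ A z) (a b d : E) :
    let N : E → E → E → 𝔸 := fun v x y => fderiv ℝ (curvForm A) z v x y
      + (A z v * curvForm A z x y - curvForm A z x y * A z v)
    N a b d + N b d a + N d a b = 0 := by
  intro N
  have hs : ∀ x y w, fderiv ℝ (fderiv ℝ A) z x y w = fderiv ℝ (fderiv ℝ A) z y x w := fun x y w => by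
    rw [(h.isSymmSndFDerivAt (by simp; exact two_le_infty)).eq x y]
  simp only [N, fderiv_curvForm_apply h, curvForm_apply]
  rw [hs b a, hs d a, hs d b]
  noncomm_ring

theorem fderiv_pairs_prod {A : E → E →L[ℝ] 𝔸} {z : E} (h : ContDiffAt ℝ ∞ A z)
    (τ : 𝔸 →L[ℝ] ℂ) (hτ : ∀ a b, τ (a * b) = τ (b * a)) {k : ℕ} (u : E) (v : Fin (2 * k) → E) :
    fderiv ℝ (fun w => τ (List.ofFn (pairs (curvForm A w) v)).prod) z u
      = ∑ j : Fin k, τ (List.ofFn (Function.update (pairs (curvForm A z) v) j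
        (fderiv ℝ (curvForm A) z u (v ⟨2 * j.1, by omega⟩) (v ⟨2 * j.1 + 1, by omega⟩)
          + (A z u * pairs (curvForm A z) v j - pairs (curvForm A z) v j * A z u)))).prod := by
  have h2 : HasFDerivAt (curvForm A) (fderiv ℝ (curvForm A) z) z :=
    ((contDiffAt_curvForm h).differentiableAt (by simp)).hasFDerivAt
  have h3 : ∀ j : Fin k, HasFDerivAt (fun w => pairs (curvForm A w) v j) _ z := fun j =>
    (h2.clm_apply (hasFDerivAt_const (v ⟨2 * j.1, by omega⟩) z)).clm_apply
      (hasFDerivAt_const (v ⟨2 * j.1 + 1, by omega⟩) z)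
  have h4 := τ.hasFDerivAt.comp z
    (HasFDerivAt.multilinear_comp (ContinuousMultilinearMap.mkPiAlgebraFin ℝ k 𝔸) h3)
  have h5 : (fun w => τ (List.ofFn (pairs (curvForm A w) v)).prod)
      = τ ∘ fun w => ContinuousMultilinearMap.mkPiAlgebraFin ℝ k 𝔸
        fun j => pairs (curvForm A w) v j := by
    ext w
    simp [ContinuousMultilinearMap.mkPiAlgebraFin_apply]
  rw [h5, h4.fderiv]
  have h6 := congrArg τ (sum_update_commutator (A z u) (pairs (curvForm A z) v))
  rw [map_sub, hτ, sub_self, map_sum] at h6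
  simp only [← ContinuousMultilinearMap.mkPiAlgebraFin_apply (R := ℝ)] at h6 ⊢
  simp only [ContinuousMultilinearMap.map_update_add, map_add, Finset.sum_add_distrib]
  rw [h6, add_zero]
  simp [ContinuousMultilinearMap.toContinuousLinearMap]

/-- The Chern forms of a connection are closed. -/
theorem extDeriv_chernForm_curvForm [FiniteDimensional ℝ E] {A : E → E →L[ℝ] 𝔸} {z : E}
    (h : ContDiffAt ℝ ∞ A z) (τ : 𝔸 →L[ℝ] ℂ) (hτ : ∀ a b, τ (a * b) = τ (b * a)) (k : ℕ) :
    extDeriv (fun w => chernForm τ (curvForm A w) k) z = 0 := by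
  have hd := contDiffAt_chernForm τ (contDiffAt_curvForm h) k
  have hd' : ∀ v, DifferentiableAt ℝ
      (fun w => τ (List.ofFn (pairs (k := k) (curvForm A w) v)).prod) z := by
    intro v
    refine (τ.contDiff.contDiffAt.comp z (n := ∞) ?_).differentiableAt (by simp)
    simp only [← ContinuousMultilinearMap.mkPiAlgebraFin_apply (R := ℝ)]
    refine (ContinuousMultilinearMap.contDiff _).contDiffAt.comp z (contDiffAt_pi.2 fun j => ?_)
    exact ((contDiffAt_curvForm h).clm_apply contDiffAt_const).clm_apply contDiffAt_const
  ext v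
  rw [extDeriv_apply (hd.differentiableAt (by simp))]
  simp only [chernForm_apply]
  rw [show (0 : E [⋀^Fin (2 * k + 1)]→L[ℝ] ℂ) v = 0 from rfl]
  let F : (Fin (2 * k + 1) → E) → ℂ := fun x =>
    fderiv ℝ (fun w => τ (List.ofFn (pairs (curvForm A w) (Fin.tail x))).prod) z (x 0)
  have h1 : ∀ i : Fin (2 * k + 1), fderiv ℝ (fun w => chernConst k * ∑ σ : Equiv.Perm (Fin (2 * k)),
      ((Equiv.Perm.sign σ : ℤ) : ℂ) * τ (List.ofFn (pairs (curvForm A w) (i.removeNth v ∘ σ))).prod)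
        z (v i) = chernConst k * ∑ σ : Equiv.Perm (Fin (2 * k)),
      ((Equiv.Perm.sign σ : ℤ) : ℂ) * F (Fin.cons (v i) (i.removeNth v ∘ σ)) := by
    intro i
    rw [fderiv_const_mul (DifferentiableAt.fun_sum fun σ _ => (hd' _).const_mul _),
      fderiv_fun_sum fun σ _ => (hd' _).const_mul _]
    simp only [smul_apply, sum_apply, smul_eq_mul]
    congr 1
    refine Finset.sum_congr rfl fun σ _ => ?_
    rw [fderiv_const_mul (hd' _)]
    simp [F]
  have h2 : ∑ i : Fin (2 * k + 1), (-1 : ℤ) ^ (i : ℕ) • (chernConst k *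
      ∑ σ : Equiv.Perm (Fin (2 * k)), ((Equiv.Perm.sign σ : ℤ) : ℂ)
        * F (Fin.cons (v i) (i.removeNth v ∘ σ))) = chernConst k *
      ∑ σ : Equiv.Perm (Fin (2 * k + 1)), ((Equiv.Perm.sign σ : ℤ) : ℂ) * F (v ∘ σ) := by
    rw [← sum_succAbove_perm, Finset.mul_sum]
    refine Finset.sum_congr rfl fun i _ => ?_
    rw [mul_smul_comm]
  have h3 : ∑ σ : Equiv.Perm (Fin (2 * k + 1)), ((Equiv.Perm.sign σ : ℤ) : ℂ) * F (v ∘ σ) = 0 := by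
    simp only [F, fderiv_pairs_prod h τ hτ, Finset.mul_sum]
    rw [Finset.sum_comm]
    refine Finset.sum_eq_zero fun j _ => ?_
    let i₁ : Fin (2 * k + 1) := ⟨2 * j.1 + 1, by omega⟩
    let i₂ : Fin (2 * k + 1) := ⟨2 * j.1 + 2, by omega⟩
    have n1 : (0 : Fin (2 * k + 1)) ≠ i₁ := by
      intro e; have := congrArg Fin.val e; simp [i₁] at this
    have n2 : (0 : Fin (2 * k + 1)) ≠ i₂ := by
      intro e; have := congrArg Fin.val e; simp [i₂] at this
    have n3 : i₁ ≠ i₂ := by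
      intro e; have := congrArg Fin.val e; simp [i₁, i₂] at this
    let N : E → E → E → 𝔸 := fun v x y => fderiv ℝ (curvForm A) z v x y
      + (A z v * curvForm A z x y - curvForm A z x y * A z v)
    have hN : ∀ a b d, N a b d + N b d a + N d a b = 0 := fun a b d => bianchi h a b d
    let G : (Fin (2 * k + 1) → E) → ℂ := fun x =>
      τ (ContinuousMultilinearMap.mkPiAlgebraFin ℝ k 𝔸 (Function.update
        (pairs (curvForm A z) (Fin.tail x)) j (N (x 0) (x i₁) (x i₂))))
    have hG : ∀ v, G v + G (v ∘ (Equiv.swap 0 i₁ * Equiv.swap i₁ i₂ : Equiv.Perm _))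
        + G (v ∘ (Equiv.swap i₁ i₂ * Equiv.swap 0 i₁ : Equiv.Perm _)) = 0 := by
      intro x
      have hc : ∀ c : Equiv.Perm (Fin (2 * k + 1)), (∀ i, i ≠ 0 → i ≠ i₁ → i ≠ i₂ → c i = i) →
          G (x ∘ c) = τ (ContinuousMultilinearMap.mkPiAlgebraFin ℝ k 𝔸 (Function.update
            (pairs (curvForm A z) (Fin.tail x)) j (N (x (c 0)) (x (c i₁)) (x (c i₂))))) := by
        intro c hc
        simp only [G]
        congr 2
        ext l
        rcases eq_or_ne l j with rfl | hl
        · simp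
        · have hl' : l.1 ≠ j.1 := fun e => hl (Fin.ext e)
          rw [Function.update_of_ne hl, Function.update_of_ne hl]
          simp only [pairs, Fin.tail, Function.comp]
          rw [hc, hc] <;>
          · intro e
            have := congrArg Fin.val e
            simp [i₁, i₂] at this
            try omega
      rw [hc, hc, ← map_add, ← map_add]
      · have e1 : (Equiv.swap 0 i₁ * Equiv.swap i₁ i₂ : Equiv.Perm _) 0 = i₁ := by
          simp [Equiv.swap_apply_of_ne_of_ne n1 n2]
        have e2 : (Equiv.swap 0 i₁ * Equiv.swap i₁ i₂ : Equiv.Perm _) i₁ = i₂ := by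
          simp [Equiv.swap_apply_of_ne_of_ne n2.symm n3.symm]
        have e3 : (Equiv.swap 0 i₁ * Equiv.swap i₁ i₂ : Equiv.Perm _) i₂ = 0 := by simp
        have e4 : (Equiv.swap i₁ i₂ * Equiv.swap 0 i₁ : Equiv.Perm _) 0 = i₂ := by simp
        have e5 : (Equiv.swap i₁ i₂ * Equiv.swap 0 i₁ : Equiv.Perm _) i₁ = 0 := by
          simp [Equiv.swap_apply_of_ne_of_ne n1 n2]
        have e6 : (Equiv.swap i₁ i₂ * Equiv.swap 0 i₁ : Equiv.Perm _) i₂ = i₁ := by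
          simp [Equiv.swap_apply_of_ne_of_ne n2.symm n3.symm]
        rw [e1, e2, e3, e4, e5, e6]
        rw [← ContinuousMultilinearMap.map_update_add, ← ContinuousMultilinearMap.map_update_add,
          hN, ContinuousMultilinearMap.map_coord_zero _ j (by simp), map_zero]
      · intro i h0 h1 h2
        simp [Equiv.swap_apply_of_ne_of_ne h0 h1, Equiv.swap_apply_of_ne_of_ne h1 h2]
      · intro i h0 h1 h2
        simp [Equiv.swap_apply_of_ne_of_ne h0 h1, Equiv.swap_apply_of_ne_of_ne h1 h2]
    have := sum_sign_smul_eq_zero_of_cyclic n1 n3 hG v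
    rw [← this]
    refine Finset.sum_congr rfl fun σ _ => ?_
    rfl
  have h4 := Finset.sum_congr rfl fun (i : Fin (2 * k + 1)) (_ : i ∈ Finset.univ) =>
    congrArg (fun t => (-1 : ℤ) ^ (i : ℕ) • t) (h1 i)
  rw [h2, h3, mul_zero] at h4
  exact_mod_cast h4

end ChernForm

section Quadrature

open Polynomial in
/-- A quadrature formula `p(1) - p(0) = ∑ wᵢ p'(tᵢ)`, exact for polynomials of degree `≤ d`. -/
theorem exists_quadrature (d : ℕ) : ∃ (w : Fin d → ℂ) (t : Fin d → ℝ), ∀ p : ℂ[X],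
    p.natDegree ≤ d → p.eval 1 - p.eval 0 = ∑ i, w i * (derivative p).eval (t i : ℂ) := by
  let J : ℂ[X] →ₗ[ℂ] ℂ := Polynomial.lsum fun n =>
    ((1 : ℂ) / (n + 1)) • (LinearMap.id : ℂ →ₗ[ℂ] ℂ)
  have hJ : ∀ p : ℂ[X], J (derivative p) = p.eval 1 - p.eval 0 := by
    intro p
    induction p using Polynomial.induction_on' with
    | add p q hp hq => simp [hp, hq]; ring
    | monomial n a =>
      rcases n with _ | n
      · simp
      · have : (n + 1 : ℂ) ≠ 0 := by exact_mod_cast Nat.succ_ne_zero n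
        simp [J, Polynomial.lsum_apply]
        field_simp
  let v : Fin d → ℂ := fun i => ((i : ℕ) : ℂ)
  have hv : Set.InjOn v (Finset.univ : Finset (Fin d)) := by
    intro i _ j _ h
    exact Fin.ext (Nat.cast_injective (R := ℂ) h)
  refine ⟨fun i => J (Lagrange.basis Finset.univ v i), fun i => (i : ℕ), fun p hp => ?_⟩
  rcases Nat.eq_zero_or_pos d with rfl | hd
  · rw [Polynomial.eq_C_of_natDegree_le_zero hp]
    simp
  · have hdeg : (derivative p).degree < (Finset.univ : Finset (Fin d)).card := by
      rw [Finset.card_univ, Fintype.card_fin]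
      rcases eq_or_ne (derivative p) 0 with h0 | h0
      · rw [h0]; simp
      · have hp0 : p.natDegree ≠ 0 := fun h => h0 (by
          rw [Polynomial.eq_C_of_natDegree_eq_zero h]; simp)
        rw [Polynomial.degree_eq_natDegree h0]
        have := Polynomial.natDegree_derivative_lt hp0
        exact_mod_cast lt_of_lt_of_le this hp
    have h := Lagrange.eq_interpolate hv hdeg
    rw [← hJ]
    conv_lhs => rw [h]
    rw [Lagrange.interpolate_apply, map_sum]
    refine Finset.sum_congr rfl fun i _ => ?_
    rw [← Polynomial.smul_eq_C_mul, map_smul, smul_eq_mul, mul_comm]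
    simp [v]

theorem exists_polynomial_prod {R : Type*} [Ring R] [Algebra ℝ R] {k : ℕ} (g₀ g₁ g₂ : Fin k → R)
    (φ : R →ₗ[ℝ] ℂ) : ∃ p : Polynomial ℂ, p.natDegree ≤ 2 * k ∧ ∀ s : ℝ,
      φ (List.ofFn fun j => g₀ j + s • g₁ j + s ^ 2 • g₂ j).prod = p.eval (s : ℂ) := by
  induction k generalizing φ with
  | zero => exact ⟨Polynomial.C (φ 1), by simp, by simp⟩
  | succ k ih =>
    have ih' := fun a : R => ih (fun j => g₀ j.succ) (fun j => g₁ j.succ) (fun j => g₂ j.succ)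
      (φ.comp (LinearMap.mulLeft ℝ a))
    obtain ⟨p₀, d₀, h₀⟩ := ih' (g₀ 0)
    obtain ⟨p₁, d₁, h₁⟩ := ih' (g₁ 0)
    obtain ⟨p₂, d₂, h₂⟩ := ih' (g₂ 0)
    refine ⟨p₀ + Polynomial.X * p₁ + Polynomial.X ^ 2 * p₂, ?_, fun s => ?_⟩
    · refine (Polynomial.natDegree_add_le _ _).trans (max_le ((Polynomial.natDegree_add_le _ _).trans
        (max_le (by omega) (Polynomial.natDegree_mul_le.trans ?_)))
        (Polynomial.natDegree_mul_le.trans ?_))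
      · have := Polynomial.natDegree_X_le (R := ℂ); omega
      · have := Polynomial.natDegree_X_pow_le (R := ℂ) 2; omega
    · have e₀ := h₀ s
      have e₁ := h₁ s
      have e₂ := h₂ s
      simp only [LinearMap.comp_apply, LinearMap.mulLeft_apply] at e₀ e₁ e₂
      rw [List.ofFn_succ, List.prod_cons, add_mul, add_mul, map_add, map_add, smul_mul_assoc,
        smul_mul_assoc, map_smul, map_smul, e₀, e₁, e₂]
      simp

end Quadrature

section Transgression

set_option synthInstance.maxHeartbeats 400000
set_option maxHeartbeats 1000000

variable {E : Type*} [NormedAddCommGroup E] [NormedSpace ℝ E]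
  {E' : Type*} [NormedAddCommGroup E'] [NormedSpace ℝ E']
  {𝔸 : Type*} [NormedRing 𝔸] [NormedAlgebra ℝ 𝔸]

theorem chernForm_compContinuousLinearMap (τ : 𝔸 →L[ℝ] ℂ) (Ω : E →L[ℝ] E →L[ℝ] 𝔸) (k : ℕ)
    (f : E' →L[ℝ] E) :
    (chernForm τ Ω k).compContinuousLinearMap f = chernForm τ (Ω.bilinearComp f f) k := by
  ext v
  rw [ContinuousAlternatingMap.compContinuousLinearMap_apply, chernForm_apply, chernForm_apply]
  rfl

theorem prod_ofFn_conj {R : Type*} [Ring R] {k : ℕ} {g g' : Fin k → R} {c : R}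
    (h : ∀ j, g' j * c = c * g j) : (List.ofFn g').prod * c = c * (List.ofFn g).prod := by
  induction k with
  | zero => simp
  | succ k ih =>
    rw [List.ofFn_succ, List.ofFn_succ, List.prod_cons, List.prod_cons, mul_assoc,
      ih fun j => h j.succ, ← mul_assoc, h, mul_assoc]

theorem chernForm_conj (τ : 𝔸 →L[ℝ] ℂ) (hτ : ∀ a b, τ (a * b) = τ (b * a))
    {Ω Ω' : E →L[ℝ] E →L[ℝ] 𝔸} (c : 𝔸ˣ) (h : ∀ a b, Ω' a b * c = c * Ω a b) (k : ℕ) :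
    chernForm τ Ω' k = chernForm τ Ω k := by
  ext v
  rw [chernForm_apply, chernForm_apply]
  congr 1
  refine Finset.sum_congr rfl fun σ _ => ?_
  congr 1
  have := prod_ofFn_conj (g := pairs Ω (v ∘ σ)) (g' := pairs Ω' (v ∘ σ)) (c := (c : 𝔸))
    fun j => h _ _
  rw [(Units.eq_mul_inv_iff_mul_eq c).2 this, hτ, Units.inv_mul_cancel_left]

/-- The commutator `(a, b) ↦ [α a, α b]`. -/
def wedgeComm (α : E →L[ℝ] 𝔸) : E →L[ℝ] E →L[ℝ] 𝔸 :=
  (ContinuousLinearMap.mul ℝ 𝔸).bilinearComp α α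
    - ((ContinuousLinearMap.mul ℝ 𝔸).bilinearComp α α).flip

theorem wedgeComm_apply (α : E →L[ℝ] 𝔸) (a b : E) :
    wedgeComm α a b = α a * α b - α b * α a := by
  simp [wedgeComm]

/-- The curvature of `A₀ + t α`, when `Ω₀` and `Ω₁` are the curvatures of `A₀` and `A₀ + α`. -/
def interCurv (α : E →L[ℝ] 𝔸) (Ω₀ Ω₁ : E →L[ℝ] E →L[ℝ] 𝔸) (t : ℝ) : E →L[ℝ] E →L[ℝ] 𝔸 :=
  Ω₀ + t • (Ω₁ - Ω₀ - wedgeComm α) + t ^ 2 • wedgeComm α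

/-- The curvature of the connection `A₀ + t α` on `E × ℝ`. -/
def extCurv (α : E →L[ℝ] 𝔸) (Ω₀ Ω₁ : E →L[ℝ] E →L[ℝ] 𝔸) (t : ℝ) :
    (E × ℝ) →L[ℝ] (E × ℝ) →L[ℝ] 𝔸 :=
  (interCurv α Ω₀ Ω₁ t).bilinearComp (ContinuousLinearMap.fst ℝ E ℝ) (ContinuousLinearMap.fst ℝ E ℝ)
    + ((ContinuousLinearMap.smulRightL ℝ (E × ℝ) 𝔸 (ContinuousLinearMap.snd ℝ E ℝ)).comp
        (α.comp (ContinuousLinearMap.fst ℝ E ℝ))).flip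
    - (ContinuousLinearMap.smulRightL ℝ (E × ℝ) 𝔸 (ContinuousLinearMap.snd ℝ E ℝ)).comp
        (α.comp (ContinuousLinearMap.fst ℝ E ℝ))

theorem extCurv_apply (α : E →L[ℝ] 𝔸) (Ω₀ Ω₁ : E →L[ℝ] E →L[ℝ] 𝔸) (t : ℝ) (x y : E × ℝ) :
    extCurv α Ω₀ Ω₁ t x y = interCurv α Ω₀ Ω₁ t x.1 y.1 + x.2 • α y.1 - y.2 • α x.1 := by
  simp [extCurv]

/-- The integrand, at `t`, of the transgression form of degree `2k + 1`. -/
def transInt (τ : 𝔸 →L[ℝ] ℂ) (α : E →L[ℝ] 𝔸) (Ω₀ Ω₁ : E →L[ℝ] E →L[ℝ] 𝔸) (t : ℝ) (k : ℕ) :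
    E [⋀^Fin (2 * k + 1)]→L[ℝ] ℂ :=
  ((show (E × ℝ) [⋀^Fin (2 * k + 1 + 1)]→L[ℝ] ℂ from
    chernForm τ (extCurv α Ω₀ Ω₁ t) (k + 1)).curryLeft (0, 1)).compContinuousLinearMap
      (ContinuousLinearMap.inl ℝ E ℝ)

theorem transInt_apply (τ : 𝔸 →L[ℝ] ℂ) (α : E →L[ℝ] 𝔸) (Ω₀ Ω₁ : E →L[ℝ] E →L[ℝ] 𝔸) (t : ℝ)
    (k : ℕ) (v : Fin (2 * k + 1) → E) : transInt τ α Ω₀ Ω₁ t k v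
      = chernForm τ (extCurv α Ω₀ Ω₁ t) (k + 1)
        (Fin.cons (0, 1) fun i => (v i, 0) : Fin (2 * k + 1 + 1) → E × ℝ) := rfl

theorem curvForm_interConn {A₀ A₁ : E → E →L[ℝ] 𝔸} {z : E} (h₀ : DifferentiableAt ℝ A₀ z)
    (h₁ : DifferentiableAt ℝ A₁ z) (t : ℝ) :
    curvForm (fun p : E × ℝ => (A₀ p.1 + p.2 • (A₁ p.1 - A₀ p.1)).comp
        (ContinuousLinearMap.fst ℝ E ℝ)) (z, t)
      = extCurv (A₁ z - A₀ z) (curvForm A₀ z) (curvForm A₁ z) t := by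
  have d₀ : HasFDerivAt A₀ (fderiv ℝ A₀ z) z := h₀.hasFDerivAt
  have d₁ : HasFDerivAt A₁ (fderiv ℝ A₁ z) z := h₁.hasFDerivAt
  have hf : HasFDerivAt (fun p : E × ℝ => p.1) (ContinuousLinearMap.fst ℝ E ℝ) (z, t) :=
    hasFDerivAt_fst
  have hs : HasFDerivAt (fun p : E × ℝ => p.2) (ContinuousLinearMap.snd ℝ E ℝ) (z, t) :=
    hasFDerivAt_snd
  have e₀ := HasFDerivAt.comp (z, t) (g := A₀) d₀ hf
  have e₁ := HasFDerivAt.comp (z, t) (g := A₁) d₁ hf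
  have e := (e₀.add (hs.smul (e₁.sub e₀))).clm_comp
    (hasFDerivAt_const (ContinuousLinearMap.fst ℝ E ℝ) (z, t))
  have e' : ∀ x y : E × ℝ, fderiv ℝ (fun p : E × ℝ => (A₀ p.1 + p.2 • (A₁ p.1 - A₀ p.1)).comp
      (ContinuousLinearMap.fst ℝ E ℝ)) (z, t) x y = fderiv ℝ A₀ z x.1 y.1
        + (t • (fderiv ℝ A₁ z x.1 y.1 - fderiv ℝ A₀ z x.1 y.1) + x.2 • (A₁ z y.1 - A₀ z y.1)) :=
    fun x y => by
      refine (DFunLike.congr_fun (DFunLike.congr_fun e.fderiv x) y).trans ?_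
      change (A₀ z + t • (A₁ z - A₀ z)) (0 : E) + (fderiv ℝ A₀ z x.1 y.1
        + (t • (fderiv ℝ A₁ z x.1 y.1 - fderiv ℝ A₀ z x.1 y.1) + x.2 • (A₁ z y.1 - A₀ z y.1))) = _
      rw [map_zero, zero_add]
  refine ContinuousLinearMap.ext fun x => ContinuousLinearMap.ext fun y => ?_
  rw [curvForm_apply, e', e', extCurv_apply]
  change _ + ((A₀ z x.1 + t • (A₁ z x.1 - A₀ z x.1)) * (A₀ z y.1 + t • (A₁ z y.1 - A₀ z y.1))
    - (A₀ z y.1 + t • (A₁ z y.1 - A₀ z y.1)) * (A₀ z x.1 + t • (A₁ z x.1 - A₀ z x.1))) = _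
  simp only [interCurv, add_apply, smul_apply, sub_apply, wedgeComm_apply, curvForm_apply]
  simp only [mul_add, add_mul, mul_sub, sub_mul, smul_sub, smul_add, smul_mul_assoc,
    mul_smul_comm, smul_smul, sq]
  module

theorem contDiffAt_interConn {A₀ A₁ : E → E →L[ℝ] 𝔸} {z : E} (h₀ : ContDiffAt ℝ ∞ A₀ z)
    (h₁ : ContDiffAt ℝ ∞ A₁ z) (t : ℝ) :
    ContDiffAt ℝ ∞ (fun p : E × ℝ => (A₀ p.1 + p.2 • (A₁ p.1 - A₀ p.1)).comp
      (ContinuousLinearMap.fst ℝ E ℝ)) (z, t) := by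
  have e₀ : ContDiffAt ℝ ∞ (fun p : E × ℝ => A₀ p.1) (z, t) :=
    ContDiffAt.comp (z, t) (g := A₀) h₀ contDiffAt_fst
  have e₁ : ContDiffAt ℝ ∞ (fun p : E × ℝ => A₁ p.1) (z, t) :=
    ContDiffAt.comp (z, t) (g := A₁) h₁ contDiffAt_fst
  exact (e₀.add (contDiffAt_snd.smul (e₁.sub e₀))).clm_comp contDiffAt_const

theorem contDiffAt_extCurv {D : Type*} [NormedAddCommGroup D] [NormedSpace ℝ D]
    {α : D → E →L[ℝ] 𝔸} {Ω₀ Ω₁ : D → E →L[ℝ] E →L[ℝ] 𝔸} {z : D} (hα : ContDiffAt ℝ ∞ α z)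
    (h₀ : ContDiffAt ℝ ∞ Ω₀ z) (h₁ : ContDiffAt ℝ ∞ Ω₁ z) (t : ℝ) (x y : E × ℝ) :
    ContDiffAt ℝ ∞ (fun w => extCurv (α w) (Ω₀ w) (Ω₁ w) t x y) z := by
  have ha : ∀ a, ContDiffAt ℝ ∞ (fun w => α w a) z := fun a => hα.clm_apply contDiffAt_const
  have ho : ∀ a b, ContDiffAt ℝ ∞ (fun w => Ω₀ w a b) z := fun a b =>
    (h₀.clm_apply contDiffAt_const).clm_apply contDiffAt_const
  have hi : ∀ a b, ContDiffAt ℝ ∞ (fun w => Ω₁ w a b) z := fun a b =>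
    (h₁.clm_apply contDiffAt_const).clm_apply contDiffAt_const
  have hw : ∀ a b, ContDiffAt ℝ ∞ (fun w => wedgeComm (α w) a b) z := fun a b => by
    simp only [wedgeComm_apply]
    exact ((ha a).mul (ha b)).sub ((ha b).mul (ha a))
  simp only [extCurv_apply, interCurv, add_apply, smul_apply, sub_apply]
  exact ((((ho _ _).add ((((hi _ _).sub (ho _ _)).sub (hw _ _)).const_smul t)).add
    ((hw _ _).const_smul (t ^ 2))).add ((ha _).const_smul _)).sub ((ha _).const_smul _)

theorem contDiffAt_transInt [FiniteDimensional ℝ E] (τ : 𝔸 →L[ℝ] ℂ) {D : Type*}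
    [NormedAddCommGroup D] [NormedSpace ℝ D]
    {α : D → E →L[ℝ] 𝔸} {Ω₀ Ω₁ : D → E →L[ℝ] E →L[ℝ] 𝔸} {z : D} (hα : ContDiffAt ℝ ∞ α z)
    (h₀ : ContDiffAt ℝ ∞ Ω₀ z) (h₁ : ContDiffAt ℝ ∞ Ω₁ z) (t : ℝ) (k : ℕ) :
    ContDiffAt ℝ ∞ (fun w => transInt τ (α w) (Ω₀ w) (Ω₁ w) t k) z := by
  refine contDiffAt_alternatingMap fun v => ?_
  simp only [transInt_apply, chernForm_apply]
  refine contDiffAt_const.mul (ContDiffAt.sum fun σ _ => contDiffAt_const.mul ?_)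
  refine τ.contDiff.contDiffAt.comp z ?_
  simp only [← ContinuousMultilinearMap.mkPiAlgebraFin_apply (R := ℝ)]
  refine (ContinuousMultilinearMap.contDiff _).contDiffAt.comp z (contDiffAt_pi.2 fun j => ?_)
  exact contDiffAt_extCurv hα h₀ h₁ t _ _

theorem chernForm_interCurv_apply (τ : 𝔸 →L[ℝ] ℂ) (α : E →L[ℝ] 𝔸) (Ω₀ Ω₁ : E →L[ℝ] E →L[ℝ] 𝔸)
    (t : ℝ) (k : ℕ) (v : Fin (2 * k) → E) :
    chernForm τ (interCurv α Ω₀ Ω₁ t) k v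
      = chernForm τ (extCurv α Ω₀ Ω₁ t) k fun i => (v i, 0) := by
  rw [chernForm_apply, chernForm_apply]
  congr 1
  refine Finset.sum_congr rfl fun σ _ => ?_
  congr 4
  ext j
  simp [pairs, extCurv_apply]

theorem hasDerivAt_chernForm_interCurv [FiniteDimensional ℝ E] {A₀ A₁ : E → E →L[ℝ] 𝔸} {z : E}
    (h₀ : ContDiffAt ℝ ∞ A₀ z) (h₁ : ContDiffAt ℝ ∞ A₁ z) (τ : 𝔸 →L[ℝ] ℂ)
    (hτ : ∀ a b, τ (a * b) = τ (b * a)) (t : ℝ) (k : ℕ) (v : Fin (2 * (k + 1)) → E) :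
    HasDerivAt (fun s => chernForm τ (interCurv (A₁ z - A₀ z) (curvForm A₀ z) (curvForm A₁ z) s)
        (k + 1) v)
      ((extDeriv (fun w => transInt τ (A₁ w - A₀ w) (curvForm A₀ w) (curvForm A₁ w) t k) z :
        E [⋀^Fin (2 * (k + 1))]→L[ℝ] ℂ) v) t := by
  let At : E × ℝ → (E × ℝ) →L[ℝ] 𝔸 := fun p => (A₀ p.1 + p.2 • (A₁ p.1 - A₀ p.1)).comp
      (ContinuousLinearMap.fst ℝ E ℝ)
  have hAt : ContDiffAt ℝ ∞ At (z, t) := contDiffAt_interConn h₀ h₁ t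
  have hc := extDeriv_chernForm_curvForm hAt τ hτ (k + 1)
  have hs := (contDiffAt_chernForm τ (contDiffAt_curvForm hAt) (k + 1)).differentiableAt (by simp)
  have hsv := fun v => (contDiffAt_chernForm_apply τ (contDiffAt_curvForm hAt) (k + 1)
    v).differentiableAt (by simp)
  have hts := (contDiffAt_transInt τ (h₁.sub h₀) (contDiffAt_curvForm h₀) (contDiffAt_curvForm h₁)
    t k).differentiableAt (by simp)
  have hc' := DFunLike.congr_fun hc (Fin.cons (0, 1) fun i => (v i, 0) :
    Fin (2 * (k + 1) + 1) → E × ℝ)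
  rw [extDeriv_apply hs, Fin.sum_univ_succ] at hc'
  have e1 : (extDeriv (fun w => transInt τ (A₁ w - A₀ w) (curvForm A₀ w) (curvForm A₁ w) t k) z :
        E [⋀^Fin (2 * (k + 1))]→L[ℝ] ℂ) v = ∑ i : Fin (2 * k + 1 + 1), (-1 : ℤ) ^ (i : ℕ) •
          fderiv ℝ (fun w => transInt τ (A₁ w - A₀ w) (curvForm A₀ w) (curvForm A₁ w) t k
            (i.removeNth (show Fin (2 * k + 1 + 1) → E from v))) z (v i) := extDeriv_apply hts v
  have e2 : ∀ i : Fin (2 * k + 1 + 1), fderiv ℝ (fun w => transInt τ (A₁ w - A₀ w) (curvForm A₀ w)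
      (curvForm A₁ w) t k (i.removeNth (show Fin (2 * k + 1 + 1) → E from v))) z (v i)
      = fderiv ℝ (fun p => chernForm τ (curvForm At p) (k + 1) ((Fin.succ i).removeNth
        (Fin.cons (0, 1) fun i => (v i, 0) : Fin (2 * (k + 1) + 1) → E × ℝ))) (z, t) (v i, 0) := by
    intro i
    have hr : (Fin.succ i).removeNth (Fin.cons (0, 1) fun i => (v i, 0) :
        Fin (2 * (k + 1) + 1) → E × ℝ) = (Fin.cons (0, 1) fun j =>
          (i.removeNth (show Fin (2 * k + 1 + 1) → E from v) j, 0) :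
            Fin (2 * k + 1 + 1) → E × ℝ) := by
      ext1 j
      refine Fin.cases ?_ (fun j => ?_) j
      · simp [Fin.removeNth]
      · simp [Fin.removeNth]
    have hev : ∀ᶠ w in 𝓝 z, DifferentiableAt ℝ A₀ w ∧ DifferentiableAt ℝ A₁ w := by
      have g₀ := (h₀.of_le (m := 1) (by simp)).eventually (by simp)
      have g₁ := (h₁.of_le (m := 1) (by simp)).eventually (by simp)
      filter_upwards [g₀, g₁] with w hw₀ hw₁
      exact ⟨hw₀.differentiableAt (by simp), hw₁.differentiableAt (by simp)⟩
    have hf : (fun w => transInt τ (A₁ w - A₀ w) (curvForm A₀ w)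
        (curvForm A₁ w) t k (i.removeNth (show Fin (2 * k + 1 + 1) → E from v))) =ᶠ[𝓝 z]
        (fun p => chernForm τ (curvForm At p) (k + 1) ((Fin.succ i).removeNth
        (Fin.cons (0, 1) fun i => (v i, 0) : Fin (2 * (k + 1) + 1) → E × ℝ))) ∘
          fun w => (w, t) := by
      filter_upwards [hev] with w hw
      simp only [Function.comp, At]
      rw [curvForm_interConn hw.1 hw.2, transInt_apply, hr]
    have hl : HasFDerivAt (fun w : E => ((w, t) : E × ℝ)) (ContinuousLinearMap.inl ℝ E ℝ) z :=
      hasFDerivAt_prodMk_left z t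
    rw [hf.fderiv_eq, ((hsv _).hasFDerivAt.comp z hl).fderiv]
    simp
  have e3 : HasDerivAt (fun s => chernForm τ (interCurv (A₁ z - A₀ z) (curvForm A₀ z)
      (curvForm A₁ z) s) (k + 1) v) (fderiv ℝ (fun p => chernForm τ (curvForm At p) (k + 1)
        fun i => (v i, 0)) (z, t) (0, 1)) t := by
    have hl : HasFDerivAt (fun s : ℝ => ((z, s) : E × ℝ)) (ContinuousLinearMap.inr ℝ E ℝ) t :=
      hasFDerivAt_prodMk_right z t
    have := ((hsv fun i => (v i, 0)).hasFDerivAt.comp t hl).hasDerivAt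
    simp only [ContinuousLinearMap.comp_apply, ContinuousLinearMap.inr_apply] at this
    refine this.congr_of_eventuallyEq (Filter.Eventually.of_forall fun s => ?_)
    simp only [Function.comp, At]
    rw [curvForm_interConn (h₀.differentiableAt (by simp)) (h₁.differentiableAt (by simp)) s,
      chernForm_interCurv_apply]
  rw [e1]
  convert e3 using 1
  simp only [Fin.val_zero, pow_zero, one_smul, Fin.cons_zero, Fin.cons_succ, Fin.val_succ] at hc'
  have hr0 : (0 : Fin (2 * (k + 1) + 1)).removeNth (Fin.cons (0, 1) fun i => (v i, 0) :
      Fin (2 * (k + 1) + 1) → E × ℝ) = fun i => (v i, 0) := by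
    ext1 j; simp [Fin.removeNth]
  rw [hr0] at hc'
  simp_rw [e2]
  rw [← sub_eq_zero, ← neg_eq_zero, neg_sub, sub_eq_add_neg, ← Finset.sum_neg_distrib]
  refine Eq.trans ?_ hc'
  congr 1
  refine Finset.sum_congr rfl fun i _ => ?_
  rw [pow_succ, mul_neg_one, neg_smul]

theorem chernForm_interCurv_polynomial (τ : 𝔸 →L[ℝ] ℂ) (α : E →L[ℝ] 𝔸)
    (Ω₀ Ω₁ : E →L[ℝ] E →L[ℝ] 𝔸) (k : ℕ) (v : Fin (2 * k) → E) :
    ∃ p : Polynomial ℂ, p.natDegree ≤ 2 * k ∧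
      ∀ s : ℝ, chernForm τ (interCurv α Ω₀ Ω₁ s) k v = p.eval (s : ℂ) := by
  have := fun σ : Equiv.Perm (Fin (2 * k)) => exists_polynomial_prod (pairs Ω₀ (v ∘ σ))
    (pairs (Ω₁ - Ω₀ - wedgeComm α) (v ∘ σ)) (pairs (wedgeComm α) (v ∘ σ)) (τ : 𝔸 →ₗ[ℝ] ℂ)
  choose p hp hpe using this
  refine ⟨Polynomial.C (chernConst k) * ∑ σ, Polynomial.C ((Equiv.Perm.sign σ : ℤ) : ℂ) * p σ,
    ?_, fun s => ?_⟩
  · refine (Polynomial.natDegree_C_mul_le _ _).trans (Polynomial.natDegree_sum_le_of_forall_le _ _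
      fun σ _ => (Polynomial.natDegree_C_mul_le _ _).trans (hp σ))
  · rw [chernForm_apply]
    simp only [Polynomial.eval_mul, Polynomial.eval_C, Polynomial.eval_finsetSum, ← hpe]
    rfl

/-- The nodes and the weights of a quadrature formula on `[0, 1]`. -/
def quadWeight (d : ℕ) : Fin d → ℂ := (exists_quadrature d).choose

/-- The nodes of the quadrature formula with weights `quadWeight`. -/
def quadNode (d : ℕ) : Fin d → ℝ := (exists_quadrature d).choose_spec.choose

theorem quad_spec (d : ℕ) (p : Polynomial ℂ) (hp : p.natDegree ≤ d) :
    p.eval 1 - p.eval 0 = ∑ i, quadWeight d i * (Polynomial.derivative p).eval (quadNode d i : ℂ) :=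
  (exists_quadrature d).choose_spec.choose_spec p hp

/-- The transgression form of degree `2k + 1`. -/
def transForm (τ : 𝔸 →L[ℝ] ℂ) (α : E →L[ℝ] 𝔸) (Ω₀ Ω₁ : E →L[ℝ] E →L[ℝ] 𝔸) (k : ℕ) :
    E [⋀^Fin (2 * k + 1)]→L[ℝ] ℂ :=
  ∑ i, quadWeight (2 * (k + 1)) i • transInt τ α Ω₀ Ω₁ (quadNode (2 * (k + 1)) i) k

theorem contDiffAt_transForm [FiniteDimensional ℝ E] (τ : 𝔸 →L[ℝ] ℂ) {D : Type*}
    [NormedAddCommGroup D] [NormedSpace ℝ D]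
    {α : D → E →L[ℝ] 𝔸} {Ω₀ Ω₁ : D → E →L[ℝ] E →L[ℝ] 𝔸} {z : D} (hα : ContDiffAt ℝ ∞ α z)
    (h₀ : ContDiffAt ℝ ∞ Ω₀ z) (h₁ : ContDiffAt ℝ ∞ Ω₁ z) (k : ℕ) :
    ContDiffAt ℝ ∞ (fun w => transForm τ (α w) (Ω₀ w) (Ω₁ w) k) z :=
  ContDiffAt.sum fun _ _ => (contDiffAt_transInt τ hα h₀ h₁ _ k).const_smul _

/-- The transgression formula. -/
theorem extDeriv_transForm [FiniteDimensional ℝ E] {A₀ A₁ : E → E →L[ℝ] 𝔸} {z : E}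
    (h₀ : ContDiffAt ℝ ∞ A₀ z) (h₁ : ContDiffAt ℝ ∞ A₁ z) (τ : 𝔸 →L[ℝ] ℂ)
    (hτ : ∀ a b, τ (a * b) = τ (b * a)) (k : ℕ) :
    extDeriv (fun w => transForm τ (A₁ w - A₀ w) (curvForm A₀ w) (curvForm A₁ w) k) z
      = (show E [⋀^Fin (2 * k + 1 + 1)]→L[ℝ] ℂ from
        chernForm τ (curvForm A₁ z) (k + 1) - chernForm τ (curvForm A₀ z) (k + 1)) := by
  have hts := fun t => (contDiffAt_transInt τ (h₁.sub h₀) (contDiffAt_curvForm h₀)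
    (contDiffAt_curvForm h₁) t k).differentiableAt (by simp)
  ext v
  obtain ⟨p, hp, hpe⟩ := chernForm_interCurv_polynomial τ (A₁ z - A₀ z) (curvForm A₀ z)
    (curvForm A₁ z) (k + 1) v
  have hd : ∀ t : ℝ, (extDeriv (fun w => transInt τ (A₁ w - A₀ w) (curvForm A₀ w)
      (curvForm A₁ w) t k) z : E [⋀^Fin (2 * (k + 1))]→L[ℝ] ℂ) v
        = (Polynomial.derivative p).eval (t : ℂ) := by
    intro t
    refine (hasDerivAt_chernForm_interCurv h₀ h₁ τ hτ t k v).unique ?_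
    simp only [hpe]
    exact (p.hasDerivAt (t : ℂ)).comp_ofReal
  have hi0 : interCurv (A₁ z - A₀ z) (curvForm A₀ z) (curvForm A₁ z) 0 = curvForm A₀ z := by
    simp [interCurv]
  have hi1 : interCurv (A₁ z - A₀ z) (curvForm A₀ z) (curvForm A₁ z) 1 = curvForm A₁ z := by
    rw [interCurv, one_smul, one_pow, one_smul]
    abel
  have h10 := quad_spec _ p hp
  have q1 := hpe 1
  have q0 := hpe 0
  rw [hi1] at q1
  rw [hi0] at q0
  simp only [Complex.ofReal_one, Complex.ofReal_zero] at q0 q1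
  rw [← q0, ← q1] at h10
  refine Eq.trans ?_ h10.symm
  rw [extDeriv_apply ((contDiffAt_transForm τ (h₁.sub h₀) (contDiffAt_curvForm h₀)
    (contDiffAt_curvForm h₁) k).differentiableAt (by simp))]
  simp_rw [← hd]
  have hd' : ∀ t : ℝ, (extDeriv (fun w => transInt τ (A₁ w - A₀ w) (curvForm A₀ w)
      (curvForm A₁ w) t k) z : E [⋀^Fin (2 * (k + 1))]→L[ℝ] ℂ) v = _ := fun t =>
    extDeriv_apply (hts t) v
  simp_rw [hd', Finset.mul_sum]
  rw [Finset.sum_comm]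
  refine Finset.sum_congr rfl fun i _ => ?_
  have hdv : ∀ t u, DifferentiableAt ℝ (fun w => transInt τ (A₁ w - A₀ w) (curvForm A₀ w)
      (curvForm A₁ w) t k u) z := fun t u =>
    (ContinuousAlternatingMap.apply ℝ E ℂ u).differentiableAt.comp z (hts t)
  have hf : (fun w => transForm τ (A₁ w - A₀ w) (curvForm A₀ w) (curvForm A₁ w) k (i.removeNth v))
      = fun w => ∑ j, quadWeight (2 * (k + 1)) j * transInt τ (A₁ w - A₀ w) (curvForm A₀ w)
        (curvForm A₁ w) (quadNode (2 * (k + 1)) j) k (i.removeNth v) := by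
    ext w
    simp [transForm]
  rw [hf, fderiv_fun_sum fun j _ => (hdv _ _).const_mul _, sum_apply, Finset.smul_sum]
  refine Finset.sum_congr rfl fun j _ => ?_
  rw [fderiv_const_mul (hdv _ _), smul_apply, smul_eq_mul, mul_smul_comm]

theorem transForm_conj (τ : 𝔸 →L[ℝ] ℂ) (hτ : ∀ a b, τ (a * b) = τ (b * a))
    {α α' : E →L[ℝ] 𝔸} {Ω₀ Ω₀' Ω₁ Ω₁' : E →L[ℝ] E →L[ℝ] 𝔸} (c : 𝔸ˣ)
    (hα : ∀ a, α' a * c = c * α a) (h₀ : ∀ a b, Ω₀' a b * c = c * Ω₀ a b)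
    (h₁ : ∀ a b, Ω₁' a b * c = c * Ω₁ a b) (k : ℕ) :
    transForm τ α' Ω₀' Ω₁' k = transForm τ α Ω₀ Ω₁ k := by
  have hw : ∀ a b, wedgeComm α' a b * c = c * wedgeComm α a b := fun a b => by
    rw [wedgeComm_apply, wedgeComm_apply, sub_mul, mul_assoc, hα, ← mul_assoc, hα, mul_assoc,
      mul_assoc, hα, ← mul_assoc _ (c : 𝔸), hα, mul_sub, mul_assoc]
  unfold transForm transInt
  refine Finset.sum_congr rfl fun i _ => ?_
  rw [chernForm_conj τ hτ (Ω := extCurv α Ω₀ Ω₁ _) (Ω' := extCurv α' Ω₀' Ω₁' _) c]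
  intro x y
  simp only [extCurv_apply, interCurv, add_apply, sub_apply, smul_apply, add_mul, sub_mul, mul_add,
    mul_sub, smul_mul_assoc, mul_smul_comm, hα, h₀, h₁, hw]

theorem transForm_compContinuousLinearMap (τ : 𝔸 →L[ℝ] ℂ) (α : E →L[ℝ] 𝔸)
    (Ω₀ Ω₁ : E →L[ℝ] E →L[ℝ] 𝔸) (k : ℕ) (f : E' →L[ℝ] E) :
    (transForm τ α Ω₀ Ω₁ k).compContinuousLinearMap f
      = transForm τ (α.comp f) (Ω₀.bilinearComp f f) (Ω₁.bilinearComp f f) k := by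
  ext v
  simp only [transForm, ContinuousAlternatingMap.compContinuousLinearMap_apply,
    ContinuousAlternatingMap.sum_apply, ContinuousAlternatingMap.smul_apply]
  refine Finset.sum_congr rfl fun i _ => ?_
  congr 1
  rw [transInt_apply, transInt_apply, chernForm_apply, chernForm_apply]
  congr 1
  refine Finset.sum_congr rfl fun σ _ => ?_
  congr 4
  ext j
  have hv : ∀ l : Fin (2 * k + 1 + 1), (Fin.cons (0, 1) (fun i => ((f ∘ v) i, 0)) :
      Fin (2 * k + 1 + 1) → E × ℝ) l = (f ((Fin.cons (0, 1) (fun i => (v i, 0)) :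
        Fin (2 * k + 1 + 1) → E' × ℝ) l).1, ((Fin.cons (0, 1) (fun i => (v i, 0)) :
        Fin (2 * k + 1 + 1) → E' × ℝ) l).2) := by
    intro l
    refine Fin.cases ?_ (fun l => ?_) l
    · simp
    · simp
  simp only [pairs, Function.comp_apply]
  have h1 := hv (σ ⟨2 * j.1, by omega⟩)
  have h2 := hv (σ ⟨2 * j.1 + 1, by omega⟩)
  simp only [Function.comp_apply] at h1 h2
  rw [h1, h2]
  simp [extCurv_apply, interCurv, wedgeComm_apply]

theorem curvForm_pullback {A : E → E →L[ℝ] 𝔸} {S : E' → E} {z : E'}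
    (hA : DifferentiableAt ℝ A (S z)) (hS : ContDiffAt ℝ ∞ S z) :
    curvForm (fun w => (A (S w)).comp (fderiv ℝ S w)) z
      = (curvForm A (S z)).bilinearComp (fderiv ℝ S z) (fderiv ℝ S z) := by
  have h1 : HasFDerivAt (fderiv ℝ S) (fderiv ℝ (fderiv ℝ S) z) z :=
    ((hS.fderiv_right (m := ∞) (by simp)).differentiableAt (by simp)).hasFDerivAt
  have h2 := (hA.hasFDerivAt.comp z (hS.differentiableAt (by simp)).hasFDerivAt).clm_comp h1
  have h3 : fderiv ℝ (fun w => (A (S w)).comp (fderiv ℝ S w)) z = _ := h2.fderiv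
  have hs := hS.isSymmSndFDerivAt (by simp; exact two_le_infty)
  refine ContinuousLinearMap.ext fun x => ContinuousLinearMap.ext fun y => ?_
  rw [curvForm_apply, h3]
  simp [curvForm_apply]
  rw [hs.eq x y]
  abel

/-- The curvature in another frame. -/
theorem curvForm_gauge {A A' : E → E →L[ℝ] 𝔸} {h : E → 𝔸} {z : E}
    (hA : DifferentiableAt ℝ A z) (hA' : DifferentiableAt ℝ A' z) (hh : ContDiffAt ℝ ∞ h z)
    (he : ∀ᶠ w in 𝓝 z, ∀ v, h w * A' w v = fderiv ℝ h w v + A w v * h w) (a b : E) :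
    curvForm A z a b * h z = h z * curvForm A' z a b := by
  have hz := he.self_of_nhds
  have h0 : HasFDerivAt h (fderiv ℝ h z) z := (hh.differentiableAt (by simp)).hasFDerivAt
  have h1 : HasFDerivAt (fderiv ℝ h) (fderiv ℝ (fderiv ℝ h) z) z :=
    ((hh.fderiv_right (m := ∞) (by simp)).differentiableAt (by simp)).hasFDerivAt
  have key : ∀ a b, fderiv ℝ h z a * A' z b + h z * fderiv ℝ A' z a b
      = fderiv ℝ (fderiv ℝ h) z a b + (fderiv ℝ A z a b * h z + A z b * fderiv ℝ h z a) := by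
    intro a b
    have l := h0.mul' (hA'.hasFDerivAt.clm_apply (hasFDerivAt_const b z))
    have r := (h1.clm_apply (hasFDerivAt_const b z)).add
      ((hA.hasFDerivAt.clm_apply (hasFDerivAt_const b z)).mul' h0)
    have hlr : (h * fun y => A' y b) =ᶠ[𝓝 z] (fun y => fderiv ℝ h y b) + (fun y => A y b) * h := by
      filter_upwards [he] with w hw
      exact hw b
    have := DFunLike.congr_fun (l.unique (r.congr_of_eventuallyEq hlr)) a
    simp at this
    rw [add_comm, this]
    abel
  have hs := (hh.isSymmSndFDerivAt (by simp; exact two_le_infty)).eq a b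
  have k1 := key a b
  have k2 := key b a
  have hD : ∀ v, fderiv ℝ h z v = h z * A' z v - A z v * h z := fun v => by rw [hz v]; abel
  rw [hD] at k1 k2
  have e1 : h z * fderiv ℝ A' z a b = fderiv ℝ (fderiv ℝ h) z a b + (fderiv ℝ A z a b * h z
      + A z b * (h z * A' z a - A z a * h z)) - (h z * A' z a - A z a * h z) * A' z b := by
    rw [← k1]; abel
  have e2 : h z * fderiv ℝ A' z b a = fderiv ℝ (fderiv ℝ h) z b a + (fderiv ℝ A z b a * h z
      + A z a * (h z * A' z b - A z b * h z)) - (h z * A' z b - A z b * h z) * A' z a := by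
    rw [← k2]; abel
  rw [curvForm_apply, curvForm_apply, mul_add, mul_sub, e1, e2, hs]
  noncomm_ring

end Transgression

section Parity

variable {E : Type*} [NormedAddCommGroup E] [NormedSpace ℝ E]

/-- The non-homogeneous form with components `f k` of degree `2k`. -/
def evenForm (f : ∀ k, E [⋀^Fin (2 * k)]→L[ℝ] ℂ) (m : ℕ) : E [⋀^Fin m]→L[ℝ] ℂ :=
  if h : 2 * (m / 2) = m then h ▸ f (m / 2) else 0

/-- The non-homogeneous form with components `f k` of degree `2k + 1`. -/
def oddForm (f : ∀ k, E [⋀^Fin (2 * k + 1)]→L[ℝ] ℂ) (m : ℕ) : E [⋀^Fin m]→L[ℝ] ℂ :=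
  if h : 2 * (m / 2) + 1 = m then h ▸ f (m / 2) else 0

theorem evenForm_even (f : ∀ k, E [⋀^Fin (2 * k)]→L[ℝ] ℂ) (k : ℕ) : evenForm f (2 * k) = f k := by
  have key : ∀ (l : ℕ) (h : 2 * l = 2 * k),
      (h ▸ f l : E [⋀^Fin (2 * k)]→L[ℝ] ℂ) = f k := by
    intro l h
    obtain rfl : l = k := by omega
    rfl
  rw [evenForm, dif_pos (by omega)]
  exact key _ _

theorem evenForm_odd (f : ∀ k, E [⋀^Fin (2 * k)]→L[ℝ] ℂ) (k : ℕ) :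
    evenForm f (2 * k + 1) = 0 := by
  rw [evenForm, dif_neg (by omega)]

theorem oddForm_odd (f : ∀ k, E [⋀^Fin (2 * k + 1)]→L[ℝ] ℂ) (k : ℕ) :
    oddForm f (2 * k + 1) = f k := by
  have key : ∀ (l : ℕ) (h : 2 * l + 1 = 2 * k + 1),
      (h ▸ f l : E [⋀^Fin (2 * k + 1)]→L[ℝ] ℂ) = f k := by
    intro l h
    obtain rfl : l = k := by omega
    rfl
  rw [oddForm, dif_pos (by omega)]
  exact key _ _

theorem oddForm_even (f : ∀ k, E [⋀^Fin (2 * k + 1)]→L[ℝ] ℂ) (k : ℕ) :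
    oddForm f (2 * k) = 0 := by
  rw [oddForm, dif_neg (by omega)]

end Parity

section Charts

variable {E : Type*} [NormedAddCommGroup E] [NormedSpace ℝ E]
  {H : Type*} [TopologicalSpace H] {I : ModelWithCorners ℝ E H} [I.Boundaryless]
  {X : Type*} [TopologicalSpace X] [ChartedSpace H X]

/-- The derivative of a chart, as a map to the model space. -/
def dchart (I : ModelWithCorners ℝ E H) (w x : X) : E →L[ℝ] E :=
  mfderiv I 𝓘(ℝ, E) (extChartAt I w) x

/-- The derivative of the inverse of a chart, as a map from the model space. -/
def dchartSymm (I : ModelWithCorners ℝ E H) (w : X) (z : E) : E →L[ℝ] E :=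
  mfderiv 𝓘(ℝ, E) I (extChartAt I w).symm z

variable [IsManifold I 1 X]

theorem dchart_comp_dchartSymm {w : X} {z : E} (hz : z ∈ (extChartAt I w).target) :
    (dchart I w ((extChartAt I w).symm z)).comp (dchartSymm I w z) = ContinuousLinearMap.id ℝ E := by
  have := mfderiv_extChartAt_comp_mfderivWithin_extChartAt_symm hz
  rw [I.range_eq_univ, mfderivWithin_univ] at this
  exact this

theorem dchartSymm_comp_dchart {w x : X} (hx : x ∈ (extChartAt I w).source) :
    (dchartSymm I w (extChartAt I w x)).comp (dchart I w x) = ContinuousLinearMap.id ℝ E := by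
  have := mfderivWithin_extChartAt_symm_comp_mfderiv_extChartAt' hx
  rw [I.range_eq_univ, mfderivWithin_univ] at this
  exact this

theorem dchart_self (x : X) : dchart I x x = ContinuousLinearMap.id ℝ E :=
  mfderiv_extChartAt_self

theorem dchartSymm_self (x : X) :
    dchartSymm I x (extChartAt I x x) = ContinuousLinearMap.id ℝ E := by
  have := dchartSymm_comp_dchart (I := I) (mem_extChartAt_source (I := I) x)
  rwa [dchart_self, ContinuousLinearMap.comp_id] at this

theorem formRep_eq (c : TotalForm I X) (m : ℕ) (w : X) (z : E) :
    formRep c m w z = (show E [⋀^Fin m]→L[ℝ] ℂ from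
      c ((extChartAt I w).symm z) m).compContinuousLinearMap (dchartSymm I w z) := rfl

theorem eventually_chart {V : Set X} (hV : IsOpen V) {w : X} {z : E}
    (hz : z ∈ (extChartAt I w).target) (hzV : (extChartAt I w).symm z ∈ V) :
    ∀ᶠ y in 𝓝 z, y ∈ (extChartAt I w).target ∧ (extChartAt I w).symm y ∈ V :=
  Filter.Eventually.and (extChartAt_target_mem_nhds' hz)
    ((continuousAt_extChartAt_symm'' hz).eventually (hV.mem_nhds hzV))

end Charts

section Global

variable {E : Type*} [NormedAddCommGroup E] [NormedSpace ℝ E] [FiniteDimensional ℝ E]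
  {H : Type*} [TopologicalSpace H] {I : ModelWithCorners ℝ E H} [I.Boundaryless]
  {X : Type*} [TopologicalSpace X] [ChartedSpace H X] [IsManifold I 1 X]
  {𝔸 : Type*} [NormedRing 𝔸] [NormedAlgebra ℝ 𝔸]

/-- A pair of local connections on a possibly twisted bundle over an open set `V`. The relation
`P u α Ω₀ Ω₁` says that, in some frame at `u`, `α` is the difference of the connections and `Ω₀`,
`Ω₁` are their curvatures. -/
structure IsConnectionPair (V : Set X)
    (P : X → (E →L[ℝ] 𝔸) → (E →L[ℝ] E →L[ℝ] 𝔸) → (E →L[ℝ] E →L[ℝ] 𝔸) → Prop) : Prop where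
  conj : ∀ u ∈ V, ∀ α Ω₀ Ω₁ α' Ω₀' Ω₁', P u α Ω₀ Ω₁ → P u α' Ω₀' Ω₁' →
    ∃ c : 𝔸ˣ, (∀ a, α' a * c = c * α a) ∧ (∀ a b, Ω₀' a b * c = c * Ω₀ a b) ∧
      ∀ a b, Ω₁' a b * c = c * Ω₁ a b
  loc : ∀ w : X, ∀ u ∈ V, u ∈ (extChartAt I w).source → ∃ A₀ A₁ : E → E →L[ℝ] 𝔸,
    ContDiffAt ℝ ∞ A₀ (extChartAt I w u) ∧ ContDiffAt ℝ ∞ A₁ (extChartAt I w u) ∧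
    ∀ᶠ z in 𝓝 (extChartAt I w u), P ((extChartAt I w).symm z)
      ((A₁ z - A₀ z).comp (dchart I w ((extChartAt I w).symm z)))
      ((curvForm A₀ z).bilinearComp (dchart I w ((extChartAt I w).symm z))
        (dchart I w ((extChartAt I w).symm z)))
      ((curvForm A₁ z).bilinearComp (dchart I w ((extChartAt I w).symm z))
        (dchart I w ((extChartAt I w).symm z)))

theorem bilinearComp_bilinearComp_id (Ω : E →L[ℝ] E →L[ℝ] 𝔸) {f g : E →L[ℝ] E}
    (h : f.comp g = ContinuousLinearMap.id ℝ E) : (Ω.bilinearComp f f).bilinearComp g g = Ω := by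
  refine ContinuousLinearMap.ext fun x => ContinuousLinearMap.ext fun y => ?_
  have := fun x => DFunLike.congr_fun h x
  simp only [ContinuousLinearMap.comp_apply, ContinuousLinearMap.id_apply] at this
  simp [this]

theorem IsConnectionPair.exists_forms {V : Set X} (hV : IsOpen V)
    {P : X → (E →L[ℝ] 𝔸) → (E →L[ℝ] E →L[ℝ] 𝔸) → (E →L[ℝ] E →L[ℝ] 𝔸) → Prop}
    (hP : IsConnectionPair (I := I) V P) (τ : 𝔸 →L[ℝ] ℂ) (hτ : ∀ a b, τ (a * b) = τ (b * a)) :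
    ∃ C₀ C₁ : TotalForm I X, SmoothFormOn V C₀ ∧ SmoothFormOn V C₁ ∧
      IsClosedFormOn V C₀ ∧ IsClosedFormOn V C₁ ∧ CohomologousOn V C₁ C₀ ∧
      (∀ u ∈ V, ∀ α Ω₀ Ω₁, P u α Ω₀ Ω₁ → ∀ k,
        C₀ u (2 * k) = chernForm τ Ω₀ k ∧ C₁ u (2 * k) = chernForm τ Ω₁ k) ∧
      ∀ u ∈ V, ∀ k, C₀ u (2 * k + 1) = 0 ∧ C₁ u (2 * k + 1) = 0 := by
  classical
  have hex : ∀ u, ∃ d : (E →L[ℝ] 𝔸) × (E →L[ℝ] E →L[ℝ] 𝔸) × (E →L[ℝ] E →L[ℝ] 𝔸),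
      u ∈ V → P u d.1 d.2.1 d.2.2 := by
    intro u
    by_cases hu : u ∈ V
    · obtain ⟨A₀, A₁, -, -, h⟩ := hP.loc u u hu (mem_extChartAt_source u)
      have := h.self_of_nhds
      rw [extChartAt_to_inv] at this
      exact ⟨⟨_, _, _⟩, fun _ => this⟩
    · exact ⟨0, fun h => absurd h hu⟩
  choose d hd using hex
  let C₀ : TotalForm I X := fun u => evenForm (E := E) fun k => chernForm τ (d u).2.1 k
  let C₁ : TotalForm I X := fun u => evenForm (E := E) fun k => chernForm τ (d u).2.2 k
  let η : TotalForm I X := fun u => oddForm (E := E) fun k =>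
    transForm τ (d u).1 (d u).2.1 (d u).2.2 k
  have hC : ∀ u ∈ V, ∀ α Ω₀ Ω₁, P u α Ω₀ Ω₁ → ∀ k,
      C₀ u (2 * k) = chernForm τ Ω₀ k ∧ C₁ u (2 * k) = chernForm τ Ω₁ k ∧
        η u (2 * k + 1) = transForm τ α Ω₀ Ω₁ k := by
    intro u hu α Ω₀ Ω₁ h k
    obtain ⟨c, c1, c2, c3⟩ := hP.conj u hu _ _ _ _ _ _ h (hd u hu)
    refine ⟨?_, ?_, ?_⟩
    · exact (evenForm_even _ k).trans (chernForm_conj τ hτ c c2 k)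
    · exact (evenForm_even _ k).trans (chernForm_conj τ hτ c c3 k)
    · exact (oddForm_odd _ k).trans (transForm_conj τ hτ c c1 c2 c3 k)
  have hodd : ∀ u k, C₀ u (2 * k + 1) = 0 ∧ C₁ u (2 * k + 1) = 0 ∧ η u (2 * k) = 0 := fun u k =>
    ⟨evenForm_odd _ k, evenForm_odd _ k, oddForm_even _ k⟩
  have zcomp : ∀ (m : ℕ) (f : E →L[ℝ] E),
      (0 : E [⋀^Fin m]→L[ℝ] ℂ).compContinuousLinearMap f = 0 := fun m f => rfl
  have hrep : ∀ w : X, ∀ z ∈ (extChartAt I w).target, (extChartAt I w).symm z ∈ V →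
      ∃ A₀ A₁ : E → E →L[ℝ] 𝔸, ContDiffAt ℝ ∞ A₀ z ∧ ContDiffAt ℝ ∞ A₁ z ∧
        ∀ᶠ y in 𝓝 z, ∀ k, formRep C₀ (2 * k) w y = chernForm τ (curvForm A₀ y) k ∧
          formRep C₁ (2 * k) w y = chernForm τ (curvForm A₁ y) k ∧
          formRep η (2 * k + 1) w y
            = transForm τ (A₁ y - A₀ y) (curvForm A₀ y) (curvForm A₁ y) k ∧
          formRep C₀ (2 * k + 1) w y = 0 ∧ formRep C₁ (2 * k + 1) w y = 0 ∧
          formRep η (2 * k) w y = 0 := by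
    intro w z hz hzV
    obtain ⟨A₀, A₁, h₀, h₁, h⟩ := hP.loc w _ hzV ((extChartAt I w).map_target hz)
    rw [(extChartAt I w).right_inv hz] at h₀ h₁ h
    refine ⟨A₀, A₁, h₀, h₁, ?_⟩
    filter_upwards [h, eventually_chart hV hz hzV] with y hy hyt k
    obtain ⟨e0, e1, e2⟩ := hC _ hyt.2 _ _ _ hy k
    obtain ⟨o0, o1, o2⟩ := hodd ((extChartAt I w).symm y) k
    have hid := dchart_comp_dchartSymm (I := I) hyt.1
    refine ⟨?_, ?_, ?_, ?_, ?_, ?_⟩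
    · rw [formRep_eq, e0, chernForm_compContinuousLinearMap, bilinearComp_bilinearComp_id _ hid]
    · rw [formRep_eq, e1, chernForm_compContinuousLinearMap, bilinearComp_bilinearComp_id _ hid]
    · rw [formRep_eq, e2, transForm_compContinuousLinearMap, bilinearComp_bilinearComp_id _ hid,
        bilinearComp_bilinearComp_id _ hid, ContinuousLinearMap.comp_assoc, hid,
        ContinuousLinearMap.comp_id]
    · rw [formRep_eq, o0]; exact zcomp _ _
    · rw [formRep_eq, o1]; exact zcomp _ _
    · rw [formRep_eq, o2]; exact zcomp _ _
  have hext0 : ∀ (m : ℕ) (f : E → E [⋀^Fin m]→L[ℝ] ℂ) (z : E), (∀ᶠ y in 𝓝 z, f y = 0) →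
      extDeriv f z = 0 := by
    intro m f z hf
    have : f =ᶠ[𝓝 z] fun _ => 0 := hf
    rw [this.extDeriv_eq]
    ext v
    rw [extDeriv_apply (differentiableAt_const _)]
    simp
  have hxV : ∀ x ∈ V, (extChartAt I x).symm (extChartAt I x x) ∈ V := fun x hx => by
    rwa [extChartAt_to_inv]
  have hself : ∀ (c : TotalForm I X) (m : ℕ) (x : X), formRep c m x (extChartAt I x x) = c x m := by
    intro c m x
    rw [formRep_eq, dchartSymm_self, extChartAt_to_inv]
    rfl
  refine ⟨C₀, C₁, ?_, ?_, ?_, ?_, ⟨η, ?_, ?_⟩, fun u hu α Ω₀ Ω₁ h k =>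
    ⟨(hC u hu _ _ _ h k).1, (hC u hu _ _ _ h k).2.1⟩, fun u _ k =>
    ⟨(hodd u k).1, (hodd u k).2.1⟩⟩
  · intro m w z hz
    obtain ⟨A₀, A₁, h₀, h₁, h⟩ := hrep w z hz.1 hz.2
    refine ContDiffAt.contDiffWithinAt ?_
    obtain ⟨k, rfl | rfl⟩ := m.even_or_odd'
    · exact (contDiffAt_chernForm τ (contDiffAt_curvForm h₀) k).congr_of_eventuallyEq
        (h.mono fun y hy => (hy k).1)
    · exact contDiffAt_const.congr_of_eventuallyEq (h.mono fun y hy => (hy k).2.2.2.1)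
  · intro m w z hz
    obtain ⟨A₀, A₁, h₀, h₁, h⟩ := hrep w z hz.1 hz.2
    refine ContDiffAt.contDiffWithinAt ?_
    obtain ⟨k, rfl | rfl⟩ := m.even_or_odd'
    · exact (contDiffAt_chernForm τ (contDiffAt_curvForm h₁) k).congr_of_eventuallyEq
        (h.mono fun y hy => (hy k).2.1)
    · exact contDiffAt_const.congr_of_eventuallyEq (h.mono fun y hy => (hy k).2.2.2.2.1)
  · intro x hx m
    obtain ⟨A₀, A₁, h₀, h₁, h⟩ := hrep x _ (mem_extChartAt_target x) (hxV x hx)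
    obtain ⟨k, rfl | rfl⟩ := m.even_or_odd'
    · exact (Filter.EventuallyEq.extDeriv_eq (h.mono fun y hy => (hy k).1)).trans
        (extDeriv_chernForm_curvForm h₀ τ hτ k)
    · exact hext0 _ _ _ (h.mono fun y hy => (hy k).2.2.2.1)
  · intro x hx m
    obtain ⟨A₀, A₁, h₀, h₁, h⟩ := hrep x _ (mem_extChartAt_target x) (hxV x hx)
    obtain ⟨k, rfl | rfl⟩ := m.even_or_odd'
    · exact (Filter.EventuallyEq.extDeriv_eq (h.mono fun y hy => (hy k).2.1)).trans
        (extDeriv_chernForm_curvForm h₁ τ hτ k)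
    · exact hext0 _ _ _ (h.mono fun y hy => (hy k).2.2.2.2.1)
  · intro m w z hz
    obtain ⟨A₀, A₁, h₀, h₁, h⟩ := hrep w z hz.1 hz.2
    refine ContDiffAt.contDiffWithinAt ?_
    obtain ⟨k, rfl | rfl⟩ := m.even_or_odd'
    · exact contDiffAt_const.congr_of_eventuallyEq (h.mono fun y hy => (hy k).2.2.2.2.2)
    · exact (contDiffAt_transForm τ (h₁.sub h₀) (contDiffAt_curvForm h₀) (contDiffAt_curvForm h₁)
        k).congr_of_eventuallyEq (h.mono fun y hy => (hy k).2.2.1)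
  · intro x hx
    obtain ⟨A₀, A₁, h₀, h₁, h⟩ := hrep x _ (mem_extChartAt_target x) (hxV x hx)
    have hx' := h.self_of_nhds
    refine ⟨?_, fun m => ?_⟩
    · rw [← hself C₁, ← hself C₀]
      have e1 := (hx' 0).2.1
      have e0 := (hx' 0).1
      refine e1.trans (Eq.trans ?_ e0.symm)
      ext v
      rw [chernForm_apply, chernForm_apply]
      rfl
    · obtain ⟨k, rfl | rfl⟩ := m.even_or_odd'
      · rw [(hodd x k).1, (hodd x k).2.1, sub_zero]
        exact (hext0 _ _ _ (h.mono fun y hy => (hy k).2.2.2.2.2)).symm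
      · rw [← hself C₁, ← hself C₀]
        have e := (Filter.EventuallyEq.extDeriv_eq (h.mono fun y hy => (hy k).2.2.1)).trans
          (extDeriv_transForm h₀ h₁ τ hτ k)
        refine Eq.trans ?_ e.symm
        exact congrArg₂ (· - ·) (hx' (k + 1)).2.1 (hx' (k + 1)).1

theorem formRep_congr {V : Set X} (hV : IsOpen V) {c c' : TotalForm I X}
    (h : ∀ u ∈ V, ∀ m, c u m = c' u m) (m : ℕ) {w : X} {z : E} (hz : z ∈ (extChartAt I w).target)
    (hzV : (extChartAt I w).symm z ∈ V) : formRep c m w =ᶠ[𝓝 z] formRep c' m w := by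
  filter_upwards [eventually_chart hV hz hzV] with y hy
  rw [formRep_eq, formRep_eq, h _ hy.2]

theorem IsClosedFormOn.congr {V : Set X} (hV : IsOpen V) {c c' : TotalForm I X}
    (hc : IsClosedFormOn V c) (h : ∀ u ∈ V, ∀ m, c' u m = c u m) : IsClosedFormOn V c' := by
  intro x hx m
  refine Eq.trans ?_ (hc x hx m)
  exact (formRep_congr hV h m (mem_extChartAt_target x)
    (by rwa [extChartAt_to_inv])).extDeriv_eq

theorem CohomologousOn.congr {V : Set X} {c₁ c₂ c₁' c₂' : TotalForm I X}
    (hc : CohomologousOn V c₁ c₂) (h₁ : ∀ u ∈ V, ∀ m, c₁' u m = c₁ u m)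
    (h₂ : ∀ u ∈ V, ∀ m, c₂' u m = c₂ u m) : CohomologousOn V c₁' c₂' := by
  obtain ⟨η, hη, h⟩ := hc
  refine ⟨η, hη, fun x hx => ?_⟩
  simp only [h₁ x hx, h₂ x hx]
  exact h x hx

end Global

section ChartFunctions

variable {E : Type*} [NormedAddCommGroup E] [NormedSpace ℝ E]
  {H : Type*} [TopologicalSpace H] {I : ModelWithCorners ℝ E H} [I.Boundaryless]
  {X : Type*} [TopologicalSpace X] [ChartedSpace H X]
  {F : Type*} [NormedAddCommGroup F] [NormedSpace ℝ F]

theorem mdifferentiableAt_chart [IsManifold I 1 X] {w x : X} (hx : x ∈ (extChartAt I w).source) :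
    MDifferentiableAt I 𝓘(ℝ, E) (extChartAt I w) x :=
  mdifferentiableAt_extChartAt (by rwa [extChartAt_source] at hx)

theorem mdifferentiableAt_chart_symm [IsManifold I 1 X] {w : X} {z : E}
    (hz : z ∈ (extChartAt I w).target) :
    MDifferentiableAt 𝓘(ℝ, E) I (extChartAt I w).symm z := by
  have := mdifferentiableWithinAt_extChartAt_symm hz
  rwa [I.range_eq_univ, mdifferentiableWithinAt_univ] at this

theorem contMDiffAt_chart_symm [IsManifold I ∞ X] {w : X} {z : E}
    (hz : z ∈ (extChartAt I w).target) :
    ContMDiffAt 𝓘(ℝ, E) I ∞ (extChartAt I w).symm z :=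
  ((contMDiffOn_extChartAt_symm w) z hz).contMDiffAt (extChartAt_target_mem_nhds' hz)

theorem contMDiffAt_iff_contDiffAt_chart [IsManifold I ∞ X] {f : X → F} {w x : X}
    (hx : x ∈ (extChartAt I w).source) :
    ContMDiffAt I 𝓘(ℝ, F) ∞ f x ↔
      ContDiffAt ℝ ∞ (f ∘ (extChartAt I w).symm) (extChartAt I w x) := by
  rw [contMDiffAt_iff_source_of_mem_source (I := I) (x := w) (by rwa [extChartAt_source] at hx),
    I.range_eq_univ, contMDiffWithinAt_univ, contMDiffAt_iff_contDiffAt]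

theorem mdifferentiableAt_iff_differentiableAt_chart [IsManifold I 1 X] {f : X → F} {w x : X}
    (hx : x ∈ (extChartAt I w).source) :
    MDifferentiableAt I 𝓘(ℝ, F) f x ↔
      DifferentiableAt ℝ (f ∘ (extChartAt I w).symm) (extChartAt I w x) := by
  rw [← mdifferentiableAt_iff_differentiableAt]
  constructor
  · intro h
    refine MDifferentiableAt.comp (I' := I) _ ?_ (mdifferentiableAt_chart_symm
      ((extChartAt I w).map_source hx))
    rwa [(extChartAt I w).left_inv hx]
  · intro h
    refine (h.comp (I' := 𝓘(ℝ, E)) x (mdifferentiableAt_chart hx)).congr_of_eventuallyEq ?_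
    filter_upwards [extChartAt_source_mem_nhds' hx] with y hy
    exact congrArg f ((extChartAt I w).left_inv hy).symm

theorem mvfderiv_eq_fderiv_chart [IsManifold I 1 X] {f : X → F} {w x : X}
    (hx : x ∈ (extChartAt I w).source) (hf : MDifferentiableAt I 𝓘(ℝ, F) f x) (v : E) :
    mvfderiv I f x v
      = fderiv ℝ (f ∘ (extChartAt I w).symm) (extChartAt I w x) (dchart I w x v) := by
  have h1 := (mdifferentiableAt_iff_differentiableAt_chart hx).1 hf
  have h2 : f =ᶠ[𝓝 x] (f ∘ (extChartAt I w).symm) ∘ extChartAt I w := by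
    filter_upwards [extChartAt_source_mem_nhds' hx] with y hy
    exact congrArg f ((extChartAt I w).left_inv hy).symm
  have h3 := mfderiv_comp (I' := 𝓘(ℝ, E)) x h1.mdifferentiableAt (mdifferentiableAt_chart hx)
  rw [← h2.mfderiv_eq, mfderiv_eq_fderiv] at h3
  exact DFunLike.congr_fun h3 v

end ChartFunctions

section Frames

variable {E : Type*} [NormedAddCommGroup E] [NormedSpace ℝ E]
  {H : Type*} [TopologicalSpace H] {I : ModelWithCorners ℝ E H} [I.Boundaryless]
  {X : Type*} [TopologicalSpace X] [ChartedSpace H X] [IsManifold I ∞ X]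
  {F : Type*} [NormedAddCommGroup F] [NormedSpace ℝ F]
  {W : X → Type*} [TopologicalSpace (TotalSpace F W)]
  [∀ x, AddCommGroup (W x)] [∀ x, Module ℝ (W x)] [∀ x, TopologicalSpace (W x)]
  [∀ x, IsTopologicalAddGroup (W x)] [∀ x, ContinuousSMul ℝ (W x)] [FiberBundle F W]
  [VectorBundle ℝ F W] [ContMDiffVectorBundle ∞ F W I]
  {e : Trivialization F (TotalSpace.proj : TotalSpace F W → X)} [MemTrivializationAtlas e]

/-- A section in the chart at `w` and the trivialization `e`. -/
def secRep (I : ModelWithCorners ℝ E H)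
    (e : Trivialization F (TotalSpace.proj : TotalSpace F W → X)) [MemTrivializationAtlas e]
    (w : X) (s : Π x : X, W x) (z : E) : F :=
  e.continuousLinearMapAt ℝ ((extChartAt I w).symm z) (s ((extChartAt I w).symm z))

/-- A vector field in the chart at `w`. -/
def vecRep (w : X) (Y : Π x : X, TangentSpace I x) (z : E) : E :=
  dchart I w ((extChartAt I w).symm z) (Y ((extChartAt I w).symm z))

theorem contMDiffAt_section_iff_clma {s : Π x : X, W x} {x : X} (he : x ∈ e.baseSet) :
    ContMDiffAt I (I.prod 𝓘(ℝ, F)) ∞ (fun y => TotalSpace.mk' F y (s y)) x ↔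
      ContMDiffAt I 𝓘(ℝ, F) ∞ (fun y => e.continuousLinearMapAt ℝ y (s y)) x := by
  rw [e.contMDiffAt_section_iff he]
  refine Filter.EventuallyEq.contMDiffAt_iff ?_
  filter_upwards [e.open_baseSet.mem_nhds he] with y hy
  rw [e.continuousLinearMapAt_apply_of_mem ℝ hy]

theorem mdifferentiableAt_section_iff_clma {s : Π x : X, W x} {x : X} (he : x ∈ e.baseSet) :
    MDifferentiableAt I (I.prod 𝓘(ℝ, F)) (fun y => TotalSpace.mk' F y (s y)) x ↔
      MDifferentiableAt I 𝓘(ℝ, F) (fun y => e.continuousLinearMapAt ℝ y (s y)) x := by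
  have : IsManifold I 1 X := .of_le (n := ∞) (by simp)
  have : ContMDiffVectorBundle 1 F W I := .of_le (n := ∞) (by simp)
  rw [e.mdifferentiableAt_section_iff I s he]
  refine Filter.EventuallyEq.mdifferentiableAt_iff ?_
  filter_upwards [e.open_baseSet.mem_nhds he] with y hy
  rw [e.continuousLinearMapAt_apply_of_mem ℝ hy]

theorem contMDiffAt_section_iff_secRep {s : Π x : X, W x} {w x : X} (he : x ∈ e.baseSet)
    (hx : x ∈ (extChartAt I w).source) :
    ContMDiffAt I (I.prod 𝓘(ℝ, F)) ∞ (fun y => TotalSpace.mk' F y (s y)) x ↔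
      ContDiffAt ℝ ∞ (secRep I e w s) (extChartAt I w x) :=
  (contMDiffAt_section_iff_clma he).trans (contMDiffAt_iff_contDiffAt_chart hx)

theorem mdifferentiableAt_section_iff_secRep {s : Π x : X, W x} {w x : X} (he : x ∈ e.baseSet)
    (hx : x ∈ (extChartAt I w).source) :
    MDifferentiableAt I (I.prod 𝓘(ℝ, F)) (fun y => TotalSpace.mk' F y (s y)) x ↔
      DifferentiableAt ℝ (secRep I e w s) (extChartAt I w x) := by
  have : IsManifold I 1 X := .of_le (n := ∞) (by simp)
  exact (mdifferentiableAt_section_iff_clma he).trans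
    (mdifferentiableAt_iff_differentiableAt_chart hx)

theorem clma_trivializationAt_tangent {w x : X} [IsManifold I 1 X]
    (hx : x ∈ (extChartAt I w).source) :
    (trivializationAt E (TangentSpace I) w).continuousLinearMapAt ℝ x = dchart I w x :=
  TangentBundle.continuousLinearMapAt_trivializationAt (by rwa [extChartAt_source] at hx)

theorem secRep_tangent [IsManifold I 1 X] (w : X) (Y : Π x : X, TangentSpace I x) {z : E}
    (hz : z ∈ (extChartAt I w).target) :
    secRep I (trivializationAt E (TangentSpace I) w) w Y z = vecRep w Y z := by
  have := clma_trivializationAt_tangent (I := I) ((extChartAt I w).map_target hz)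
  exact DFunLike.congr_fun this _

theorem contMDiffAt_field_iff_vecRep {Y : Π x : X, TangentSpace I x} {w x : X}
    (hx : x ∈ (extChartAt I w).source) :
    ContMDiffAt I I.tangent ∞ (fun y => (⟨y, Y y⟩ : TangentBundle I X)) x ↔
      ContDiffAt ℝ ∞ (vecRep w Y) (extChartAt I w x) := by
  have : IsManifold I 1 X := .of_le (n := ∞) (by simp)
  have hx' : x ∈ (chartAt H w).source := by rwa [extChartAt_source] at hx
  have heq : secRep I (trivializationAt E (TangentSpace I) w) w Y
      =ᶠ[𝓝 (extChartAt I w x)] vecRep w Y := by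
    filter_upwards [extChartAt_target_mem_nhds' ((extChartAt I w).map_source hx)] with z hz
    exact secRep_tangent w Y hz
  exact (contMDiffAt_section_iff_secRep (F := E) (W := fun x : X => TangentSpace I x)
      (e := trivializationAt E (TangentSpace I) w) (by simpa using hx') hx).trans
    ⟨fun h => h.congr_of_eventuallyEq heq.symm, fun h => h.congr_of_eventuallyEq heq⟩

/-- The vector field with constant coefficients `v` in the chart at `w`. -/
def constField (I : ModelWithCorners ℝ E H) (w : X) (v : E) (x : X) : TangentSpace I x :=
  dchartSymm I w (extChartAt I w x) v

/-- The section with constant coefficients `f` in the trivialization `e`. -/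
def constSec (e : Trivialization F (TotalSpace.proj : TotalSpace F W → X))
    [MemTrivializationAtlas e] (f : F) (x : X) : W x := e.symmL ℝ x f

theorem vecRep_constField [IsManifold I 1 X] {w : X} (v : E) {z : E}
    (hz : z ∈ (extChartAt I w).target) : vecRep w (constField I w v) z = v := by
  have := dchart_comp_dchartSymm (I := I) hz
  rw [vecRep, constField, (extChartAt I w).right_inv hz]
  exact DFunLike.congr_fun this v

theorem contMDiffOn_constField (w : X) (v : E) :
    SmoothFieldOn (extChartAt I w).source (constField I w v) := by
  have : IsManifold I 1 X := .of_le (n := ∞) (by simp)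
  intro x hx
  refine ((contMDiffAt_field_iff_vecRep hx).2 ?_).contMDiffWithinAt
  refine contDiffAt_const (c := v) |>.congr_of_eventuallyEq ?_
  filter_upwards [extChartAt_target_mem_nhds' ((extChartAt I w).map_source hx)] with z hz
  exact vecRep_constField v hz

theorem clma_constSec {x : X} (hx : x ∈ e.baseSet) (f : F) :
    e.continuousLinearMapAt ℝ x (constSec e f x) = f :=
  e.continuousLinearMapAt_symmL hx f

theorem contMDiffOn_constSec (f : F) :
    ContMDiffOn I (I.prod 𝓘(ℝ, F)) ∞ (fun x => TotalSpace.mk' F x (constSec e f x)) e.baseSet := by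
  intro x hx
  refine ((contMDiffAt_section_iff_clma (e := e) hx).2 ?_).contMDiffWithinAt
  refine (contMDiffAt_const (c := f)).congr_of_eventuallyEq ?_
  filter_upwards [e.open_baseSet.mem_nhds hx] with y hy
  exact clma_constSec hy f

end Frames

theorem contDiffAt_clm_of_apply {D E F : Type*} [NormedAddCommGroup D] [NormedSpace ℝ D]
    [NormedAddCommGroup E] [NormedSpace ℝ E] [FiniteDimensional ℝ E]
    [NormedAddCommGroup F] [NormedSpace ℝ F] {f : D → E →L[ℝ] F} {x : D}
    (h : ∀ v, ContDiffAt ℝ ∞ (fun y => f y v) x) : ContDiffAt ℝ ∞ f x := by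
  let e₁ := ContinuousLinearEquiv.ofFinrankEq
    (Module.finrank_fin_fun ℝ (n := Module.finrank ℝ E)).symm
  let e₂ := (e₁.arrowCongr (1 : F ≃L[ℝ] F)).trans
    (ContinuousLinearEquiv.piRing (Fin (Module.finrank ℝ E)))
  rw [← Function.id_comp f, ← e₂.symm_comp_self]
  exact e₂.symm.contDiff.contDiffAt.comp x (contDiffAt_pi.mpr fun i => h _)

theorem curvForm_eq_commutator {E F : Type*} [NormedAddCommGroup E] [NormedSpace ℝ E]
    [NormedAddCommGroup F] [NormedSpace ℝ F] {A : E → E →L[ℝ] F →L[ℝ] F} {s : E → F}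
    {Y Z : E → E} {z : E} (hA : ContDiffAt ℝ ∞ A z) (hs : ContDiffAt ℝ ∞ s z)
    (hY : ContDiffAt ℝ ∞ Y z) (hZ : ContDiffAt ℝ ∞ Z z) :
    (fderiv ℝ (fun w => fderiv ℝ s w (Z w) + A w (Z w) (s w)) z (Y z)
        + A z (Y z) (fderiv ℝ s z (Z z) + A z (Z z) (s z)))
      - (fderiv ℝ (fun w => fderiv ℝ s w (Y w) + A w (Y w) (s w)) z (Z z)
        + A z (Z z) (fderiv ℝ s z (Y z) + A z (Y z) (s z)))
      - (fderiv ℝ s z (VectorField.lieBracket ℝ Y Z z) + A z (VectorField.lieBracket ℝ Y Z z) (s z))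
      = curvForm A z (Y z) (Z z) (s z) := by
  have dA := (hA.differentiableAt (by simp)).hasFDerivAt
  have ds := (hs.differentiableAt (by simp)).hasFDerivAt
  have dds := ((hs.fderiv_right (m := ∞) (by simp)).differentiableAt (by simp)).hasFDerivAt
  have key : ∀ (Z : E → E), ContDiffAt ℝ ∞ Z z → ∀ v,
      fderiv ℝ (fun w => fderiv ℝ s w (Z w) + A w (Z w) (s w)) z v
      = fderiv ℝ (fderiv ℝ s) z v (Z z) + fderiv ℝ s z (fderiv ℝ Z z v)
        + (fderiv ℝ A z v (Z z) (s z) + A z (fderiv ℝ Z z v) (s z)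
          + A z (Z z) (fderiv ℝ s z v)) := by
    intro Z hZ v
    have dZ := (hZ.differentiableAt (by simp)).hasFDerivAt
    have hd := (dds.clm_apply dZ).add ((dA.clm_apply dZ).clm_apply ds)
    refine (DFunLike.congr_fun hd.fderiv v).trans ?_
    simp only [add_apply, ContinuousLinearMap.comp_apply, ContinuousLinearMap.flip_apply]
    abel
  have hsym : fderiv ℝ (fderiv ℝ s) z (Y z) (Z z) = fderiv ℝ (fderiv ℝ s) z (Z z) (Y z) :=
    (hs.isSymmSndFDerivAt (by simpa using two_le_infty)) _ _
  rw [key Z hZ, key Y hY, hsym, curvForm_apply, VectorField.lieBracket]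
  simp only [map_sub, map_add, sub_apply, add_apply]
  change _ = _ + (A z (Y z) (A z (Z z) (s z)) - A z (Z z) (A z (Y z) (s z)))
  abel

theorem mlieBracket_eq_lieBracket {E : Type*} [NormedAddCommGroup E] [NormedSpace ℝ E]
    (V W : Π x : E, TangentSpace 𝓘(ℝ, E) x) :
    VectorField.mlieBracket 𝓘(ℝ, E) V W = VectorField.lieBracket ℝ V W := by
  rw [← VectorField.mlieBracketWithin_univ, VectorField.mlieBracketWithin_eq_lieBracketWithin]
  exact VectorField.lieBracketWithin_univ

section ConnectionForm

variable {E : Type*} [NormedAddCommGroup E] [NormedSpace ℝ E]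
  {H : Type*} [TopologicalSpace H] {I : ModelWithCorners ℝ E H} [I.Boundaryless]
  {X : Type*} [TopologicalSpace X] [ChartedSpace H X] [IsManifold I ∞ X] [IsManifold I 1 X]
  {F : Type*} [NormedAddCommGroup F] [NormedSpace ℝ F]
  {W : X → Type*} [TopologicalSpace (TotalSpace F W)]
  [∀ x, AddCommGroup (W x)] [∀ x, Module ℝ (W x)] [∀ x, TopologicalSpace (W x)]
  [∀ x, IsTopologicalAddGroup (W x)] [∀ x, ContinuousSMul ℝ (W x)] [FiberBundle F W]
  [VectorBundle ℝ F W] [ContMDiffVectorBundle ∞ F W I]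
  {e : Trivialization F (TotalSpace.proj : TotalSpace F W → X)} [MemTrivializationAtlas e]

/-- The connection with vanishing connection form in the trivialization `e`. -/
def flatConn (I : ModelWithCorners ℝ E H)
    (e : Trivialization F (TotalSpace.proj : TotalSpace F W → X)) [MemTrivializationAtlas e]
    (s : Π x : X, W x) (x : X) : TangentSpace I x →L[ℝ] W x :=
  (e.symmL ℝ x).comp (mvfderiv I (fun y => e.continuousLinearMapAt ℝ y (s y)) x)

theorem isCovariantDerivativeOn_flatConn :
    IsCovariantDerivativeOn F (flatConn (F := F) (W := W) I e) e.baseSet where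
  add {σ σ' x} hσ hσ' hx := by
    have h1 := (mdifferentiableAt_section_iff_clma (e := e) hx).1 hσ
    have h2 := (mdifferentiableAt_section_iff_clma (e := e) hx).1 hσ'
    ext v
    simp only [flatConn, Pi.add_apply, map_add, ContinuousLinearMap.comp_apply, add_apply]
    rw [mvfderiv_fun_add h1 h2, add_apply, map_add]
  leibniz {σ g x} hσ hg hx := by
    have h1 := (mdifferentiableAt_section_iff_clma (e := e) hx).1 hσ
    ext v
    simp only [flatConn, Pi.smul_apply', map_smul, ContinuousLinearMap.comp_apply, add_apply,
      smul_apply, ContinuousLinearMap.smulRight_apply]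
    rw [mvfderiv_fun_smul hg h1]
    have h2 := e.symmL_continuousLinearMapAt (R := ℝ) hx (σ x)
    simp only [add_apply, smul_apply, ContinuousLinearMap.smulRight_apply, map_add, map_smul]
    rw [h2]

/-- `A` is the connection form of `D` on `V`, in the chart at `w` and the trivialization `e`. -/
def HasConnForm (V : Set X) (D : (Π x : X, W x) → (Π x : X, TangentSpace I x →L[ℝ] W x))
    (e : Trivialization F (TotalSpace.proj : TotalSpace F W → X)) [MemTrivializationAtlas e]
    (w : X) (A : E → E →L[ℝ] F →L[ℝ] F) : Prop :=
  ∀ x ∈ V, x ∈ e.baseSet → x ∈ (extChartAt I w).source →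
    ContDiffAt ℝ ∞ A (extChartAt I w x) ∧ ∀ s : Π x : X, W x,
      MDifferentiableAt I (I.prod 𝓘(ℝ, F)) (fun y => TotalSpace.mk' F y (s y)) x →
      ∀ v : E, e.continuousLinearMapAt ℝ x (D s x v)
        = fderiv ℝ (secRep I e w s) (extChartAt I w x) (dchart I w x v)
          + A (extChartAt I w x) (dchart I w x v) (e.continuousLinearMapAt ℝ x (s x))

theorem IsSmoothConnectionOn.smooth_apply {V : Set X}
    {D : (Π x : X, W x) → (Π x : X, TangentSpace I x →L[ℝ] W x)}
    (hD : IsSmoothConnectionOn F V D) {U : Set X} (hUV : U ⊆ V) (hU : IsOpen U)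
    {s : Π x : X, W x} (hs : SmoothSectionOn (I := I) F U s) {Y : Π x : X, TangentSpace I x}
    (hY : SmoothFieldOn U Y) : SmoothSectionOn (I := I) F U (fun x => D s x (Y x)) := by
  have h := (hD.smooth U hUV hU).contMDiff hs
  intro x hx
  exact (h x hx).clm_bundle_apply (hY x hx)

theorem exists_hasConnForm [FiniteDimensional ℝ E] [FiniteDimensional ℝ F] {V : Set X}
    (hV : IsOpen V) {D : (Π x : X, W x) → (Π x : X, TangentSpace I x →L[ℝ] W x)}
    (hD : IsSmoothConnectionOn F V D)
    (e : Trivialization F (TotalSpace.proj : TotalSpace F W → X)) [MemTrivializationAtlas e]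
    (w : X) : ∃ A : E → E →L[ℝ] F →L[ℝ] F, HasConnForm V D e w A := by
  have : ContMDiffVectorBundle 1 F W I := .of_le (n := ∞) (by simp)
  set O : Set X := V ∩ e.baseSet with hO
  have c1 : IsCovariantDerivativeOn F D O := hD.isCov.mono Set.inter_subset_left
  have c2 : IsCovariantDerivativeOn F (flatConn (F := F) (W := W) I e) O :=
    isCovariantDerivativeOn_flatConn.mono Set.inter_subset_right
  let T : Π x : X, W x →L[ℝ] TangentSpace I x →L[ℝ] W x := fun x =>
    IsCovariantDerivativeOn.difference c1 c2 x
  have hT : ∀ x ∈ O, ∀ s : Π x : X, W x,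
      MDifferentiableAt I (I.prod 𝓘(ℝ, F)) (fun y => TotalSpace.mk' F y (s y)) x →
      T x (s x) = D s x - flatConn I e s x := fun x hx s hs =>
    IsCovariantDerivativeOn.difference_apply c1 c2 hx hs
  let a (z : E) : E →ₗ[ℝ] F →ₗ[ℝ] F := LinearMap.mk₂ ℝ (fun (v : E) (f : F) =>
      e.continuousLinearMapAt ℝ ((extChartAt I w).symm z)
        (T ((extChartAt I w).symm z) (e.symmL ℝ ((extChartAt I w).symm z) f)
          (dchartSymm I w z v)))
      (fun v v' f => by rw [map_add]; exact (congrArg _ (map_add _ _ _)).trans (map_add _ _ _))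
      (fun c v f => by rw [map_smul]; exact (congrArg _ (map_smul _ _ _)).trans (map_smul _ _ _))
      (fun v f f' => by rw [map_add, map_add]; exact map_add _ _ _)
      (fun c v f => by rw [map_smul, map_smul]; exact map_smul _ _ _)
  let A (z : E) : E →L[ℝ] F →L[ℝ] F := LinearMap.toContinuousLinearMap
    ((LinearMap.toContinuousLinearMap : (F →ₗ[ℝ] F) ≃ₗ[ℝ] (F →L[ℝ] F)).toLinearMap ∘ₗ a z)
  have hA : ∀ z v f, A z v f = e.continuousLinearMapAt ℝ ((extChartAt I w).symm z)
        (T ((extChartAt I w).symm z) (e.symmL ℝ ((extChartAt I w).symm z) f)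
          (dchartSymm I w z v)) := fun z v f => rfl
  refine ⟨A, fun x hxV hxe hxw => ⟨?_, fun s hs v => ?_⟩⟩
  · refine contDiffAt_clm_of_apply fun v => contDiffAt_clm_of_apply fun f => ?_
    set U : Set X := O ∩ (extChartAt I w).source with hU
    have hUo : IsOpen U := (hV.inter e.open_baseSet).inter (isOpen_extChartAt_source w)
    have h1 := hD.smooth_apply (U := U) (fun y hy => hy.1.1) hUo
      (s := constSec e f) ((contMDiffOn_constSec f).mono fun y hy => hy.1.2)
      (Y := constField I w v) ((contMDiffOn_constField w v).mono fun y hy => hy.2)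
    have h2 := (contMDiffAt_section_iff_secRep hxe hxw).1
      ((h1 x ⟨⟨hxV, hxe⟩, hxw⟩).contMDiffAt (hUo.mem_nhds ⟨⟨hxV, hxe⟩, hxw⟩))
    refine h2.congr_of_eventuallyEq ?_
    filter_upwards [eventually_chart (I := I) hUo ((extChartAt I w).map_source hxw)
      (by rw [(extChartAt I w).left_inv hxw]; exact ⟨⟨hxV, hxe⟩, hxw⟩)] with z hz
    have h3 := hT _ hz.2.1 (constSec e f) (((contMDiffOn_constSec f) _ hz.2.1.2).contMDiffAt
      (e.open_baseSet.mem_nhds hz.2.1.2) |>.mdifferentiableAt (by simp))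
    have h4 : flatConn I e (constSec e f) ((extChartAt I w).symm z) = 0 := by
      have : (fun y => e.continuousLinearMapAt ℝ y (constSec e f y))
          =ᶠ[𝓝 ((extChartAt I w).symm z)] fun _ => f := by
        filter_upwards [e.open_baseSet.mem_nhds hz.2.1.2] with y hy
        exact clma_constSec hy f
      have h5 : mvfderiv I (fun y => e.continuousLinearMapAt ℝ y (constSec e f y))
          ((extChartAt I w).symm z) = 0 := by
        rw [mvfderiv, this.mfderiv_eq, mfderiv_const]
        exact ContinuousLinearMap.comp_zero _
      rw [flatConn, h5]
      exact ContinuousLinearMap.comp_zero _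
    rw [h4, sub_zero] at h3
    rw [hA, secRep]
    exact congrArg _ (by
      rw [constField, (extChartAt I w).right_inv hz.1]
      exact DFunLike.congr_fun h3 _)
  · have h1 := hT x ⟨hxV, hxe⟩ s hs
    have h2 : D s x v = T x (s x) v + flatConn I e s x v :=
      DFunLike.congr_fun (sub_eq_iff_eq_add.1 h1.symm) v
    have h3 := dchartSymm_comp_dchart (I := I) hxw
    have h4 : e.continuousLinearMapAt ℝ x (flatConn I e s x v)
        = fderiv ℝ (secRep I e w s) (extChartAt I w x) (dchart I w x v) :=
      (e.continuousLinearMapAt_symmL hxe _).trans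
        (mvfderiv_eq_fderiv_chart hxw ((mdifferentiableAt_section_iff_clma hxe).1 hs) v)
    have h5 : e.continuousLinearMapAt ℝ x (T x (s x) v)
        = A (extChartAt I w x) (dchart I w x v) (e.continuousLinearMapAt ℝ x (s x)) := by
      rw [hA, (extChartAt I w).left_inv hxw, e.symmL_continuousLinearMapAt hxe]
      exact congrArg _ (congrArg _ (DFunLike.congr_fun h3 v).symm)
    exact ((congrArg _ h2).trans (map_add _ _ _)).trans
      ((add_comm _ _).trans (congrArg₂ (· + ·) h4 h5))

theorem vecRep_mlieBracket [CompleteSpace E] {Y Z : Π x : X, TangentSpace I x} {w x : X}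
    (hx : x ∈ (extChartAt I w).source)
    (hY : ContMDiffAt I I.tangent ∞ (fun y => (⟨y, Y y⟩ : TangentBundle I X)) x)
    (hZ : ContMDiffAt I I.tangent ∞ (fun y => (⟨y, Z y⟩ : TangentBundle I X)) x) :
    dchart I w x (VectorField.mlieBracket I Y Z x)
      = VectorField.lieBracket ℝ (vecRep w Y) (vecRep w Z) (extChartAt I w x) := by
  have hz := (extChartAt I w).map_source hx
  have hinv : ∀ z ∈ (extChartAt I w).target,
      (dchartSymm I w z).inverse = dchart I w ((extChartAt I w).symm z) := fun z hz =>
    ContinuousLinearMap.inverse_eq (by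
      have := dchartSymm_comp_dchart (I := I) ((extChartAt I w).map_target hz)
      rwa [(extChartAt I w).right_inv hz] at this) (dchart_comp_dchartSymm hz)
  have hpull : ∀ Y : Π x : X, TangentSpace I x, ∀ z ∈ (extChartAt I w).target,
      VectorField.mpullback 𝓘(ℝ, E) I (extChartAt I w).symm Y z = vecRep w Y z := fun Y z hz =>
    DFunLike.congr_fun (hinv z hz) _
  have : IsManifold I (minSmoothness ℝ 2) X := .of_le (n := ∞) (by simpa using two_le_infty)
  have h := VectorField.mpullback_mlieBracket (I := 𝓘(ℝ, E)) (I' := I) (n := ∞)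
    (f := (extChartAt I w).symm) (V := Y) (W := Z) (x₀ := extChartAt I w x)
    (by rw [(extChartAt I w).left_inv hx]; exact hY.mdifferentiableAt (by simp))
    (by rw [(extChartAt I w).left_inv hx]; exact hZ.mdifferentiableAt (by simp))
    (contMDiffAt_chart_symm hz) (by simpa using two_le_infty)
  have h2 := hpull (VectorField.mlieBracket I Y Z) _ hz
  rw [vecRep, (extChartAt I w).left_inv hx] at h2
  rw [← h2, h]
  have hev : ∀ Y : Π x : X, TangentSpace I x,
      VectorField.mpullback 𝓘(ℝ, E) I (extChartAt I w).symm Y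
        =ᶠ[𝓝 (extChartAt I w x)] vecRep w Y := fun Y => by
    filter_upwards [extChartAt_target_mem_nhds' hz] with z hz
    exact hpull Y z hz
  rw [(hev Y).mlieBracket_vectorField_eq (hev Z)]
  exact congrFun (mlieBracket_eq_lieBracket _ _) _

theorem HasConnForm.secRep_apply {V : Set X}
    {D : (Π x : X, W x) → (Π x : X, TangentSpace I x →L[ℝ] W x)} {w : X}
    {A : E → E →L[ℝ] F →L[ℝ] F} (hA : HasConnForm V D e w A) {s : Π x : X, W x}
    {U : Set X} (hUV : U ⊆ V) (hU : IsOpen U) (hs : SmoothSectionOn (I := I) F U s)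
    (Y : Π x : X, TangentSpace I x) {x : X} (hx : x ∈ U) (he : x ∈ e.baseSet)
    (hw : x ∈ (extChartAt I w).source) :
    secRep I e w (fun y => D s y (Y y)) =ᶠ[𝓝 (extChartAt I w x)] fun z =>
      fderiv ℝ (secRep I e w s) z (vecRep w Y z) + A z (vecRep w Y z) (secRep I e w s z) := by
  filter_upwards [eventually_chart (I := I) (hU.inter e.open_baseSet)
    ((extChartAt I w).map_source hw) (by rw [(extChartAt I w).left_inv hw]; exact ⟨hx, he⟩)]
    with z hz
  have := (hA _ (hUV hz.2.1) hz.2.2 ((extChartAt I w).map_target hz.1)).2 s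
    (((hs _ hz.2.1).contMDiffAt (hU.mem_nhds hz.2.1)).mdifferentiableAt (by simp))
    (Y ((extChartAt I w).symm z))
  rw [(extChartAt I w).right_inv hz.1] at this
  exact this

theorem HasConnForm.curvature [CompleteSpace E] {V : Set X}
    {D : (Π x : X, W x) → (Π x : X, TangentSpace I x →L[ℝ] W x)}
    (hD : IsSmoothConnectionOn F V D) {w : X}
    {A : E → E →L[ℝ] F →L[ℝ] F} (hA : HasConnForm V D e w A) {s : Π x : X, W x}
    {U : Set X} (hUV : U ⊆ V) (hU : IsOpen U) (hs : SmoothSectionOn (I := I) F U s)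
    {Y Z : Π x : X, TangentSpace I x} (hY : SmoothFieldOn U Y) (hZ : SmoothFieldOn U Z)
    {x : X} (hx : x ∈ U) (he : x ∈ e.baseSet) (hw : x ∈ (extChartAt I w).source) :
    e.continuousLinearMapAt ℝ x (D (fun y => D s y (Z y)) x (Y x)
      - D (fun y => D s y (Y y)) x (Z x) - D s x (VectorField.mlieBracket I Y Z x))
      = curvForm A (extChartAt I w x) (dchart I w x (Y x)) (dchart I w x (Z x))
        (e.continuousLinearMapAt ℝ x (s x)) := by
  have hxU := hU.mem_nhds hx
  have hs' := (contMDiffAt_section_iff_secRep he hw).1 ((hs x hx).contMDiffAt hxU)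
  have hY' := (contMDiffAt_field_iff_vecRep hw).1 ((hY x hx).contMDiffAt hxU)
  have hZ' := (contMDiffAt_field_iff_vecRep hw).1 ((hZ x hx).contMDiffAt hxU)
  obtain ⟨hAs, hAD⟩ := hA x (hUV hx) he hw
  have hb := vecRep_mlieBracket hw ((hY x hx).contMDiffAt hxU) ((hZ x hx).contMDiffAt hxU)
  have hval : ∀ s : Π x : X, W x,
      secRep I e w s (extChartAt I w x) = e.continuousLinearMapAt ℝ x (s x) := fun s => by
    rw [secRep, (extChartAt I w).left_inv hw]
  have hvalY : ∀ Y : Π x : X, TangentSpace I x,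
      vecRep w Y (extChartAt I w x) = dchart I w x (Y x) := fun s => by
    rw [vecRep, (extChartAt I w).left_inv hw]
  have hDs : ∀ Y Z : Π x : X, TangentSpace I x, SmoothFieldOn U Z →
      e.continuousLinearMapAt ℝ x (D (fun y => D s y (Z y)) x (Y x))
      = fderiv ℝ (fun z => fderiv ℝ (secRep I e w s) z (vecRep w Z z)
            + A z (vecRep w Z z) (secRep I e w s z)) (extChartAt I w x)
            (vecRep w Y (extChartAt I w x))
        + A (extChartAt I w x) (vecRep w Y (extChartAt I w x))
          (fderiv ℝ (secRep I e w s) (extChartAt I w x) (vecRep w Z (extChartAt I w x))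
            + A (extChartAt I w x) (vecRep w Z (extChartAt I w x))
              (secRep I e w s (extChartAt I w x))) := by
    intro Y Z hZ
    have h1 := hAD (fun y => D s y (Z y)) (((hD.smooth_apply hUV hU hs hZ) x hx).contMDiffAt hxU
      |>.mdifferentiableAt (by simp)) (Y x)
    have h2 := hA.secRep_apply hUV hU hs Z hx he hw
    rw [← hval (fun y => D s y (Z y)), h2.self_of_nhds, h2.fderiv_eq] at h1
    rw [hvalY Y]
    exact h1
  have h0 := hAD s (((hs x hx).contMDiffAt hxU).mdifferentiableAt (by simp))
    (VectorField.mlieBracket I Y Z x)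
  rw [hb] at h0
  have key := curvForm_eq_commutator hAs hs' hY' hZ'
  rw [map_sub, map_sub, hDs Y Z hZ, hDs Z Y hY, h0, ← hvalY, ← hvalY, ← hval s]
  exact key

theorem constField_apply {w x : X} (hw : x ∈ (extChartAt I w).source) (Y : TangentSpace I x) :
    constField I w (dchart I w x Y) x = Y := by
  have := dchartSymm_comp_dchart (I := I) hw
  exact DFunLike.congr_fun this Y

theorem constSec_apply {x : X} (he : x ∈ e.baseSet) (u : W x) :
    constSec e (e.continuousLinearMapAt ℝ x u) x = u :=
  e.symmL_continuousLinearMapAt he u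

theorem IsCurvatureOn.clma_apply [CompleteSpace E] {V : Set X} (hV : IsOpen V)
    {D : (Π x : X, W x) → (Π x : X, TangentSpace I x →L[ℝ] W x)}
    (hD : IsSmoothConnectionOn F V D)
    {R : Π x : X, TangentSpace I x → TangentSpace I x → W x → W x} (hR : IsCurvatureOn F V D R)
    {w : X} {A : E → E →L[ℝ] F →L[ℝ] F} (hA : HasConnForm V D e w A) {x : X} (hx : x ∈ V)
    (he : x ∈ e.baseSet) (hw : x ∈ (extChartAt I w).source) (Y Z : TangentSpace I x) (u : W x) :
    e.continuousLinearMapAt ℝ x (R x Y Z u)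
      = curvForm A (extChartAt I w x) (dchart I w x Y) (dchart I w x Z)
        (e.continuousLinearMapAt ℝ x u) := by
  set U : Set X := (V ∩ e.baseSet) ∩ (extChartAt I w).source with hU
  have hUo : IsOpen U := (hV.inter e.open_baseSet).inter (isOpen_extChartAt_source w)
  have hUV : U ⊆ V := fun y hy => hy.1.1
  have hxU : x ∈ U := ⟨⟨hx, he⟩, hw⟩
  have hY : SmoothFieldOn U (constField I w (dchart I w x Y)) :=
    ContMDiffOn.mono (contMDiffOn_constField w _) fun y hy => hy.2
  have hZ : SmoothFieldOn U (constField I w (dchart I w x Z)) :=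
    ContMDiffOn.mono (contMDiffOn_constField w _) fun y hy => hy.2
  have hs : SmoothSectionOn (I := I) F U (constSec e (e.continuousLinearMapAt ℝ x u)) :=
    ContMDiffOn.mono (contMDiffOn_constSec _) fun y hy => hy.1.2
  have h1 := hR U hUV hUo _ _ _ hY hZ hs x hxU
  have h2 := hA.curvature hD hUV hUo hs hY hZ hxU he hw
  rw [← h1, constField_apply hw, constField_apply hw, constSec_apply he] at h2
  exact h2

theorem exists_isCurvatureOn [FiniteDimensional ℝ E] [FiniteDimensional ℝ F] {V : Set X}
    (hV : IsOpen V) {D : (Π x : X, W x) → (Π x : X, TangentSpace I x →L[ℝ] W x)}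
    (hD : IsSmoothConnectionOn F V D) :
    ∃ R : Π x : X, TangentSpace I x → TangentSpace I x → (W x →ₗ[ℝ] W x),
      IsCurvatureOn F V D (fun x Y Z => R x Y Z) := by
  have : CompleteSpace E := FiniteDimensional.complete ℝ E
  choose A hA using fun x : X => exists_hasConnForm hV hD (trivializationAt F W x) x
  let R : Π x : X, TangentSpace I x → TangentSpace I x → (W x →ₗ[ℝ] W x) := fun x Y Z =>
    ((trivializationAt F W x).symmL ℝ x).toLinearMap ∘ₗ
      (curvForm (A x) (extChartAt I x x) (dchart I x x Y) (dchart I x x Z)).toLinearMap ∘ₗ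
      ((trivializationAt F W x).continuousLinearMapAt ℝ x).toLinearMap
  refine ⟨R, fun U hUV hU Y Z s hY hZ hs x hx => ?_⟩
  have he := mem_baseSet_trivializationAt F W x
  have h := (hA x).curvature hD hUV hU hs hY hZ hx he (mem_extChartAt_source x)
  refine (congrArg ((trivializationAt F W x).symmL ℝ x) h.symm).trans ?_
  exact (trivializationAt F W x).symmL_continuousLinearMapAt he _

end ConnectionForm

section Trace

theorem chernForm_eq_chernIntegrand {E 𝔸 T W : Type*} [NormedAddCommGroup E] [NormedSpace ℝ E]
    [NormedRing 𝔸] [NormedAlgebra ℝ 𝔸] [AddCommGroup W] [Module ℂ W] (τ : 𝔸 →L[ℝ] ℂ)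
    (Φ : 𝔸 →* Module.End ℂ W) (hτ : ∀ a, τ a = LinearMap.trace ℂ W (Φ a)) (i : T → E)
    (Ω : E →L[ℝ] E →L[ℝ] 𝔸) (R : T → T → W →ₗ[ℂ] W) (h : ∀ Y Z, Φ (Ω (i Y) (i Z)) = R Y Z)
    (k : ℕ) (Y : Fin (2 * k) → T) : chernForm τ Ω k (fun j => i (Y j)) = chernIntegrand R k Y := by
  rw [chernForm_apply, chernConst, chernIntegrand, mul_assoc]
  congr 2
  refine Finset.sum_congr rfl fun σ _ => ?_
  have h1 := map_list_prod Φ (List.ofFn (pairs Ω ((fun j => i (Y j)) ∘ σ)))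
  rw [hτ, h1, List.map_ofFn]
  congr 4
  ext1 j
  exact h _ _

theorem trace_baseChange_complex {W : Type*} [AddCommGroup W] [Module ℝ W] [FiniteDimensional ℝ W]
    (A : Module.End ℝ W) :
    LinearMap.trace ℂ (TensorProduct ℝ ℂ W) (A.baseChange ℂ) = ((LinearMap.trace ℝ W A : ℝ) : ℂ) :=
  LinearMap.trace_baseChange A ℂ

/-- The trace of endomorphisms of a real vector space, with complex values. -/
def realTrace (F : Type*) [NormedAddCommGroup F] [NormedSpace ℝ F] [FiniteDimensional ℝ F] :
    (F →L[ℝ] F) →L[ℝ] ℂ :=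
  LinearMap.toContinuousLinearMap (Complex.ofRealCLM.toLinearMap ∘ₗ LinearMap.trace ℝ F ∘ₗ
    ContinuousLinearMap.coeLM ℝ)

theorem realTrace_apply {F : Type*} [NormedAddCommGroup F] [NormedSpace ℝ F]
    [FiniteDimensional ℝ F] (A : F →L[ℝ] F) :
    realTrace F A = ((LinearMap.trace ℝ F A.toLinearMap : ℝ) : ℂ) := rfl

theorem realTrace_mul_comm {F : Type*} [NormedAddCommGroup F] [NormedSpace ℝ F]
    [FiniteDimensional ℝ F] (A B : F →L[ℝ] F) : realTrace F (A * B) = realTrace F (B * A) := by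
  rw [realTrace_apply, realTrace_apply]
  exact congrArg _ (LinearMap.trace_mul_comm ℝ A.toLinearMap B.toLinearMap)

/-- Complexification of endomorphisms, after transport to an isomorphic space. -/
def conjBaseChange {F W : Type*} [NormedAddCommGroup F] [NormedSpace ℝ F] [AddCommGroup W]
    [Module ℝ W] (θ : F ≃ₗ[ℝ] W) : (F →L[ℝ] F) →* Module.End ℂ (TensorProduct ℝ ℂ W) :=
  ((Module.End.baseChangeHom ℝ ℂ W).toMonoidHom.comp
    (LinearEquiv.conjRingEquiv θ).toRingHom.toMonoidHom).comp
      ContinuousLinearMap.toLinearMapRingHom.toMonoidHom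

theorem realTrace_eq_trace {F W : Type*} [NormedAddCommGroup F] [NormedSpace ℝ F]
    [FiniteDimensional ℝ F] [AddCommGroup W] [Module ℝ W] (θ : F ≃ₗ[ℝ] W) (A : F →L[ℝ] F) :
    realTrace F A = LinearMap.trace ℂ (TensorProduct ℝ ℂ W) (conjBaseChange θ A) := by
  have : FiniteDimensional ℝ W := LinearEquiv.finiteDimensional θ
  refine Eq.trans ?_ (trace_baseChange_complex (θ.conj A.toLinearMap)).symm
  rw [realTrace_apply, LinearMap.trace_conj']

end Trace

section BundlePair

variable {E : Type*} [NormedAddCommGroup E] [NormedSpace ℝ E]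
  {H : Type*} [TopologicalSpace H] {I : ModelWithCorners ℝ E H} [I.Boundaryless]
  {X : Type*} [TopologicalSpace X] [ChartedSpace H X] [IsManifold I ∞ X] [IsManifold I 1 X]
  {F : Type*} [NormedAddCommGroup F] [NormedSpace ℝ F]
  {W : X → Type*} [TopologicalSpace (TotalSpace F W)]
  [∀ x, AddCommGroup (W x)] [∀ x, Module ℝ (W x)] [∀ x, TopologicalSpace (W x)]
  [∀ x, IsTopologicalAddGroup (W x)] [∀ x, ContinuousSMul ℝ (W x)] [FiberBundle F W]
  [VectorBundle ℝ F W] [ContMDiffVectorBundle ∞ F W I]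

/-- The linear isomorphism inverse to a trivialization. -/
def frameEquiv (e : Trivialization F (TotalSpace.proj : TotalSpace F W → X))
    [MemTrivializationAtlas e] {x : X} (hx : x ∈ e.baseSet) : F ≃ₗ[ℝ] W x where
  __ := (e.symmL ℝ x).toLinearMap
  invFun := e.continuousLinearMapAt ℝ x
  left_inv := e.continuousLinearMapAt_symmL hx
  right_inv := e.symmL_continuousLinearMapAt hx

/-- The difference of two connections and their curvatures at `u`, in the frame `θ`. -/
structure InFrame (D₀ D₁ : (Π x : X, W x) → (Π x : X, TangentSpace I x →L[ℝ] W x))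
    (R₀ R₁ : Π x : X, TangentSpace I x → TangentSpace I x → (W x →ₗ[ℝ] W x)) (u : X)
    (θ : F ≃ₗ[ℝ] W u) (α : E →L[ℝ] F →L[ℝ] F) (Ω₀ Ω₁ : E →L[ℝ] E →L[ℝ] F →L[ℝ] F) : Prop where
  diff : ∀ s : Π x : X, W x,
    MDifferentiableAt I (I.prod 𝓘(ℝ, F)) (fun y => TotalSpace.mk' F y (s y)) u →
    ∀ a : TangentSpace I u, θ (α a (θ.symm (s u))) = D₁ s u a - D₀ s u a
  curv₀ : ∀ (a b : TangentSpace I u) (f : F), θ (Ω₀ a b f) = R₀ u a b (θ f)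
  curv₁ : ∀ (a b : TangentSpace I u) (f : F), θ (Ω₁ a b f) = R₁ u a b (θ f)

theorem exists_section (u : X) (w : W u) : ∃ s : Π x : X, W x,
    MDifferentiableAt I (I.prod 𝓘(ℝ, F)) (fun y => TotalSpace.mk' F y (s y)) u ∧ s u = w := by
  have he := mem_baseSet_trivializationAt F W u
  refine ⟨constSec (trivializationAt F W u) ((trivializationAt F W u).continuousLinearMapAt ℝ u w),
    ?_, constSec_apply he w⟩
  exact ((contMDiffOn_constSec (I := I) _ u he).contMDiffAt
    ((trivializationAt F W u).open_baseSet.mem_nhds he)).mdifferentiableAt (by simp)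

/-- The unit of `F →L[ℝ] F` given by a linear automorphism. -/
def unitOfEquiv [FiniteDimensional ℝ F] (θ : F ≃ₗ[ℝ] F) : (F →L[ℝ] F)ˣ :=
  ContinuousLinearEquiv.toUnit θ.toContinuousLinearEquiv

theorem isConnectionPair_inFrame [FiniteDimensional ℝ E] [FiniteDimensional ℝ F] {V : Set X}
    (hV : IsOpen V) {D₀ D₁ : (Π x : X, W x) → (Π x : X, TangentSpace I x →L[ℝ] W x)}
    (h₀ : IsSmoothConnectionOn F V D₀) (h₁ : IsSmoothConnectionOn F V D₁)
    {R₀ R₁ : Π x : X, TangentSpace I x → TangentSpace I x → (W x →ₗ[ℝ] W x)}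
    (c₀ : IsCurvatureOn F V D₀ fun x Y Z => R₀ x Y Z)
    (c₁ : IsCurvatureOn F V D₁ fun x Y Z => R₁ x Y Z) :
    IsConnectionPair (I := I) V (fun u α Ω₀ Ω₁ => ∃ θ, InFrame (F := F) D₀ D₁ R₀ R₁ u θ α Ω₀ Ω₁) where
  conj := by
    rintro u hu α Ω₀ Ω₁ α' Ω₀' Ω₁' ⟨θ, h⟩ ⟨θ', h'⟩
    refine ⟨unitOfEquiv (θ.trans θ'.symm), fun a => ?_, fun a b => ?_, fun a b => ?_⟩
    · ext f
      obtain ⟨s, hs, hsu⟩ := exists_section (F := F) (I := I) u (θ f)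
      have e1 := h.diff s hs a
      have e2 := h'.diff s hs a
      rw [hsu, ← e1, hsu, θ.symm_apply_apply] at e2
      exact θ'.injective (e2.trans (θ'.apply_symm_apply _).symm)
    · ext f
      have e1 := h.curv₀ a b f
      have e2 := h'.curv₀ a b (θ'.symm (θ f))
      rw [θ'.apply_symm_apply, ← e1] at e2
      exact θ'.injective (e2.trans (θ'.apply_symm_apply _).symm)
    · ext f
      have e1 := h.curv₁ a b f
      have e2 := h'.curv₁ a b (θ'.symm (θ f))
      rw [θ'.apply_symm_apply, ← e1] at e2
      exact θ'.injective (e2.trans (θ'.apply_symm_apply _).symm)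
  loc := by
    intro w u hu huw
    have : CompleteSpace E := FiniteDimensional.complete ℝ E
    set e := trivializationAt F W u with he
    have hue : u ∈ e.baseSet := mem_baseSet_trivializationAt F W u
    obtain ⟨A₀, hA₀⟩ := exists_hasConnForm hV h₀ e w
    obtain ⟨A₁, hA₁⟩ := exists_hasConnForm hV h₁ e w
    refine ⟨A₀, A₁, (hA₀ u hu hue huw).1, (hA₁ u hu hue huw).1, ?_⟩
    filter_upwards [eventually_chart (I := I) (hV.inter e.open_baseSet)
      ((extChartAt I w).map_source huw)
      (by rw [(extChartAt I w).left_inv huw]; exact ⟨hu, hue⟩)] with z hz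
    obtain ⟨hzt, hzV, hze⟩ := hz
    have hzw := (extChartAt I w).map_target hzt
    set x := (extChartAt I w).symm z with hx
    have hxz : extChartAt I w x = z := (extChartAt I w).right_inv hzt
    refine ⟨frameEquiv e hze, ⟨fun s hs a => ?_,
      fun a b f => ?_, fun a b f => ?_⟩⟩
    · have k0 := (hA₀ x hzV hze hzw).2 s hs a
      have k1 := (hA₁ x hzV hze hzw).2 s hs a
      rw [hxz] at k0 k1
      have k2 : e.continuousLinearMapAt ℝ x (D₁ s x a - D₀ s x a)
          = (A₁ z - A₀ z) (dchart I w x a) (e.continuousLinearMapAt ℝ x (s x)) := by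
        rw [map_sub, k0, k1, sub_apply, sub_apply]
        abel
      refine (congrArg (e.symmL ℝ x) k2.symm).trans ?_
      exact e.symmL_continuousLinearMapAt hze _
    · have k := c₀.clma_apply hV h₀ hA₀ hzV hze hzw a b (e.symmL ℝ x f)
      rw [hxz, e.continuousLinearMapAt_symmL hze] at k
      refine (congrArg (e.symmL ℝ x) k.symm).trans ?_
      exact e.symmL_continuousLinearMapAt hze _
    · have k := c₁.clma_apply hV h₁ hA₁ hzV hze hzw a b (e.symmL ℝ x f)
      rw [hxz, e.continuousLinearMapAt_symmL hze] at k
      refine (congrArg (e.symmL ℝ x) k.symm).trans ?_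
      exact e.symmL_continuousLinearMapAt hze _

theorem exists_chernForms [FiniteDimensional ℝ E] [FiniteDimensional ℝ F] {V : Set X}
    (hV : IsOpen V) {D₀ D₁ : (Π x : X, W x) → (Π x : X, TangentSpace I x →L[ℝ] W x)}
    (h₀ : IsSmoothConnectionOn F V D₀) (h₁ : IsSmoothConnectionOn F V D₁)
    {R₀ R₁ : Π x : X, TangentSpace I x → TangentSpace I x → (W x →ₗ[ℝ] W x)}
    (c₀ : IsCurvatureOn F V D₀ fun x Y Z => R₀ x Y Z)
    (c₁ : IsCurvatureOn F V D₁ fun x Y Z => R₁ x Y Z) :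
    ∃ C₀ C₁ : TotalForm I X, SmoothFormOn V C₀ ∧ SmoothFormOn V C₁ ∧
      IsClosedFormOn V C₀ ∧ IsClosedFormOn V C₁ ∧ CohomologousOn V C₁ C₀ ∧
      (∀ u ∈ V, ∀ (k : ℕ) (Y : Fin (2 * k) → TangentSpace I u),
        C₀ u (2 * k) Y = chernIntegrand (fun Y Z => (R₀ u Y Z).baseChange ℂ) k Y ∧
        C₁ u (2 * k) Y = chernIntegrand (fun Y Z => (R₁ u Y Z).baseChange ℂ) k Y) ∧
      ∀ u ∈ V, ∀ k, C₀ u (2 * k + 1) = 0 ∧ C₁ u (2 * k + 1) = 0 := by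
  have hP := isConnectionPair_inFrame hV h₀ h₁ c₀ c₁
  obtain ⟨C₀, C₁, s0, s1, d0, d1, hc, hev, hodd⟩ :=
    hP.exists_forms hV (realTrace F) realTrace_mul_comm
  refine ⟨C₀, C₁, s0, s1, d0, d1, hc, fun u hu k Y => ?_, hodd⟩
  obtain ⟨A₀, A₁, -, -, h⟩ := hP.loc u u hu (mem_extChartAt_source u)
  have h' := h.self_of_nhds
  rw [extChartAt_to_inv] at h'
  obtain ⟨e0, e1⟩ := hev u hu _ _ _ h' k
  obtain ⟨θ, hθ⟩ := h'
  have conj : ∀ (B : F →L[ℝ] F) (R : W u →ₗ[ℝ] W u), (∀ f, θ (B f) = R (θ f)) →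
      conjBaseChange θ B = R.baseChange ℂ := by
    intro B R hBR
    have : θ.conj B.toLinearMap = R := by
      ext w
      have := hBR (θ.symm w)
      rw [θ.apply_symm_apply] at this
      exact this
    exact congrArg (fun R : W u →ₗ[ℝ] W u => R.baseChange ℂ) this
  constructor
  · refine (DFunLike.congr_fun e0 Y).trans ?_
    exact chernForm_eq_chernIntegrand (E := E) (T := TangentSpace I u) _ (conjBaseChange θ)
      (realTrace_eq_trace θ) (fun a => a) _ _ (fun Y Z => conj _ _ (hθ.curv₀ Y Z)) k Y
  · refine (DFunLike.congr_fun e1 Y).trans ?_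
    exact chernForm_eq_chernIntegrand (E := E) (T := TangentSpace I u) _ (conjBaseChange θ)
      (realTrace_eq_trace θ) (fun a => a) _ _ (fun Y Z => conj _ _ (hθ.curv₁ Y Z)) k Y

end BundlePair

local instance continuousSMulEu (n : ℕ) : ContinuousSMul ℝ (Eu n) := inferInstance

local instance continuousSMulEuProd (n : ℕ) : ContinuousSMul ℝ (Eu n × Eu n) := inferInstance

section Coordinates

variable {n : ℕ}

theorem eu_sum_single (X : Eu n) : ∑ i, X i • EuclideanSpace.single i (1 : ℝ) = X := by
  ext j
  simp [Finset.sum_apply, Pi.single_apply]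

theorem map_eq_sum_single {V T : Type*} [AddCommGroup V] [Module ℝ V] [FunLike T (Eu n) V]
    [LinearMapClass T ℝ (Eu n) V] (η : T) (X : Eu n) :
    η X = ∑ i, X i • η (EuclideanSpace.single i (1 : ℝ)) := by
  conv_lhs => rw [← eu_sum_single X]
  simp only [map_sum, map_smul]

/-- The bilinear form `(1/2) ∂²l/∂y∂y`. -/
def hessB (l : Eu n × Eu n → ℝ) (z : Eu n × Eu n) : Eu n →L[ℝ] Eu n →L[ℝ] ℝ :=
  (1 / 2 : ℝ) • (fderiv ℝ (fderiv ℝ l) z).bilinearComp (ContinuousLinearMap.inr ℝ (Eu n) (Eu n))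
    (ContinuousLinearMap.inr ℝ (Eu n) (Eu n))

theorem hessB_apply (l : Eu n × Eu n → ℝ) (z : Eu n × Eu n) (X Z : Eu n) :
    hessB l z X Z = (1 / 2) * fderiv ℝ (fderiv ℝ l) z (0, X) (0, Z) := rfl

theorem fderiv_fderiv_apply {l : Eu n × Eu n → ℝ} {z : Eu n × Eu n} (hl : ContDiffAt ℝ ∞ l z)
    (a b : Eu n × Eu n) :
    fderiv ℝ (fun w => fderiv ℝ l w a) z b = fderiv ℝ (fderiv ℝ l) z b a := by
  have h := (hl.fderiv_right (m := ∞) (by simp)).differentiableAt (by simp)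
  rw [(h.hasFDerivAt.clm_apply (hasFDerivAt_const a z)).fderiv]
  simp

theorem symm_fderiv_fderiv {l : Eu n × Eu n → ℝ} {z : Eu n × Eu n} (hl : ContDiffAt ℝ ∞ l z)
    (a b : Eu n × Eu n) : fderiv ℝ (fderiv ℝ l) z a b = fderiv ℝ (fderiv ℝ l) z b a :=
  hl.isSymmSndFDerivAt (by simpa using two_le_infty) _ _

theorem hessB_symm {l : Eu n × Eu n → ℝ} {z : Eu n × Eu n} (hl : ContDiffAt ℝ ∞ l z)
    (X Z : Eu n) : hessB l z X Z = hessB l z Z X := by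
  rw [hessB_apply, hessB_apply, symm_fderiv_fderiv hl]

theorem hessLoc_apply {l : Eu n × Eu n → ℝ} {z : Eu n × Eu n} (hl : ContDiffAt ℝ ∞ l z)
    (i j : Fin n) : hessLoc l z i j
      = hessB l z (EuclideanSpace.single i 1) (EuclideanSpace.single j 1) := by
  rw [hessB_apply, ← fderiv_fderiv_apply hl]
  rfl

theorem contDiffAt_hessB {l : Eu n × Eu n → ℝ} {z : Eu n × Eu n} (hl : ContDiffAt ℝ ∞ l z) :
    ContDiffAt ℝ ∞ (hessB l) z := by
  have h := (hl.fderiv_right (m := ∞) (by simp)).fderiv_right (m := ∞) (by simp)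
  refine contDiffAt_clm_of_apply fun X => contDiffAt_clm_of_apply fun Z => ?_
  simp only [hessB_apply]
  exact contDiffAt_const.mul ((h.clm_apply contDiffAt_const).clm_apply contDiffAt_const)

/-- `l` is a regular Lagrangian near `z`. -/
def IsRegularNear (l : Eu n × Eu n → ℝ) (z : Eu n × Eu n) : Prop :=
  ∀ᶠ w in 𝓝 z, ContDiffAt ℝ ∞ l w ∧ (hessLoc l w).det ≠ 0

variable {l : Eu n × Eu n → ℝ} {z : Eu n × Eu n}

theorem IsRegularNear.eventually (h : IsRegularNear l z) : ∀ᶠ w in 𝓝 z, IsRegularNear l w :=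
  eventually_eventually_nhds.2 h

theorem IsRegularNear.contDiffAt (h : IsRegularNear l z) : ContDiffAt ℝ ∞ l z :=
  h.self_of_nhds.1

theorem IsRegularNear.det_ne_zero (h : IsRegularNear l z) : (hessLoc l z).det ≠ 0 :=
  h.self_of_nhds.2

theorem sum_hessLoc_mul (hl : ContDiffAt ℝ ∞ l z) (X Z : Eu n) :
    ∑ i, ∑ j, hessLoc l z i j * X i * Z j = hessB l z X Z := by
  rw [map_eq_sum_single (hessB l z) X]
  simp only [sum_apply, smul_apply, smul_eq_mul]
  refine Finset.sum_congr rfl fun i _ => ?_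
  rw [map_eq_sum_single (hessB l z (EuclideanSpace.single i 1)) Z, Finset.mul_sum]
  refine Finset.sum_congr rfl fun j _ => ?_
  rw [hessLoc_apply hl, smul_eq_mul]
  ring

theorem det_hessLoc_ne_zero_iff (hl : ContDiffAt ℝ ∞ l z) :
    (hessLoc l z).det ≠ 0 ↔ ∀ X, (∀ Z, hessB l z Z X = 0) → X = 0 := by
  rw [Ne, ← Matrix.exists_mulVec_eq_zero_iff]
  push Not
  have key : ∀ X : Eu n, (hessLoc l z).mulVec X = 0 ↔ ∀ Z, hessB l z Z X = 0 := by
    intro X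
    have h1 : ∀ i, (hessLoc l z).mulVec X i = hessB l z (EuclideanSpace.single i 1) X := by
      intro i
      rw [map_eq_sum_single (hessB l z (EuclideanSpace.single i 1)) X, Matrix.mulVec, dotProduct]
      refine Finset.sum_congr rfl fun j _ => ?_
      rw [hessLoc_apply hl, smul_eq_mul, mul_comm]
    constructor
    · intro h Z
      rw [map_eq_sum_single (hessB l z) Z]
      simp only [sum_apply, smul_apply, smul_eq_mul]
      exact Finset.sum_eq_zero fun i _ => by rw [← h1, h]; simp
    · intro h
      ext i
      rw [h1, h]; rfl
  constructor
  · intro h X hX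
    by_contra hne
    exact h X (fun h0 => hne (by ext i; exact congrFun h0 i)) ((key X).2 hX)
  · intro h v hv h0
    have := h (WithLp.toLp 2 v) ((key _).1 h0)
    exact hv (by ext i; exact congrArg (fun X : Eu n => X i) this)

theorem IsRegularNear.ext (h : IsRegularNear l z) {X X' : Eu n}
    (hX : ∀ Z, hessB l z X Z = hessB l z X' Z) : X = X' := by
  refine sub_eq_zero.1 ((det_hessLoc_ne_zero_iff h.contDiffAt).1 h.det_ne_zero _ fun Z => ?_)
  rw [hessB_symm h.contDiffAt, map_sub, sub_apply, hX, sub_self]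

/-- The vector with covariant components `η`. -/
def sharp (l : Eu n × Eu n → ℝ) (z : Eu n × Eu n) (η : Fin n → ℝ) : Eu n :=
  WithLp.toLp 2 fun i => ∑ r, (hessLoc l z)⁻¹ i r * η r

theorem hessB_sharp (h : IsRegularNear l z) (η : Fin n → ℝ) (Z : Eu n) :
    hessB l z (sharp l z η) Z = ∑ r, η r * Z r := by
  rw [← sum_hessLoc_mul h.contDiffAt, Finset.sum_comm]
  refine Finset.sum_congr rfl fun j _ => ?_
  rw [← Finset.sum_mul]
  congr 1
  have hsymm : ∀ i j, hessLoc l z i j = hessLoc l z j i := fun i j => by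
    rw [hessLoc_apply h.contDiffAt, hessLoc_apply h.contDiffAt, hessB_symm h.contDiffAt]
  have hinv := Matrix.mul_nonsing_inv (hessLoc l z) (isUnit_iff_ne_zero.2 h.det_ne_zero)
  have h1 : ((hessLoc l z * (hessLoc l z)⁻¹).mulVec η) j = η j := by rw [hinv, Matrix.one_mulVec]
  rw [← Matrix.mulVec_mulVec] at h1
  rw [← h1]
  simp only [Matrix.mulVec, dotProduct, sharp]
  exact Finset.sum_congr rfl fun i _ => by rw [hsymm i j]

theorem contDiffAt_matrix_det {D : Type*} [NormedAddCommGroup D] [NormedSpace ℝ D] {m : ℕ}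
    {g : D → Matrix (Fin m) (Fin m) ℝ} {w : D} (hg : ∀ i j, ContDiffAt ℝ ∞ (fun w => g w i j) w) :
    ContDiffAt ℝ ∞ (fun w => (g w).det) w := by
  simp only [Matrix.det_apply]
  exact ContDiffAt.sum fun σ _ => ContDiffAt.const_smul _ (contDiffAt_prod fun i _ => hg _ _)

theorem contDiffAt_matrix_inv {D : Type*} [NormedAddCommGroup D] [NormedSpace ℝ D] {m : ℕ}
    {g : D → Matrix (Fin m) (Fin m) ℝ} {w : D} (hg : ∀ i j, ContDiffAt ℝ ∞ (fun w => g w i j) w)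
    (hdet : (g w).det ≠ 0) (i j : Fin m) : ContDiffAt ℝ ∞ (fun w => (g w)⁻¹ i j) w := by
  have h1 : ∀ w, (g w)⁻¹ i j = ((g w).det)⁻¹ * (g w).adjugate i j := fun w => by
    rw [Matrix.inv_def, Ring.inverse_eq_inv']
    rfl
  simp only [h1]
  refine ((contDiffAt_matrix_det hg).inv hdet).mul ?_
  simp only [Matrix.adjugate_apply]
  refine contDiffAt_matrix_det fun a b => ?_
  by_cases hab : a = j
  · subst hab
    simpa using contDiffAt_const
  · simpa [Matrix.updateRow_ne hab] using hg a b

theorem contDiffAt_hessLoc (h : ∀ᶠ w in 𝓝 z, ContDiffAt ℝ ∞ l w) (i j : Fin n) :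
    ContDiffAt ℝ ∞ (fun w => hessLoc l w i j) z := by
  have h1 := contDiffAt_hessB h.self_of_nhds
  refine ((h1.clm_apply (contDiffAt_const (c := EuclideanSpace.single i 1))).clm_apply
    (contDiffAt_const (c := EuclideanSpace.single j 1))).congr_of_eventuallyEq ?_
  filter_upwards [h] with w hw
  exact hessLoc_apply hw i j

theorem IsRegularNear.contDiffAt_inv (h : IsRegularNear l z) (i j : Fin n) :
    ContDiffAt ℝ ∞ (fun w => (hessLoc l w)⁻¹ i j) z :=
  contDiffAt_matrix_inv (contDiffAt_hessLoc (h.mono fun _ hw => hw.1)) h.det_ne_zero i j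

theorem contDiffAt_sharp (h : IsRegularNear l z) {η : Eu n × Eu n → Fin n → ℝ}
    (hη : ∀ r, ContDiffAt ℝ ∞ (fun w => η w r) z) :
    ContDiffAt ℝ ∞ (fun w => sharp l w (η w)) z := by
  rw [contDiffAt_euclidean]
  intro i
  have h1 : ContDiffAt ℝ ∞ (fun w => ∑ r, (hessLoc l w)⁻¹ i r * η w r) z :=
    ContDiffAt.sum fun r _ => (h.contDiffAt_inv i r).mul (hη r)
  exact h1

/-- The vector `G` of spray coefficients. -/
def sprayVec (l : Eu n × Eu n → ℝ) (z : Eu n × Eu n) : Eu n :=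
  WithLp.toLp 2 fun i => sprayLoc l i z

theorem sprayVec_eq (hl : ContDiffAt ℝ ∞ l z) :
    sprayVec l z = (1 / 4 : ℝ) • sharp l z fun j =>
      fderiv ℝ (fderiv ℝ l) z (z.2, 0) (0, EuclideanSpace.single j 1)
        - fderiv ℝ l z (EuclideanSpace.single j 1, 0) := by
  ext i
  simp only [sprayVec, sprayLoc, sharp, PiLp.smul_apply, smul_eq_mul]
  congr 1
  refine Finset.sum_congr rfl fun j _ => ?_
  congr 2
  have h1 : ((z.2, 0) : Eu n × Eu n)
      = ∑ k, z.2 k • ((EuclideanSpace.single k 1, 0) : Eu n × Eu n) := by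
    have := map_eq_sum_single (ContinuousLinearMap.inl ℝ (Eu n) (Eu n)) z.2
    simpa using this
  rw [h1, map_sum, sum_apply]
  refine Finset.sum_congr rfl fun k _ => ?_
  rw [map_smul, smul_apply, smul_eq_mul, mul_comm]
  congr 1
  exact fderiv_fderiv_apply hl _ _

theorem hessB_sprayVec (h : IsRegularNear l z) (Z : Eu n) :
    4 * hessB l z (sprayVec l z) Z
      = fderiv ℝ (fderiv ℝ l) z (z.2, 0) (0, Z) - fderiv ℝ l z (Z, 0) := by
  rw [sprayVec_eq h.contDiffAt, map_smul, smul_apply, hessB_sharp h, smul_eq_mul]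
  have h1 := map_eq_sum_single ((fderiv ℝ (fderiv ℝ l) z (z.2, 0)).comp
    (ContinuousLinearMap.inr ℝ (Eu n) (Eu n)) - (fderiv ℝ l z).comp
      (ContinuousLinearMap.inl ℝ (Eu n) (Eu n))) Z
  simp only [sub_apply, ContinuousLinearMap.comp_apply, ContinuousLinearMap.inr_apply,
    ContinuousLinearMap.inl_apply, smul_eq_mul] at h1
  rw [h1, ← mul_assoc]
  norm_num
  exact Finset.sum_congr rfl fun i _ => by ring

theorem contDiffAt_sprayVec (h : IsRegularNear l z) : ContDiffAt ℝ ∞ (sprayVec l) z := by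
  have h1 := h.contDiffAt.fderiv_right (m := ∞) (by simp)
  have h2 := h1.fderiv_right (m := ∞) (by simp)
  refine (ContDiffAt.const_smul (1 / 4 : ℝ) (contDiffAt_sharp h
    (η := fun z j => fderiv ℝ (fderiv ℝ l) z (z.2, 0) (0, EuclideanSpace.single j 1)
        - fderiv ℝ l z (EuclideanSpace.single j 1, 0)) fun r => ?_)).congr_of_eventuallyEq ?_
  · exact ((h2.clm_apply (contDiffAt_snd.prodMk contDiffAt_const)).clm_apply
      contDiffAt_const).sub (h1.clm_apply contDiffAt_const)
  · filter_upwards [h] with w hw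
    exact sprayVec_eq hw.1

/-- The N-connection as a linear map. -/
def nMap (l : Eu n × Eu n → ℝ) (z : Eu n × Eu n) : Eu n →L[ℝ] Eu n :=
  Matrix.toEuclideanCLM (𝕜 := ℝ) (nLoc l z)

theorem nMap_apply (h : IsRegularNear l z) (b : Eu n) :
    nMap l z b = fderiv ℝ (sprayVec l) z (0, b) := by
  have hs := (contDiffAt_sprayVec h).differentiableAt (by simp)
  have h1 := map_eq_sum_single ((fderiv ℝ (sprayVec l) z).comp
    (ContinuousLinearMap.inr ℝ (Eu n) (Eu n))) b
  simp only [ContinuousLinearMap.comp_apply, ContinuousLinearMap.inr_apply] at h1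
  rw [h1]
  ext a
  have h2 : ∀ j, nLoc l z a j = (fderiv ℝ (sprayVec l) z (0, EuclideanSpace.single j 1)) a := by
    intro j
    have h3 := ((EuclideanSpace.proj (𝕜 := ℝ) a : Eu n →L[ℝ] ℝ).hasFDerivAt.comp z
      hs.hasFDerivAt).fderiv
    exact DFunLike.congr_fun h3 _
  have h4 : nMap l z b a = ∑ j, nLoc l z a j * b j := rfl
  rw [h4]
  simp only [WithLp.ofLp_sum, WithLp.ofLp_smul, Finset.sum_apply, Pi.smul_apply, smul_eq_mul]
  exact Finset.sum_congr rfl fun j _ => by rw [h2, mul_comm]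

theorem contDiffAt_nMap (h : IsRegularNear l z) : ContDiffAt ℝ ∞ (nMap l) z := by
  refine contDiffAt_clm_of_apply fun b => ?_
  have h1 := (contDiffAt_sprayVec h).fderiv_right (m := ∞) (by simp)
  refine (h1.clm_apply (contDiffAt_const (c := (0, b)))).congr_of_eventuallyEq ?_
  filter_upwards [h.eventually] with w hw
  exact nMap_apply hw b

theorem nLoc_apply (a j : Fin n) : nLoc l z a j = (nMap l z (EuclideanSpace.single j 1)) a := by
  have : nMap l z (EuclideanSpace.single j 1) a
      = ∑ k, nLoc l z a k * (EuclideanSpace.single j (1 : ℝ) : Eu n) k := rfl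
  rw [this]
  simp

theorem vcomp_nLoc (Y : Eu n × Eu n) : vcomp (nLoc l z) Y = Y.2 + nMap l z Y.1 := rfl

theorem fromAdapted_nLoc (Y : Eu n × Eu n) :
    fromAdapted (nLoc l z) Y = (Y.1, Y.2 - nMap l z Y.1) := rfl

end Coordinates

section Coefficients

variable {n : ℕ} {l : Eu n × Eu n → ℝ} {z : Eu n × Eu n}

/-- The horizontal lift `aᵏ e_k`. -/
def horLift (l : Eu n × Eu n → ℝ) (z : Eu n × Eu n) (a : Eu n) : Eu n × Eu n := (a, -nMap l z a)

theorem horLift_add (a b : Eu n) : horLift l z (a + b) = horLift l z a + horLift l z b := by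
  simp [horLift, add_comm]

theorem horLift_smul (c : ℝ) (a : Eu n) : horLift l z (c • a) = c • horLift l z a := by
  simp [horLift]

/-- The derivative `∂_X N`. -/
def dN (l : Eu n × Eu n → ℝ) (z : Eu n × Eu n) (X a : Eu n) : Eu n :=
  fderiv ℝ (nMap l) z (0, X) a

/-- The derivative of the Hessian. -/
def dG (l : Eu n × Eu n → ℝ) (z v : Eu n × Eu n) (X Z : Eu n) : ℝ :=
  fderiv ℝ (hessB l) z v X Z

theorem fderiv_hessB_apply (h : IsRegularNear l z) (v : Eu n × Eu n) (X Z : Eu n) :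
    fderiv ℝ (fun w => hessB l w X Z) z v = dG l z v X Z := by
  have hd := ((contDiffAt_hessB h.contDiffAt).differentiableAt (by simp)).hasFDerivAt
  rw [((hd.clm_apply (hasFDerivAt_const X z)).clm_apply (hasFDerivAt_const Z z)).fderiv]
  simp [dG]

theorem dG_symm (h : IsRegularNear l z) (v : Eu n × Eu n) (X Z : Eu n) :
    dG l z v X Z = dG l z v Z X := by
  have h1 : (fun w => hessB l w X Z) =ᶠ[𝓝 z] fun w => hessB l w Z X := by
    filter_upwards [h] with w hw
    exact hessB_symm hw.1 X Z
  rw [← fderiv_hessB_apply h, ← fderiv_hessB_apply h, h1.fderiv_eq]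

theorem fderiv_hessLoc (h : IsRegularNear l z) (i j : Fin n) (v : Eu n × Eu n) :
    fderiv ℝ (fun w => hessLoc l w i j) z v
      = dG l z v (EuclideanSpace.single i 1) (EuclideanSpace.single j 1) := by
  have h1 : (fun w => hessLoc l w i j) =ᶠ[𝓝 z] fun w =>
      hessB l w (EuclideanSpace.single i 1) (EuclideanSpace.single j 1) := by
    filter_upwards [h] with w hw
    exact hessLoc_apply hw.1 i j
  rw [h1.fderiv_eq, fderiv_hessB_apply h]

theorem fderiv_nLoc (h : IsRegularNear l z) (i j : Fin n) (v : Eu n × Eu n) :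
    fderiv ℝ (fun w => nLoc l w i j) z v
      = (fderiv ℝ (nMap l) z v (EuclideanSpace.single j 1)) i := by
  have hd := ((contDiffAt_nMap h).differentiableAt (by simp)).hasFDerivAt
  have h1 : (fun w => nLoc l w i j) = fun w =>
      (EuclideanSpace.proj (𝕜 := ℝ) i : Eu n →L[ℝ] ℝ) (nMap l w (EuclideanSpace.single j 1)) := by
    ext w
    exact nLoc_apply i j
  have h2 := ((EuclideanSpace.proj (𝕜 := ℝ) i : Eu n →L[ℝ] ℝ).hasFDerivAt.comp z
    (hd.clm_apply (hasFDerivAt_const (EuclideanSpace.single j (1 : ℝ)) z))).fderiv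
  rw [h1]
  refine (DFunLike.congr_fun h2 v).trans ?_
  simp

theorem elong_eq (f : Eu n × Eu n → ℝ) (k : Fin n) :
    elong (nLoc l) k f z = fderiv ℝ f z (horLift l z (EuclideanSpace.single k 1)) := by
  have h1 : horLift l z (EuclideanSpace.single k 1) = (EuclideanSpace.single k 1, 0)
      - ∑ a, nLoc l z a k • ((0, EuclideanSpace.single a 1) : Eu n × Eu n) := by
    have h2 := map_eq_sum_single (ContinuousLinearMap.inr ℝ (Eu n) (Eu n))
      (nMap l z (EuclideanSpace.single k 1))
    simp only [ContinuousLinearMap.inr_apply, ← nLoc_apply] at h2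
    rw [← h2]
    simp [horLift]
  rw [h1, map_sub, map_sum]
  simp only [map_smul, smul_eq_mul]
  rfl

theorem sum_single_mul {φ : Eu n → ℝ} (hφ : IsLinearMap ℝ φ) (Z : Eu n) :
    ∑ r, φ (EuclideanSpace.single r 1) * Z r = φ Z := by
  have := map_eq_sum_single (hφ.mk' φ) Z
  simp only [IsLinearMap.mk'_apply, smul_eq_mul] at this
  rw [this]
  exact Finset.sum_congr rfl fun r _ => mul_comm _ _

/-- The coefficients `Lⁱ_jk`, as a bilinear map. -/
def gLh (l : Eu n × Eu n → ℝ) (z : Eu n × Eu n) (a X : Eu n) : Eu n :=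
  (1 / 2 : ℝ) • sharp l z fun r =>
    dG l z (horLift l z a) X (EuclideanSpace.single r 1)
      + dG l z (horLift l z X) a (EuclideanSpace.single r 1)
      - dG l z (horLift l z (EuclideanSpace.single r 1)) X a

/-- The coefficients `Cⁱ_jc`, as a bilinear map. -/
def gCh (l : Eu n × Eu n → ℝ) (z : Eu n × Eu n) (c X : Eu n) : Eu n :=
  (1 / 2 : ℝ) • sharp l z fun r => dG l z (0, c) X (EuclideanSpace.single r 1)

/-- The coefficients `Lᵃ_bk`, as a bilinear map. -/
def gLv (l : Eu n × Eu n → ℝ) (z : Eu n × Eu n) (a X : Eu n) : Eu n :=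
  dN l z X a + (1 / 2 : ℝ) • sharp l z fun r =>
    dG l z (horLift l z a) X (EuclideanSpace.single r 1)
      - hessB l z (dN l z X a) (EuclideanSpace.single r 1)
      - hessB l z (dN l z (EuclideanSpace.single r 1) a) X

/-- The coefficients `Cᵃ_bc`, as a bilinear map. -/
def gCv (l : Eu n × Eu n → ℝ) (z : Eu n × Eu n) (c X : Eu n) : Eu n :=
  (1 / 2 : ℝ) • sharp l z fun r =>
    dG l z (0, c) X (EuclideanSpace.single r 1) + dG l z (0, X) c (EuclideanSpace.single r 1)
      - dG l z (0, EuclideanSpace.single r 1) X c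

theorem zero_add_prod (X Z : Eu n) : ((0, X + Z) : Eu n × Eu n) = (0, X) + (0, Z) := by simp

theorem zero_smul_prod (c : ℝ) (X : Eu n) : ((0, c • X) : Eu n × Eu n) = c • (0, X) := by simp

theorem dG_isLinear (v : Eu n × Eu n) (X : Eu n) : IsLinearMap ℝ (dG l z v X) :=
  ⟨fun _ _ => map_add _ _ _, fun _ _ => map_smul _ _ _⟩

theorem dG_add_left (v w : Eu n × Eu n) (X Z : Eu n) :
    dG l z (v + w) X Z = dG l z v X Z + dG l z w X Z := by simp [dG]

theorem dG_smul_left (c : ℝ) (v : Eu n × Eu n) (X Z : Eu n) :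
    dG l z (c • v) X Z = c * dG l z v X Z := by simp [dG]

theorem dG_add_mid (v : Eu n × Eu n) (X Y Z : Eu n) :
    dG l z v (X + Y) Z = dG l z v X Z + dG l z v Y Z := by simp [dG]

theorem dG_smul_mid (c : ℝ) (v : Eu n × Eu n) (X Z : Eu n) :
    dG l z v (c • X) Z = c * dG l z v X Z := by simp [dG]

theorem dG_add_right (v : Eu n × Eu n) (X Y Z : Eu n) :
    dG l z v X (Y + Z) = dG l z v X Y + dG l z v X Z := by simp [dG]

theorem dG_smul_right (c : ℝ) (v : Eu n × Eu n) (X Z : Eu n) :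
    dG l z v X (c • Z) = c * dG l z v X Z := by simp [dG]

theorem dN_add_left (X Y a : Eu n) : dN l z (X + Y) a = dN l z X a + dN l z Y a := by
  simp only [dN, zero_add_prod, map_add, add_apply]

theorem dN_smul_left (c : ℝ) (X a : Eu n) : dN l z (c • X) a = c • dN l z X a := by
  simp only [dN, zero_smul_prod, map_smul, smul_apply]

theorem dN_add_right (X a b : Eu n) : dN l z X (a + b) = dN l z X a + dN l z X b :=
  map_add _ _ _

theorem dN_smul_right (c : ℝ) (X a : Eu n) : dN l z X (c • a) = c • dN l z X a :=
  map_smul _ _ _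

theorem hessB_gLh (h : IsRegularNear l z) (a X Z : Eu n) :
    2 * hessB l z (gLh l z a X) Z = dG l z (horLift l z a) X Z + dG l z (horLift l z X) a Z
      - dG l z (horLift l z Z) X a := by
  rw [gLh, map_smul, smul_apply, hessB_sharp h, sum_single_mul (φ := fun Z =>
    dG l z (horLift l z a) X Z + dG l z (horLift l z X) a Z - dG l z (horLift l z Z) X a)]
  · simp
  · constructor <;> intros <;> simp only [dG_add_right, dG_smul_right, horLift_add, horLift_smul,
      dG_add_left, dG_smul_left, smul_eq_mul] <;> ring

theorem hessB_gCh (h : IsRegularNear l z) (c X Z : Eu n) :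
    2 * hessB l z (gCh l z c X) Z = dG l z (0, c) X Z := by
  rw [gCh, map_smul, smul_apply, hessB_sharp h, sum_single_mul (dG_isLinear _ _)]
  simp

theorem hessB_gLv (h : IsRegularNear l z) (a X Z : Eu n) :
    2 * hessB l z (gLv l z a X) Z = dG l z (horLift l z a) X Z
      + hessB l z (dN l z X a) Z - hessB l z (dN l z Z a) X := by
  rw [gLv, map_add, add_apply, map_smul, smul_apply, hessB_sharp h, sum_single_mul (φ := fun Z =>
    dG l z (horLift l z a) X Z - hessB l z (dN l z X a) Z - hessB l z (dN l z Z a) X)]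
  · simp only [smul_eq_mul]; ring
  · constructor <;> intros <;> simp only [dG_add_right, dG_smul_right, dN_add_left, dN_smul_left,
      map_add, add_apply, map_smul, smul_apply, smul_eq_mul] <;> ring

theorem hessB_gCv (h : IsRegularNear l z) (c X Z : Eu n) :
    2 * hessB l z (gCv l z c X) Z = dG l z (0, c) X Z + dG l z (0, X) c Z - dG l z (0, Z) X c := by
  rw [gCv, map_smul, smul_apply, hessB_sharp h, sum_single_mul (φ := fun Z =>
    dG l z (0, c) X Z + dG l z (0, X) c Z - dG l z (0, Z) X c)]
  · simp
  · constructor <;> intros <;> simp only [dG_add_right, dG_smul_right, zero_add_prod,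
      zero_smul_prod, dG_add_left, dG_smul_left, smul_eq_mul] <;> ring

theorem IsRegularNear.ext_two (h : IsRegularNear l z) {X X' : Eu n}
    (hX : ∀ Z, 2 * hessB l z X Z = 2 * hessB l z X' Z) : X = X' :=
  h.ext fun Z => mul_left_cancel₀ two_ne_zero (hX Z)

/-- Bilinear maps on `ℝⁿ`. -/
structure IsBilin (f : Eu n → Eu n → Eu n) : Prop where
  add_left : ∀ a b X, f (a + b) X = f a X + f b X
  smul_left : ∀ (c : ℝ) a X, f (c • a) X = c • f a X
  add_right : ∀ a X Y, f a (X + Y) = f a X + f a Y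
  smul_right : ∀ (c : ℝ) a X, f a (c • X) = c • f a X

theorem isBilin_gLh (h : IsRegularNear l z) : IsBilin (gLh l z) := by
  constructor <;> intros <;> refine h.ext_two fun Z => ?_ <;>
  simp only [map_add, add_apply, map_smul, smul_apply, smul_eq_mul, mul_add,
    mul_left_comm (2 : ℝ), hessB_gLh h] <;>
  simp only [dG_add_right, dG_smul_right, horLift_add, horLift_smul, dG_add_left, dG_smul_left,
    dG_add_mid, dG_smul_mid] <;> ring

theorem isBilin_gCh (h : IsRegularNear l z) : IsBilin (gCh l z) := by
  constructor <;> intros <;> refine h.ext_two fun Z => ?_ <;>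
  simp only [map_add, add_apply, map_smul, smul_apply, smul_eq_mul, mul_add,
    mul_left_comm (2 : ℝ), hessB_gCh h] <;>
  simp only [zero_add_prod, zero_smul_prod, dG_add_left, dG_smul_left, dG_add_mid, dG_smul_mid]

theorem isBilin_gLv (h : IsRegularNear l z) : IsBilin (gLv l z) := by
  constructor <;> intros <;> refine h.ext_two fun Z => ?_ <;>
  simp only [map_add, add_apply, map_smul, smul_apply, smul_eq_mul, mul_add,
    mul_left_comm (2 : ℝ), hessB_gLv h] <;>
  simp only [horLift_add, horLift_smul, dG_add_left, dG_smul_left, dN_add_left, dN_smul_left,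
    dN_add_right, dN_smul_right, map_add, map_smul, add_apply, smul_apply, smul_eq_mul,
    dG_add_mid, dG_smul_mid] <;> ring

theorem isBilin_gCv (h : IsRegularNear l z) : IsBilin (gCv l z) := by
  constructor <;> intros <;> refine h.ext_two fun Z => ?_ <;>
  simp only [map_add, add_apply, map_smul, smul_apply, smul_eq_mul, mul_add,
    mul_left_comm (2 : ℝ), hessB_gCv h] <;>
  simp only [zero_add_prod, zero_smul_prod, dG_add_left, dG_smul_left, dG_add_mid, dG_smul_mid,
    dG_add_right, dG_smul_right] <;> ring

theorem IsBilin.sum_single {f : Eu n → Eu n → Eu n} (hf : IsBilin f) (a X : Eu n) :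
    ∑ k, a k • (WithLp.toLp 2 fun i =>
      ∑ j, f (EuclideanSpace.single k 1) (EuclideanSpace.single j 1) i * X j : Eu n) = f a X := by
  have h1 := map_eq_sum_single ((⟨fun a b => hf.add_left a b X, fun c a => hf.smul_left c a X⟩ :
    IsLinearMap ℝ (fun a => f a X)).mk' _) a
  refine Eq.trans (Finset.sum_congr rfl fun k _ => ?_) h1.symm
  have h2 := map_eq_sum_single ((⟨hf.add_right (EuclideanSpace.single k 1),
    fun c => hf.smul_right c _⟩ : IsLinearMap ℝ (f (EuclideanSpace.single k 1))).mk' _) X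
  refine congrArg (a k • ·) (Eq.trans ?_ h2.symm)
  ext i
  simp [mul_comm]

theorem coefLh_eq (h : IsRegularNear l z) (i j k : Fin n) :
    coefLh (nLoc l) (hessLoc l) z i j k
      = gLh l z (EuclideanSpace.single k 1) (EuclideanSpace.single j 1) i := by
  simp only [coefLh, elong_eq, fderiv_hessLoc h]
  rfl

theorem coefCh_eq (h : IsRegularNear l z) (i j c : Fin n) :
    coefCh (hessLoc l) z i j c
      = gCh l z (EuclideanSpace.single c 1) (EuclideanSpace.single j 1) i := by
  simp only [coefCh, pdy, fderiv_hessLoc h]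
  rfl

theorem coefLv_eq (h : IsRegularNear l z) (a b k : Fin n) :
    coefLv (nLoc l) (hessLoc l) z a b k
      = gLv l z (EuclideanSpace.single k 1) (EuclideanSpace.single b 1) a := by
  have h1 : ∀ b c, ∑ d, hessLoc l z d c * (fderiv ℝ (nMap l) z (0, EuclideanSpace.single b 1)
      (EuclideanSpace.single k 1)) d
      = hessB l z (dN l z (EuclideanSpace.single b 1) (EuclideanSpace.single k 1))
        (EuclideanSpace.single c 1) := by
    intro b c
    rw [map_eq_sum_single (hessB l z) (dN l z _ _)]
    simp only [sum_apply, smul_apply, smul_eq_mul, hessLoc_apply h.contDiffAt, dN]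
    exact Finset.sum_congr rfl fun d _ => mul_comm _ _
  simp only [coefLv, elong_eq, pdy, fderiv_hessLoc h, fderiv_nLoc h, h1]
  rfl

theorem coefCv_eq (h : IsRegularNear l z) (a b c : Fin n) :
    coefCv (hessLoc l) z a b c
      = gCv l z (EuclideanSpace.single c 1) (EuclideanSpace.single b 1) a := by
  simp only [coefCv, pdy, fderiv_hessLoc h]
  rfl

/-- The connection coefficients on the h-part. -/
def gammaH (l : Eu n × Eu n → ℝ) (z v : Eu n × Eu n) (X : Eu n) : Eu n :=
  gLh l z v.1 X + gCh l z (vcomp (nLoc l z) v) X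

/-- The connection coefficients on the v-part. -/
def gammaV (l : Eu n × Eu n → ℝ) (z v : Eu n × Eu n) (X : Eu n) : Eu n :=
  gLv l z v.1 X + gCv l z (vcomp (nLoc l z) v) X

theorem covLoc_apply (h : IsRegularNear l z) (Y : Eu n × Eu n → Eu n × Eu n) (v : Eu n × Eu n) :
    covLoc (nLoc l) (hessLoc l) (hessLoc l) Y z v = fromAdapted (nLoc l z)
      (fderiv ℝ (fun w => (Y w).1) z v + gammaH l z v (Y z).1,
        fderiv ℝ (fun w => vcomp (nLoc l w) (Y w)) z v
          + gammaV l z v (vcomp (nLoc l z) (Y z))) := by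
  have hp : ∀ (i : Fin n) (v : Eu n), (EuclideanSpace.proj (𝕜 := ℝ) i : Eu n →L[ℝ] ℝ) v = v i :=
    fun _ _ => rfl
  simp only [covLoc, ContinuousLinearMap.comp_apply, ContinuousLinearMap.prod_apply, add_apply,
    sum_apply, ContinuousLinearMap.smulRight_apply, ContinuousLinearMap.coe_fst',
    hp, coefLh_eq h, coefCh_eq h, coefLv_eq h, coefCv_eq h,
    (isBilin_gLh h).sum_single, (isBilin_gCh h).sum_single, (isBilin_gLv h).sum_single,
    (isBilin_gCv h).sum_single, add_assoc, gammaH, gammaV]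

end Coefficients

section CoordinateChange

variable {n : ℕ}

theorem horLift_fst (l : Eu n × Eu n → ℝ) (z : Eu n × Eu n) (a : Eu n) : (horLift l z a).1 = a :=
  rfl

/-- The tangent map `(x, y) ↦ (φ x, Dφ(x) y)`. -/
def tmap (φ : Eu n → Eu n) (z : Eu n × Eu n) : Eu n × Eu n := (φ z.1, fderiv ℝ φ z.1 z.2)

/-- The derivative of the tangent map. -/
def dtmap (φ : Eu n → Eu n) (z v : Eu n × Eu n) : Eu n × Eu n :=
  (fderiv ℝ φ z.1 v.1, fderiv ℝ (fderiv ℝ φ) z.1 v.1 z.2 + fderiv ℝ φ z.1 v.2)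

variable {φ : Eu n → Eu n} {l l' : Eu n × Eu n → ℝ} {z : Eu n × Eu n}

theorem hasFDerivAt_jac (hφ : ContDiffAt ℝ ∞ φ z.1) :
    HasFDerivAt (fun w : Eu n × Eu n => fderiv ℝ φ w.1)
      ((fderiv ℝ (fderiv ℝ φ) z.1).comp (ContinuousLinearMap.fst ℝ (Eu n) (Eu n))) z :=
  (((hφ.fderiv_right (m := ∞) (by simp)).differentiableAt (by simp)).hasFDerivAt).comp z
    hasFDerivAt_fst

theorem contDiffAt_tmap (hφ : ContDiffAt ℝ ∞ φ z.1) : ContDiffAt ℝ ∞ (tmap φ) z :=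
  (hφ.comp z contDiffAt_fst).prodMk
    (((hφ.fderiv_right (m := ∞) (by simp)).comp z contDiffAt_fst).clm_apply contDiffAt_snd)

theorem fderiv_tmap (hφ : ContDiffAt ℝ ∞ φ z.1) (v : Eu n × Eu n) :
    fderiv ℝ (tmap φ) z v = dtmap φ z v := by
  have h1 := ((hφ.differentiableAt (by simp)).hasFDerivAt).comp z hasFDerivAt_fst
  have h2 := (hasFDerivAt_jac hφ).clm_apply (hasFDerivAt_snd (𝕜 := ℝ) (E := Eu n) (F := Eu n)
    (p := z))
  have h3 : fderiv ℝ (tmap φ) z = _ := (h1.prodMk h2).fderiv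
  rw [h3]
  ext1
  · rfl
  · simp [dtmap, add_comm]

theorem symm_hess (hφ : ContDiffAt ℝ ∞ φ z.1) (a b : Eu n) :
    fderiv ℝ (fderiv ℝ φ) z.1 a b = fderiv ℝ (fderiv ℝ φ) z.1 b a :=
  (hφ.isSymmSndFDerivAt (by simpa using two_le_infty)).eq a b

/-- The Lagrangian `l` is the expression of `l'` after the coordinate change `φ`. -/
def IsCoordChange (φ : Eu n → Eu n) (l l' : Eu n × Eu n → ℝ) (z : Eu n × Eu n) : Prop :=
  ∀ᶠ w in 𝓝 z, ContDiffAt ℝ ∞ φ w.1 ∧ Function.Bijective (fderiv ℝ φ w.1) ∧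
    l w = l' (tmap φ w) ∧ ContDiffAt ℝ ∞ l' (tmap φ w)

section

variable (h : IsCoordChange φ l l' z)
include h

theorem IsCoordChange.eventually : ∀ᶠ w in 𝓝 z, IsCoordChange φ l l' w :=
  eventually_eventually_nhds.2 h

theorem IsCoordChange.contDiffAt_map : ContDiffAt ℝ ∞ φ z.1 := h.self_of_nhds.1

theorem IsCoordChange.contDiffAt_right : ContDiffAt ℝ ∞ l' (tmap φ z) := h.self_of_nhds.2.2.2

theorem IsCoordChange.contDiffAt_left : ContDiffAt ℝ ∞ l z :=
  (h.contDiffAt_right.comp z (contDiffAt_tmap h.contDiffAt_map)).congr_of_eventuallyEq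
    (h.mono fun _ hw => hw.2.2.1)

theorem IsCoordChange.fderiv_apply (v : Eu n × Eu n) :
    fderiv ℝ l z v = fderiv ℝ l' (tmap φ z) (dtmap φ z v) := by
  have h1 : l =ᶠ[𝓝 z] l' ∘ tmap φ := h.mono fun _ hw => hw.2.2.1
  rw [h1.fderiv_eq, fderiv_comp z (h.contDiffAt_right.differentiableAt (by simp))
    ((contDiffAt_tmap h.contDiffAt_map).differentiableAt (by simp)),
    ContinuousLinearMap.comp_apply, fderiv_tmap h.contDiffAt_map]

theorem IsCoordChange.fderiv_fderiv_apply (v : Eu n × Eu n) (Z : Eu n) :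
    fderiv ℝ (fderiv ℝ l) z v (0, Z)
      = fderiv ℝ (fderiv ℝ l') (tmap φ z) (dtmap φ z v) (0, fderiv ℝ φ z.1 Z)
        + fderiv ℝ l' (tmap φ z) (0, fderiv ℝ (fderiv ℝ φ) z.1 v.1 Z) := by
  have hd : ∀ {f : Eu n × Eu n → ℝ} {w}, ContDiffAt ℝ ∞ f w →
      HasFDerivAt (fderiv ℝ f) (fderiv ℝ (fderiv ℝ f) w) w := fun hf =>
    ((hf.fderiv_right (m := ∞) (by simp)).differentiableAt (by simp)).hasFDerivAt
  have h1 : (fun w => fderiv ℝ l w (0, Z)) =ᶠ[𝓝 z]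
      fun w => fderiv ℝ l' (tmap φ w) (0, fderiv ℝ φ w.1 Z) := by
    filter_upwards [h.eventually] with w hw
    rw [hw.fderiv_apply]
    simp [dtmap]
  have h2 := ((hd h.contDiffAt_left).clm_apply
    (hasFDerivAt_const ((0, Z) : Eu n × Eu n) z)).fderiv
  have h3 := (((hd h.contDiffAt_right).comp z ((contDiffAt_tmap h.contDiffAt_map).differentiableAt
    (by simp)).hasFDerivAt).clm_apply ((hasFDerivAt_const (0 : Eu n) z).prodMk
      ((hasFDerivAt_jac h.contDiffAt_map).clm_apply (hasFDerivAt_const Z z)))).fderiv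
  have h4 := (h2.symm.trans h1.fderiv_eq).trans h3
  have h5 := DFunLike.congr_fun h4 v
  simp [fderiv_tmap h.contDiffAt_map] at h5
  rw [h5, add_comm]

theorem IsCoordChange.hessB_eq (X Z : Eu n) :
    hessB l z X Z = hessB l' (tmap φ z) (fderiv ℝ φ z.1 X) (fderiv ℝ φ z.1 Z) := by
  rw [hessB_apply, hessB_apply, h.fderiv_fderiv_apply]
  simp only [dtmap, map_zero, zero_apply, zero_add, mul_eq_mul_left_iff, add_eq_left]
  exact Or.inl (map_zero _)

theorem IsCoordChange.surj (X : Eu n) : ∃ Z, fderiv ℝ φ z.1 Z = X := h.self_of_nhds.2.1.2 X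

theorem IsCoordChange.det_iff : (hessLoc l z).det ≠ 0 ↔ (hessLoc l' (tmap φ z)).det ≠ 0 := by
  rw [det_hessLoc_ne_zero_iff h.contDiffAt_left, det_hessLoc_ne_zero_iff h.contDiffAt_right]
  constructor
  · intro H X' hX'
    obtain ⟨X, rfl⟩ := h.surj X'
    rw [H X fun Z => by rw [h.hessB_eq, hX'], map_zero]
  · intro H X hX
    refine h.self_of_nhds.2.1.1 ?_
    rw [map_zero]
    refine H _ fun Z' => ?_
    obtain ⟨Z, rfl⟩ := h.surj Z'
    rw [← h.hessB_eq, hX]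

variable (hr : IsRegularNear l z) (hr' : IsRegularNear l' (tmap φ z))
include hr hr'

theorem IsCoordChange.ext {X X' : Eu n} (hX : ∀ Z, hessB l' (tmap φ z) X (fderiv ℝ φ z.1 Z)
    = hessB l' (tmap φ z) X' (fderiv ℝ φ z.1 Z)) : X = X' :=
  hr'.ext fun Z' => by
    obtain ⟨Z, rfl⟩ := h.surj Z'
    exact hX Z

theorem IsCoordChange.regular_eventually :
    ∀ᶠ w in 𝓝 z, IsCoordChange φ l l' w ∧ IsRegularNear l w ∧ IsRegularNear l' (tmap φ w) := by
  filter_upwards [h.eventually, hr.eventually,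
    (contDiffAt_tmap h.contDiffAt_map).continuousAt.eventually hr'.eventually] with w h1 h2 h3
  exact ⟨h1, h2, h3⟩

theorem IsCoordChange.sprayVec_eq : fderiv ℝ φ z.1 (sprayVec l z) = sprayVec l' (tmap φ z)
    + (1 / 2 : ℝ) • fderiv ℝ (fderiv ℝ φ) z.1 z.2 z.2 := by
  refine h.ext hr hr' fun Z => ?_
  have h1 := hessB_sprayVec hr Z
  have h2 := hessB_sprayVec hr' (fderiv ℝ φ z.1 Z)
  rw [h.fderiv_fderiv_apply, h.fderiv_apply, h.hessB_eq] at h1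
  have h3 : dtmap φ z (z.2, 0) = ((tmap φ z).2, 0)
      + (0, fderiv ℝ (fderiv ℝ φ) z.1 z.2 z.2) := by simp [dtmap, tmap]
  have h4 : dtmap φ z (Z, 0) = (fderiv ℝ φ z.1 Z, 0)
      + (0, fderiv ℝ (fderiv ℝ φ) z.1 z.2 Z) := by
    simp [dtmap, symm_hess h.contDiffAt_map Z]
  rw [h3, h4, map_add, map_add, add_apply] at h1
  have h5 := hessB_apply l' (tmap φ z) (fderiv ℝ (fderiv ℝ φ) z.1 z.2 z.2) (fderiv ℝ φ z.1 Z)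
  simp only [map_add, add_apply, map_smul, smul_apply, smul_eq_mul]
  linarith

theorem IsCoordChange.nMap_eq (b : Eu n) : fderiv ℝ φ z.1 (nMap l z b)
    = nMap l' (tmap φ z) (fderiv ℝ φ z.1 b) + fderiv ℝ (fderiv ℝ φ) z.1 b z.2 := by
  have h1 : (fun w : Eu n × Eu n => fderiv ℝ φ w.1 (sprayVec l w)) =ᶠ[𝓝 z] fun w =>
      sprayVec l' (tmap φ w) + (1 / 2 : ℝ) • fderiv ℝ (fderiv ℝ φ) w.1 w.2 w.2 := by
    filter_upwards [h.regular_eventually hr hr'] with w ⟨a1, a2, a3⟩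
    exact a1.sprayVec_eq a2 a3
  have hφ := h.contDiffAt_map
  have h2 := ((hasFDerivAt_jac hφ).clm_apply
    ((contDiffAt_sprayVec hr).differentiableAt (by simp)).hasFDerivAt).fderiv
  have hB : HasFDerivAt (fun w : Eu n × Eu n => fderiv ℝ (fderiv ℝ φ) w.1) _ z :=
    ((((hφ.fderiv_right (m := ∞) (by simp)).fderiv_right (m := ∞) (by simp)).differentiableAt
      (by simp)).hasFDerivAt).comp z hasFDerivAt_fst
  have h3 := (HasFDerivAt.add ((((contDiffAt_sprayVec hr').differentiableAt
    (by simp)).hasFDerivAt).comp z ((contDiffAt_tmap hφ).differentiableAt (by simp)).hasFDerivAt)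
    (((hB.clm_apply hasFDerivAt_snd).clm_apply hasFDerivAt_snd).const_smul (1 / 2 : ℝ))).fderiv
  have h4 := (h2.symm.trans h1.fderiv_eq).trans h3
  have h5 := DFunLike.congr_fun h4 (0, b)
  simp [fderiv_tmap hφ, dtmap] at h5
  rw [nMap_apply hr, nMap_apply hr', h5, symm_hess hφ z.2 b]
  congr 1
  rw [← add_smul]
  norm_num

theorem IsCoordChange.dtmap_horLift (a : Eu n) :
    dtmap φ z (horLift l z a) = horLift l' (tmap φ z) (fderiv ℝ φ z.1 a) := by
  simp [dtmap, horLift, h.nMap_eq hr hr']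

theorem IsCoordChange.vcomp_eq (Y : Eu n × Eu n) :
    vcomp (nLoc l' (tmap φ z)) (dtmap φ z Y) = fderiv ℝ φ z.1 (vcomp (nLoc l z) Y) := by
  rw [vcomp_nLoc, vcomp_nLoc, map_add, h.nMap_eq hr hr', dtmap]
  exact (add_assoc _ _ _).trans ((add_comm _ _).trans (add_assoc _ _ _))

theorem IsCoordChange.dtmap_fromAdapted (Y : Eu n × Eu n) :
    dtmap φ z (fromAdapted (nLoc l z) Y) = fromAdapted (nLoc l' (tmap φ z))
      (fderiv ℝ φ z.1 Y.1, fderiv ℝ φ z.1 Y.2) := by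
  simp [fromAdapted_nLoc, dtmap, h.nMap_eq hr hr']
  abel

theorem IsCoordChange.dN_eq (X a : Eu n) : fderiv ℝ φ z.1 (dN l z X a)
    = dN l' (tmap φ z) (fderiv ℝ φ z.1 X) (fderiv ℝ φ z.1 a)
      + fderiv ℝ (fderiv ℝ φ) z.1 a X := by
  have h1 : (fun w : Eu n × Eu n => fderiv ℝ φ w.1 (nMap l w a)) =ᶠ[𝓝 z] fun w =>
      nMap l' (tmap φ w) (fderiv ℝ φ w.1 a) + fderiv ℝ (fderiv ℝ φ) w.1 a w.2 := by
    filter_upwards [h.regular_eventually hr hr'] with w ⟨a1, a2, a3⟩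
    exact a1.nMap_eq a2 a3 a
  have hφ := h.contDiffAt_map
  have hA := hasFDerivAt_jac hφ
  have hn := fun {l : Eu n × Eu n → ℝ} {z} (hr : IsRegularNear l z) =>
    ((contDiffAt_nMap hr).differentiableAt (by simp)).hasFDerivAt
  have h2 := (hA.clm_apply ((hn hr).clm_apply (hasFDerivAt_const a z))).fderiv
  have hB : HasFDerivAt (fun w : Eu n × Eu n => fderiv ℝ (fderiv ℝ φ) w.1) _ z :=
    ((((hφ.fderiv_right (m := ∞) (by simp)).fderiv_right (m := ∞) (by simp)).differentiableAt
      (by simp)).hasFDerivAt).comp z hasFDerivAt_fst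
  have h3 := (HasFDerivAt.add (((hn hr').comp z ((contDiffAt_tmap hφ).differentiableAt
    (by simp)).hasFDerivAt).clm_apply (hA.clm_apply (hasFDerivAt_const a z)))
    ((hB.clm_apply (hasFDerivAt_const a z)).clm_apply hasFDerivAt_snd)).fderiv
  have h4 := (h2.symm.trans h1.fderiv_eq).trans h3
  have h5 := DFunLike.congr_fun h4 (0, X)
  simp [fderiv_tmap hφ, dtmap] at h5
  exact h5

theorem IsCoordChange.dG_eq (v : Eu n × Eu n) (X Z : Eu n) :
    dG l z v X Z = dG l' (tmap φ z) (dtmap φ z v) (fderiv ℝ φ z.1 X) (fderiv ℝ φ z.1 Z)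
      + hessB l' (tmap φ z) (fderiv ℝ (fderiv ℝ φ) z.1 v.1 X) (fderiv ℝ φ z.1 Z)
      + hessB l' (tmap φ z) (fderiv ℝ φ z.1 X) (fderiv ℝ (fderiv ℝ φ) z.1 v.1 Z) := by
  have h1 : (fun w => hessB l w X Z) =ᶠ[𝓝 z] fun w =>
      hessB l' (tmap φ w) (fderiv ℝ φ w.1 X) (fderiv ℝ φ w.1 Z) := by
    filter_upwards [h.eventually] with w hw
    exact hw.hessB_eq X Z
  have hφ := h.contDiffAt_map
  have hA := hasFDerivAt_jac hφ
  have h3 := ((((((contDiffAt_hessB hr'.contDiffAt).differentiableAt (by simp)).hasFDerivAt).comp z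
    ((contDiffAt_tmap hφ).differentiableAt (by simp)).hasFDerivAt).clm_apply
      (hA.clm_apply (hasFDerivAt_const X z))).clm_apply
        (hA.clm_apply (hasFDerivAt_const Z z))).fderiv
  rw [← fderiv_hessB_apply hr]
  refine (DFunLike.congr_fun (h1.fderiv_eq.trans h3) v).trans ?_
  simp [fderiv_tmap hφ, dG]
  ring

theorem IsCoordChange.gLh_eq (a X : Eu n) : fderiv ℝ φ z.1 (gLh l z a X)
    = gLh l' (tmap φ z) (fderiv ℝ φ z.1 a) (fderiv ℝ φ z.1 X)
      + fderiv ℝ (fderiv ℝ φ) z.1 a X := by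
  refine h.ext hr hr' fun Z => ?_
  have h1 := hessB_gLh hr a X Z
  have h2 := hessB_gLh hr' (fderiv ℝ φ z.1 a) (fderiv ℝ φ z.1 X) (fderiv ℝ φ z.1 Z)
  simp only [h.dG_eq hr hr', h.dtmap_horLift hr hr', h.hessB_eq, horLift_fst] at h1
  rw [map_add, add_apply]
  have s := symm_hess h.contDiffAt_map
  have t := hessB_symm hr'.contDiffAt
  rw [s X a, s X Z, s Z a, t (fderiv ℝ φ z.1 X), t (fderiv ℝ φ z.1 a) (fderiv ℝ (fderiv ℝ φ) z.1 Z X)] at h1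
  linarith

theorem IsCoordChange.gCh_eq (c X : Eu n) : fderiv ℝ φ z.1 (gCh l z c X)
    = gCh l' (tmap φ z) (fderiv ℝ φ z.1 c) (fderiv ℝ φ z.1 X) := by
  refine h.ext hr hr' fun Z => ?_
  have h1 := hessB_gCh hr c X Z
  have h2 := hessB_gCh hr' (fderiv ℝ φ z.1 c) (fderiv ℝ φ z.1 X) (fderiv ℝ φ z.1 Z)
  simp only [h.dG_eq hr hr', h.hessB_eq, dtmap, map_zero, zero_apply, zero_add, add_zero] at h1
  linarith

theorem IsCoordChange.gLv_eq (a X : Eu n) : fderiv ℝ φ z.1 (gLv l z a X)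
    = gLv l' (tmap φ z) (fderiv ℝ φ z.1 a) (fderiv ℝ φ z.1 X)
      + fderiv ℝ (fderiv ℝ φ) z.1 a X := by
  refine h.ext hr hr' fun Z => ?_
  have h1 := hessB_gLv hr a X Z
  have h2 := hessB_gLv hr' (fderiv ℝ φ z.1 a) (fderiv ℝ φ z.1 X) (fderiv ℝ φ z.1 Z)
  simp only [h.dG_eq hr hr', h.dtmap_horLift hr hr', h.hessB_eq, h.dN_eq hr hr',
    horLift_fst, map_add, add_apply] at h1
  rw [map_add, add_apply]
  have t := hessB_symm hr'.contDiffAt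
  rw [t (fderiv ℝ φ z.1 X)] at h1
  linarith

theorem IsCoordChange.gCv_eq (c X : Eu n) : fderiv ℝ φ z.1 (gCv l z c X)
    = gCv l' (tmap φ z) (fderiv ℝ φ z.1 c) (fderiv ℝ φ z.1 X) := by
  refine h.ext hr hr' fun Z => ?_
  have h1 := hessB_gCv hr c X Z
  have h2 := hessB_gCv hr' (fderiv ℝ φ z.1 c) (fderiv ℝ φ z.1 X) (fderiv ℝ φ z.1 Z)
  simp only [h.dG_eq hr hr', h.hessB_eq, dtmap, map_zero, zero_apply, zero_add, add_zero] at h1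
  linarith

theorem IsCoordChange.gammaH_eq (v : Eu n × Eu n) (X : Eu n) : fderiv ℝ φ z.1 (gammaH l z v X)
    = fderiv ℝ (fderiv ℝ φ) z.1 v.1 X
      + gammaH l' (tmap φ z) (dtmap φ z v) (fderiv ℝ φ z.1 X) := by
  rw [gammaH, gammaH, h.vcomp_eq hr hr', map_add, h.gLh_eq hr hr', h.gCh_eq hr hr', dtmap]
  abel

theorem IsCoordChange.gammaV_eq (v : Eu n × Eu n) (X : Eu n) : fderiv ℝ φ z.1 (gammaV l z v X)
    = fderiv ℝ (fderiv ℝ φ) z.1 v.1 X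
      + gammaV l' (tmap φ z) (dtmap φ z v) (fderiv ℝ φ z.1 X) := by
  rw [gammaV, gammaV, h.vcomp_eq hr hr', map_add, h.gLv_eq hr hr', h.gCv_eq hr hr', dtmap]
  abel

end

theorem vcomp_comp_contDiffAt (hr : IsRegularNear l z) {Y : Eu n × Eu n → Eu n × Eu n} {k : ℕ∞}
    (hY : ContDiffAt ℝ k Y z) : ContDiffAt ℝ k (fun w => vcomp (nLoc l w) (Y w)) z :=
  (contDiffAt_snd.comp z hY).add (((contDiffAt_nMap hr).of_le (by exact_mod_cast le_top)).clm_apply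
    (contDiffAt_fst.comp z hY))

theorem vcomp_comp_differentiableAt (hr : IsRegularNear l z) {Y : Eu n × Eu n → Eu n × Eu n}
    (hY : DifferentiableAt ℝ Y z) : DifferentiableAt ℝ (fun w => vcomp (nLoc l w) (Y w)) z :=
  (differentiableAt_snd.comp z hY).add (((contDiffAt_nMap hr).differentiableAt (by simp)).clm_apply
    (differentiableAt_fst.comp z hY))

theorem fderiv_jac_comp (hφ : ContDiffAt ℝ ∞ φ z.1) {f f' : Eu n × Eu n → Eu n}
    (hf : DifferentiableAt ℝ f z) (hf' : DifferentiableAt ℝ f' (tmap φ z))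
    (he : ∀ᶠ w in 𝓝 z, f' (tmap φ w) = fderiv ℝ φ w.1 (f w)) (v : Eu n × Eu n) :
    fderiv ℝ f' (tmap φ z) (dtmap φ z v)
      = fderiv ℝ φ z.1 (fderiv ℝ f z v) + fderiv ℝ (fderiv ℝ φ) z.1 v.1 (f z) := by
  have h1 := (hf'.hasFDerivAt.comp z
    ((contDiffAt_tmap hφ).differentiableAt (by simp)).hasFDerivAt).fderiv
  have h2 := ((hasFDerivAt_jac hφ).clm_apply hf.hasFDerivAt).fderiv
  have h3 : (f' ∘ tmap φ) =ᶠ[𝓝 z] fun w => fderiv ℝ φ w.1 (f w) := he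
  have h4 := DFunLike.congr_fun ((h1.symm.trans h3.fderiv_eq).trans h2) v
  simpa [fderiv_tmap hφ] using h4

theorem IsCoordChange.covLoc_eq (h : IsCoordChange φ l l' z) (hr : IsRegularNear l z)
    (hr' : IsRegularNear l' (tmap φ z)) {Y Y' : Eu n × Eu n → Eu n × Eu n}
    (hY : DifferentiableAt ℝ Y z) (hY' : DifferentiableAt ℝ Y' (tmap φ z))
    (he : ∀ᶠ w in 𝓝 z, Y' (tmap φ w) = dtmap φ w (Y w)) (v : Eu n × Eu n) :
    dtmap φ z (covLoc (nLoc l) (hessLoc l) (hessLoc l) Y z v)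
      = covLoc (nLoc l') (hessLoc l') (hessLoc l') Y' (tmap φ z) (dtmap φ z v) := by
  rw [covLoc_apply hr, covLoc_apply hr', h.dtmap_fromAdapted hr hr', map_add, map_add,
    h.gammaH_eq hr hr', h.gammaV_eq hr hr', he.self_of_nhds, h.vcomp_eq hr hr',
    fderiv_jac_comp h.contDiffAt_map (f := fun w => (Y w).1) (f' := fun w => (Y' w).1)
      (differentiableAt_fst.comp z hY) (differentiableAt_fst.comp _ hY')
      (he.mono fun w hw => by rw [hw]; rfl),
    fderiv_jac_comp h.contDiffAt_map (f := fun w => vcomp (nLoc l w) (Y w))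
      (f' := fun w => vcomp (nLoc l' w) (Y' w)) (vcomp_comp_differentiableAt hr hY)
      (vcomp_comp_differentiableAt hr' hY') (by
        filter_upwards [he, h.regular_eventually hr hr'] with w hw ⟨a1, a2, a3⟩
        rw [hw, a1.vcomp_eq a2 a3])]
  congr 2 <;> abel

theorem IsCoordChange.sasakiLoc_eq (h : IsCoordChange φ l l' z) (hr : IsRegularNear l z)
    (hr' : IsRegularNear l' (tmap φ z)) (Y Z : Eu n × Eu n) :
    sasakiLoc (nLoc l z) (hessLoc l z) Y Z = sasakiLoc (nLoc l' (tmap φ z))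
      (hessLoc l' (tmap φ z)) (dtmap φ z Y) (dtmap φ z Z) := by
  rw [sasakiLoc, sasakiLoc, sum_hessLoc_mul hr.contDiffAt, sum_hessLoc_mul hr.contDiffAt,
    sum_hessLoc_mul hr'.contDiffAt, sum_hessLoc_mul hr'.contDiffAt, h.vcomp_eq hr hr',
    h.vcomp_eq hr hr', h.hessB_eq, h.hessB_eq]
  rfl

/-- The metric compatibility of the connection coefficients. -/
theorem dG_eq_gammaH (hr : IsRegularNear l z) (v : Eu n × Eu n) (X Z : Eu n) :
    dG l z v X Z = hessB l z (gammaH l z v X) Z + hessB l z X (gammaH l z v Z) := by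
  have hv : v = horLift l z v.1 + (0, vcomp (nLoc l z) v) := by
    rw [vcomp_nLoc, horLift]; ext1 <;> simp
  have t := hessB_symm hr.contDiffAt
  have s := dG_symm hr
  have a1 := hessB_gLh hr v.1 X Z
  have a2 := hessB_gLh hr v.1 Z X
  have b1 := hessB_gCh hr (vcomp (nLoc l z) v) X Z
  have b2 := hessB_gCh hr (vcomp (nLoc l z) v) Z X
  have hl : dG l z v X Z = dG l z (horLift l z v.1) X Z + dG l z (0, vcomp (nLoc l z) v) X Z := by
    conv_lhs => rw [hv]
    exact dG_add_left _ _ _ _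
  rw [hl, gammaH, gammaH, map_add, map_add, add_apply, t X, t X]
  rw [s _ Z X, s _ Z v.1, s _ v.1 X] at a2
  rw [s _ Z X] at b2
  linarith [s (horLift l z X) v.1 Z]

theorem dG_eq_gammaV (hr : IsRegularNear l z) (v : Eu n × Eu n) (X Z : Eu n) :
    dG l z v X Z = hessB l z (gammaV l z v X) Z + hessB l z X (gammaV l z v Z) := by
  have hv : v = horLift l z v.1 + (0, vcomp (nLoc l z) v) := by
    rw [vcomp_nLoc, horLift]; ext1 <;> simp
  have t := hessB_symm hr.contDiffAt
  have s := dG_symm hr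
  have a1 := hessB_gLv hr v.1 X Z
  have a2 := hessB_gLv hr v.1 Z X
  have b1 := hessB_gCv hr (vcomp (nLoc l z) v) X Z
  have b2 := hessB_gCv hr (vcomp (nLoc l z) v) Z X
  have hl : dG l z v X Z = dG l z (horLift l z v.1) X Z + dG l z (0, vcomp (nLoc l z) v) X Z := by
    conv_lhs => rw [hv]
    exact dG_add_left _ _ _ _
  rw [hl, gammaV, gammaV, map_add, map_add, add_apply, t X, t X]
  rw [s _ Z X] at a2
  rw [s _ Z X, s _ Z (vcomp (nLoc l z) v), s _ (vcomp (nLoc l z) v) X] at b2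
  linarith [s (0, X) (vcomp (nLoc l z) v) Z, s (0, Z) X (vcomp (nLoc l z) v)]

end CoordinateChange

local instance topologicalSpaceTM (n : ℕ) (M : Type*) [TopologicalSpace M] [ChartedSpace (Eu n) M]
    [IsManifold (𝓡 n) ∞ M] : TopologicalSpace (TM n M) := inferInstance

local instance normedAlgebraEu (n : ℕ) :
    NormedAlgebra ℝ ((Eu n × Eu n) →L[ℝ] (Eu n × Eu n)) := inferInstance

local instance isManifoldTM (n : ℕ) (M : Type*) [TopologicalSpace M] [ChartedSpace (Eu n) M]
    [IsManifold (𝓡 n) ∞ M] : IsManifold (IT n) 1 (TM n M) :=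
  IsManifold.of_le (n := ∞) (by simp)

section Coordinates

variable {n : ℕ} {M : Type*} [TopologicalSpace M] [ChartedSpace (Eu n) M]
  [IsManifold (𝓡 n) ∞ M]

theorem coord_apply (w u : TM n M) :
    coord w u = (extChartAt (𝓡 n) w.1 u.1, tangentCoordChange (𝓡 n) u.1 w.1 u.1 u.2) := by
  change extChartAt ((𝓡 n).prod 𝓘(ℝ, Eu n)) w u = _
  rw [FiberBundle.extChartAt]
  rfl

theorem mem_coord_source (w u : TM n M) :
    u ∈ (coord w).source ↔ u.1 ∈ (extChartAt (𝓡 n) w.1).source := by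
  rw [extChartAt_source, extChartAt_source, TangentBundle.mem_chart_source_iff]

theorem mem_coord_source_self (u : TM n M) : u ∈ (coord u).source := mem_extChartAt_source u

theorem isOpen_slit : IsOpen (slit n M) := by
  rw [isOpen_iff_mem_nhds]
  intro u hu
  have h1 : (coord u u).2 ≠ 0 := by
    rw [coord_apply]
    have h := tangentCoordChange_self (I := 𝓡 n) (x := u.1) (v := u.2)
      (mem_extChartAt_source (I := 𝓡 n) u.1)
    exact fun h0 => hu (h.symm.trans h0)
  have h2 : ContinuousAt (fun v => (coord u v).2) u :=
    continuous_snd.continuousAt.comp (continuousAt_extChartAt u)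
  filter_upwards [h2.eventually_ne h1] with v hv h0
  refine hv ?_
  rw [coord_apply]
  simp only [h0]
  exact map_zero _

/-- The coordinate change of `M` underlying the change of natural coordinates from `u` to `w`. -/
def chartChange (u w : TM n M) : Eu n → Eu n :=
  extChartAt (𝓡 n) w.1 ∘ (extChartAt (𝓡 n) u.1).symm

variable {u w : TM n M}

theorem coord_eq_tmap {v : TM n M} (hu : v ∈ (coord u).source) (hw : v ∈ (coord w).source) :
    coord w v = tmap (chartChange u w) (coord u v) := by
  rw [mem_coord_source] at hu hw
  rw [coord_apply, coord_apply, tmap]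
  have h1 : chartChange u w (extChartAt (𝓡 n) u.1 v.1) = extChartAt (𝓡 n) w.1 v.1 :=
    congrArg _ ((extChartAt (𝓡 n) u.1).left_inv hu)
  have h2 : fderiv ℝ (chartChange u w) (extChartAt (𝓡 n) u.1 v.1)
      = tangentCoordChange (𝓡 n) u.1 w.1 v.1 := by
    rw [tangentCoordChange_def, (𝓡 n).range_eq_univ, fderivWithin_univ]
    rfl
  rw [h1, h2]
  exact Prod.ext rfl (tangentCoordChange_comp (I := 𝓡 n) (v := v.2)
    ⟨⟨mem_extChartAt_source v.1, hu⟩, hw⟩).symm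

theorem contDiffAt_chartChange {x : Eu n} (hx : x ∈ (extChartAt (𝓡 n) u.1).target)
    (hx' : (extChartAt (𝓡 n) u.1).symm x ∈ (extChartAt (𝓡 n) w.1).source) :
    ContDiffAt ℝ ∞ (chartChange u w) x := by
  have h := contDiffWithinAt_ext_coord_change (I := 𝓡 n) (n := ∞) w.1 u.1 (y := x) ⟨hx, hx'⟩
  rwa [(𝓡 n).range_eq_univ, contDiffWithinAt_univ] at h

theorem bijective_fderiv_chartChange {x : Eu n} (hx : x ∈ (extChartAt (𝓡 n) u.1).target)
    (hx' : (extChartAt (𝓡 n) u.1).symm x ∈ (extChartAt (𝓡 n) w.1).source) :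
    Function.Bijective (fderiv ℝ (chartChange u w) x) := by
  set y := (extChartAt (𝓡 n) u.1).symm x with hy
  have hyu : y ∈ (extChartAt (𝓡 n) u.1).source := (extChartAt (𝓡 n) u.1).map_target hx
  have h2 : fderiv ℝ (chartChange u w) x = tangentCoordChange (𝓡 n) u.1 w.1 y := by
    rw [tangentCoordChange_def, (𝓡 n).range_eq_univ, fderivWithin_univ, hy,
      (extChartAt (𝓡 n) u.1).right_inv hx]
    rfl
  rw [h2]
  refine Function.bijective_iff_has_inverse.2 ⟨tangentCoordChange (𝓡 n) w.1 u.1 y, fun a => ?_,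
    fun a => ?_⟩
  · rw [tangentCoordChange_comp ⟨⟨hyu, hx'⟩, hyu⟩, tangentCoordChange_self hyu]
  · rw [tangentCoordChange_comp ⟨⟨hx', hyu⟩, hx'⟩, tangentCoordChange_self hx']

theorem eventually_coord {V : Set (TM n M)} (hV : IsOpen V) {v : TM n M} (hv : v ∈ V)
    (hu : v ∈ (coord u).source) : ∀ᶠ z in 𝓝 (coord u v), z ∈ (coord u).target ∧
      (coord u).symm z ∈ V :=
  eventually_chart hV ((coord u).map_source hu) (by rwa [(coord u).left_inv hu])

theorem tmap_coord_symm {z : Eu n × Eu n} (hz : z ∈ (coord u).target)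
    (hw : (coord u).symm z ∈ (coord w).source) :
    tmap (chartChange u w) z = coord w ((coord u).symm z) := by
  rw [coord_eq_tmap ((coord u).map_target hz) hw, (coord u).right_inv hz]

variable {L : TM n M → ℝ}

theorem contDiffAt_funRep (hL : IsLagrangeSpace L) {v : TM n M} (hv : v ∈ slit n M)
    (hw : v ∈ (coord w).source) : ContDiffAt ℝ ∞ (funRep L w) (coord w v) :=
  (contMDiffAt_iff_contDiffAt_chart (I := IT n) hw).1
    ((hL.smooth v hv).contMDiffAt (isOpen_slit.mem_nhds hv))

theorem isCoordChange_chartChange (hL : IsLagrangeSpace L) {v : TM n M} (hv : v ∈ slit n M)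
    (hu : v ∈ (coord u).source) (hw : v ∈ (coord w).source) :
    IsCoordChange (chartChange u w) (funRep L u) (funRep L w) (coord u v) := by
  filter_upwards [eventually_coord (isOpen_slit.inter (isOpen_extChartAt_source (I := IT n) w))
    ⟨hv, hw⟩ hu] with z ⟨hz, hz', hzw⟩
  have hzu := (coord u).map_target hz
  have e1 : z.1 = extChartAt (𝓡 n) u.1 ((coord u).symm z).1 := by
    conv_lhs => rw [← (coord u).right_inv hz, coord_apply]
  have t1 : z.1 ∈ (extChartAt (𝓡 n) u.1).target := by
    rw [e1]
    exact (extChartAt (𝓡 n) u.1).map_source ((mem_coord_source _ _).1 hzu)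
  have t2 : (extChartAt (𝓡 n) u.1).symm z.1 ∈ (extChartAt (𝓡 n) w.1).source := by
    rw [e1, (extChartAt (𝓡 n) u.1).left_inv ((mem_coord_source _ _).1 hzu)]
    exact (mem_coord_source _ _).1 hzw
  refine ⟨contDiffAt_chartChange t1 t2, bijective_fderiv_chartChange t1 t2, ?_, ?_⟩
  · rw [tmap_coord_symm hz hzw, funRep, funRep, (coord w).left_inv hzw]
  · rw [tmap_coord_symm hz hzw]
    exact contDiffAt_funRep hL hz' hzw

theorem isRegularNear_funRep (hL : IsLagrangeSpace L) {v : TM n M} (hv : v ∈ slit n M)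
    (hw : v ∈ (coord w).source) : IsRegularNear (funRep L w) (coord w v) := by
  filter_upwards [eventually_coord isOpen_slit hv hw] with z ⟨hz, hz'⟩
  have hzw := (coord w).map_target hz
  have h1 := contDiffAt_funRep hL hz' hzw
  have h2 := (isCoordChange_chartChange hL hz' (mem_coord_source_self _) hzw).det_iff.1
    (hL.regular _ hz')
  rw [← coord_eq_tmap (mem_coord_source_self _) hzw] at h2
  rw [(coord w).right_inv hz] at h1 h2
  exact ⟨h1, h2⟩

theorem dtmap_dcoord {v : TM n M} (hu : v ∈ (coord u).source) (hw : v ∈ (coord w).source)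
    (Y : Eu n × Eu n) : dtmap (chartChange u w) (coord u v) (dchart (IT n) u v Y)
      = dchart (IT n) w v Y := by
  have h0 : coord w =ᶠ[𝓝 v] tmap (chartChange u w) ∘ coord u := by
    filter_upwards [extChartAt_source_mem_nhds' (I := IT n) hu,
      extChartAt_source_mem_nhds' (I := IT n) hw] with y h1 h2
    exact coord_eq_tmap h1 h2
  have hc : ContDiffAt ℝ ∞ (chartChange u w) (coord u v).1 := by
    rw [coord_apply]
    rw [mem_coord_source] at hu hw
    exact contDiffAt_chartChange ((extChartAt (𝓡 n) u.1).map_source hu)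
      (by rwa [(extChartAt (𝓡 n) u.1).left_inv hu])
  have h1 := mfderiv_comp (I' := 𝓘(ℝ, Eu n × Eu n)) v
    ((contDiffAt_tmap hc).differentiableAt (by simp)).mdifferentiableAt
    (mdifferentiableAt_chart hu)
  rw [← h0.mfderiv_eq, mfderiv_eq_fderiv] at h1
  exact ((DFunLike.congr_fun h1 Y).trans (fderiv_tmap hc _)).symm

theorem fieldRep_tmap (Y : Π u : TM n M, TangentSpace (IT n) u) {z : Eu n × Eu n}
    (hz : z ∈ (coord u).target) (hw : (coord u).symm z ∈ (coord w).source) :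
    fieldRep Y w (tmap (chartChange u w) z) = dtmap (chartChange u w) z (fieldRep Y u z) := by
  have h1 := dtmap_dcoord ((coord u).map_target hz) hw (Y ((coord u).symm z))
  rw [(coord u).right_inv hz] at h1
  rw [tmap_coord_symm hz hw]
  refine Eq.trans ?_ h1.symm
  rw [fieldRep, (coord w).left_inv hw]
  rfl

theorem fieldRep_coord (Y : Π u : TM n M, TangentSpace (IT n) u) {v : TM n M}
    (hw : v ∈ (coord w).source) : fieldRep Y w (coord w v) = dchart (IT n) w v (Y v) := by
  rw [fieldRep, (coord w).left_inv hw]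
  rfl

theorem differentiableAt_fieldRep {Y : Π u : TM n M, TangentSpace (IT n) u} {v : TM n M}
    (hY : MDifferentiableAt (IT n) ((IT n).prod 𝓘(ℝ, Eu n × Eu n))
      (fun u => TotalSpace.mk' (Eu n × Eu n) u (Y u)) v) (hw : v ∈ (coord w).source) :
    DifferentiableAt ℝ (fieldRep Y w) (coord w v) := by
  have h := (mdifferentiableAt_section_iff_secRep (F := Eu n × Eu n)
    (W := fun x : TM n M => TangentSpace (IT n) x)
    (e := trivializationAt (Eu n × Eu n) (TangentSpace (IT n)) w)
    (by simpa [extChartAt_source] using hw) hw).1 hY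
  refine h.congr_of_eventuallyEq ?_
  filter_upwards [extChartAt_target_mem_nhds' ((coord w).map_source hw)] with z hz
  exact (secRep_tangent w Y hz).symm

theorem dchart_lagN (hL : IsLagrangeSpace L) {v : TM n M} (hv : v ∈ slit n M)
    (hw : v ∈ (coord w).source) (Y : Eu n × Eu n) :
    dchart (IT n) w v (lagN L v Y)
      = (0, vcomp (nLoc (funRep L w) (coord w v)) (dchart (IT n) w v Y)) := by
  have hv0 := mem_coord_source_self v
  have h := isCoordChange_chartChange hL hv hv0 hw
  have hr := isRegularNear_funRep hL hv hv0
  have hr' := isRegularNear_funRep hL hv hw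
  rw [coord_eq_tmap hv0 hw] at hr'
  have e1 : ∀ Y : Eu n × Eu n, dchart (IT n) w v Y = dtmap (chartChange v w) (coord v v) Y :=
    fun Y => by
      rw [← dtmap_dcoord hv0 hw Y, dchart_self]
      rfl
  rw [e1 Y, coord_eq_tmap hv0 hw, h.vcomp_eq hr hr']
  refine (e1 _).trans ?_
  change dtmap _ _ (0, vcomp (nLoc (funRep L v) (coord v v)) Y) = _
  simp [dtmap]

theorem lagG_eq (hL : IsLagrangeSpace L) {v : TM n M} (hv : v ∈ slit n M)
    (hw : v ∈ (coord w).source) (Y Z : Eu n × Eu n) :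
    lagG L v Y Z = sasakiLoc (nLoc (funRep L w) (coord w v)) (hessLoc (funRep L w) (coord w v))
      (dchart (IT n) w v Y) (dchart (IT n) w v Z) := by
  have hv0 := mem_coord_source_self v
  have h := isCoordChange_chartChange hL hv hv0 hw
  have hr := isRegularNear_funRep hL hv hv0
  have hr' := isRegularNear_funRep hL hv hw
  rw [coord_eq_tmap hv0 hw] at hr'
  have e1 : ∀ Y : Eu n × Eu n, dchart (IT n) w v Y = dtmap (chartChange v w) (coord v v) Y :=
    fun Y => by
      rw [← dtmap_dcoord hv0 hw Y, dchart_self]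
      rfl
  rw [e1 Y, e1 Z, coord_eq_tmap hv0 hw, ← h.sasakiLoc_eq hr hr']
  rfl

theorem dchart_lagD (hL : IsLagrangeSpace L) {Y : Π u : TM n M, TangentSpace (IT n) u}
    {v : TM n M} (hv : v ∈ slit n M) (hY : MDifferentiableAt (IT n) ((IT n).prod 𝓘(ℝ, Eu n × Eu n))
      (fun u => TotalSpace.mk' (Eu n × Eu n) u (Y u)) v) (hw : v ∈ (coord w).source)
    (Z : Eu n × Eu n) :
    dchart (IT n) w v (lagD L Y v Z) = covLoc (nLoc (funRep L w)) (hessLoc (funRep L w))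
        (hessLoc (funRep L w)) (fieldRep Y w) (coord w v) (dchart (IT n) w v Z) := by
  have hv0 := mem_coord_source_self v
  have h := isCoordChange_chartChange hL hv hv0 hw
  have hr := isRegularNear_funRep hL hv hv0
  have hr' := isRegularNear_funRep hL hv hw
  have hd' := differentiableAt_fieldRep hY hw
  rw [coord_eq_tmap hv0 hw] at hr' hd'
  have e1 : ∀ Y : Eu n × Eu n, dchart (IT n) w v Y = dtmap (chartChange v w) (coord v v) Y :=
    fun Y => by
      rw [← dtmap_dcoord hv0 hw Y, dchart_self]
      rfl
  rw [e1 Z, coord_eq_tmap hv0 hw, ← h.covLoc_eq hr hr' (differentiableAt_fieldRep hY hv0) hd']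
  · exact e1 _
  · filter_upwards [eventually_coord (isOpen_extChartAt_source (I := IT n) w) hw hv0]
      with z ⟨hz, hzw⟩
    exact fieldRep_tmap Y hz hzw

theorem SmoothFieldOn.mdifferentiableAt {U : Set (TM n M)} (hU : IsOpen U)
    {Y : Π u : TM n M, TangentSpace (IT n) u} (hY : SmoothFieldOn U Y) {v : TM n M} (hv : v ∈ U) :
    MDifferentiableAt (IT n) ((IT n).prod 𝓘(ℝ, Eu n × Eu n))
      (fun u => TotalSpace.mk' (Eu n × Eu n) u (Y u)) v :=
  ((hY v hv).contMDiffAt (hU.mem_nhds hv)).mdifferentiableAt (by simp)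

theorem isGloballyDefined (hL : IsLagrangeSpace L) : IsGloballyDefined L where
  nconn _ _ hu hw Y := dchart_lagN hL hu hw Y
  dmetric _ _ hu hw Y Z := lagG_eq hL hu hw Y Z
  dconn _ _ hUV hU _ hY _ hu hw Z := dchart_lagD hL (hUV hu) (hY.mdifferentiableAt hU hu) hw Z

theorem mfderiv_proj (u : TM n M) (Y : Eu n × Eu n) :
    mfderiv (IT n) (𝓡 n) (fun w : TM n M => w.1) u Y = Y.1 := by
  have hp : MDifferentiableAt (IT n) (𝓡 n) (fun w : TM n M => w.1) u :=
    (contMDiff_proj (n := 1) (TangentSpace (𝓡 n)) u).mdifferentiableAt (by simp)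
  have hu := mem_coord_source_self u
  have h0 : extChartAt (𝓡 n) u.1 ∘ (fun w : TM n M => w.1) = Prod.fst ∘ coord u := by
    ext1 v
    simp only [Function.comp_apply, coord_apply]
  have h1 := mfderiv_comp (I' := 𝓡 n) (I'' := 𝓘(ℝ, Eu n)) u
    (mdifferentiableAt_chart (mem_extChartAt_source (I := 𝓡 n) u.1)) hp
  have h2 := mfderiv_comp (I' := 𝓘(ℝ, Eu n × Eu n)) (I'' := 𝓘(ℝ, Eu n)) u
    (differentiableAt_fst (𝕜 := ℝ) (p := coord u u)).mdifferentiableAt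
    (mdifferentiableAt_chart hu)
  rw [← h0, mfderiv_eq_fderiv] at h2
  have h3 := DFunLike.congr_fun (h1.symm.trans h2) Y
  have h4 : dchart (𝓡 n) u.1 u.1 (mfderiv (IT n) (𝓡 n) (fun w : TM n M => w.1) u Y)
    = (fderiv ℝ Prod.fst (coord u u)) (dchart (IT n) u u Y) := h3
  rw [dchart_self, dchart_self, fderiv_fst] at h4
  exact h4

theorem isNConnection_lagN (hL : IsLagrangeSpace L) : IsNConnection (lagN L) where
  vertical u _ Y := mfderiv_proj u _
  splits u _ Y hY := by
    have key : ∀ Y : Eu n × Eu n, Y.1 = 0 →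
        ((0 : Eu n), vcomp (nLoc (funRep L u) (coord u u)) Y) = Y := by
      intro Y h1
      rw [vcomp_nLoc, h1, map_zero, add_zero, ← h1]
    exact key Y ((mfderiv_proj u Y).symm.trans hY)
  smooth U hUV hU Y hY u hu := by
    have hu0 := mem_coord_source_self u
    have h1 := (contMDiffAt_field_iff_vecRep hu0).1 ((hY u hu).contMDiffAt (hU.mem_nhds hu))
    have hr := isRegularNear_funRep hL (hUV hu) hu0
    refine ((contMDiffAt_field_iff_vecRep hu0).2 ?_).contMDiffWithinAt
    refine ((contDiffAt_const (c := (0 : Eu n))).prodMk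
      (vcomp_comp_contDiffAt (k := ⊤) hr h1)).congr_of_eventuallyEq ?_
    filter_upwards [eventually_coord isOpen_slit (hUV hu) hu0] with z ⟨hz, hz'⟩
    refine (dchart_lagN hL hz' ((coord u).map_target hz) _).trans ?_
    rw [(coord u).right_inv hz]
    rfl

end Coordinates

section OfConnForm

variable {E : Type*} [NormedAddCommGroup E] [NormedSpace ℝ E]
  {H : Type*} [TopologicalSpace H] {I : ModelWithCorners ℝ E H} [I.Boundaryless]
  {X : Type*} [TopologicalSpace X] [ChartedSpace H X] [IsManifold I ∞ X] [IsManifold I 1 X]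
  {F : Type*} [NormedAddCommGroup F] [NormedSpace ℝ F]
  {W : X → Type*} [TopologicalSpace (TotalSpace F W)]
  [∀ x, AddCommGroup (W x)] [∀ x, Module ℝ (W x)] [∀ x, TopologicalSpace (W x)]
  [∀ x, IsTopologicalAddGroup (W x)] [∀ x, ContinuousSMul ℝ (W x)] [FiberBundle F W]
  [VectorBundle ℝ F W] [ContMDiffVectorBundle ∞ F W I]

theorem isSmoothConnectionOn_of_hasConnForm [FiniteDimensional ℝ E] {V : Set X}
    {D : (Π x : X, W x) → (Π x : X, TangentSpace I x →L[ℝ] W x)}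
    (h : ∀ x ∈ V, ∃ A, HasConnForm V D (trivializationAt F W x) x A) :
    IsSmoothConnectionOn F V D where
  isCov := by
    constructor
    · intro σ σ' x hσ hσ' hx
      obtain ⟨A, hA⟩ := h x hx
      have he := FiberBundle.mem_baseSet_trivializationAt F W x
      have hw := mem_extChartAt_source (I := I) x
      have hA := (hA x hx he hw).2
      have d := (mdifferentiableAt_section_iff_secRep he hw).1 hσ
      have d' := (mdifferentiableAt_section_iff_secRep he hw).1 hσ'
      have ha : secRep I (trivializationAt F W x) x (σ + σ')
          = secRep I (trivializationAt F W x) x σ + secRep I (trivializationAt F W x) x σ' := by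
        ext1 z; exact map_add _ _ _
      ext v
      refine (frameEquiv (trivializationAt F W x) he).symm.injective ?_
      have e1 : ∀ u, (frameEquiv (trivializationAt F W x) he).symm u
        = (trivializationAt F W x).continuousLinearMapAt ℝ x u := fun u => rfl
      have hs : MDifferentiableAt I (I.prod 𝓘(ℝ, F))
          (fun y => TotalSpace.mk' F y ((σ + σ') y)) x := by
        refine (mdifferentiableAt_section_iff_secRep he hw).2 ?_
        rw [ha]
        exact d.add d'
      refine (e1 _).trans ((hA _ hs v).trans ?_)
      refine Eq.trans ?_ (((e1 _).trans (map_add _ (D σ x v) (D σ' x v))).trans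
        (congrArg₂ (· + ·) (hA _ hσ v) (hA _ hσ' v))).symm
      rw [ha, fderiv_add d d']
      simp only [add_apply, Pi.add_apply, map_add]
      abel
    · intro σ g x hσ hg hx
      obtain ⟨A, hA⟩ := h x hx
      have he := FiberBundle.mem_baseSet_trivializationAt F W x
      have hw := mem_extChartAt_source (I := I) x
      have hA := (hA x hx he hw).2
      have d := (mdifferentiableAt_section_iff_secRep he hw).1 hσ
      have dg := (mdifferentiableAt_iff_differentiableAt_chart hw).1 hg
      have ha : secRep I (trivializationAt F W x) x (g • σ) = fun z =>
          (g ∘ (extChartAt I x).symm) z • secRep I (trivializationAt F W x) x σ z := by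
        ext1 z; exact map_smul _ _ _
      ext v
      refine (frameEquiv (trivializationAt F W x) he).symm.injective ?_
      have e1 : ∀ u, (frameEquiv (trivializationAt F W x) he).symm u
        = (trivializationAt F W x).continuousLinearMapAt ℝ x u := fun u => rfl
      have hs : MDifferentiableAt I (I.prod 𝓘(ℝ, F))
          (fun y => TotalSpace.mk' F y ((g • σ) y)) x := by
        refine (mdifferentiableAt_section_iff_secRep he hw).2 ?_
        rw [ha]
        exact dg.smul d
      have hg0 : (g ∘ (extChartAt I x).symm) (extChartAt I x x) = g x := by
        rw [Function.comp_apply, (extChartAt I x).left_inv hw]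
      have hs0 : secRep I (trivializationAt F W x) x σ (extChartAt I x x)
          = (trivializationAt F W x).continuousLinearMapAt ℝ x (σ x) := by
        rw [secRep, (extChartAt I x).left_inv hw]
      refine (e1 _).trans ((hA _ hs v).trans ?_)
      refine Eq.trans ?_ (((e1 _).trans (map_add _ (g x • D σ x v) (mvfderiv I g x v • σ x))).trans
        (congrArg₂ (· + ·) ((map_smul _ _ _).trans (congrArg (g x • ·) (hA _ hσ v)))
          ((map_smul _ _ _).trans (congrArg (· • _) (mvfderiv_eq_fderiv_chart hw hg v))))).symm
      rw [ha, fderiv_fun_smul dg d]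
      simp only [add_apply, smul_apply, Pi.smul_apply', map_smul, hg0, hs0, smul_add,
        ContinuousLinearMap.smulRight_apply]
      abel
  smooth U hUV hU := by
    constructor
    intro σ hσ x hx
    rw [show (∞ : WithTop ℕ∞) + 1 = ∞ from rfl] at hσ
    obtain ⟨A, hA⟩ := h x (hUV hx)
    refine ContMDiffAt.contMDiffWithinAt ?_
    rw [contMDiffAt_hom_bundle]
    refine ⟨contMDiffAt_id, ?_⟩
    have he := FiberBundle.mem_baseSet_trivializationAt F W x
    have hw := mem_extChartAt_source (I := I) x
    have hs := (contMDiffAt_section_iff_secRep he hw).1 ((hσ x hx).contMDiffAt (hU.mem_nhds hx))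
    refine (contMDiffAt_iff_contDiffAt_chart hw).2 ?_
    have h1 : ContDiffAt ℝ ∞ (fun z => fderiv ℝ (secRep I (trivializationAt F W x) x σ) z
        + (A z).flip (secRep I (trivializationAt F W x) x σ z)) (extChartAt I x x) :=
      contDiffAt_clm_of_apply fun v => ((hs.fderiv_right (m := ∞) (by simp)).clm_apply
        (contDiffAt_const (c := v))).add
          (((hA x (hUV hx) he hw).1.clm_apply (contDiffAt_const (c := v))).clm_apply hs)
    refine h1.congr_of_eventuallyEq ?_
    filter_upwards [eventually_chart (hU.inter (trivializationAt F W x).open_baseSet)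
      ((extChartAt I x).map_source hw) (by
        rw [(extChartAt I x).left_inv hw]; exact ⟨hx, he⟩)] with z ⟨hz, hzU, hze⟩
    have hzw := (extChartAt I x).map_target hz
    have hzs : MDifferentiableAt I (I.prod 𝓘(ℝ, F)) (fun y => TotalSpace.mk' F y (σ y))
        ((extChartAt I x).symm z) :=
      ((hσ _ hzU).contMDiffAt (hU.mem_nhds hzU)).mdifferentiableAt (by simp)
    have hzc : (extChartAt I x).symm z ∈ (chartAt H x).source := by
      rwa [extChartAt_source] at hzw
    ext v
    have hv : dchart I x ((extChartAt I x).symm z)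
        ((trivializationAt E (TangentSpace I) x).symmL ℝ ((extChartAt I x).symm z) v) = v := by
      rw [← clma_trivializationAt_tangent hzw]
      exact Trivialization.continuousLinearMapAt_symmL _ (by simpa using hzc) v
    have h2 := (hA _ (hUV hzU) hze hzw).2 σ hzs
      ((trivializationAt E (TangentSpace I) x).symmL ℝ ((extChartAt I x).symm z) v)
    rw [hv, (extChartAt I x).right_inv hz] at h2
    refine Eq.trans ?_ h2
    rfl

end OfConnForm

section ConnForm

variable {n : ℕ} {l : Eu n × Eu n → ℝ} {z : Eu n × Eu n}

theorem IsBilin.zero_right {f : Eu n → Eu n → Eu n} (hf : IsBilin f) (a : Eu n) : f a 0 = 0 := by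
  simpa using hf.smul_right 0 a 0

theorem contDiffAt_dG (h : IsRegularNear l z) {v : Eu n × Eu n → Eu n × Eu n}
    {X Z : Eu n × Eu n → Eu n} (hv : ContDiffAt ℝ ∞ v z) (hX : ContDiffAt ℝ ∞ X z)
    (hZ : ContDiffAt ℝ ∞ Z z) : ContDiffAt ℝ ∞ (fun w => dG l w (v w) (X w) (Z w)) z :=
  ((((contDiffAt_hessB h.contDiffAt).fderiv_right (m := ∞) (by simp)).clm_apply hv).clm_apply
    hX).clm_apply hZ

theorem contDiffAt_dN (h : IsRegularNear l z) {X a : Eu n × Eu n → Eu n}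
    (hX : ContDiffAt ℝ ∞ X z) (ha : ContDiffAt ℝ ∞ a z) :
    ContDiffAt ℝ ∞ (fun w => dN l w (X w) (a w)) z :=
  (((contDiffAt_nMap h).fderiv_right (m := ∞) (by simp)).clm_apply
    (contDiffAt_const.prodMk hX)).clm_apply ha

theorem contDiffAt_horLift (h : IsRegularNear l z) {a : Eu n × Eu n → Eu n}
    (ha : ContDiffAt ℝ ∞ a z) : ContDiffAt ℝ ∞ (fun w => horLift l w (a w)) z :=
  ha.prodMk ((contDiffAt_nMap h).clm_apply ha).neg

theorem contDiffAt_gammaH (h : IsRegularNear l z) (v : Eu n × Eu n) (X : Eu n) :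
    ContDiffAt ℝ ∞ (fun w => gammaH l w v X) z := by
  have hc : ∀ a : Eu n, ContDiffAt ℝ ∞ (fun _ : Eu n × Eu n => a) z := fun a => contDiffAt_const
  have hh := fun a => contDiffAt_horLift h (hc a)
  have hv := vcomp_comp_contDiffAt (k := ⊤) h (contDiffAt_const (c := v))
  exact ((contDiffAt_sharp h fun r => ((contDiffAt_dG h (hh _) (hc _) (hc _)).add
    (contDiffAt_dG h (hh _) (hc _) (hc _))).sub (contDiffAt_dG h (hh _) (hc _) (hc _))).const_smul
      (1 / 2 : ℝ)).add ((contDiffAt_sharp h fun r => contDiffAt_dG h (contDiffAt_const.prodMk hv)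
        (hc _) (hc _)).const_smul (1 / 2 : ℝ))

theorem contDiffAt_gammaV (h : IsRegularNear l z) (v : Eu n × Eu n) {X : Eu n × Eu n → Eu n}
    (hX : ContDiffAt ℝ ∞ X z) :
    ContDiffAt ℝ ∞ (fun w => gammaV l w v (X w)) z := by
  have hc : ∀ a : Eu n, ContDiffAt ℝ ∞ (fun _ : Eu n × Eu n => a) z := fun a => contDiffAt_const
  have hh := fun a => contDiffAt_horLift h (hc a)
  have hv := vcomp_comp_contDiffAt (k := ⊤) h (contDiffAt_const (c := v))
  have h0 : ∀ {f : Eu n × Eu n → Eu n}, ContDiffAt ℝ ∞ f z →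
      ContDiffAt ℝ ∞ (fun w => ((0, f w) : Eu n × Eu n)) z := fun hf => contDiffAt_const.prodMk hf
  have hB := contDiffAt_hessB h.contDiffAt
  exact ((contDiffAt_dN h hX (hc _)).add ((contDiffAt_sharp h fun r =>
    ((contDiffAt_dG h (hh _) hX (hc _)).sub ((hB.clm_apply (contDiffAt_dN h hX (hc _))).clm_apply
      (hc _))).sub ((hB.clm_apply (contDiffAt_dN h (hc _) (hc _))).clm_apply hX)).const_smul
        (1 / 2 : ℝ))).add ((contDiffAt_sharp h fun r => ((contDiffAt_dG h (h0 hv) hX (hc _)).add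
          (contDiffAt_dG h (h0 hX) hv (hc _))).sub (contDiffAt_dG h (h0 (hc _)) hX hv)).const_smul
            (1 / 2 : ℝ))

/-- The connection form of the canonical d-connection in coordinates. -/
def covFormFun (l : Eu n × Eu n → ℝ) (z v f : Eu n × Eu n) : Eu n × Eu n :=
  (gammaH l z v f.1, fderiv ℝ (nMap l) z v f.1 + gammaV l z v (vcomp (nLoc l z) f)
    - nMap l z (gammaH l z v f.1))

theorem gammaH_add_left (h : IsRegularNear l z) (v v' : Eu n × Eu n) (X : Eu n) :
    gammaH l z (v + v') X = gammaH l z v X + gammaH l z v' X := by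
  simp only [gammaH, map_add, Prod.fst_add, (isBilin_gLh h).add_left, (isBilin_gCh h).add_left]
  abel

theorem gammaH_smul_left (h : IsRegularNear l z) (c : ℝ) (v : Eu n × Eu n) (X : Eu n) :
    gammaH l z (c • v) X = c • gammaH l z v X := by
  simp only [gammaH, map_smul, Prod.smul_fst, (isBilin_gLh h).smul_left,
    (isBilin_gCh h).smul_left, smul_add]

theorem gammaH_add_right (h : IsRegularNear l z) (v : Eu n × Eu n) (X X' : Eu n) :
    gammaH l z v (X + X') = gammaH l z v X + gammaH l z v X' := by
  simp only [gammaH, (isBilin_gLh h).add_right, (isBilin_gCh h).add_right]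
  abel

theorem gammaH_smul_right (h : IsRegularNear l z) (c : ℝ) (v : Eu n × Eu n) (X : Eu n) :
    gammaH l z v (c • X) = c • gammaH l z v X := by
  simp only [gammaH, (isBilin_gLh h).smul_right, (isBilin_gCh h).smul_right, smul_add]

theorem gammaV_add_left (h : IsRegularNear l z) (v v' : Eu n × Eu n) (X : Eu n) :
    gammaV l z (v + v') X = gammaV l z v X + gammaV l z v' X := by
  simp only [gammaV, map_add, Prod.fst_add, (isBilin_gLv h).add_left, (isBilin_gCv h).add_left]
  abel

theorem gammaV_smul_left (h : IsRegularNear l z) (c : ℝ) (v : Eu n × Eu n) (X : Eu n) :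
    gammaV l z (c • v) X = c • gammaV l z v X := by
  simp only [gammaV, map_smul, Prod.smul_fst, (isBilin_gLv h).smul_left,
    (isBilin_gCv h).smul_left, smul_add]

theorem gammaV_add_right (h : IsRegularNear l z) (v : Eu n × Eu n) (X X' : Eu n) :
    gammaV l z v (X + X') = gammaV l z v X + gammaV l z v X' := by
  simp only [gammaV, (isBilin_gLv h).add_right, (isBilin_gCv h).add_right]
  abel

theorem gammaV_smul_right (h : IsRegularNear l z) (c : ℝ) (v : Eu n × Eu n) (X : Eu n) :
    gammaV l z v (c • X) = c • gammaV l z v X := by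
  simp only [gammaV, (isBilin_gLv h).smul_right, (isBilin_gCv h).smul_right, smul_add]

theorem covLoc_eq_add (h : IsRegularNear l z) {Y : Eu n × Eu n → Eu n × Eu n}
    (hY : DifferentiableAt ℝ Y z) (v : Eu n × Eu n) :
    covLoc (nLoc l) (hessLoc l) (hessLoc l) Y z v = fderiv ℝ Y z v + covFormFun l z v (Y z) := by
  have hN := (contDiffAt_nMap h).differentiableAt (by simp)
  have h1 : fderiv ℝ (fun w => (Y w).1) z v = (fderiv ℝ Y z v).1 :=
    DFunLike.congr_fun ((hasFDerivAt_fst (𝕜 := ℝ) (p := Y z)).comp z hY.hasFDerivAt).fderiv v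
  have h2 : fderiv ℝ (fun w => vcomp (nLoc l w) (Y w)) z v
      = (fderiv ℝ Y z v).2 + (nMap l z (fderiv ℝ Y z v).1 + fderiv ℝ (nMap l) z v (Y z).1) := by
    have h3 := (((hasFDerivAt_snd (𝕜 := ℝ) (p := Y z)).comp z hY.hasFDerivAt).add
      (hN.hasFDerivAt.clm_apply
        ((hasFDerivAt_fst (𝕜 := ℝ) (p := Y z)).comp z hY.hasFDerivAt))).fderiv
    exact DFunLike.congr_fun h3 v
  rw [covLoc_apply h, h1, h2, fromAdapted_nLoc, covFormFun]
  ext1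
  · rfl
  · simp only [Prod.snd_add, map_add]
    abel

open Classical in
/-- The connection form of the canonical d-connection in coordinates. -/
def covForm (l : Eu n × Eu n → ℝ) (z : Eu n × Eu n) :
    (Eu n × Eu n) →L[ℝ] (Eu n × Eu n) →L[ℝ] (Eu n × Eu n) :=
  if h : IsRegularNear l z then
    LinearMap.toContinuousLinearMap (LinearMap.toContinuousLinearMap.toLinearMap ∘ₗ
      LinearMap.mk₂ ℝ (covFormFun l z)
        (fun v v' f => by
          simp only [covFormFun, gammaH_add_left h, gammaV_add_left h, map_add, add_apply]
          ext1
          · rfl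
          · simp only [Prod.snd_add]; abel)
        (fun c v f => by
          simp only [covFormFun, gammaH_smul_left h, gammaV_smul_left h, map_smul, smul_apply,
            Prod.smul_mk, smul_add, smul_sub])
        (fun v f f' => by
          simp only [covFormFun, gammaH_add_right h, gammaV_add_right h, map_add, Prod.fst_add]
          ext1
          · rfl
          · simp only [Prod.snd_add]; abel)
        (fun c v f => by
          simp only [covFormFun, gammaH_smul_right h, gammaV_smul_right h, map_smul,
            Prod.smul_fst, Prod.smul_mk, smul_add, smul_sub]))
  else 0

theorem covForm_apply (h : IsRegularNear l z) (v f : Eu n × Eu n) :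
    covForm l z v f = covFormFun l z v f := by
  rw [covForm, dif_pos h]
  rfl

theorem contDiffAt_covForm (h : IsRegularNear l z) : ContDiffAt ℝ ∞ (covForm l) z := by
  refine contDiffAt_clm_of_apply fun v => contDiffAt_clm_of_apply fun f => ?_
  have hv := vcomp_comp_contDiffAt (k := ⊤) h (contDiffAt_const (c := f))
  have hN := contDiffAt_nMap h
  have h1 : ContDiffAt ℝ ∞ (fun w => covFormFun l w v f) z :=
    (contDiffAt_gammaH h v f.1).prodMk (((((hN.fderiv_right (m := ∞) (by simp)).clm_apply
      contDiffAt_const).clm_apply contDiffAt_const).add (contDiffAt_gammaV h v hv)).sub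
        (hN.clm_apply (contDiffAt_gammaH h v f.1)))
  refine h1.congr_of_eventuallyEq ?_
  filter_upwards [h.eventually] with w hw
  exact covForm_apply hw v f

theorem vcomp_fromAdapted (p : Eu n × Eu n) :
    vcomp (nLoc l z) (fromAdapted (nLoc l z) p) = p.2 := by
  rw [vcomp_nLoc, fromAdapted_nLoc]
  exact sub_add_cancel _ _

theorem sasakiLoc_eq_hessB (h : IsRegularNear l z) (Y Z : Eu n × Eu n) :
    sasakiLoc (nLoc l z) (hessLoc l z) Y Z = hessB l z Y.1 Z.1
      + hessB l z (vcomp (nLoc l z) Y) (vcomp (nLoc l z) Z) := by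
  rw [sasakiLoc, sum_hessLoc_mul h.contDiffAt, sum_hessLoc_mul h.contDiffAt]

theorem fderiv_hessB_comp (h : IsRegularNear l z) {X Z : Eu n × Eu n → Eu n}
    (hX : DifferentiableAt ℝ X z) (hZ : DifferentiableAt ℝ Z z) (v : Eu n × Eu n) :
    fderiv ℝ (fun w => hessB l w (X w) (Z w)) z v = dG l z v (X z) (Z z)
      + hessB l z (fderiv ℝ X z v) (Z z) + hessB l z (X z) (fderiv ℝ Z z v) := by
  have hd := ((contDiffAt_hessB h.contDiffAt).differentiableAt (by simp)).hasFDerivAt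
  refine (DFunLike.congr_fun ((hd.clm_apply hX.hasFDerivAt).clm_apply
    hZ.hasFDerivAt).fderiv v).trans ?_
  simp [dG]
  ring

theorem fderiv_sasakiLoc (h : IsRegularNear l z) {Y Y' : Eu n × Eu n → Eu n × Eu n}
    (hY : DifferentiableAt ℝ Y z) (hY' : DifferentiableAt ℝ Y' z) (v : Eu n × Eu n) :
    fderiv ℝ (fun w => sasakiLoc (nLoc l w) (hessLoc l w) (Y w) (Y' w)) z v
      = sasakiLoc (nLoc l z) (hessLoc l z)
          (covLoc (nLoc l) (hessLoc l) (hessLoc l) Y z v) (Y' z)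
        + sasakiLoc (nLoc l z) (hessLoc l z) (Y z)
          (covLoc (nLoc l) (hessLoc l) (hessLoc l) Y' z v) := by
  have h1 : (fun w => sasakiLoc (nLoc l w) (hessLoc l w) (Y w) (Y' w)) =ᶠ[𝓝 z]
      (fun w => hessB l w (Y w).1 (Y' w).1)
        + fun w => hessB l w (vcomp (nLoc l w) (Y w)) (vcomp (nLoc l w) (Y' w)) := by
    filter_upwards [h.eventually] with w hw
    exact sasakiLoc_eq_hessB hw _ _
  have hB := (contDiffAt_hessB h.contDiffAt).differentiableAt (by simp)
  have d1 : DifferentiableAt ℝ (fun w => (Y w).1) z := differentiableAt_fst.comp z hY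
  have d1' : DifferentiableAt ℝ (fun w => (Y' w).1) z := differentiableAt_fst.comp z hY'
  have d2 := vcomp_comp_differentiableAt h hY
  have d2' := vcomp_comp_differentiableAt h hY'
  rw [h1.fderiv_eq, fderiv_add ((hB.clm_apply d1).clm_apply d1')
    ((hB.clm_apply d2).clm_apply d2'), add_apply,
    fderiv_hessB_comp h (X := fun w => (Y w).1) (Z := fun w => (Y' w).1) d1 d1',
    fderiv_hessB_comp h d2 d2', dG_eq_gammaH h, dG_eq_gammaV h, sasakiLoc_eq_hessB h,
    sasakiLoc_eq_hessB h, covLoc_apply h, covLoc_apply h, vcomp_fromAdapted, vcomp_fromAdapted,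
    fromAdapted_nLoc, fromAdapted_nLoc]
  simp only [map_add, add_apply]
  ring

end ConnForm

section Global

variable {n : ℕ} {M : Type*} [TopologicalSpace M] [ChartedSpace (Eu n) M]
  [IsManifold (𝓡 n) ∞ M] {L : TM n M → ℝ}

theorem hasConnForm_lagD (hL : IsLagrangeSpace L) (w : TM n M) :
    HasConnForm (F := Eu n × Eu n) (W := fun u : TM n M => TangentSpace (IT n) u) (slit n M)
      (lagD L) (trivializationAt (Eu n × Eu n) (TangentSpace (IT n)) w) w
      (covForm (funRep L w)) := by
  intro x hx _ hw
  have hr := isRegularNear_funRep hL hx hw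
  refine ⟨contDiffAt_covForm hr, fun s hs v => ?_⟩
  have h1 := dchart_lagD hL hx hs hw v
  rw [covLoc_eq_add hr (differentiableAt_fieldRep hs hw), ← covForm_apply hr] at h1
  have hc : ∀ u : Eu n × Eu n, (trivializationAt (Eu n × Eu n)
      (fun u : TM n M => TangentSpace (IT n) u) w).continuousLinearMapAt ℝ x u
        = dchart (IT n) w x u := fun u => DFunLike.congr_fun (clma_trivializationAt_tangent hw) u
  have he : secRep (IT n) (trivializationAt (Eu n × Eu n)
      (fun u : TM n M => TangentSpace (IT n) u) w) w s =ᶠ[𝓝 (coord w x)] fieldRep s w := by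
    filter_upwards [extChartAt_target_mem_nhds' ((coord w).map_source hw)] with z hz
    exact secRep_tangent w s hz
  refine ((hc _).trans h1).trans (congrArg₂ (· + ·) ?_ ?_)
  · rw [he.fderiv_eq]
  · exact congrArg _ ((fieldRep_coord s hw).trans (hc _).symm)

theorem isSmoothConnectionOn_lagD (hL : IsLagrangeSpace L) :
    IsSmoothConnectionOn (Eu n × Eu n) (slit n M) (lagD L) :=
  isSmoothConnectionOn_of_hasConnForm fun x _ => ⟨_, hasConnForm_lagD hL x⟩

theorem isDConnection_lagD (hL : IsLagrangeSpace L) : IsDConnection (lagN L) (lagD L) where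
  isConnection := isSmoothConnectionOn_lagD hL
  adapted U hUV hU Y hY u hu Z := by
    have hu0 := mem_coord_source_self u
    have hr := isRegularNear_funRep hL (hUV hu) hu0
    have hd := differentiableAt_fieldRep (hY.mdifferentiableAt hU hu) hu0
    have h1 : fieldRep (fun w => lagN L w (Y w)) u =ᶠ[𝓝 (coord u u)]
        fun z => (0, vcomp (nLoc (funRep L u) z) (fieldRep Y u z)) := by
      filter_upwards [eventually_coord isOpen_slit (hUV hu) hu0] with z ⟨hz, hz'⟩
      refine (dchart_lagN hL hz' ((coord u).map_target hz) _).trans ?_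
      rw [(coord u).right_inv hz]
      rfl
    have h2 : (fun z => (fieldRep (fun w => lagN L w (Y w)) u z).1) =ᶠ[𝓝 (coord u u)]
        fun z => 0 := h1.mono fun z hz => congrArg Prod.fst hz
    have h3 : (fun z => vcomp (nLoc (funRep L u) z) (fieldRep (fun w => lagN L w (Y w)) u z))
        =ᶠ[𝓝 (coord u u)] fun z => vcomp (nLoc (funRep L u) z) (fieldRep Y u z) :=
      h1.mono fun z hz => (congrArg (vcomp _) hz).trans (by rw [vcomp_nLoc]; simp)
    have h4 : (fieldRep (fun w => lagN L w (Y w)) u (coord u u)).1 = 0 := h2.self_of_nhds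
    have h5 := h3.self_of_nhds
    beta_reduce at h5
    have key : ∀ Z : Eu n × Eu n, covLoc (nLoc (funRep L u)) (hessLoc (funRep L u))
        (hessLoc (funRep L u)) (fieldRep (fun w => lagN L w (Y w)) u) (coord u u) Z
        = (0, vcomp (nLoc (funRep L u) (coord u u)) (covLoc (nLoc (funRep L u))
          (hessLoc (funRep L u)) (hessLoc (funRep L u)) (fieldRep Y u) (coord u u) Z)) := by
      intro Z
      rw [covLoc_apply hr, covLoc_apply hr, vcomp_fromAdapted, h2.fderiv_eq, h3.fderiv_eq,
        h4, h5]
      have h0 : gammaH (funRep L u) (coord u u) Z 0 = 0 := by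
        rw [gammaH, (isBilin_gLh hr).zero_right, (isBilin_gCh hr).zero_right, add_zero]
      rw [h0, fromAdapted_nLoc]
      simp
    exact key Z

theorem isMetricCompatible_lagD (hL : IsLagrangeSpace L) :
    IsMetricCompatible (lagG L) (lagD L) := by
  intro U hUV hU Y Y' hY hY' u hu Z
  have hu0 := mem_coord_source_self u
  have hr := isRegularNear_funRep hL (hUV hu) hu0
  have hd := differentiableAt_fieldRep (hY.mdifferentiableAt hU hu) hu0
  have hd' := differentiableAt_fieldRep (hY'.mdifferentiableAt hU hu) hu0
  set S : Eu n × Eu n → ℝ := fun z => sasakiLoc (nLoc (funRep L u) z) (hessLoc (funRep L u) z)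
    (fieldRep Y u z) (fieldRep Y' u z) with hS
  have h0 : (fun w => lagG L w (Y w) (Y' w)) =ᶠ[𝓝 u] S ∘ coord u := by
    filter_upwards [extChartAt_source_mem_nhds' (I := IT n) hu0, isOpen_slit.mem_nhds (hUV hu)]
      with v hv hvs
    refine (lagG_eq hL hvs hv _ _).trans ?_
    rw [← fieldRep_coord Y hv, ← fieldRep_coord Y' hv]
    rfl
  have hSd : DifferentiableAt ℝ S (coord u u) := by
    have hB := (contDiffAt_hessB hr.contDiffAt).differentiableAt (by simp)
    have d1 := differentiableAt_fst.comp (coord u u) hd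
    have d1' := differentiableAt_fst.comp (coord u u) hd'
    have d2 := vcomp_comp_differentiableAt hr hd
    have d2' := vcomp_comp_differentiableAt hr hd'
    refine (((hB.clm_apply d1).clm_apply d1').add
      ((hB.clm_apply d2).clm_apply d2')).congr_of_eventuallyEq ?_
    filter_upwards [hr.eventually] with w hw
    exact sasakiLoc_eq_hessB hw _ _
  have h1 := mfderiv_comp (I' := 𝓘(ℝ, Eu n × Eu n)) (I'' := 𝓘(ℝ, ℝ)) u
    hSd.mdifferentiableAt (mdifferentiableAt_chart hu0)
  rw [← h0.mfderiv_eq, mfderiv_eq_fderiv] at h1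
  have h2 : mfderiv (IT n) 𝓘(ℝ, ℝ) (fun w => lagG L w (Y w) (Y' w)) u Z
      = fderiv ℝ S (coord u u) (dchart (IT n) u u Z) := DFunLike.congr_fun h1 Z
  rw [dchart_self] at h2
  refine h2.trans ((fderiv_sasakiLoc hr hd hd' Z).trans ?_)
  have e : ∀ Y : Π u : TM n M, TangentSpace (IT n) u, fieldRep Y u (coord u u) = Y u := fun Y => by
    refine (fieldRep_coord Y hu0).trans ?_
    rw [dchart_self]
    rfl
  rw [e Y, e Y']
  rfl

end Global

section TangentPart

variable {n : ℕ} {M : Type*} [TopologicalSpace M] [ChartedSpace (Eu n) M]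
  [IsManifold (𝓡 n) ∞ M] {L : TM n M → ℝ}

theorem exists_tangentChernCharacters
    {D₀ D₁ : (Π u : TM n M, TangentSpace (IT n) u) →
      (Π u : TM n M, TangentSpace (IT n) u →L[ℝ] TangentSpace (IT n) u)}
    (h₀ : IsSmoothConnectionOn (Eu n × Eu n) (slit n M) D₀)
    (h₁ : IsSmoothConnectionOn (Eu n × Eu n) (slit n M) D₁)
    {R₀ R₁ : Π u : TM n M, TangentSpace (IT n) u → TangentSpace (IT n) u →
        (TangentSpace (IT n) u →ₗ[ℝ] TangentSpace (IT n) u)}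
    (c₀ : IsCurvatureOn (Eu n × Eu n) (slit n M) D₀ fun u Y Z => R₀ u Y Z)
    (c₁ : IsCurvatureOn (Eu n × Eu n) (slit n M) D₁ fun u Y Z => R₁ u Y Z) :
    ∃ C₀ C₁ : TotalForm (IT n) (TM n M), IsTangentChernCharacter R₀ C₀ ∧
      IsTangentChernCharacter R₁ C₁ ∧ IsClosedFormOn (slit n M) C₀ ∧
      IsClosedFormOn (slit n M) C₁ ∧ CohomologousOn (slit n M) C₁ C₀ := by
  obtain ⟨C₀, C₁, s0, s1, d0, d1, hc, hev, hodd⟩ := exists_chernForms isOpen_slit h₀ h₁ c₀ c₁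
  exact ⟨C₀, C₁, ⟨s0, fun u hu k Y => (hev u hu k Y).1, fun u hu k => (hodd u hu k).1⟩,
    ⟨s1, fun u hu k Y => (hev u hu k Y).2, fun u hu k => (hodd u hu k).2⟩, d0, d1, hc⟩

theorem IsTangentChernCharacter.eq {R : Π u : TM n M, TangentSpace (IT n) u →
      TangentSpace (IT n) u → (TangentSpace (IT n) u →ₗ[ℝ] TangentSpace (IT n) u)}
    {c c' : TotalForm (IT n) (TM n M)} (h : IsTangentChernCharacter R c)
    (h' : IsTangentChernCharacter R c') {u : TM n M} (hu : u ∈ slit n M) (m : ℕ) :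
    c u m = c' u m := by
  obtain ⟨k, rfl | rfl⟩ := m.even_or_odd'
  · ext Y
    rw [h.even u hu, h'.even u hu]
  · rw [h.odd u hu, h'.odd u hu]

end TangentPart

section ComplexAlgebra

variable (F : Type*) [NormedAddCommGroup F] [NormedSpace ℝ F] [NormedSpace ℂ F]
  [IsScalarTower ℝ ℂ F]

/-- The algebra of complex linear endomorphisms, as a real algebra. -/
def complexEnd : Subalgebra ℝ (F →L[ℝ] F) where
  carrier := {a | ∀ f, a (Complex.I • f) = Complex.I • a f}
  mul_mem' {a b} ha hb f := by
    change a (b (Complex.I • f)) = Complex.I • a (b f)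
    rw [hb, ha]
  one_mem' _ := rfl
  add_mem' {a b} ha hb f := by
    change a (Complex.I • f) + b (Complex.I • f) = Complex.I • (a f + b f)
    rw [ha, hb, smul_add]
  zero_mem' f := (smul_zero Complex.I).symm
  algebraMap_mem' r f := by
    change r • (Complex.I • f) = Complex.I • (r • f)
    rw [smul_comm]

variable {F}

theorem map_complex_smul {F W : Type*} [AddCommGroup F] [Module ℝ F] [Module ℂ F]
    [IsScalarTower ℝ ℂ F] [AddCommGroup W] [Module ℝ W] [Module ℂ W] [IsScalarTower ℝ ℂ W]
    (a : F →ₗ[ℝ] W) (ha : ∀ f, a (Complex.I • f) = Complex.I • a f) (c : ℂ) (f : F) :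
    a (c • f) = c • a f := by
  have h1 : ∀ f : F, c • f = c.re • f + c.im • Complex.I • f := fun f => by
    conv_lhs => rw [← Complex.re_add_im c, add_smul, mul_smul]
    rw [← algebraMap_smul ℂ c.re f, ← algebraMap_smul ℂ c.im (Complex.I • f)]
    rfl
  have h2 : ∀ f : W, c • f = c.re • f + c.im • Complex.I • f := fun f => by
    conv_lhs => rw [← Complex.re_add_im c, add_smul, mul_smul]
    rw [← algebraMap_smul ℂ c.re f, ← algebraMap_smul ℂ c.im (Complex.I • f)]
    rfl
  rw [h1, h2, map_add, map_smul, map_smul, ha]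

/-- A real linear map commuting with `i`, as a complex linear map. -/
def toComplexLinear {F W : Type*} [AddCommGroup F] [Module ℝ F] [Module ℂ F]
    [IsScalarTower ℝ ℂ F] [AddCommGroup W] [Module ℝ W] [Module ℂ W] [IsScalarTower ℝ ℂ W]
    (a : F →ₗ[ℝ] W) (ha : ∀ f, a (Complex.I • f) = Complex.I • a f) : F →ₗ[ℂ] W where
  toFun := a
  map_add' := map_add a
  map_smul' := map_complex_smul a ha

/-- The elements of `complexEnd F` as complex linear endomorphisms. -/
def complexEnd.toEnd : complexEnd F →* Module.End ℂ F where
  toFun a := toComplexLinear (a : F →L[ℝ] F).toLinearMap a.2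
  map_one' := rfl
  map_mul' _ _ := rfl

variable [FiniteDimensional ℂ F]

theorem finiteDimensional_real (F : Type*) [AddCommGroup F] [Module ℝ F] [Module ℂ F]
    [IsScalarTower ℝ ℂ F] [FiniteDimensional ℂ F] : FiniteDimensional ℝ F :=
  Module.Finite.trans ℂ F

variable (F) in
/-- The complex trace. -/
def complexTrace : complexEnd F →L[ℝ] ℂ :=
  have : FiniteDimensional ℝ F := finiteDimensional_real F
  LinearMap.toContinuousLinearMap
    { toFun := fun a => LinearMap.trace ℂ F (complexEnd.toEnd a)
      map_add' := fun a b => by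
        rw [← map_add]
        rfl
      map_smul' := fun r a => by
        have h : complexEnd.toEnd (r • a) = (r : ℂ) • complexEnd.toEnd a := by
          ext f
          exact (algebraMap_smul ℂ r ((a : F →L[ℝ] F) f)).symm
        rw [h, map_smul]
        rfl }

theorem complexTrace_apply (a : complexEnd F) :
    complexTrace F a = LinearMap.trace ℂ F (complexEnd.toEnd a) := rfl

theorem complexTrace_mul_comm (a b : complexEnd F) :
    complexTrace F (a * b) = complexTrace F (b * a) := by
  rw [complexTrace_apply, complexTrace_apply, map_mul complexEnd.toEnd,
    map_mul complexEnd.toEnd, LinearMap.trace_mul_comm]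

variable (F) in
/-- Multiplication by `i`. -/
def mulI : F →L[ℝ] F :=
  have : FiniteDimensional ℝ F := finiteDimensional_real F
  LinearMap.toContinuousLinearMap ((LinearMap.lsmul ℂ F Complex.I).restrictScalars ℝ)

variable (F) in
/-- The projection of the real endomorphisms onto the complex linear ones. -/
def complexProj : (F →L[ℝ] F) →L[ℝ] complexEnd F :=
  have : FiniteDimensional ℝ F := finiteDimensional_real F
  LinearMap.toContinuousLinearMap (LinearMap.codRestrict (Subalgebra.toSubmodule (complexEnd F))
    { toFun := fun a => (1 / 2 : ℝ) • (a - mulI F * a * mulI F)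
      map_add' := fun a b => by
        rw [mul_add, add_mul, ← smul_add]
        congr 1
        abel
      map_smul' := fun r a => by
        rw [mul_smul_comm, smul_mul_assoc, ← smul_sub, smul_comm]
        rfl } (fun a f => by
      change (1 / 2 : ℝ) • (a (Complex.I • f) - Complex.I • a (Complex.I • Complex.I • f))
        = Complex.I • ((1 / 2 : ℝ) • (a f - Complex.I • a (Complex.I • f)))
      rw [smul_comm Complex.I (1 / 2 : ℝ), smul_sub Complex.I, smul_smul Complex.I Complex.I,
        smul_smul Complex.I Complex.I, Complex.I_mul_I, neg_one_smul, neg_one_smul, map_neg,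
        smul_neg]
      congr 1
      abel))

theorem complexProj_apply {a : F →L[ℝ] F} (ha : ∀ f, a (Complex.I • f) = Complex.I • a f) :
    (complexProj F a : F →L[ℝ] F) = a := by
  ext f
  change (1 / 2 : ℝ) • (a f - Complex.I • a (Complex.I • f)) = a f
  rw [ha, smul_smul, Complex.I_mul_I, neg_one_smul, sub_neg_eq_add, ← two_smul ℝ, smul_smul]
  norm_num

end ComplexAlgebra

section Subalgebra

variable {E 𝔸 : Type*} [NormedAddCommGroup E] [NormedSpace ℝ E] [NormedRing 𝔸] [NormedAlgebra ℝ 𝔸]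

theorem curvForm_map {𝔹 : Type*} [NormedRing 𝔹] [NormedAlgebra ℝ 𝔹] (ι : 𝔹 →L[ℝ] 𝔸)
    (hι : ∀ a b, ι (a * b) = ι a * ι b) {A : E → E →L[ℝ] 𝔹} {A' : E → E →L[ℝ] 𝔸} {z : E}
    (hA : DifferentiableAt ℝ A z) (h : ∀ᶠ w in 𝓝 z, ∀ v, A' w v = ι (A w v)) (a b : E) :
    curvForm A' z a b = ι (curvForm A z a b) := by
  let J : (E →L[ℝ] 𝔹) →L[ℝ] (E →L[ℝ] 𝔸) := ContinuousLinearMap.compL ℝ E 𝔹 𝔸 ι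
  have h1 : A' =ᶠ[𝓝 z] fun w => J (A w) := h.mono fun w hw => by
    ext v
    exact hw v
  have h2 : fderiv ℝ A' z = J.comp (fderiv ℝ A z) := by
    rw [h1.fderiv_eq]
    exact (J.hasFDerivAt.comp z hA.hasFDerivAt).fderiv
  rw [curvForm_apply, curvForm_apply, h2, h.self_of_nhds, h.self_of_nhds, map_add, map_sub,
    map_sub, hι, hι]
  rfl

theorem curvForm_coe {S : Subalgebra ℝ 𝔸} {A : E → E →L[ℝ] S} {A' : E → E →L[ℝ] 𝔸} {z : E}
    (hA : DifferentiableAt ℝ A z) (h : ∀ᶠ w in 𝓝 z, ∀ v, A' w v = A w v) (a b : E) :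
    curvForm A' z a b = (curvForm A z a b : S) :=
  curvForm_map (⟨S.val.toLinearMap, continuous_subtype_val⟩ : S →L[ℝ] 𝔸) (fun _ _ => rfl) hA h a b

end Subalgebra

section LocalInverse

variable {k : ℕ} {𝔤₁ : Type*} [NormedAddCommGroup 𝔤₁] [NormedSpace ℝ 𝔤₁]
  {𝔤₂ : Type*} [NormedAddCommGroup 𝔤₂] [NormedSpace ℝ 𝔤₂]
  {Gc₁ : Type*} [TopologicalSpace Gc₁] [ChartedSpace 𝔤₁ Gc₁] [Group Gc₁]
  {G₁ : Type*} [TopologicalSpace G₁] [ChartedSpace 𝔤₁ G₁] [Group G₁]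
  {Gc₂ : Type*} [TopologicalSpace Gc₂] [ChartedSpace 𝔤₂ Gc₂] [Group Gc₂]
  {G₂ : Type*} [TopologicalSpace G₂] [ChartedSpace 𝔤₂ G₂] [Group G₂]
  (ext₁ : CentralExtension k 𝔤₁ Gc₁ G₁) (ext₂ : CentralExtension k 𝔤₂ Gc₂ G₂)

theorem dProj_surjective : Function.Surjective (dProj ext₁ ext₂) := fun g => by
  obtain ⟨a, ha⟩ := ext₁.proj_surjective g.1
  obtain ⟨b, hb⟩ := ext₂.proj_surjective g.2
  exact ⟨(a, b), Prod.ext ha hb⟩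

theorem exists_localLift (g : Gc₁ × Gc₂) : ∃ (O : Set (G₁ × G₂)) (ℓ : G₁ × G₂ → Gc₁ × Gc₂),
    IsOpen O ∧ dProj ext₁ ext₂ g ∈ O ∧
    ContMDiffOn (𝓘(ℝ, 𝔤₁).prod 𝓘(ℝ, 𝔤₂)) (𝓘(ℝ, 𝔤₁).prod 𝓘(ℝ, 𝔤₂)) ∞ ℓ O ∧
    (∀ x ∈ O, dProj ext₁ ext₂ (ℓ x) = x) ∧ ∀ᶠ γ in 𝓝 g, ℓ (dProj ext₁ ext₂ γ) = γ := by
  obtain ⟨Φ₁, h₁, e₁⟩ := ext₁.isLocalDiffeomorph g.1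
  obtain ⟨Φ₂, h₂, e₂⟩ := ext₂.isLocalDiffeomorph g.2
  refine ⟨Φ₁.target ×ˢ Φ₂.target, Prod.map Φ₁.symm Φ₂.symm, Φ₁.open_target.prod Φ₂.open_target,
    ⟨?_, ?_⟩, ?_, ?_, ?_⟩
  · exact (congrArg (· ∈ Φ₁.target) (e₁ h₁)).mpr (Φ₁.map_source h₁)
  · exact (congrArg (· ∈ Φ₂.target) (e₂ h₂)).mpr (Φ₂.map_source h₂)
  · exact Φ₁.contMDiffOn_invFun.prodMap Φ₂.contMDiffOn_invFun
  · rintro ⟨x, y⟩ ⟨hx, hy⟩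
    exact Prod.ext ((e₁ (Φ₁.map_target hx)).trans (Φ₁.right_inv hx))
      ((e₂ (Φ₂.map_target hy)).trans (Φ₂.right_inv hy))
  · filter_upwards [(Φ₁.open_source.prod Φ₂.open_source).mem_nhds ⟨h₁, h₂⟩] with γ hγ
    exact Prod.ext ((congrArg Φ₁.symm (e₁ hγ.1)).trans (Φ₁.left_inv hγ.1))
      ((congrArg Φ₂.symm (e₂ hγ.2)).trans (Φ₂.left_inv hγ.2))

theorem exists_nhds_injOn (g : Gc₁ × Gc₂) : ∃ N ∈ 𝓝 g, Set.InjOn (dProj ext₁ ext₂) N := by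
  obtain ⟨O, ℓ, -, -, -, -, h⟩ := exists_localLift ext₁ ext₂ g
  exact ⟨_, h, fun a ha b hb hab => ha.symm.trans ((congrArg ℓ hab).trans hb)⟩

end LocalInverse

section Along

variable {E : Type*} [NormedAddCommGroup E] [NormedSpace ℝ E] [FiniteDimensional ℝ E]
  {H : Type*} [TopologicalSpace H] {I : ModelWithCorners ℝ E H} [I.Boundaryless]
  {X : Type*} [TopologicalSpace X] [ChartedSpace H X] [IsManifold I ∞ X] [IsManifold I 1 X]
  {F : Type*} [NormedAddCommGroup F] [NormedSpace ℝ F] [FiniteDimensional ℝ F]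
  {W : X → Type*} [TopologicalSpace (TotalSpace F W)]
  [∀ x, AddCommGroup (W x)] [∀ x, Module ℝ (W x)] [∀ x, TopologicalSpace (W x)]
  [∀ x, IsTopologicalAddGroup (W x)] [∀ x, ContinuousSMul ℝ (W x)] [FiberBundle F W]
  [VectorBundle ℝ F W] [ContMDiffVectorBundle ∞ F W I]

theorem mvfderiv_comp_apply {EN : Type*} [NormedAddCommGroup EN] [NormedSpace ℝ EN] {HN : Type*}
    [TopologicalSpace HN] {IN : ModelWithCorners ℝ EN HN} {N : Type*} [TopologicalSpace N]
    [ChartedSpace HN N] {φ : N → X} {x : N} {f : X → F}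
    (hf : MDifferentiableAt I 𝓘(ℝ, F) f (φ x)) (hφ : MDifferentiableAt IN I φ x) (v : EN) :
    (mvfderiv I f (φ x) (mfderiv IN I φ x v) : F) = mfderiv IN 𝓘(ℝ, F) (f ∘ φ) x v :=
  (DFunLike.congr_fun (mfderiv_comp x hf hφ) v).symm

theorem HasConnForm.clma_apply {V : Set X}
    {D : (Π x : X, W x) → (Π x : X, TangentSpace I x →L[ℝ] W x)}
    {e : Trivialization F (TotalSpace.proj : TotalSpace F W → X)} [MemTrivializationAtlas e]
    {w : X} {A : E → E →L[ℝ] F →L[ℝ] F} (hA : HasConnForm V D e w A) {x : X} (hx : x ∈ V)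
    (he : x ∈ e.baseSet) (hw : x ∈ (extChartAt I w).source) {s : Π x : X, W x}
    (hs : MDifferentiableAt I (I.prod 𝓘(ℝ, F)) (fun y => TotalSpace.mk' F y (s y)) x) (v : E) :
    e.continuousLinearMapAt ℝ x (D s x v)
      = mvfderiv I (fun y => e.continuousLinearMapAt ℝ y (s y)) x v
        + A (extChartAt I w x) (dchart I w x v) (e.continuousLinearMapAt ℝ x (s x)) :=
  ((hA x hx he hw).2 s hs v).trans (congrArg (· + _) (mvfderiv_eq_fderiv_chart hw
    ((mdifferentiableAt_section_iff_clma he).1 hs) v).symm)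

/-- The covariant derivative in a direction tangent to a map depends only on the section along
that map. -/
theorem IsSmoothConnectionOn.congr_along {V : Set X} (hV : IsOpen V)
    {D : (Π x : X, W x) → (Π x : X, TangentSpace I x →L[ℝ] W x)}
    (hD : IsSmoothConnectionOn F V D)
    {EN : Type*} [NormedAddCommGroup EN] [NormedSpace ℝ EN] {HN : Type*}
    [TopologicalSpace HN] {IN : ModelWithCorners ℝ EN HN} {N : Type*} [TopologicalSpace N]
    [ChartedSpace HN N] {φ : N → X} {x : N} (hx : φ x ∈ V) (hφ : MDifferentiableAt IN I φ x)
    {s s' : Π x : X, W x}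
    (hs : MDifferentiableAt I (I.prod 𝓘(ℝ, F)) (fun y => TotalSpace.mk' F y (s y)) (φ x))
    (hs' : MDifferentiableAt I (I.prod 𝓘(ℝ, F)) (fun y => TotalSpace.mk' F y (s' y)) (φ x))
    (h : ∀ᶠ y in 𝓝 x, s (φ y) = s' (φ y)) (v : EN) :
    D s (φ x) (mfderiv IN I φ x v) = D s' (φ x) (mfderiv IN I φ x v) := by
  let e := trivializationAt F W (φ x)
  have he : φ x ∈ e.baseSet := mem_baseSet_trivializationAt F W (φ x)
  have hw : φ x ∈ (extChartAt I (φ x)).source := mem_extChartAt_source (φ x)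
  obtain ⟨A, hA⟩ := exists_hasConnForm hV hD e (φ x)
  have h1 := (hA.clma_apply hx he hw hs (mfderiv IN I φ x v)).trans (congrArg (· + _)
    (mvfderiv_comp_apply ((mdifferentiableAt_section_iff_clma he).1 hs) hφ v))
  have h2 := (hA.clma_apply hx he hw hs' (mfderiv IN I φ x v)).trans (congrArg (· + _)
    (mvfderiv_comp_apply ((mdifferentiableAt_section_iff_clma he).1 hs') hφ v))
  have h3 : (fun y => e.continuousLinearMapAt ℝ y (s y)) ∘ φ
      =ᶠ[𝓝 x] (fun y => e.continuousLinearMapAt ℝ y (s' y)) ∘ φ :=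
    h.mono fun y hy => congrArg (e.continuousLinearMapAt ℝ (φ y)) hy
  rw [h3.mfderiv_eq, h.self_of_nhds] at h1
  have h4 := h1.trans h2.symm
  have := congrArg (e.symmL ℝ (φ x)) h4
  rwa [e.symmL_continuousLinearMapAt he, e.symmL_continuousLinearMapAt he] at this

theorem HasConnForm.apply_constSec {V : Set X}
    {D : (Π x : X, W x) → (Π x : X, TangentSpace I x →L[ℝ] W x)}
    {e : Trivialization F (TotalSpace.proj : TotalSpace F W → X)} [MemTrivializationAtlas e]
    {w : X} {A : E → E →L[ℝ] F →L[ℝ] F} (hA : HasConnForm V D e w A) {x : X} (hx : x ∈ V)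
    (he : x ∈ e.baseSet) (hw : x ∈ (extChartAt I w).source) (f : F) (v : E) :
    D (constSec e f) x v = constSec e (A (extChartAt I w x) (dchart I w x v) f) x := by
  have hs := ((contMDiffOn_constSec (I := I) (e := e) f) x he).contMDiffAt
    (e.open_baseSet.mem_nhds he)
  have h1 := hA.clma_apply hx he hw (hs.mdifferentiableAt (by simp)) v
  have h2 : (fun y => e.continuousLinearMapAt ℝ y (constSec e f y)) =ᶠ[𝓝 x] fun _ => f := by
    filter_upwards [e.open_baseSet.mem_nhds he] with y hy using clma_constSec hy f
  have h3 : (mvfderiv I (fun y => e.continuousLinearMapAt ℝ y (constSec e f y)) x v : F) = 0 := by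
    have := h2.mfderiv_eq (I := I) (I' := 𝓘(ℝ, F))
    refine (DFunLike.congr_fun this v).trans ?_
    rw [mfderiv_const]
    rfl
  rw [h3, zero_add, clma_constSec he] at h1
  exact (e.symmL_continuousLinearMapAt he _).symm.trans (congrArg (e.symmL ℝ x) h1)

end Along

section Frames

variable {k : ℕ} [NeZero k]
  {𝔤₁ : Type*} [NormedAddCommGroup 𝔤₁] [NormedSpace ℝ 𝔤₁]
  {𝔤₂ : Type*} [NormedAddCommGroup 𝔤₂] [NormedSpace ℝ 𝔤₂]
  {Gc₁ : Type*} [TopologicalSpace Gc₁] [ChartedSpace 𝔤₁ Gc₁] [Group Gc₁]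
  {G₁ : Type*} [TopologicalSpace G₁] [ChartedSpace 𝔤₁ G₁] [Group G₁]
  {Gc₂ : Type*} [TopologicalSpace Gc₂] [ChartedSpace 𝔤₂ Gc₂] [Group Gc₂]
  {G₂ : Type*} [TopologicalSpace G₂] [ChartedSpace 𝔤₂ G₂] [Group G₂]
  {ext₁ : CentralExtension k 𝔤₁ Gc₁ G₁} {ext₂ : CentralExtension k 𝔤₂ Gc₂ G₂} {q : ℤ}
  {EB : Type*} [NormedAddCommGroup EB] [NormedSpace ℝ EB]
  {B : Type*} [TopologicalSpace B] [ChartedSpace EB B] [IsManifold 𝓘(ℝ, EB) ∞ B]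
  [MulAction (G₁ × G₂) B]
  {E : Type*} [NormedAddCommGroup E] [NormedSpace ℝ E] {H : Type*} [TopologicalSpace H]
  {I : ModelWithCorners ℝ E H} {X : Type*} [TopologicalSpace X] [ChartedSpace H X]

/-- A local section `s` of a principal bundle over `U`, and a map `κ` from an open subset `O` of
the bundle to the extended group, with `b = κ b • s (pr b)`. -/
structure IsLocalLifting (ext₁ : CentralExtension k 𝔤₁ Gc₁ G₁)
    (ext₂ : CentralExtension k 𝔤₂ Gc₂ G₂) (I : ModelWithCorners ℝ E H) (pr : B → X)
    (s : X → B) (U : Set X) (κ : B → Gc₁ × Gc₂) (O : Set B) : Prop where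
  isOpen_base : IsOpen U
  smooth_section : ContMDiffOn I 𝓘(ℝ, EB) ∞ s U
  proj_section : ∀ u ∈ U, pr (s u) = u
  isOpen : IsOpen O
  smooth_lift : ContMDiffOn 𝓘(ℝ, EB) (𝓘(ℝ, 𝔤₁).prod 𝓘(ℝ, 𝔤₂)) ∞ κ O
  proj_mem : ∀ b ∈ O, pr b ∈ U
  smul_eq : ∀ b ∈ O, dProj ext₁ ext₂ (κ b) • s (pr b) = b

theorem exists_isLocalLifting {V : Set X} {pr : B → X}
    (hB : IsPrincipalBundle (G := G₁ × G₂) (EB := EB) I (𝓘(ℝ, 𝔤₁).prod 𝓘(ℝ, 𝔤₂)) V pr)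
    {u₀ : X} (hu : u₀ ∈ V) : ∃ (s : X → B) (U₀ : Set X), U₀ ⊆ V ∧ IsOpen U₀ ∧ u₀ ∈ U₀ ∧
      ContMDiffOn I 𝓘(ℝ, EB) ∞ s U₀ ∧ (∀ u ∈ U₀, pr (s u) = u) ∧
      ∀ U ⊆ U₀, IsOpen U → ∀ b, pr b ∈ U → ∃ κ O, b ∈ O ∧
        IsLocalLifting (EB := EB) ext₁ ext₂ I pr s U κ O := by
  obtain ⟨U₀, hU₀V, hU₀, huU₀, s, τ, hs, hps, hτ, hτs⟩ := hB.locally_trivial u₀ hu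
  refine ⟨s, U₀, hU₀V, hU₀, huU₀, hs, hps, fun U hUU₀ hU b hb => ?_⟩
  obtain ⟨g, hg⟩ := dProj_surjective ext₁ ext₂ (τ b)
  obtain ⟨Q, ℓ, hQ, hgQ, hℓ, hpℓ, -⟩ := exists_localLift ext₁ ext₂ g
  have hpU : IsOpen (pr ⁻¹' U) := hU.preimage hB.smooth_proj.continuous
  have hτ' : ContMDiffOn 𝓘(ℝ, EB) (𝓘(ℝ, 𝔤₁).prod 𝓘(ℝ, 𝔤₂)) ∞ τ (pr ⁻¹' U) :=
    hτ.mono (Set.preimage_mono hUU₀)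
  refine ⟨ℓ ∘ τ, pr ⁻¹' U ∩ τ ⁻¹' Q, ⟨hb, by rwa [Set.mem_preimage, ← hg]⟩, hU, hs.mono hUU₀,
    fun u hu => hps u (hUU₀ hu), hτ'.continuousOn.isOpen_inter_preimage hpU hQ,
    hℓ.comp (hτ'.mono Set.inter_subset_left) fun c hc => hc.2, fun c hc => hc.1, fun c hc => ?_⟩
  have h1 := hpℓ _ hc.2
  exact (congrArg (· • s (pr c)) h1).trans (hτs c (hUU₀ hc.1))

variable {pr : B → X} {s : X → B} {U : Set X} {κ : B → Gc₁ × Gc₂} {O : Set B}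

/-- Two continuous liftings which agree at a point agree near it. -/
theorem IsLocalLifting.eventually_eq {V : Set X}
    (hB : IsPrincipalBundle (G := G₁ × G₂) (EB := EB) I (𝓘(ℝ, 𝔤₁).prod 𝓘(ℝ, 𝔤₂)) V pr)
    (hκ : IsLocalLifting (EB := EB) ext₁ ext₂ I pr s U κ O) {N : Type*} [TopologicalSpace N]
    {c : N → B} {γ : N → Gc₁ × Gc₂} {x : N} (hc : ContinuousAt c x) (hγ : ContinuousAt γ x)
    (hx : c x ∈ O) (h : ∀ᶠ y in 𝓝 x, dProj ext₁ ext₂ (γ y) • s (pr (c y)) = c y)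
    (h0 : κ (c x) = γ x) : ∀ᶠ y in 𝓝 x, c y ∈ O ∧ κ (c y) = γ y := by
  obtain ⟨N', hN', hinj⟩ := exists_nhds_injOn ext₁ ext₂ (γ x)
  have h1 : ∀ᶠ y in 𝓝 x, c y ∈ O := hc.eventually (hκ.isOpen.mem_nhds hx)
  have h2 : ContinuousAt (fun y => κ (c y)) x :=
    (hκ.smooth_lift.continuousOn.continuousAt (hκ.isOpen.mem_nhds hx)).comp hc
  have h3 : ∀ᶠ y in 𝓝 x, κ (c y) ∈ N' := h2.eventually_mem (by simpa only [h0] using hN')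
  filter_upwards [h1, h3, hγ.eventually hN', h] with y hy1 hy2 hy3 hy4
  refine ⟨hy1, hinj hy2 hy3 ?_⟩
  have h5 := (hκ.smul_eq _ hy1).trans hy4.symm
  have h6 := hB.free ((dProj ext₁ ext₂ (γ y))⁻¹ * dProj ext₁ ext₂ (κ (c y))) (s (pr (c y)))
    (by rw [mul_smul, h5, inv_smul_smul])
  rw [inv_mul_eq_one] at h6
  exact h6.symm

variable {F : Type*} [NormedAddCommGroup F] [NormedSpace ℝ F]
  {W : B → Type*} [TopologicalSpace (TotalSpace F W)]
  [∀ b, AddCommGroup (W b)] [∀ b, Module ℝ (W b)] [∀ b, Module ℂ (W b)]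
  [∀ b, TopologicalSpace (W b)] [FiberBundle F W]
  (P : PsiModule q ext₁ ext₂ EB F W)

/-- The action of `g` as a map to the fibre over a point which is given to be `g • b`. -/
def actTo (g : Gc₁ × Gc₂) {b b' : B} (h : dProj ext₁ ext₂ g • b = b') : W b →ₗ[ℂ] W b' :=
  h ▸ P.act g b

theorem mk_actTo (g : Gc₁ × Gc₂) {b b' : B} (h : dProj ext₁ ext₂ g • b = b') (w : W b) :
    TotalSpace.mk' F b' (actTo P g h w) = TotalSpace.mk' F _ (P.act g b w) := by
  subst h
  rfl

/-- The action on the total space. -/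
def totalAct (g : Gc₁ × Gc₂) (w : TotalSpace F W) : TotalSpace F W :=
  TotalSpace.mk' F (dProj ext₁ ext₂ g • w.1) (P.act g w.1 w.2)

theorem totalAct_mul (g g' : Gc₁ × Gc₂) (w : TotalSpace F W) :
    totalAct P (g * g') w = totalAct P g (totalAct P g' w) :=
  P.act_mul g g' w.1 w.2

theorem mk_actTo_eq (g : Gc₁ × Gc₂) {b b' : B} (h : dProj ext₁ ext₂ g • b = b') (w : W b) :
    TotalSpace.mk' F b' (actTo P g h w) = totalAct P g (TotalSpace.mk' F b w) :=
  mk_actTo P g h w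

theorem actTo_bijective (g : Gc₁ × Gc₂) {b b' : B} (h : dProj ext₁ ext₂ g • b = b') :
    Function.Bijective (actTo P g h) := by
  have h' : dProj ext₁ ext₂ g⁻¹ • b' = b := by rw [← h, map_inv, inv_smul_smul]
  have key : ∀ (g g' : Gc₁ × Gc₂) (b b' : B) (h : dProj ext₁ ext₂ g • b = b')
      (h' : dProj ext₁ ext₂ g' • b' = b) (_ : g' * g = 1) (w : W b),
      actTo P g' h' (actTo P g h w) = w := by
    intro g g' b b' h h' hg w
    refine (TotalSpace.mk_inj (F := F)).1 ?_
    refine (mk_actTo_eq P g' h' _).trans ?_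
    refine (congrArg (totalAct P g') (mk_actTo_eq P g h w)).trans ?_
    rw [← totalAct_mul, hg]
    exact P.act_one b w
  exact ⟨Function.LeftInverse.injective (key g g⁻¹ b b' h h' (inv_mul_cancel g)),
    Function.RightInverse.surjective (key g⁻¹ g b' b h' h (mul_inv_cancel g))⟩

end Frames

section ModuleFrame

variable {k : ℕ} [NeZero k]
  {𝔤₁ : Type*} [NormedAddCommGroup 𝔤₁] [NormedSpace ℝ 𝔤₁]
  {𝔤₂ : Type*} [NormedAddCommGroup 𝔤₂] [NormedSpace ℝ 𝔤₂]
  {Gc₁ : Type*} [TopologicalSpace Gc₁] [ChartedSpace 𝔤₁ Gc₁] [Group Gc₁]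
  {G₁ : Type*} [TopologicalSpace G₁] [ChartedSpace 𝔤₁ G₁] [Group G₁]
  {Gc₂ : Type*} [TopologicalSpace Gc₂] [ChartedSpace 𝔤₂ Gc₂] [Group Gc₂]
  {G₂ : Type*} [TopologicalSpace G₂] [ChartedSpace 𝔤₂ G₂] [Group G₂]
  {ext₁ : CentralExtension k 𝔤₁ Gc₁ G₁} {ext₂ : CentralExtension k 𝔤₂ Gc₂ G₂} {q : ℤ}
  {EB : Type*} [NormedAddCommGroup EB] [NormedSpace ℝ EB]
  {B : Type*} [TopologicalSpace B] [ChartedSpace EB B] [IsManifold 𝓘(ℝ, EB) ∞ B]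
  [MulAction (G₁ × G₂) B]
  {E : Type*} [NormedAddCommGroup E] [NormedSpace ℝ E] {H : Type*} [TopologicalSpace H]
  {I : ModelWithCorners ℝ E H} {X : Type*} [TopologicalSpace X] [ChartedSpace H X]
  {F : Type*} [NormedAddCommGroup F] [NormedSpace ℝ F]
  {W : B → Type*} [TopologicalSpace (TotalSpace F W)]
  [∀ b, AddCommGroup (W b)] [∀ b, Module ℝ (W b)] [∀ b, Module ℂ (W b)]
  [∀ b, TopologicalSpace (W b)] [∀ b, IsTopologicalAddGroup (W b)]
  [∀ b, ContinuousSMul ℝ (W b)] [FiberBundle F W] [VectorBundle ℝ F W]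
  [ContMDiffVectorBundle ∞ F W 𝓘(ℝ, EB)]
  (P : PsiModule q ext₁ ext₂ EB F W) (pr : B → X) (s : X → B) (κ : B → Gc₁ × Gc₂)
  (e : Trivialization F (TotalSpace.proj : TotalSpace F W → B)) [MemTrivializationAtlas e]

open Classical in
/-- The section obtained from the constant section `f` along `s` by the action of `κ`. -/
def moduleFrame (f : F) (b : B) : W b :=
  if h : dProj ext₁ ext₂ (κ b) • s (pr b) = b then
    actTo P (κ b) h (constSec e f (s (pr b))) else 0

variable {pr s κ} {U : Set X} {O : Set B}

theorem mk_moduleFrame (hκ : IsLocalLifting (EB := EB) ext₁ ext₂ I pr s U κ O) (f : F) {b : B}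
    (hb : b ∈ O) : TotalSpace.mk' F b (moduleFrame P pr s κ e f b)
      = totalAct P (κ b) (TotalSpace.mk' F (s (pr b)) (constSec e f (s (pr b)))) := by
  rw [moduleFrame, dif_pos (hκ.smul_eq b hb)]
  exact mk_actTo_eq P _ _ _

theorem contMDiff_totalAct_comp {EN : Type*} [NormedAddCommGroup EN] [NormedSpace ℝ EN]
    {HN : Type*} [TopologicalSpace HN] {IN : ModelWithCorners ℝ EN HN} {N : Type*}
    [TopologicalSpace N] [ChartedSpace HN N] {γ : N → Gc₁ × Gc₂} {w : N → TotalSpace F W} {x : N}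
    (hγ : ContMDiffAt IN (𝓘(ℝ, 𝔤₁).prod 𝓘(ℝ, 𝔤₂)) ∞ γ x)
    (hw : ContMDiffAt IN (𝓘(ℝ, EB).prod 𝓘(ℝ, F)) ∞ w x) :
    ContMDiffAt IN (𝓘(ℝ, EB).prod 𝓘(ℝ, F)) ∞ (fun y => totalAct P (γ y) (w y)) x :=
  (P.smooth_act (γ x, w x)).comp x (hγ.prodMk hw)

theorem contMDiffAt_moduleFrame {V : Set X}
    (hB : IsPrincipalBundle (G := G₁ × G₂) (EB := EB) I (𝓘(ℝ, 𝔤₁).prod 𝓘(ℝ, 𝔤₂)) V pr)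
    (hκ : IsLocalLifting (EB := EB) ext₁ ext₂ I pr s U κ O)
    (he : ∀ u ∈ U, s u ∈ e.baseSet) (f : F) {b : B} (hb : b ∈ O) :
    ContMDiffAt 𝓘(ℝ, EB) (𝓘(ℝ, EB).prod 𝓘(ℝ, F)) ∞
      (fun c => TotalSpace.mk' F c (moduleFrame P pr s κ e f c)) b := by
  have hu := hκ.proj_mem b hb
  have h1 : ContMDiffAt 𝓘(ℝ, EB) (𝓘(ℝ, EB).prod 𝓘(ℝ, F)) ∞
      (fun c => TotalSpace.mk' F (s (pr c)) (constSec e f (s (pr c)))) b :=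
    ContMDiffAt.comp (g := fun c => TotalSpace.mk' F c (constSec e f c)) (f := fun c => s (pr c)) b
      ((contMDiffOn_constSec (I := 𝓘(ℝ, EB)) (e := e) f).contMDiffAt
        (e.open_baseSet.mem_nhds (he _ hu)))
      (((hκ.smooth_section.contMDiffAt (hκ.isOpen_base.mem_nhds hu))).comp b
        (hB.smooth_proj b))
  refine (contMDiff_totalAct_comp P (hκ.smooth_lift.contMDiffAt (hκ.isOpen.mem_nhds hb)) h1)
    |>.congr_of_eventuallyEq ?_
  filter_upwards [hκ.isOpen.mem_nhds hb] with c hc using mk_moduleFrame P e hκ f hc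

theorem moduleFrame_bijective (hκ : IsLocalLifting (EB := EB) ext₁ ext₂ I pr s U κ O)
    (he : ∀ u ∈ U, s u ∈ e.baseSet) {b : B} (hb : b ∈ O) :
    Function.Bijective fun f => moduleFrame P pr s κ e f b := by
  have h1 : (fun f => moduleFrame P pr s κ e f b)
      = actTo P (κ b) (hκ.smul_eq b hb) ∘ (frameEquiv e (he _ (hκ.proj_mem b hb))) :=
    funext fun f => dif_pos (hκ.smul_eq b hb)
  rw [h1]
  exact (actTo_bijective P _ _).comp (LinearEquiv.bijective _)

section Linear

variable [NormedSpace ℂ F] [VectorBundle ℂ F W]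

theorem constSec_add (f f' : F) (b : B) :
    constSec e (f + f') b = constSec e f b + constSec e f' b :=
  map_add (e.symmL ℝ b) f f'

theorem constSec_smul (c : ℂ) (f : F) (b : B) : constSec e (c • f) b = c • constSec e f b := by
  have h : ∀ f, constSec e f b = e.symmL ℂ b f := fun f => by
    by_cases hb : b ∈ e.baseSet
    · exact (e.symmL_apply (R := ℝ) hb f).trans (e.symmL_apply (R := ℂ) hb f).symm
    · exact (e.symmL_apply_of_notMem (R := ℝ) hb f).trans
        (e.symmL_apply_of_notMem (R := ℂ) hb f).symm
  rw [h, h, map_smul]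

/-- `moduleFrame` as a complex linear isomorphism. -/
def moduleFrameEquiv (hκ : IsLocalLifting (EB := EB) ext₁ ext₂ I pr s U κ O)
    (he : ∀ u ∈ U, s u ∈ e.baseSet) {b : B} (hb : b ∈ O) : F ≃ₗ[ℂ] W b :=
  LinearEquiv.ofBijective
    { toFun := fun f => moduleFrame P pr s κ e f b
      map_add' := fun f f' => by
        simp only [moduleFrame, dif_pos (hκ.smul_eq b hb), constSec_add, map_add]
      map_smul' := fun c f => by
        simp only [moduleFrame, dif_pos (hκ.smul_eq b hb), constSec_smul, map_smul,
          RingHom.id_apply] }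
    (moduleFrame_bijective P e hκ he hb)

end Linear

end ModuleFrame

section ModuleConnection

variable {k : ℕ} [NeZero k]
  {𝔤₁ : Type*} [NormedAddCommGroup 𝔤₁] [NormedSpace ℝ 𝔤₁]
  {𝔤₂ : Type*} [NormedAddCommGroup 𝔤₂] [NormedSpace ℝ 𝔤₂]
  {Gc₁ : Type*} [TopologicalSpace Gc₁] [ChartedSpace 𝔤₁ Gc₁] [Group Gc₁]
  [LieGroup 𝓘(ℝ, 𝔤₁) ∞ Gc₁]
  {G₁ : Type*} [TopologicalSpace G₁] [ChartedSpace 𝔤₁ G₁] [Group G₁]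
  {Gc₂ : Type*} [TopologicalSpace Gc₂] [ChartedSpace 𝔤₂ Gc₂] [Group Gc₂]
  [LieGroup 𝓘(ℝ, 𝔤₂) ∞ Gc₂]
  {G₂ : Type*} [TopologicalSpace G₂] [ChartedSpace 𝔤₂ G₂] [Group G₂]
  {ext₁ : CentralExtension k 𝔤₁ Gc₁ G₁} {ext₂ : CentralExtension k 𝔤₂ Gc₂ G₂} {q : ℤ}
  {EB : Type*} [NormedAddCommGroup EB] [NormedSpace ℝ EB] [FiniteDimensional ℝ EB]
  {B : Type*} [TopologicalSpace B] [ChartedSpace EB B] [IsManifold 𝓘(ℝ, EB) ∞ B]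
  [MulAction (G₁ × G₂) B]
  {E : Type*} [NormedAddCommGroup E] [NormedSpace ℝ E] {H : Type*} [TopologicalSpace H]
  {I : ModelWithCorners ℝ E H} {X : Type*} [TopologicalSpace X] [ChartedSpace H X]
  {V : Set X} {pr : B → X} {s : X → B} {κ : B → Gc₁ × Gc₂} {U : Set X} {O : Set B}

theorem contMDiff_group_mul :
    ContMDiff ((𝓘(ℝ, 𝔤₁).prod 𝓘(ℝ, 𝔤₂)).prod (𝓘(ℝ, 𝔤₁).prod 𝓘(ℝ, 𝔤₂)))
      (𝓘(ℝ, 𝔤₁).prod 𝓘(ℝ, 𝔤₂)) ∞ (fun p : (Gc₁ × Gc₂) × (Gc₁ × Gc₂) => p.1 * p.2) :=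
  contMDiff_mul _ ∞

theorem IsPrincipalBundle.proj_smul
    (hB : IsPrincipalBundle (G := G₁ × G₂) (EB := EB) I (𝓘(ℝ, 𝔤₁).prod 𝓘(ℝ, 𝔤₂)) V pr)
    (g : G₁ × G₂) (b : B) : pr (g • b) = pr b :=
  ((hB.proj_eq_iff b (g • b)).2 ⟨g, rfl⟩).symm

theorem IsPrincipalBundle.contMDiff_dProj_smul
    (hB : IsPrincipalBundle (G := G₁ × G₂) (EB := EB) I (𝓘(ℝ, 𝔤₁).prod 𝓘(ℝ, 𝔤₂)) V pr)
    (ext₁ : CentralExtension k 𝔤₁ Gc₁ G₁) (ext₂ : CentralExtension k 𝔤₂ Gc₂ G₂) :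
    ContMDiff ((𝓘(ℝ, 𝔤₁).prod 𝓘(ℝ, 𝔤₂)).prod 𝓘(ℝ, EB)) 𝓘(ℝ, EB) ∞
      (fun p : (Gc₁ × Gc₂) × B => dProj ext₁ ext₂ p.1 • p.2) :=
  hB.smooth_smul.comp (((contMDiff_dProj ext₁ ext₂).comp contMDiff_fst).prodMk contMDiff_snd)

theorem IsPrincipalBundle.contMDiff_const_smul
    (hB : IsPrincipalBundle (G := G₁ × G₂) (EB := EB) I (𝓘(ℝ, 𝔤₁).prod 𝓘(ℝ, 𝔤₂)) V pr)
    (g : G₁ × G₂) : ContMDiff 𝓘(ℝ, EB) 𝓘(ℝ, EB) ∞ (fun b : B => g • b) :=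
  hB.smooth_smul.comp (contMDiff_const.prodMk contMDiff_id)

/-- A tangent vector of a principal bundle is the sum of a vector tangent to the fibre and of the
image of its projection under a local section through its base point. -/
theorem IsLocalLifting.exists_vertical_add
    (hB : IsPrincipalBundle (G := G₁ × G₂) (EB := EB) I (𝓘(ℝ, 𝔤₁).prod 𝓘(ℝ, 𝔤₂)) V pr)
    (hκ : IsLocalLifting (EB := EB) ext₁ ext₂ I pr s U κ O) {b : B} (hb : b ∈ O) (Y : EB) :
    ∃ (ξ : 𝔤₁ × 𝔤₂) (y z : EB), Y = y + z ∧ y = mfderiv (𝓘(ℝ, 𝔤₁).prod 𝓘(ℝ, 𝔤₂)) 𝓘(ℝ, EB)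
        (fun γ : Gc₁ × Gc₂ => dProj ext₁ ext₂ γ • b) 1 ξ ∧
      z = mfderiv I 𝓘(ℝ, EB) (fun u => dProj ext₁ ext₂ (κ b) • s u) (pr b)
        (mfderiv 𝓘(ℝ, EB) I pr b Y) := by
  set g := κ b with hg
  have hu := hκ.proj_mem b hb
  let Φ : (Gc₁ × Gc₂) × B → B := fun p => dProj ext₁ ext₂ p.1 • p.2
  let φ : X → B := fun u => dProj ext₁ ext₂ g • s u
  let j : B → (Gc₁ × Gc₂) × B := fun c => (κ c * g⁻¹, φ (pr c))
  have hφ : ContMDiffAt I 𝓘(ℝ, EB) ∞ φ (pr b) :=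
    (hB.contMDiff_const_smul (dProj ext₁ ext₂ g) (s (pr b))).comp (pr b)
      (hκ.smooth_section.contMDiffAt (hκ.isOpen_base.mem_nhds hu))
  have hφm := hφ.mdifferentiableAt (by simp)
  have hprm := (hB.smooth_proj b).mdifferentiableAt (by simp)
  have hκb := hκ.smooth_lift.contMDiffAt (hκ.isOpen.mem_nhds hb)
  have h1 : MDifferentiableAt 𝓘(ℝ, EB) (𝓘(ℝ, 𝔤₁).prod 𝓘(ℝ, 𝔤₂)) (fun c => κ c * g⁻¹) b :=
    ((contMDiff_group_mul (κ b, g⁻¹)).comp b (hκb.prodMk contMDiffAt_const)).mdifferentiableAt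
      (by simp)
  have h2 : MDifferentiableAt 𝓘(ℝ, EB) 𝓘(ℝ, EB) (fun c => φ (pr c)) b := hφm.comp b hprm
  have hΦ := (hB.contMDiff_dProj_smul ext₁ ext₂ (j b)).mdifferentiableAt (by simp)
  have hid : (fun c => c) =ᶠ[𝓝 b] Φ ∘ j := by
    filter_upwards [hκ.isOpen.mem_nhds hb] with c hc
    change c = dProj ext₁ ext₂ (κ c * g⁻¹) • dProj ext₁ ext₂ g • s (pr c)
    rw [smul_smul, ← map_mul, inv_mul_cancel_right, hκ.smul_eq c hc]
  have e1 : (mfderiv 𝓘(ℝ, EB) 𝓘(ℝ, EB) (fun c : B => c) b Y : EB) = Y :=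
    DFunLike.congr_fun (mfderiv_id (I := 𝓘(ℝ, EB)) (x := b)) Y
  have e2 : (mfderiv 𝓘(ℝ, EB) 𝓘(ℝ, EB) (fun c : B => c) b Y : EB)
      = mfderiv ((𝓘(ℝ, 𝔤₁).prod 𝓘(ℝ, 𝔤₂)).prod 𝓘(ℝ, EB)) 𝓘(ℝ, EB) Φ (j b)
        (mfderiv 𝓘(ℝ, EB) ((𝓘(ℝ, 𝔤₁).prod 𝓘(ℝ, 𝔤₂)).prod 𝓘(ℝ, EB)) j b Y) := by
    refine (DFunLike.congr_fun hid.mfderiv_eq Y).trans ?_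
    exact DFunLike.congr_fun (mfderiv_comp b hΦ (h1.prodMk h2)) Y
  have e3 := mfderiv_prod_eq_add_apply (v := mfderiv 𝓘(ℝ, EB)
    ((𝓘(ℝ, 𝔤₁).prod 𝓘(ℝ, 𝔤₂)).prod 𝓘(ℝ, EB)) j b Y) hΦ
  have e4 : mfderiv 𝓘(ℝ, EB) ((𝓘(ℝ, 𝔤₁).prod 𝓘(ℝ, 𝔤₂)).prod 𝓘(ℝ, EB)) j b
      = (mfderiv 𝓘(ℝ, EB) (𝓘(ℝ, 𝔤₁).prod 𝓘(ℝ, 𝔤₂)) (fun c => κ c * g⁻¹) b).prod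
        (mfderiv 𝓘(ℝ, EB) 𝓘(ℝ, EB) (fun c => φ (pr c)) b) := mfderiv_prodMk h1 h2
  have e5 : (mfderiv 𝓘(ℝ, EB) 𝓘(ℝ, EB) (fun c => φ (pr c)) b Y : EB)
      = mfderiv I 𝓘(ℝ, EB) φ (pr b) (mfderiv 𝓘(ℝ, EB) I pr b Y) :=
    DFunLike.congr_fun (mfderiv_comp b hφm hprm) Y
  have key : ∀ (γ : Gc₁ × Gc₂) (c : B) (_ : γ = 1) (_ : c = b) (v : (𝔤₁ × 𝔤₂) × EB)
      (y y' z : EB), y = mfderiv (𝓘(ℝ, 𝔤₁).prod 𝓘(ℝ, 𝔤₂)) 𝓘(ℝ, EB) (fun z => Φ (z, c)) γ v.1 →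
      z = mfderiv 𝓘(ℝ, EB) 𝓘(ℝ, EB) (fun z => Φ (γ, z)) c v.2 →
      y' = mfderiv (𝓘(ℝ, 𝔤₁).prod 𝓘(ℝ, 𝔤₂)) 𝓘(ℝ, EB)
        (fun γ : Gc₁ × Gc₂ => dProj ext₁ ext₂ γ • b) 1 v.1 → y + z = y' + v.2 := by
    rintro γ c rfl rfl v y y' z hy hz hy'
    have : (fun z : B => Φ (1, z)) = id := by
      funext z
      change dProj ext₁ ext₂ 1 • z = z
      rw [map_one, one_smul]
    refine congrArg₂ (· + ·) (hy.trans hy'.symm) (hz.trans ?_)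
    exact (congrArg (fun f : B → B => (mfderiv 𝓘(ℝ, EB) 𝓘(ℝ, EB) f c v.2 : EB)) this).trans
      (DFunLike.congr_fun (mfderiv_id (I := 𝓘(ℝ, EB)) (x := c)) v.2)
  have e6 := key (κ b * g⁻¹) (φ (pr b)) (mul_inv_cancel g) (hκ.smul_eq b hb)
    (mfderiv 𝓘(ℝ, EB) ((𝓘(ℝ, 𝔤₁).prod 𝓘(ℝ, 𝔤₂)).prod 𝓘(ℝ, EB)) j b Y) _ _ _ rfl rfl rfl
  have e7 := DFunLike.congr_fun e4 Y
  refine ⟨mfderiv 𝓘(ℝ, EB) (𝓘(ℝ, 𝔤₁).prod 𝓘(ℝ, 𝔤₂)) (fun c => κ c * g⁻¹) b Y, _, _, ?_, rfl,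
    rfl⟩
  refine (e1.symm.trans (e2.trans (e3.trans e6))).trans ?_
  exact congrArg₂ (· + ·) (congrArg _ (congrArg Prod.fst e7)) ((congrArg Prod.snd e7).trans e5)

variable {F : Type*} [NormedAddCommGroup F] [NormedSpace ℝ F] [FiniteDimensional ℝ F]
  {W : B → Type*} [TopologicalSpace (TotalSpace F W)]
  [∀ b, AddCommGroup (W b)] [∀ b, Module ℝ (W b)] [∀ b, Module ℂ (W b)]
  [∀ b, TopologicalSpace (W b)] [∀ b, IsTopologicalAddGroup (W b)]
  [∀ b, ContinuousSMul ℝ (W b)] [FiberBundle F W] [VectorBundle ℝ F W]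
  [ContMDiffVectorBundle ∞ F W 𝓘(ℝ, EB)]
  {P : PsiModule q ext₁ ext₂ EB F W}
  {e : Trivialization F (TotalSpace.proj : TotalSpace F W → B)} [MemTrivializationAtlas e]
  {D : (Π b : B, W b) → (Π b : B, TangentSpace 𝓘(ℝ, EB) b →L[ℝ] W b)}

theorem mk_congr_point (D : (Π b : B, W b) → (Π b : B, TangentSpace 𝓘(ℝ, EB) b →L[ℝ] W b))
    (σ : Π b : B, W b) {b b' : B} (h : b = b') (Y : EB) :
    TotalSpace.mk' F b (D σ b Y) = TotalSpace.mk' F b' (D σ b' Y) := by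
  subst h
  rfl

theorem IsPsiConnection.apply_moduleFrame_vertical
    (hB : IsPrincipalBundle (G := G₁ × G₂) (EB := EB) I (𝓘(ℝ, 𝔤₁).prod 𝓘(ℝ, 𝔤₂)) V pr)
    (hκ : IsLocalLifting (EB := EB) ext₁ ext₂ I pr s U κ O) (he : ∀ u ∈ U, s u ∈ e.baseSet)
    (hD : IsPsiConnection P D) (f : F) {b : B} (hb : b ∈ O) (ξ : 𝔤₁ × 𝔤₂) :
    D (moduleFrame P pr s κ e f) b (mfderiv (𝓘(ℝ, 𝔤₁).prod 𝓘(ℝ, 𝔤₂)) 𝓘(ℝ, EB)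
        (fun γ : Gc₁ × Gc₂ => dProj ext₁ ext₂ γ • b) 1 ξ : EB) = 0 := by
  have hs := (contMDiffAt_moduleFrame P e hB hκ he f hb).mdifferentiableAt (by simp)
  have hγb : ContinuousAt (fun γ : Gc₁ × Gc₂ => dProj ext₁ ext₂ γ • b) 1 :=
    ((hB.contMDiff_dProj_smul ext₁ ext₂).comp
      (contMDiff_id.prodMk contMDiff_const)).continuous.continuousAt
  have hγm : ContinuousAt (fun γ : Gc₁ × Gc₂ => γ * κ b) 1 :=
    ((contMDiff_group_mul (𝔤₁ := 𝔤₁) (𝔤₂ := 𝔤₂)).comp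
      (contMDiff_id.prodMk contMDiff_const)).continuous.continuousAt
  have h1b : dProj ext₁ ext₂ (1 : Gc₁ × Gc₂) • b = b := by rw [map_one, one_smul]
  have hev := hκ.eventually_eq hB (c := fun γ : Gc₁ × Gc₂ => dProj ext₁ ext₂ γ • b)
    (γ := fun γ => γ * κ b) hγb hγm (by simpa only [h1b] using hb)
    (Filter.Eventually.of_forall fun γ => by
      rw [hB.proj_smul, map_mul, mul_smul, hκ.smul_eq b hb])
    (by simp only [h1b, one_mul])
  have h2 := hD.flat _ b hs (by
    filter_upwards [hev] with γ hγ
    refine (TotalSpace.mk_inj (F := F)).1 ?_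
    refine (congrArg (totalAct P γ) (mk_moduleFrame P e hκ f hb)).trans ?_
    refine Eq.trans ?_ (mk_moduleFrame P e hκ f hγ.1).symm
    rw [hγ.2, hB.proj_smul, totalAct_mul]) ξ
  refine (TotalSpace.mk_inj (F := F)).1 ?_
  refine (mk_congr_point D _ h1b _).symm.trans ?_
  refine (congrArg (TotalSpace.mk' F _) h2).trans ?_
  rw [h1b]

theorem IsPsiConnection.apply_moduleFrame [I.Boundaryless] [IsManifold I ∞ X]
    (hB : IsPrincipalBundle (G := G₁ × G₂) (EB := EB) I (𝓘(ℝ, 𝔤₁).prod 𝓘(ℝ, 𝔤₂)) V pr)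
    (hκ : IsLocalLifting (EB := EB) ext₁ ext₂ I pr s U κ O) (he : ∀ u ∈ U, s u ∈ e.baseSet)
    {b₁ : B} (hc : ∀ u ∈ U, s u ∈ (extChartAt 𝓘(ℝ, EB) b₁).source)
    (hD : IsPsiConnection P D) {A : EB → EB →L[ℝ] F →L[ℝ] F}
    (hA : HasConnForm Set.univ D e b₁ A) (f : F) {b : B} (hb : b ∈ O) (Y : EB) :
    D (moduleFrame P pr s κ e f) b Y
      = moduleFrame P pr s κ e (A (extChartAt 𝓘(ℝ, EB) b₁ (s (pr b)))
        (dchart 𝓘(ℝ, EB) b₁ (s (pr b)) (mfderiv I 𝓘(ℝ, EB) s (pr b)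
          (mfderiv 𝓘(ℝ, EB) I pr b Y))) f) b := by
  have hu := hκ.proj_mem b hb
  set g := κ b with hg
  let φ : X → B := fun u => dProj ext₁ ext₂ g • s u
  have hφb : φ (pr b) = b := hκ.smul_eq b hb
  obtain ⟨ξ, v, z, hYvz, hv, hz⟩ := hκ.exists_vertical_add hB hb Y
  set y := mfderiv 𝓘(ℝ, EB) I pr b Y with hy
  have hsm := hκ.smooth_section.contMDiffAt (hκ.isOpen_base.mem_nhds hu)
  have hgm := hB.contMDiff_const_smul (dProj ext₁ ext₂ g)
  have hφ : ContMDiffAt I 𝓘(ℝ, EB) ∞ φ (pr b) := (hgm (s (pr b))).comp (pr b) hsm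
  have hφm := hφ.mdifferentiableAt (by simp)
  have hσ := (contMDiffAt_moduleFrame P e hB hκ he f hb)
  have h1 : D (moduleFrame P pr s κ e f) b Y = D (moduleFrame P pr s κ e f) b
      (mfderiv I 𝓘(ℝ, EB) φ (pr b) y : EB) := by
    refine (congrArg (D (moduleFrame P pr s κ e f) b) hYvz).trans ?_
    refine (map_add (D (moduleFrame P pr s κ e f) b) v z).trans ?_
    have h2 := hD.apply_moduleFrame_vertical hB hκ he f hb ξ
    rw [← hv] at h2
    exact (congrArg₂ (· + ·) h2 (congrArg (D (moduleFrame P pr s κ e f) b) hz)).trans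
      (zero_add _)
  -- the section transported by `g`
  have hgi : ∀ c : B, dProj ext₁ ext₂ g • (dProj ext₁ ext₂ g)⁻¹ • c = c := fun c =>
    smul_inv_smul _ c
  let t : Π c : B, W c := fun c =>
    actTo P g (hgi c) (constSec e f ((dProj ext₁ ext₂ g)⁻¹ • c))
  have ht : ∀ c, TotalSpace.mk' F c (t c) = totalAct P g (TotalSpace.mk' F _
      (constSec e f ((dProj ext₁ ext₂ g)⁻¹ • c))) := fun c => mk_actTo_eq P g _ _
  have htg : ∀ c, P.act g c (constSec e f c) = t (dProj ext₁ ext₂ g • c) := fun c => by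
    refine (TotalSpace.mk_inj (F := F)).1 ?_
    rw [ht, inv_smul_smul]
    rfl
  have hsu : s (pr b) = (dProj ext₁ ext₂ g)⁻¹ • φ (pr b) := (inv_smul_smul _ _).symm
  have hce : ∀ c ∈ e.baseSet, ContMDiffAt 𝓘(ℝ, EB) (𝓘(ℝ, EB).prod 𝓘(ℝ, F)) ∞
      (fun c => TotalSpace.mk' F c (constSec e f c)) c := fun c hc =>
    (contMDiffOn_constSec (I := 𝓘(ℝ, EB)) (e := e) f).contMDiffAt (e.open_baseSet.mem_nhds hc)
  have htm : ContMDiffAt 𝓘(ℝ, EB) (𝓘(ℝ, EB).prod 𝓘(ℝ, F)) ∞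
      (fun c => TotalSpace.mk' F c (t c)) (φ (pr b)) := by
    have h2 := ContMDiffAt.comp (g := fun c => TotalSpace.mk' F c (constSec e f c))
      (f := fun c => (dProj ext₁ ext₂ g)⁻¹ • c) (φ (pr b))
      (hce _ (by rw [← hsu]; exact he _ hu))
      (hB.contMDiff_const_smul (dProj ext₁ ext₂ g)⁻¹ _)
    refine (contMDiff_totalAct_comp P (contMDiffAt_const (c := g)) h2).congr_of_eventuallyEq ?_
    exact Filter.Eventually.of_forall ht
  have hev := hκ.eventually_eq hB (c := φ) (γ := fun _ => g) (x := pr b) hφ.continuousAt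
    continuousAt_const (hφb.symm ▸ hb) (by
      filter_upwards [hκ.isOpen_base.mem_nhds hu] with u hu
      change dProj ext₁ ext₂ g • s (pr (dProj ext₁ ext₂ g • s u)) = dProj ext₁ ext₂ g • s u
      rw [hB.proj_smul, hκ.proj_section u hu]) (by rw [hφb])
  have h3 : ∀ᶠ u in 𝓝 (pr b), moduleFrame P pr s κ e f (φ u) = t (φ u) := by
    filter_upwards [hev, hκ.isOpen_base.mem_nhds hu] with u hu hu'
    refine (TotalSpace.mk_inj (F := F)).1 ?_
    refine (mk_moduleFrame P e hκ f hu.1).trans ?_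
    rw [ht, hu.2]
    have h4 : s (pr (φ u)) = (dProj ext₁ ext₂ g)⁻¹ • φ u := by
      rw [hB.proj_smul, hκ.proj_section u hu', inv_smul_smul]
    rw [h4]
  have h5 := hD.isConnection.congr_along isOpen_univ (Set.mem_univ _) hφm
    (by rw [hφb]; exact hσ.mdifferentiableAt (by simp)) (htm.mdifferentiableAt (by simp)) h3 y
  have h6 := hD.equivariant g (constSec e f) t htg (s (pr b))
    ((hce _ (he _ hu)).mdifferentiableAt (by simp)) (mfderiv I 𝓘(ℝ, EB) s (pr b) y)
  have h7 : (mfderiv 𝓘(ℝ, EB) 𝓘(ℝ, EB) (fun c : B => dProj ext₁ ext₂ g • c) (s (pr b))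
      (mfderiv I 𝓘(ℝ, EB) s (pr b) y) : EB) = mfderiv I 𝓘(ℝ, EB) φ (pr b) y :=
    (DFunLike.congr_fun (mfderiv_comp (pr b) ((hgm (s (pr b))).mdifferentiableAt (by simp))
      (hsm.mdifferentiableAt (by simp))) y).symm
  have h8 := hA.apply_constSec (Set.mem_univ _) (he _ hu) (hc _ hu) f
    (mfderiv I 𝓘(ℝ, EB) s (pr b) y)
  refine h1.trans ((TotalSpace.mk_inj (F := F)).1 ?_)
  refine (mk_congr_point D _ hφb.symm _).trans ?_
  refine (congrArg (TotalSpace.mk' F _) (h5.trans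
    ((congrArg (D t (φ (pr b))) h7.symm).trans h6.symm))).trans ?_
  refine Eq.trans ?_ (mk_moduleFrame P e hκ _ hb).symm
  exact congrArg (fun w => totalAct P g (TotalSpace.mk' F (s (pr b)) w)) h8

end ModuleConnection

section ChartMaps

variable {E : Type*} [NormedAddCommGroup E] [NormedSpace ℝ E]
  {H : Type*} [TopologicalSpace H] {I : ModelWithCorners ℝ E H} [I.Boundaryless]
  {X : Type*} [TopologicalSpace X] [ChartedSpace H X] [IsManifold I ∞ X]
  {E' : Type*} [NormedAddCommGroup E'] [NormedSpace ℝ E']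
  {H' : Type*} [TopologicalSpace H'] {I' : ModelWithCorners ℝ E' H'} [I'.Boundaryless]
  {X' : Type*} [TopologicalSpace X'] [ChartedSpace H' X'] [IsManifold I' ∞ X']

/-- A map between manifolds in charts. -/
def mapRep (I : ModelWithCorners ℝ E H) (I' : ModelWithCorners ℝ E' H') (w : X) (w' : X')
    (f : X → X') (z : E) : E' := extChartAt I' w' (f ((extChartAt I w).symm z))

variable {f : X → X'} {x w : X} {w' : X'}

theorem mapRep_chart (f : X → X') (w' : X') (hx : x ∈ (extChartAt I w).source) :
    mapRep I I' w w' f (extChartAt I w x) = extChartAt I' w' (f x) := by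
  rw [mapRep, (extChartAt I w).left_inv hx]

theorem contDiffAt_mapRep (hx : x ∈ (extChartAt I w).source)
    (hfx : f x ∈ (extChartAt I' w').source) (hf : ContMDiffAt I I' ∞ f x) :
    ContDiffAt ℝ ∞ (mapRep I I' w w' f) (extChartAt I w x) :=
  (contMDiffAt_iff_contDiffAt_chart (f := fun x => extChartAt I' w' (f x)) hx).1
    ((contMDiffAt_extChartAt' (by rwa [extChartAt_source] at hfx)).comp x hf)

theorem fderiv_mapRep (hx : x ∈ (extChartAt I w).source)
    (hfx : f x ∈ (extChartAt I' w').source) (hf : MDifferentiableAt I I' f x) (v : E) :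
    haveI : IsManifold I 1 X := .of_le (n := ∞) (by simp)
    haveI : IsManifold I' 1 X' := .of_le (n := ∞) (by simp)
    fderiv ℝ (mapRep I I' w w' f) (extChartAt I w x) (dchart I w x v)
      = dchart I' w' (f x) (mfderiv I I' f x v) := by
  have : IsManifold I 1 X := .of_le (n := ∞) (by simp)
  have : IsManifold I' 1 X' := .of_le (n := ∞) (by simp)
  have h1 := mdifferentiableAt_chart (I := I') hfx
  refine (mvfderiv_eq_fderiv_chart (f := fun x => extChartAt I' w' (f x)) hx
    (h1.comp x hf) v).symm.trans ?_
  exact DFunLike.congr_fun (mfderiv_comp x h1 hf) v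

end ChartMaps

section ModuleCurvature

variable {k : ℕ} [NeZero k]
  {𝔤₁ : Type*} [NormedAddCommGroup 𝔤₁] [NormedSpace ℝ 𝔤₁]
  {𝔤₂ : Type*} [NormedAddCommGroup 𝔤₂] [NormedSpace ℝ 𝔤₂]
  {Gc₁ : Type*} [TopologicalSpace Gc₁] [ChartedSpace 𝔤₁ Gc₁] [Group Gc₁]
  [LieGroup 𝓘(ℝ, 𝔤₁) ∞ Gc₁]
  {G₁ : Type*} [TopologicalSpace G₁] [ChartedSpace 𝔤₁ G₁] [Group G₁]
  {Gc₂ : Type*} [TopologicalSpace Gc₂] [ChartedSpace 𝔤₂ Gc₂] [Group Gc₂]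
  [LieGroup 𝓘(ℝ, 𝔤₂) ∞ Gc₂]
  {G₂ : Type*} [TopologicalSpace G₂] [ChartedSpace 𝔤₂ G₂] [Group G₂]
  {ext₁ : CentralExtension k 𝔤₁ Gc₁ G₁} {ext₂ : CentralExtension k 𝔤₂ Gc₂ G₂} {q : ℤ}
  {EB : Type*} [NormedAddCommGroup EB] [NormedSpace ℝ EB] [FiniteDimensional ℝ EB]
  {B : Type*} [TopologicalSpace B] [ChartedSpace EB B] [IsManifold 𝓘(ℝ, EB) ∞ B]
  [MulAction (G₁ × G₂) B]
  {E : Type*} [NormedAddCommGroup E] [NormedSpace ℝ E] {H : Type*} [TopologicalSpace H]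
  {I : ModelWithCorners ℝ E H} [I.Boundaryless] {X : Type*} [TopologicalSpace X]
  [ChartedSpace H X] [IsManifold I ∞ X]
  {V : Set X} {pr : B → X} {s : X → B} {κ : B → Gc₁ × Gc₂} {U : Set X} {O : Set B}
  {F : Type*} [NormedAddCommGroup F] [NormedSpace ℝ F] [FiniteDimensional ℝ F]
  {W : B → Type*} [TopologicalSpace (TotalSpace F W)]
  [∀ b, AddCommGroup (W b)] [∀ b, Module ℝ (W b)] [∀ b, Module ℂ (W b)]
  [∀ b, IsScalarTower ℝ ℂ (W b)]
  [∀ b, TopologicalSpace (W b)] [∀ b, IsTopologicalAddGroup (W b)]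
  [∀ b, ContinuousSMul ℝ (W b)] [FiberBundle F W] [VectorBundle ℝ F W]
  [ContMDiffVectorBundle ∞ F W 𝓘(ℝ, EB)]
  {P : PsiModule q ext₁ ext₂ EB F W}
  {e : Trivialization F (TotalSpace.proj : TotalSpace F W → B)} [MemTrivializationAtlas e]
  {D : (Π b : B, W b) → (Π b : B, TangentSpace 𝓘(ℝ, EB) b →L[ℝ] W b)}

theorem moduleFrame_add (f f' : F) (b : B) :
    moduleFrame P pr s κ e (f + f') b = moduleFrame P pr s κ e f b + moduleFrame P pr s κ e f' b := by
  by_cases h : dProj ext₁ ext₂ (κ b) • s (pr b) = b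
  · simp only [moduleFrame, dif_pos h]
    exact (congrArg _ (map_add (e.symmL ℝ (s (pr b))) f f')).trans (map_add _ _ _)
  · simp only [moduleFrame, dif_neg h, add_zero]

theorem moduleFrame_smul (c : ℝ) (f : F) (b : B) :
    moduleFrame P pr s κ e (c • f) b = c • moduleFrame P pr s κ e f b := by
  by_cases h : dProj ext₁ ext₂ (κ b) • s (pr b) = b
  · simp only [moduleFrame, dif_pos h]
    exact (congrArg _ (map_smul (e.symmL ℝ (s (pr b))) c f)).trans
      (map_smul ((actTo P (κ b) h).restrictScalars ℝ) c _)
  · simp only [moduleFrame, dif_neg h, smul_zero]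

variable (P pr s κ e) in
/-- The matrix of `moduleFrame` in a trivialization and a chart. -/
def frameMatrix (e' : Trivialization F (TotalSpace.proj : TotalSpace F W → B))
    [MemTrivializationAtlas e'] (w : B) (z : EB) : F →L[ℝ] F :=
  LinearMap.toContinuousLinearMap
    { toFun := fun f => secRep 𝓘(ℝ, EB) e' w (moduleFrame P pr s κ e f) z
      map_add' := fun f f' => by
        simp only [secRep, moduleFrame_add, map_add]
      map_smul' := fun c f => by
        simp only [secRep, moduleFrame_smul, map_smul, RingHom.id_apply] }

theorem frameMatrix_apply (e' : Trivialization F (TotalSpace.proj : TotalSpace F W → B))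
    [MemTrivializationAtlas e'] (w : B) (z : EB) (f : F) :
    frameMatrix pr s κ P e e' w z f = secRep 𝓘(ℝ, EB) e' w (moduleFrame P pr s κ e f) z := rfl

theorem contDiffAt_frameMatrix
    (hB : IsPrincipalBundle (G := G₁ × G₂) (EB := EB) I (𝓘(ℝ, 𝔤₁).prod 𝓘(ℝ, 𝔤₂)) V pr)
    (hκ : IsLocalLifting (EB := EB) ext₁ ext₂ I pr s U κ O) (he : ∀ u ∈ U, s u ∈ e.baseSet)
    {e' : Trivialization F (TotalSpace.proj : TotalSpace F W → B)} [MemTrivializationAtlas e']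
    {w b : B} (hb : b ∈ O) (he' : b ∈ e'.baseSet) (hw : b ∈ (extChartAt 𝓘(ℝ, EB) w).source) :
    ContDiffAt ℝ ∞ (frameMatrix pr s κ P e e' w) (extChartAt 𝓘(ℝ, EB) w b) :=
  contDiffAt_clm_of_apply fun f =>
    (contMDiffAt_section_iff_secRep he' hw).1 (contMDiffAt_moduleFrame P e hB hκ he f hb)

theorem IsPsiConnection.frameMatrix_gauge
    (hB : IsPrincipalBundle (G := G₁ × G₂) (EB := EB) I (𝓘(ℝ, 𝔤₁).prod 𝓘(ℝ, 𝔤₂)) V pr)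
    (hκ : IsLocalLifting (EB := EB) ext₁ ext₂ I pr s U κ O) (he : ∀ u ∈ U, s u ∈ e.baseSet)
    {b₁ : B} (hc : ∀ u ∈ U, s u ∈ (extChartAt 𝓘(ℝ, EB) b₁).source)
    {w : X} (hw : ∀ u ∈ U, u ∈ (extChartAt I w).source)
    (hD : IsPsiConnection P D) {A : EB → EB →L[ℝ] F →L[ℝ] F}
    (hA : HasConnForm Set.univ D e b₁ A)
    {e' : Trivialization F (TotalSpace.proj : TotalSpace F W → B)} [MemTrivializationAtlas e']
    {w' b : B} (hb : b ∈ O) (he' : b ∈ e'.baseSet) (hw' : b ∈ (extChartAt 𝓘(ℝ, EB) w').source)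
    {A' : EB → EB →L[ℝ] F →L[ℝ] F} (hA' : HasConnForm Set.univ D e' w' A') (v : EB) :
    frameMatrix pr s κ P e e' w' (extChartAt 𝓘(ℝ, EB) w' b)
        * (A (mapRep I 𝓘(ℝ, EB) w b₁ s (mapRep 𝓘(ℝ, EB) I w' w pr (extChartAt 𝓘(ℝ, EB) w' b))))
          (fderiv ℝ (mapRep I 𝓘(ℝ, EB) w b₁ s)
            (mapRep 𝓘(ℝ, EB) I w' w pr (extChartAt 𝓘(ℝ, EB) w' b))
            (fderiv ℝ (mapRep 𝓘(ℝ, EB) I w' w pr) (extChartAt 𝓘(ℝ, EB) w' b) v))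
      = fderiv ℝ (frameMatrix pr s κ P e e' w') (extChartAt 𝓘(ℝ, EB) w' b) v
        + A' (extChartAt 𝓘(ℝ, EB) w' b) v
          * frameMatrix pr s κ P e e' w' (extChartAt 𝓘(ℝ, EB) w' b) := by
  have hu := hκ.proj_mem b hb
  have hprb := hB.smooth_proj b
  have hsm := hκ.smooth_section.contMDiffAt (hκ.isOpen_base.mem_nhds hu)
  set z := extChartAt 𝓘(ℝ, EB) w' b with hz
  obtain ⟨Y, rfl⟩ : ∃ Y : EB, dchart 𝓘(ℝ, EB) w' b Y = v := by
    refine ⟨dchartSymm 𝓘(ℝ, EB) w' z v, ?_⟩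
    have := DFunLike.congr_fun (dchart_comp_dchartSymm (I := 𝓘(ℝ, EB))
      ((extChartAt 𝓘(ℝ, EB) w').map_source hw')) v
    rwa [(extChartAt 𝓘(ℝ, EB) w').left_inv hw'] at this
  have hpr : mapRep 𝓘(ℝ, EB) I w' w pr z = extChartAt I w (pr b) := mapRep_chart pr w hw'
  have hdpr := fderiv_mapRep (I := 𝓘(ℝ, EB)) (I' := I) (w' := w) hw' (hw _ hu)
    (hprb.mdifferentiableAt (by simp)) Y
  have hds := fderiv_mapRep (I := I) (I' := 𝓘(ℝ, EB)) (w' := b₁) (hw _ hu) (hc _ hu)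
    (hsm.mdifferentiableAt (by simp)) (mfderiv 𝓘(ℝ, EB) I pr b Y)
  have hs : mapRep I 𝓘(ℝ, EB) w b₁ s (extChartAt I w (pr b))
      = extChartAt 𝓘(ℝ, EB) b₁ (s (pr b)) := mapRep_chart s b₁ (hw _ hu)
  rw [hdpr, hpr, hds, hs]
  refine ContinuousLinearMap.ext fun f => ?_
  have h1 := hD.apply_moduleFrame hB hκ he hc hA f hb Y
  have h2 := (hA' b (Set.mem_univ b) he' hw').2 (moduleFrame P pr s κ e f)
    ((contMDiffAt_moduleFrame P e hB hκ he f hb).mdifferentiableAt (by simp)) Y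
  have h3 : fderiv ℝ (frameMatrix pr s κ P e e' w') z (dchart 𝓘(ℝ, EB) w' b Y) f
      = fderiv ℝ (secRep 𝓘(ℝ, EB) e' w' (moduleFrame P pr s κ e f)) z (dchart 𝓘(ℝ, EB) w' b Y) := by
    have h4 := ((contDiffAt_frameMatrix (P := P) hB hκ he hb he' hw').differentiableAt
      (by simp)).hasFDerivAt
    have h5 := (h4.clm_apply (hasFDerivAt_const f _)).fderiv
    refine Eq.trans ?_ (DFunLike.congr_fun h5 (dchart 𝓘(ℝ, EB) w' b Y)).symm
    simp
    rfl
  have h6 : ∀ f : F, frameMatrix pr s κ P e e' w' z f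
      = e'.continuousLinearMapAt ℝ b (moduleFrame P pr s κ e f b) := fun f => by
    rw [frameMatrix_apply, secRep, hz, (extChartAt 𝓘(ℝ, EB) w').left_inv hw']
  change frameMatrix pr s κ P e e' w' z _ = fderiv ℝ (frameMatrix pr s κ P e e' w') z _ f
    + A' z _ (frameMatrix pr s κ P e e' w' z f)
  rw [h3, h6, h6]
  exact (congrArg (e'.continuousLinearMapAt ℝ b) h1.symm).trans h2

/-- The curvature of a module d-connection is the pull-back of the curvature along a local section
of the principal bundle. -/
theorem IsPsiConnection.curvature_moduleFrame
    (hB : IsPrincipalBundle (G := G₁ × G₂) (EB := EB) I (𝓘(ℝ, 𝔤₁).prod 𝓘(ℝ, 𝔤₂)) V pr)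
    (hκ : IsLocalLifting (EB := EB) ext₁ ext₂ I pr s U κ O) (he : ∀ u ∈ U, s u ∈ e.baseSet)
    {b₁ : B} (hc : ∀ u ∈ U, s u ∈ (extChartAt 𝓘(ℝ, EB) b₁).source)
    {w : X} (hw : ∀ u ∈ U, u ∈ (extChartAt I w).source)
    (hD : IsPsiConnection P D) {A : EB → EB →L[ℝ] F →L[ℝ] F}
    (hA : HasConnForm Set.univ D e b₁ A)
    {R : Π b : B, TangentSpace 𝓘(ℝ, EB) b → TangentSpace 𝓘(ℝ, EB) b → W b → W b}
    (hR : IsCurvatureOn F Set.univ D R) {b : B} (hb : b ∈ O) (f : F) (Y Z : EB) :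
    R b Y Z (moduleFrame P pr s κ e f b) = moduleFrame P pr s κ e
      (curvForm (fun z => (A (mapRep I 𝓘(ℝ, EB) w b₁ s z)).comp
          (fderiv ℝ (mapRep I 𝓘(ℝ, EB) w b₁ s) z)) (extChartAt I w (pr b))
        (dchart I w (pr b) (mfderiv 𝓘(ℝ, EB) I pr b Y))
        (dchart I w (pr b) (mfderiv 𝓘(ℝ, EB) I pr b Z)) f) b := by
  have : CompleteSpace EB := FiniteDimensional.complete ℝ EB
  have hu := hκ.proj_mem b hb
  have hprb := hB.smooth_proj b
  have hsm := hκ.smooth_section.contMDiffAt (hκ.isOpen_base.mem_nhds hu)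
  set e' := trivializationAt F W b
  have he' : b ∈ e'.baseSet := mem_baseSet_trivializationAt F W b
  have hw' : b ∈ (extChartAt 𝓘(ℝ, EB) b).source := mem_extChartAt_source b
  obtain ⟨A', hA'⟩ := exists_hasConnForm isOpen_univ hD.isConnection e' b
  set z := extChartAt 𝓘(ℝ, EB) b b with hz
  set T := mapRep 𝓘(ℝ, EB) I b w pr with hT
  set S := mapRep I 𝓘(ℝ, EB) w b₁ s with hS
  have hTz : T z = extChartAt I w (pr b) := mapRep_chart pr w hw'
  have hSz : S (T z) = extChartAt 𝓘(ℝ, EB) b₁ (s (pr b)) :=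
    (congrArg S hTz).trans (mapRep_chart s b₁ (hw _ hu))
  have hTs : ContDiffAt ℝ ∞ T z := contDiffAt_mapRep hw' (hw _ hu) hprb
  have hSs : ContDiffAt ℝ ∞ S (T z) := by
    rw [hTz]
    exact contDiffAt_mapRep (hw _ hu) (hc _ hu) hsm
  have hAs : ContDiffAt ℝ ∞ A (S (T z)) := by
    rw [hSz]
    exact (hA _ (Set.mem_univ _) (he _ hu) (hc _ hu)).1
  have hE : ContDiffAt ℝ ∞ (fun y => (A (S y)).comp (fderiv ℝ S y)) (T z) :=
    (hAs.comp (T z) hSs).clm_comp (hSs.fderiv_right (m := ∞) (by simp))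
  have hEB : ContDiffAt ℝ ∞ (fun y => ((A (S (T y))).comp (fderiv ℝ S (T y))).comp
      (fderiv ℝ T y)) z :=
    (hE.comp z hTs).clm_comp (hTs.fderiv_right (m := ∞) (by simp))
  have hg : ∀ᶠ y in 𝓝 z, ∀ v, frameMatrix pr s κ P e e' b y
      * ((A (S (T y))).comp (fderiv ℝ S (T y))).comp (fderiv ℝ T y) v
      = fderiv ℝ (frameMatrix pr s κ P e e' b) y v
        + A' y v * frameMatrix pr s κ P e e' b y := by
    have := eventually_chart (I := 𝓘(ℝ, EB)) (hκ.isOpen.inter e'.open_baseSet)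
      ((extChartAt 𝓘(ℝ, EB) b).map_source hw')
      (by rw [(extChartAt 𝓘(ℝ, EB) b).left_inv hw']; exact ⟨hb, he'⟩)
    filter_upwards [this] with y hy v
    have h1 := hD.frameMatrix_gauge hB hκ he hc hw hA hy.2.1 hy.2.2
      ((extChartAt 𝓘(ℝ, EB) b).map_target hy.1) hA' v
    rw [(extChartAt 𝓘(ℝ, EB) b).right_inv hy.1] at h1
    exact h1
  have h1 := curvForm_gauge ((hA' b (Set.mem_univ b) he' hw').1.differentiableAt (by simp))
    (hEB.differentiableAt (by simp)) (contDiffAt_frameMatrix hB hκ he hb he' hw') hg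
    (dchart 𝓘(ℝ, EB) b b Y) (dchart 𝓘(ℝ, EB) b b Z)
  have h2 := curvForm_pullback (A := fun y => (A (S y)).comp (fderiv ℝ S y))
    (hE.differentiableAt (by simp)) hTs
  have h3 : ∀ Y : EB, fderiv ℝ T z (dchart 𝓘(ℝ, EB) b b Y)
      = dchart I w (pr b) (mfderiv 𝓘(ℝ, EB) I pr b Y) :=
    fderiv_mapRep (I := 𝓘(ℝ, EB)) (I' := I) (w' := w) hw' (hw _ hu)
      (hprb.mdifferentiableAt (by simp))
  have h4 := hR.clma_apply isOpen_univ hD.isConnection hA' (Set.mem_univ b) he' hw' Y Z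
    (moduleFrame P pr s κ e f b)
  have h6 : ∀ f : F, frameMatrix pr s κ P e e' b z f
      = e'.continuousLinearMapAt ℝ b (moduleFrame P pr s κ e f b) := fun f => by
    rw [frameMatrix_apply, secRep, hz, (extChartAt 𝓘(ℝ, EB) b).left_inv hw']
  have h7 := DFunLike.congr_fun h1 f
  rw [h2] at h7
  have h8 : curvForm A' z (dchart 𝓘(ℝ, EB) b b Y) (dchart 𝓘(ℝ, EB) b b Z)
      (frameMatrix pr s κ P e e' b z f) = frameMatrix pr s κ P e e' b z
        (curvForm (fun y => (A (S y)).comp (fderiv ℝ S y)) (T z)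
          (fderiv ℝ T z (dchart 𝓘(ℝ, EB) b b Y)) (fderiv ℝ T z (dchart 𝓘(ℝ, EB) b b Z)) f) := h7
  rw [h3, h3, hTz, h6, h6] at h8
  have h9 := congrArg (e'.symmL ℝ b) (h4.trans h8)
  rwa [e'.symmL_continuousLinearMapAt he', e'.symmL_continuousLinearMapAt he'] at h9

end ModuleCurvature

theorem contDiffAt_const_clm_comp {E' E 𝔸 𝔹 : Type*} [NormedAddCommGroup E'] [NormedSpace ℝ E']
    [NormedAddCommGroup E] [NormedSpace ℝ E]
    [NormedAddCommGroup 𝔸] [NormedSpace ℝ 𝔸] [NormedAddCommGroup 𝔹] [NormedSpace ℝ 𝔹]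
    (ι : 𝔸 →L[ℝ] 𝔹) {A : E' → E →L[ℝ] 𝔸} {z : E'} (hA : ContDiffAt ℝ ∞ A z) :
    ContDiffAt ℝ ∞ (fun w => ι.comp (A w)) z :=
  contDiffAt_const.clm_comp hA

section ModuleForms

variable {k : ℕ} [NeZero k]
  {𝔤₁ : Type*} [NormedAddCommGroup 𝔤₁] [NormedSpace ℝ 𝔤₁]
  {𝔤₂ : Type*} [NormedAddCommGroup 𝔤₂] [NormedSpace ℝ 𝔤₂]
  {Gc₁ : Type*} [TopologicalSpace Gc₁] [ChartedSpace 𝔤₁ Gc₁] [Group Gc₁]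
  [LieGroup 𝓘(ℝ, 𝔤₁) ∞ Gc₁]
  {G₁ : Type*} [TopologicalSpace G₁] [ChartedSpace 𝔤₁ G₁] [Group G₁]
  {Gc₂ : Type*} [TopologicalSpace Gc₂] [ChartedSpace 𝔤₂ Gc₂] [Group Gc₂]
  [LieGroup 𝓘(ℝ, 𝔤₂) ∞ Gc₂]
  {G₂ : Type*} [TopologicalSpace G₂] [ChartedSpace 𝔤₂ G₂] [Group G₂]
  {ext₁ : CentralExtension k 𝔤₁ Gc₁ G₁} {ext₂ : CentralExtension k 𝔤₂ Gc₂ G₂} {q : ℤ}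
  {EB : Type*} [NormedAddCommGroup EB] [NormedSpace ℝ EB] [FiniteDimensional ℝ EB]
  {B : Type*} [TopologicalSpace B] [ChartedSpace EB B] [IsManifold 𝓘(ℝ, EB) ∞ B]
  [MulAction (G₁ × G₂) B]
  {E : Type*} [NormedAddCommGroup E] [NormedSpace ℝ E] [FiniteDimensional ℝ E]
  {H : Type*} [TopologicalSpace H]
  {I : ModelWithCorners ℝ E H} [I.Boundaryless] {X : Type*} [TopologicalSpace X]
  [ChartedSpace H X] [IsManifold I ∞ X] [IsManifold I 1 X]
  {V : Set X} {pr : B → X}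

theorem IsPrincipalBundle.isOpen_base
    (hB : IsPrincipalBundle (G := G₁ × G₂) (EB := EB) I (𝓘(ℝ, 𝔤₁).prod 𝓘(ℝ, 𝔤₂)) V pr) :
    IsOpen V :=
  isOpen_iff_mem_nhds.2 fun u hu => by
    obtain ⟨U, hUV, hU, huU, -⟩ := hB.locally_trivial u hu
    exact Filter.mem_of_superset (hU.mem_nhds huU) hUV

theorem IsPrincipalBundle.proj_mem
    (hB : IsPrincipalBundle (G := G₁ × G₂) (EB := EB) I (𝓘(ℝ, 𝔤₁).prod 𝓘(ℝ, 𝔤₂)) V pr) (b : B) :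
    pr b ∈ V := hB.range_proj ▸ Set.mem_range_self b

theorem IsPrincipalBundle.mfderiv_proj_surjective
    (hB : IsPrincipalBundle (G := G₁ × G₂) (EB := EB) I (𝓘(ℝ, 𝔤₁).prod 𝓘(ℝ, 𝔤₂)) V pr)
    (b : B) (v : E) : ∃ Y : EB, mfderiv 𝓘(ℝ, EB) I pr b Y = v := by
  obtain ⟨U, hUV, hU, hu, s, τ, hs, hps, -, hτ⟩ := hB.locally_trivial (pr b) (hB.proj_mem b)
  let φ : X → B := fun u => τ b • s u
  have hφb : φ (pr b) = b := hτ b hu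
  have hφ : MDifferentiableAt I 𝓘(ℝ, EB) φ (pr b) :=
    ((hB.contMDiff_const_smul (τ b) (s (pr b))).comp (pr b)
      (hs.contMDiffAt (hU.mem_nhds hu))).mdifferentiableAt (by simp)
  have h1 : (fun u => u) =ᶠ[𝓝 (pr b)] pr ∘ φ := by
    filter_upwards [hU.mem_nhds hu] with u hu
    exact ((hB.proj_smul _ _).trans (hps u hu)).symm
  have h2 : (v : E) = mfderiv 𝓘(ℝ, EB) I pr (φ (pr b)) (mfderiv I 𝓘(ℝ, EB) φ (pr b) v) := by
    refine (DFunLike.congr_fun (mfderiv_id (I := I) (x := pr b)) v).symm.trans ?_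
    refine (DFunLike.congr_fun h1.mfderiv_eq v).trans ?_
    exact DFunLike.congr_fun (mfderiv_comp (pr b)
      ((hB.smooth_proj (φ (pr b))).mdifferentiableAt (by simp)) hφ) v
  have key : ∀ c (_ : c = b) (Y : EB), v = mfderiv 𝓘(ℝ, EB) I pr c Y →
      ∃ Y : EB, mfderiv 𝓘(ℝ, EB) I pr b Y = v := by
    rintro c rfl Y h
    exact ⟨Y, h.symm⟩
  exact key _ hφb _ h2

variable {F : Type*} [NormedAddCommGroup F] [NormedSpace ℝ F] [NormedSpace ℂ F]
  [IsScalarTower ℝ ℂ F] [FiniteDimensional ℂ F]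
  {W : B → Type*} [TopologicalSpace (TotalSpace F W)]
  [∀ b, AddCommGroup (W b)] [∀ b, Module ℝ (W b)] [∀ b, Module ℂ (W b)]
  [∀ b, IsScalarTower ℝ ℂ (W b)]
  [∀ b, TopologicalSpace (W b)] [∀ b, IsTopologicalAddGroup (W b)]
  [∀ b, ContinuousSMul ℝ (W b)] [FiberBundle F W] [VectorBundle ℝ F W] [VectorBundle ℂ F W]
  [ContMDiffVectorBundle ∞ F W 𝓘(ℝ, EB)]
  {P : PsiModule q ext₁ ext₂ EB F W}
  {D D₀ D₁ : (Π b : B, W b) → (Π b : B, TangentSpace 𝓘(ℝ, EB) b →L[ℝ] W b)}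

theorem IsPsiConnection.connForm_complex (hD : IsPsiConnection P D)
    {e : Trivialization F (TotalSpace.proj : TotalSpace F W → B)} [MemTrivializationAtlas e]
    {w : B} {A : EB → EB →L[ℝ] F →L[ℝ] F} (hA : HasConnForm Set.univ D e w A) {b : B}
    (he : b ∈ e.baseSet) (hw : b ∈ (extChartAt 𝓘(ℝ, EB) w).source) (v : EB) (f : F) :
    A (extChartAt 𝓘(ℝ, EB) w b) v (Complex.I • f)
      = Complex.I • A (extChartAt 𝓘(ℝ, EB) w b) v f := by
  have : FiniteDimensional ℝ F := finiteDimensional_real F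
  obtain ⟨Y, rfl⟩ : ∃ Y : EB, dchart 𝓘(ℝ, EB) w b Y = v := by
    refine ⟨dchartSymm 𝓘(ℝ, EB) w (extChartAt 𝓘(ℝ, EB) w b) v, ?_⟩
    have := DFunLike.congr_fun (dchart_comp_dchartSymm (I := 𝓘(ℝ, EB))
      ((extChartAt 𝓘(ℝ, EB) w).map_source hw)) v
    rwa [(extChartAt 𝓘(ℝ, EB) w).left_inv hw] at this
  have h1 := hA.apply_constSec (Set.mem_univ b) he hw (Complex.I • f) Y
  have h2 := hA.apply_constSec (Set.mem_univ b) he hw f Y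
  have h3 := hD.complex (constSec e f) b
    ((((contMDiffOn_constSec (I := 𝓘(ℝ, EB)) (e := e) f) b he).contMDiffAt
      (e.open_baseSet.mem_nhds he)).mdifferentiableAt (by simp)) Y
  have h4 : (fun b => Complex.I • constSec e f b) = constSec e (Complex.I • f) :=
    funext fun b => (constSec_smul e Complex.I f b).symm
  rw [h4] at h3
  have h5 := h1.symm.trans (h3.trans (congrArg (Complex.I • ·) h2))
  have h6 : constSec e (A (extChartAt 𝓘(ℝ, EB) w b) (dchart 𝓘(ℝ, EB) w b Y) (Complex.I • f)) b
      = constSec e (Complex.I • A (extChartAt 𝓘(ℝ, EB) w b) (dchart 𝓘(ℝ, EB) w b Y) f) b :=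
    h5.trans (constSec_smul e _ _ b).symm
  have h7 := congrArg (e.continuousLinearMapAt ℝ b) h6
  rwa [clma_constSec he, clma_constSec he] at h7

/-- A module d-connection has a complex linear curvature. -/
theorem IsPsiConnection.exists_curvature (hD : IsPsiConnection P D) :
    ∃ R : Π b : B, TangentSpace 𝓘(ℝ, EB) b → TangentSpace 𝓘(ℝ, EB) b → (W b →ₗ[ℂ] W b),
      IsCurvatureOn F Set.univ D (fun b Y Z => R b Y Z) := by
  have : FiniteDimensional ℝ F := finiteDimensional_real F
  have : CompleteSpace EB := FiniteDimensional.complete ℝ EB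
  obtain ⟨R, hR⟩ := exists_isCurvatureOn isOpen_univ hD.isConnection
  have key : ∀ b Y Z (u : W b), R b Y Z (Complex.I • u) = Complex.I • R b Y Z u := by
    intro b Y Z u
    set e := trivializationAt F W b
    have he : b ∈ e.baseSet := mem_baseSet_trivializationAt F W b
    have hw : b ∈ (extChartAt 𝓘(ℝ, EB) b).source := mem_extChartAt_source b
    obtain ⟨A, hA⟩ := exists_hasConnForm isOpen_univ hD.isConnection e b
    have h0 : ∀ f, R b Y Z (constSec e f b) = constSec e (curvForm A (extChartAt 𝓘(ℝ, EB) b b)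
        (dchart 𝓘(ℝ, EB) b b Y) (dchart 𝓘(ℝ, EB) b b Z) f) b := fun f => by
      have h1 := hR.clma_apply isOpen_univ hD.isConnection hA (Set.mem_univ b) he hw Y Z
        (constSec e f b)
      rw [clma_constSec he] at h1
      have h2 := congrArg (e.symmL ℝ b) h1
      rwa [e.symmL_continuousLinearMapAt he] at h2
    have hA' := (hA b (Set.mem_univ b) he hw).1
    have h1 : ∀ᶠ z in 𝓝 (extChartAt 𝓘(ℝ, EB) b b), ∀ v,
        A z v = ((complexProj F).comp (A z) v : complexEnd F) := by
      have := eventually_chart (I := 𝓘(ℝ, EB)) e.open_baseSet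
        ((extChartAt 𝓘(ℝ, EB) b).map_source hw)
        (by rw [(extChartAt 𝓘(ℝ, EB) b).left_inv hw]; exact he)
      filter_upwards [this] with z hz v
      refine (complexProj_apply fun f => ?_).symm
      have h2 := hD.connForm_complex hA hz.2 ((extChartAt 𝓘(ℝ, EB) b).map_target hz.1) v f
      rwa [(extChartAt 𝓘(ℝ, EB) b).right_inv hz.1] at h2
    have h2 := curvForm_coe (A := fun z => (complexProj F).comp (A z)) (A' := A)
      ((contDiffAt_const_clm_comp (complexProj F) hA').differentiableAt (by simp)) h1 (dchart 𝓘(ℝ, EB) b b Y) (dchart 𝓘(ℝ, EB) b b Z)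
    obtain ⟨f, rfl⟩ : ∃ f, constSec e f b = u := ⟨_, constSec_apply he u⟩
    rw [← constSec_smul, h0, h0, h2, ← constSec_smul]
    exact congrArg (constSec e · b) ((curvForm (fun z => (complexProj F).comp (A z))
      (extChartAt 𝓘(ℝ, EB) b b) (dchart 𝓘(ℝ, EB) b b Y) (dchart 𝓘(ℝ, EB) b b Z)).2 f)
  exact ⟨fun b Y Z => toComplexLinear (R b Y Z) (key b Y Z), hR⟩

/-- The difference of two connections and their curvatures at `b`, in the frame `θ`. -/
structure InModuleFrame (I : ModelWithCorners ℝ E H) (pr : B → X)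
    (D₀ D₁ : (Π b : B, W b) → (Π b : B, TangentSpace 𝓘(ℝ, EB) b →L[ℝ] W b))
    (R₀ R₁ : Π b : B, TangentSpace 𝓘(ℝ, EB) b → TangentSpace 𝓘(ℝ, EB) b → (W b →ₗ[ℂ] W b)) (b : B)
    (θ : F ≃ₗ[ℂ] W b) (α : E →L[ℝ] complexEnd F) (Ω₀ Ω₁ : E →L[ℝ] E →L[ℝ] complexEnd F) :
    Prop where
  diff : ∀ s : Π b : B, W b,
    MDifferentiableAt 𝓘(ℝ, EB) (𝓘(ℝ, EB).prod 𝓘(ℝ, F)) (fun c => TotalSpace.mk' F c (s c)) b →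
    ∀ (Y : EB) (f : F), s b = θ f → D₁ s b Y - D₀ s b Y
      = θ ((α (mfderiv 𝓘(ℝ, EB) I pr b Y) : F →L[ℝ] F) f)
  curv₀ : ∀ (Y Z : EB) (f : F), R₀ b Y Z (θ f) = θ ((Ω₀ (mfderiv 𝓘(ℝ, EB) I pr b Y)
    (mfderiv 𝓘(ℝ, EB) I pr b Z) : F →L[ℝ] F) f)
  curv₁ : ∀ (Y Z : EB) (f : F), R₁ b Y Z (θ f) = θ ((Ω₁ (mfderiv 𝓘(ℝ, EB) I pr b Y)
    (mfderiv 𝓘(ℝ, EB) I pr b Z) : F →L[ℝ] F) f)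

/-- The unit of `complexEnd F` given by a complex linear automorphism. -/
def complexUnit (θ : F ≃ₗ[ℂ] F) : (complexEnd F)ˣ :=
  have : FiniteDimensional ℝ F := finiteDimensional_real F
  { val := ⟨LinearMap.toContinuousLinearMap (θ.restrictScalars ℝ).toLinearMap,
      fun f => map_smul θ Complex.I f⟩
    inv := ⟨LinearMap.toContinuousLinearMap (θ.symm.restrictScalars ℝ).toLinearMap,
      fun f => map_smul θ.symm Complex.I f⟩
    val_inv := Subtype.ext (ContinuousLinearMap.ext θ.apply_symm_apply)
    inv_val := Subtype.ext (ContinuousLinearMap.ext θ.symm_apply_apply) }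

theorem sub_congr_of_eq (h₀ : IsSmoothConnectionOn F Set.univ D₀)
    (h₁ : IsSmoothConnectionOn F Set.univ D₁) {s s' : Π b : B, W b} {b : B}
    (hs : MDifferentiableAt 𝓘(ℝ, EB) (𝓘(ℝ, EB).prod 𝓘(ℝ, F)) (fun c => TotalSpace.mk' F c (s c)) b)
    (hs' : MDifferentiableAt 𝓘(ℝ, EB) (𝓘(ℝ, EB).prod 𝓘(ℝ, F))
      (fun c => TotalSpace.mk' F c (s' c)) b) (h : s b = s' b) (Y : EB) :
    D₁ s b Y - D₀ s b Y = D₁ s' b Y - D₀ s' b Y := by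
  have : FiniteDimensional ℝ F := finiteDimensional_real F
  set e := trivializationAt F W b
  have he : b ∈ e.baseSet := mem_baseSet_trivializationAt F W b
  have hw : b ∈ (extChartAt 𝓘(ℝ, EB) b).source := mem_extChartAt_source b
  obtain ⟨A₀, hA₀⟩ := exists_hasConnForm isOpen_univ h₀ e b
  obtain ⟨A₁, hA₁⟩ := exists_hasConnForm isOpen_univ h₁ e b
  have k0 := (hA₀ b (Set.mem_univ b) he hw).2 s hs Y
  have k1 := (hA₁ b (Set.mem_univ b) he hw).2 s hs Y
  have k0' := (hA₀ b (Set.mem_univ b) he hw).2 s' hs' Y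
  have k1' := (hA₁ b (Set.mem_univ b) he hw).2 s' hs' Y
  have key : e.continuousLinearMapAt ℝ b (D₁ s b Y - D₀ s b Y)
      = e.continuousLinearMapAt ℝ b (D₁ s' b Y - D₀ s' b Y) := by
    rw [map_sub, map_sub, k0, k1, k0', k1', h]
    abel
  have h2 := congrArg (e.symmL ℝ b) key
  rwa [e.symmL_continuousLinearMapAt he, e.symmL_continuousLinearMapAt he] at h2

set_option maxHeartbeats 1000000 in
theorem isConnectionPair_inModuleFrame
    (hB : IsPrincipalBundle (G := G₁ × G₂) (EB := EB) I (𝓘(ℝ, 𝔤₁).prod 𝓘(ℝ, 𝔤₂)) V pr)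
    (h₀ : IsPsiConnection P D₀) (h₁ : IsPsiConnection P D₁)
    {R₀ R₁ : Π b : B, TangentSpace 𝓘(ℝ, EB) b → TangentSpace 𝓘(ℝ, EB) b → (W b →ₗ[ℂ] W b)}
    (c₀ : IsCurvatureOn F Set.univ D₀ fun b Y Z => R₀ b Y Z)
    (c₁ : IsCurvatureOn F Set.univ D₁ fun b Y Z => R₁ b Y Z) :
    IsConnectionPair (I := I) V (fun u (α : E →L[ℝ] complexEnd F) Ω₀ Ω₁ => ∀ b, pr b = u →
      ∃ θ : F ≃ₗ[ℂ] W b, InModuleFrame I pr D₀ D₁ R₀ R₁ b θ α Ω₀ Ω₁) where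
  conj := by
    intro u hu α Ω₀ Ω₁ α' Ω₀' Ω₁' h h'
    obtain ⟨b, rfl⟩ : u ∈ Set.range pr := hB.range_proj ▸ hu
    obtain ⟨θ, h⟩ := h b rfl
    obtain ⟨θ', h'⟩ := h' b rfl
    have hθ : ∀ f, θ f = θ' (θ'.symm (θ f)) := fun f => (θ'.apply_symm_apply _).symm
    refine ⟨complexUnit (θ.trans θ'.symm), fun v => ?_, fun v v' => ?_, fun v v' => ?_⟩
    · obtain ⟨Y, rfl⟩ := hB.mfderiv_proj_surjective b v
      refine Subtype.ext (ContinuousLinearMap.ext fun f => ?_)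
      obtain ⟨s, hs, hsu⟩ := exists_section (F := F) (I := 𝓘(ℝ, EB)) b (θ f)
      have e1 := h.diff s hs Y f hsu
      have e2 := h'.diff s hs Y (θ'.symm (θ f)) (hsu.trans (hθ f))
      exact θ'.injective ((e2.symm.trans e1).trans (hθ _))
    · obtain ⟨Y, rfl⟩ := hB.mfderiv_proj_surjective b v
      obtain ⟨Z, rfl⟩ := hB.mfderiv_proj_surjective b v'
      refine Subtype.ext (ContinuousLinearMap.ext fun f => ?_)
      have e1 := h.curv₀ Y Z f
      have e2 := h'.curv₀ Y Z (θ'.symm (θ f))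
      rw [← hθ] at e2
      exact θ'.injective ((e2.symm.trans e1).trans (hθ _))
    · obtain ⟨Y, rfl⟩ := hB.mfderiv_proj_surjective b v
      obtain ⟨Z, rfl⟩ := hB.mfderiv_proj_surjective b v'
      refine Subtype.ext (ContinuousLinearMap.ext fun f => ?_)
      have e1 := h.curv₁ Y Z f
      have e2 := h'.curv₁ Y Z (θ'.symm (θ f))
      rw [← hθ] at e2
      exact θ'.injective ((e2.symm.trans e1).trans (hθ _))
  loc := by
    intro w u hu huw
    have : FiniteDimensional ℝ F := finiteDimensional_real F
    obtain ⟨s, U₀, -, hU₀, huU₀, hs, hps, hlift⟩ :=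
      exists_isLocalLifting (ext₁ := ext₁) (ext₂ := ext₂) hB hu
    set e := trivializationAt F W (s u) with hedef
    let U : Set X := (U₀ ∩ s ⁻¹' (e.baseSet ∩ (extChartAt 𝓘(ℝ, EB) (s u)).source))
      ∩ (extChartAt I w).source
    have hU : IsOpen U := (hs.continuousOn.isOpen_inter_preimage hU₀
      (e.open_baseSet.inter (isOpen_extChartAt_source _))).inter (isOpen_extChartAt_source w)
    have huU : u ∈ U := ⟨⟨huU₀, mem_baseSet_trivializationAt F W (s u),
      mem_extChartAt_source (s u)⟩, huw⟩
    have he : ∀ x ∈ U, s x ∈ e.baseSet := fun x hx => hx.1.2.1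
    have hc : ∀ x ∈ U, s x ∈ (extChartAt 𝓘(ℝ, EB) (s u)).source := fun x hx => hx.1.2.2
    have hw : ∀ x ∈ U, x ∈ (extChartAt I w).source := fun x hx => hx.2
    obtain ⟨A₀, hA₀⟩ := exists_hasConnForm isOpen_univ h₀.isConnection e (s u)
    obtain ⟨A₁, hA₁⟩ := exists_hasConnForm isOpen_univ h₁.isConnection e (s u)
    set S := mapRep I 𝓘(ℝ, EB) w (s u) s with hS
    have hSx : ∀ x ∈ U, S (extChartAt I w x) = extChartAt 𝓘(ℝ, EB) (s u) (s x) := fun x hx =>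
      mapRep_chart s (s u) (hw x hx)
    have hsx : ∀ x ∈ U, ContMDiffAt I 𝓘(ℝ, EB) ∞ s x := fun x hx =>
      hs.contMDiffAt (hU₀.mem_nhds hx.1.1)
    have hSs : ∀ x ∈ U, ContDiffAt ℝ ∞ S (extChartAt I w x) := fun x hx =>
      contDiffAt_mapRep (hw x hx) (hc x hx) (hsx x hx)
    have smooth : ∀ {D : (Π b : B, W b) → (Π b : B, TangentSpace 𝓘(ℝ, EB) b →L[ℝ] W b)}
        {A : EB → EB →L[ℝ] F →L[ℝ] F} (_ : HasConnForm Set.univ D e (s u) A), ∀ x ∈ U,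
        ContDiffAt ℝ ∞ (fun z => (A (S z)).comp (fderiv ℝ S z)) (extChartAt I w x) := by
      intro D A hA x hx
      have h1 : ContDiffAt ℝ ∞ A (S (extChartAt I w x)) := by
        rw [hSx x hx]
        exact (hA _ (Set.mem_univ _) (he x hx) (hc x hx)).1
      exact (h1.comp _ (hSs x hx)).clm_comp ((hSs x hx).fderiv_right (m := ∞) (by simp))
    have coe : ∀ {D : (Π b : B, W b) → (Π b : B, TangentSpace 𝓘(ℝ, EB) b →L[ℝ] W b)}
        (_ : IsPsiConnection P D) {A : EB → EB →L[ℝ] F →L[ℝ] F}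
        (_ : HasConnForm Set.univ D e (s u) A), ∀ x ∈ U, ∀ v,
        (A (S (extChartAt I w x))).comp (fderiv ℝ S (extChartAt I w x)) v
          = (((complexProj F).comp ((A (S (extChartAt I w x))).comp
            (fderiv ℝ S (extChartAt I w x))) v : complexEnd F) : F →L[ℝ] F) := by
      intro D hD A hA x hx v
      refine (complexProj_apply fun f => ?_).symm
      have h2 := hD.connForm_complex hA (he x hx) (hc x hx)
        (fderiv ℝ S (extChartAt I w x) v) f
      rw [← hSx x hx] at h2
      exact h2
    have ev : ∀ x ∈ U, ∀ᶠ z in 𝓝 (extChartAt I w x),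
        z ∈ (extChartAt I w).target ∧ (extChartAt I w).symm z ∈ U := fun x hx =>
      eventually_chart (I := I) hU ((extChartAt I w).map_source (hw x hx))
        (by rwa [(extChartAt I w).left_inv (hw x hx)])
    have curv : ∀ {D : (Π b : B, W b) → (Π b : B, TangentSpace 𝓘(ℝ, EB) b →L[ℝ] W b)}
        (_ : IsPsiConnection P D) {A : EB → EB →L[ℝ] F →L[ℝ] F}
        (_ : HasConnForm Set.univ D e (s u) A), ∀ x ∈ U, ∀ a b,
        curvForm (fun z => (A (S z)).comp (fderiv ℝ S z)) (extChartAt I w x) a b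
          = ((curvForm (fun z => (complexProj F).comp ((A (S z)).comp (fderiv ℝ S z)))
            (extChartAt I w x) a b : complexEnd F) : F →L[ℝ] F) := by
      intro D hD A hA x hx a b
      refine curvForm_coe ((contDiffAt_const_clm_comp (complexProj F)
        (smooth hA x hx)).differentiableAt (by simp)) ?_ a b
      filter_upwards [ev x hx] with z hz v
      have := coe hD hA _ hz.2 v
      rwa [(extChartAt I w).right_inv hz.1] at this
    refine ⟨fun z => (complexProj F).comp ((A₀ (S z)).comp (fderiv ℝ S z)),
      fun z => (complexProj F).comp ((A₁ (S z)).comp (fderiv ℝ S z)),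
      contDiffAt_const_clm_comp _ (smooth hA₀ u huU),
      contDiffAt_const_clm_comp _ (smooth hA₁ u huU), ?_⟩
    have main : ∀ b, pr b ∈ U → ∃ θ : F ≃ₗ[ℂ] W b, InModuleFrame I pr D₀ D₁ R₀ R₁ b θ
        (((complexProj F).comp ((A₁ (S (extChartAt I w (pr b)))).comp
            (fderiv ℝ S (extChartAt I w (pr b))))
          - (complexProj F).comp ((A₀ (S (extChartAt I w (pr b)))).comp
            (fderiv ℝ S (extChartAt I w (pr b))))).comp (dchart I w (pr b)))
        ((curvForm (fun z => (complexProj F).comp ((A₀ (S z)).comp (fderiv ℝ S z)))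
          (extChartAt I w (pr b))).bilinearComp (dchart I w (pr b)) (dchart I w (pr b)))
        ((curvForm (fun z => (complexProj F).comp ((A₁ (S z)).comp (fderiv ℝ S z)))
          (extChartAt I w (pr b))).bilinearComp (dchart I w (pr b)) (dchart I w (pr b))) := by
      intro b hb
      obtain ⟨κ, O, hbO, hκ⟩ := hlift U (fun x hx => hx.1.1) hU b hb
      have hds : ∀ Y : EB, fderiv ℝ S (extChartAt I w (pr b))
          (dchart I w (pr b) (mfderiv 𝓘(ℝ, EB) I pr b Y))
          = dchart 𝓘(ℝ, EB) (s u) (s (pr b)) (mfderiv I 𝓘(ℝ, EB) s (pr b)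
            (mfderiv 𝓘(ℝ, EB) I pr b Y)) := fun Y =>
        fderiv_mapRep (I := I) (I' := 𝓘(ℝ, EB)) (w' := s u) (hw _ hb) (hc _ hb)
          ((hsx _ hb).mdifferentiableAt (by simp)) (mfderiv 𝓘(ℝ, EB) I pr b Y)
      refine ⟨moduleFrameEquiv P e hκ he hbO, fun σ hσ Y f hσf => ?_, fun Y Z f => ?_,
        fun Y Z f => ?_⟩
      · have hf := (contMDiffAt_moduleFrame P e hB hκ he f hbO).mdifferentiableAt (by simp)
        refine (sub_congr_of_eq h₀.isConnection h₁.isConnection hσ hf hσf Y).trans ?_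
        have e0 := h₀.apply_moduleFrame hB hκ he hc hA₀ f hbO Y
        have e1 := h₁.apply_moduleFrame hB hκ he hc hA₁ f hbO Y
        rw [← hds, ← hSx _ hb] at e0 e1
        have k0 := DFunLike.congr_fun (coe h₀ hA₀ _ hb
          (dchart I w (pr b) (mfderiv 𝓘(ℝ, EB) I pr b Y))) f
        have k1 := DFunLike.congr_fun (coe h₁ hA₁ _ hb
          (dchart I w (pr b) (mfderiv 𝓘(ℝ, EB) I pr b Y))) f
        refine (congrArg₂ (· - ·) e1 e0).trans ?_
        refine (map_sub (moduleFrameEquiv P e hκ he hbO) _ _).symm.trans ?_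
        exact congrArg (moduleFrameEquiv P e hκ he hbO) (congrArg₂ (· - ·) k1 k0)
      · refine (h₀.curvature_moduleFrame hB hκ he hc hw hA₀ c₀ hbO f Y Z).trans ?_
        exact congrArg (moduleFrameEquiv P e hκ he hbO)
          (DFunLike.congr_fun (curv h₀ hA₀ _ hb _ _) f)
      · refine (h₁.curvature_moduleFrame hB hκ he hc hw hA₁ c₁ hbO f Y Z).trans ?_
        exact congrArg (moduleFrameEquiv P e hκ he hbO)
          (DFunLike.congr_fun (curv h₁ hA₁ _ hb _ _) f)
    filter_upwards [ev u huU] with z hz b hb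
    have h := main b (hb ▸ hz.2)
    rw [hb, (extChartAt I w).right_inv hz.1] at h
    exact h

/-- The trace of `complexEnd F` in a space isomorphic to `F`. -/
def conjEnd {W : Type*} [AddCommGroup W] [Module ℂ W] (θ : F ≃ₗ[ℂ] W) :
    complexEnd F →* Module.End ℂ W :=
  (LinearEquiv.conjRingEquiv θ).toRingHom.toMonoidHom.comp complexEnd.toEnd

theorem complexTrace_eq_trace {W : Type*} [AddCommGroup W] [Module ℂ W] (θ : F ≃ₗ[ℂ] W)
    (a : complexEnd F) : complexTrace F a = LinearMap.trace ℂ W (conjEnd θ a) :=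
  (LinearMap.trace_conj' (complexEnd.toEnd a) θ).symm

theorem exists_moduleForms
    (hB : IsPrincipalBundle (G := G₁ × G₂) (EB := EB) I (𝓘(ℝ, 𝔤₁).prod 𝓘(ℝ, 𝔤₂)) V pr)
    (h₀ : IsPsiConnection P D₀) (h₁ : IsPsiConnection P D₁)
    {R₀ R₁ : Π b : B, TangentSpace 𝓘(ℝ, EB) b → TangentSpace 𝓘(ℝ, EB) b → (W b →ₗ[ℂ] W b)}
    (c₀ : IsCurvatureOn F Set.univ D₀ fun b Y Z => R₀ b Y Z)
    (c₁ : IsCurvatureOn F Set.univ D₁ fun b Y Z => R₁ b Y Z) :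
    ∃ C₀ C₁ : TotalForm I X, IsChernCharacter V pr R₀ C₀ ∧ IsChernCharacter V pr R₁ C₁ ∧
      IsClosedFormOn V C₀ ∧ IsClosedFormOn V C₁ ∧ CohomologousOn V C₁ C₀ := by
  have hP := isConnectionPair_inModuleFrame hB h₀ h₁ c₀ c₁
  obtain ⟨C₀, C₁, s0, s1, d0, d1, hc, hev, hodd⟩ :=
    hP.exists_forms hB.isOpen_base (complexTrace F) complexTrace_mul_comm
  have key : ∀ (b : B) (k : ℕ) (Y : Fin (2 * k) → TangentSpace 𝓘(ℝ, EB) b),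
      C₀ (pr b) (2 * k) (fun j => mfderiv 𝓘(ℝ, EB) I pr b (Y j)) = chernIntegrand (R₀ b) k Y ∧
      C₁ (pr b) (2 * k) (fun j => mfderiv 𝓘(ℝ, EB) I pr b (Y j)) = chernIntegrand (R₁ b) k Y := by
    intro b k Y
    have hb := hB.proj_mem b
    obtain ⟨A₀, A₁, -, -, h⟩ := hP.loc (pr b) (pr b) hb (mem_extChartAt_source (pr b))
    have h' := h.self_of_nhds
    rw [extChartAt_to_inv] at h'
    obtain ⟨e0, e1⟩ := hev (pr b) hb _ _ _ h' k
    obtain ⟨θ, hθ⟩ := h' b rfl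
    have conj : ∀ (a : complexEnd F) (R : W b →ₗ[ℂ] W b),
        (∀ f, R (θ f) = θ ((a : F →L[ℝ] F) f)) → conjEnd θ a = R := by
      intro a R h
      refine LinearMap.ext fun w => ?_
      have := h (θ.symm w)
      rw [θ.apply_symm_apply] at this
      exact this.symm
    constructor
    · refine (DFunLike.congr_fun e0 _).trans ?_
      exact chernForm_eq_chernIntegrand (E := E) (T := TangentSpace 𝓘(ℝ, EB) b) _ (conjEnd θ)
        (complexTrace_eq_trace θ) (fun Y => mfderiv 𝓘(ℝ, EB) I pr b Y) _ _
        (fun Y Z => conj _ _ (hθ.curv₀ Y Z)) k Y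
    · refine (DFunLike.congr_fun e1 _).trans ?_
      exact chernForm_eq_chernIntegrand (E := E) (T := TangentSpace 𝓘(ℝ, EB) b) _ (conjEnd θ)
        (complexTrace_eq_trace θ) (fun Y => mfderiv 𝓘(ℝ, EB) I pr b Y) _ _
        (fun Y Z => conj _ _ (hθ.curv₁ Y Z)) k Y
  exact ⟨C₀, C₁, ⟨s0, fun b k Y => (key b k Y).1, fun u hu k => (hodd u hu k).1⟩,
    ⟨s1, fun b k Y => (key b k Y).2, fun u hu k => (hodd u hu k).2⟩, d0, d1, hc⟩

theorem IsChernCharacter.eq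
    (hB : IsPrincipalBundle (G := G₁ × G₂) (EB := EB) I (𝓘(ℝ, 𝔤₁).prod 𝓘(ℝ, 𝔤₂)) V pr)
    {R : Π b : B, TangentSpace 𝓘(ℝ, EB) b → TangentSpace 𝓘(ℝ, EB) b → (W b →ₗ[ℂ] W b)}
    {c c' : TotalForm I X} (h : IsChernCharacter V pr R c) (h' : IsChernCharacter V pr R c') :
    ∀ u ∈ V, ∀ m, c u m = c' u m := by
  intro u hu m
  obtain ⟨k, rfl | rfl⟩ := m.even_or_odd'
  · obtain ⟨b, rfl⟩ : u ∈ Set.range pr := hB.range_proj ▸ hu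
    refine ContinuousAlternatingMap.ext fun v => ?_
    choose Y hY using fun j => hB.mfderiv_proj_surjective b (v j)
    obtain rfl : (fun j => mfderiv 𝓘(ℝ, EB) I pr b (Y j)) = v := funext hY
    exact (h.even b k Y).trans (h'.even b k Y).symm
  · rw [h.odd u hu, h'.odd u hu]

theorem IsPsiConnection.exists_isChernCharacterOf
    (hB : IsPrincipalBundle (G := G₁ × G₂) (EB := EB) I (𝓘(ℝ, 𝔤₁).prod 𝓘(ℝ, 𝔤₂)) V pr)
    (hD : IsPsiConnection P D) : ∃ c : TotalForm I X, IsChernCharacterOf F V pr D c := by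
  obtain ⟨R, hR⟩ := hD.exists_curvature
  obtain ⟨C, -, hC, -⟩ := exists_moduleForms hB hD hD hR hR
  exact ⟨C, R, hR, hC⟩

theorem IsChernCharacterOf.isClosedFormOn
    (hB : IsPrincipalBundle (G := G₁ × G₂) (EB := EB) I (𝓘(ℝ, 𝔤₁).prod 𝓘(ℝ, 𝔤₂)) V pr)
    (hD : IsPsiConnection P D) {c : TotalForm I X} (hc : IsChernCharacterOf F V pr D c) :
    IsClosedFormOn V c := by
  obtain ⟨R, hR, hc⟩ := hc
  obtain ⟨C, -, hC, -, hd, -⟩ := exists_moduleForms hB hD hD hR hR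
  exact hd.congr hB.isOpen_base (hc.eq hB hC)

theorem IsChernCharacterOf.cohomologousOn
    (hB : IsPrincipalBundle (G := G₁ × G₂) (EB := EB) I (𝓘(ℝ, 𝔤₁).prod 𝓘(ℝ, 𝔤₂)) V pr)
    (h₀ : IsPsiConnection P D₀) (h₁ : IsPsiConnection P D₁) {c₀ c₁ : TotalForm I X}
    (hc₀ : IsChernCharacterOf F V pr D₀ c₀) (hc₁ : IsChernCharacterOf F V pr D₁ c₁) :
    CohomologousOn V c₁ c₀ := by
  obtain ⟨R₀, hR₀, hc₀⟩ := hc₀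
  obtain ⟨R₁, hR₁, hc₁⟩ := hc₁
  obtain ⟨C₀, C₁, hC₀, hC₁, -, -, h⟩ := exists_moduleForms hB h₀ h₁ hR₀ hR₁
  exact h.congr (hc₁.eq hB hC₁) (hc₀.eq hB hC₀)

end ModuleForms

section VectorValued

variable {E : Type*} [NormedAddCommGroup E] [NormedSpace ℝ E]
  {H : Type*} [TopologicalSpace H] {J : ModelWithCorners ℝ E H}
  {X : Type*} [TopologicalSpace X] [ChartedSpace H X]
  {𝔸 𝔹 : Type*} [NormedRing 𝔸] [NormedAlgebra ℝ 𝔸] [NormedAddCommGroup 𝔹] [NormedSpace ℝ 𝔹]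
  {f g : X → 𝔸} {x : X}

theorem mvfderiv_mul_apply (hf : MDifferentiableAt J 𝓘(ℝ, 𝔸) f x)
    (hg : MDifferentiableAt J 𝓘(ℝ, 𝔸) g x) (v : E) :
    mvfderiv J (fun y => f y * g y) x v = f x * mvfderiv J g x v + mvfderiv J f x v * g x :=
  DFunLike.congr_fun (hf.hasMFDerivAt.mul' hg.hasMFDerivAt).mfderiv v

theorem mvfderiv_clm_apply {h : X → 𝔸} (ι : 𝔸 →L[ℝ] 𝔹) (hf : MDifferentiableAt J 𝓘(ℝ, 𝔸) h x)
    (v : E) : mvfderiv J (fun y => ι (h y)) x v = ι (mvfderiv J h x v) :=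
  DFunLike.congr_fun ((ι.hasMFDerivAt (x := h x)).comp x hf.hasMFDerivAt).mfderiv v

theorem mvfderiv_const_apply (c : 𝔹) (x : X) (v : E) : mvfderiv J (fun _ => c) x v = 0 :=
  DFunLike.congr_fun (mfderiv_const (I := J) (I' := 𝓘(ℝ, 𝔹)) (c := c) (x := x)) v

theorem mvfderiv_congr_apply {f g : X → 𝔹} (h : f =ᶠ[𝓝 x] g) (v : E) :
    mvfderiv J f x v = mvfderiv J g x v :=
  DFunLike.congr_fun h.mfderiv_eq v

end VectorValued

section LieHom

variable {𝔤 : Type*} [NormedAddCommGroup 𝔤] [NormedSpace ℝ 𝔤]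
  {HG : Type*} [TopologicalSpace HG] {J : ModelWithCorners ℝ 𝔤 HG}
  {G : Type*} [TopologicalSpace G] [ChartedSpace HG G] [Group G] [LieGroup J ∞ G]
  {𝔸 𝔹 : Type*} [NormedRing 𝔸] [NormedAlgebra ℝ 𝔸] [NormedRing 𝔹] [NormedAlgebra ℝ 𝔹]
  (Θ : G →* 𝔸) (Θ' : G →* 𝔹)

variable (J) in
/-- The differential at `1` of a homomorphism to the units of an algebra. -/
def lieMap (Θ : G →* 𝔸) : 𝔤 →L[ℝ] 𝔸 := mvfderiv J Θ 1

variable {Θ Θ'}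

theorem mdifferentiableAt_hom (hΘ : ContMDiff J 𝓘(ℝ, 𝔸) ∞ Θ) (g : G) : MDifferentiableAt J 𝓘(ℝ, 𝔸) Θ g :=
  (hΘ g).mdifferentiableAt (by simp)

theorem mdifferentiableAt_hom_inv (hΘ : ContMDiff J 𝓘(ℝ, 𝔸) ∞ Θ) (g : G) :
    MDifferentiableAt J 𝓘(ℝ, 𝔸) (fun g => Θ g⁻¹) g :=
  ((hΘ g⁻¹).comp g (contMDiff_inv J ∞ g)).mdifferentiableAt (by simp)

theorem mvfderiv_hom_inv (hΘ : ContMDiff J 𝓘(ℝ, 𝔸) ∞ Θ) (ξ : 𝔤) : mvfderiv J (fun g : G => Θ g⁻¹) 1 ξ = -lieMap J Θ ξ := by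
  have h1 := mvfderiv_mul_apply (mdifferentiableAt_hom hΘ 1) (mdifferentiableAt_hom_inv hΘ 1) ξ
  have h2 : (fun g : G => Θ g * Θ g⁻¹) = fun _ => 1 := funext fun g => by
    rw [← map_mul, mul_inv_cancel, map_one]
  rw [h2, mvfderiv_const_apply, inv_one, map_one, one_mul, mul_one] at h1
  exact eq_neg_of_add_eq_zero_left h1.symm

theorem mvfderiv_conj (hΘ : ContMDiff J 𝓘(ℝ, 𝔸) ∞ Θ) (c : 𝔸) (ξ : 𝔤) :
    MDifferentiableAt J 𝓘(ℝ, 𝔸) (fun g => Θ g * c * Θ g⁻¹) 1 ∧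
    mvfderiv J (fun g : G => Θ g * c * Θ g⁻¹) 1 ξ = lieMap J Θ ξ * c - c * lieMap J Θ ξ := by
  have h1 := mdifferentiableAt_hom hΘ 1
  have h2 := mdifferentiableAt_hom_inv hΘ 1
  have hc : MDifferentiableAt J 𝓘(ℝ, 𝔸) (fun _ : G => c) 1 := mdifferentiableAt_const
  have h3 : MDifferentiableAt J 𝓘(ℝ, 𝔸) (fun g => Θ g * c) 1 := h1.mul hc
  refine ⟨h3.mul h2, ?_⟩
  rw [mvfderiv_mul_apply h3 h2, mvfderiv_hom_inv hΘ, mvfderiv_mul_apply h1 hc,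
    mvfderiv_const_apply, inv_one, map_one, mul_zero, one_mul, zero_add, mul_one, mul_neg]
  exact neg_add_eq_sub _ _

variable (J) in
/-- The adjoint action. -/
def adjointMap (g : G) : 𝔤 →L[ℝ] 𝔤 := mfderiv J J (fun γ : G => g * γ * g⁻¹) 1

theorem lieMap_adjointMap (hΘ : ContMDiff J 𝓘(ℝ, 𝔸) ∞ Θ) (g : G) (ξ : 𝔤) :
    lieMap J Θ (adjointMap J g ξ) = Θ g * lieMap J Θ ξ * Θ g⁻¹ := by
  have h1 := mdifferentiableAt_hom hΘ 1
  have hc : ∀ c : 𝔸, MDifferentiableAt J 𝓘(ℝ, 𝔸) (fun _ : G => c) 1 :=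
    fun c => mdifferentiableAt_const
  have h3 : MDifferentiableAt J 𝓘(ℝ, 𝔸) (fun γ => Θ g * Θ γ) 1 := (hc _).mul h1
  have e1 : (fun γ : G => Θ (g * γ * g⁻¹)) = fun γ => Θ g * Θ γ * Θ g⁻¹ := funext fun γ => by
    rw [map_mul, map_mul]
  have e2 : mvfderiv J (fun γ : G => Θ (g * γ * g⁻¹)) 1 ξ = Θ g * lieMap J Θ ξ * Θ g⁻¹ := by
    rw [e1, mvfderiv_mul_apply h3 (hc _), mvfderiv_const_apply, mul_zero, zero_add,
      mvfderiv_mul_apply (hc _) h1, mvfderiv_const_apply, zero_mul, add_zero]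
    rfl
  have hs : ContMDiffAt J J ∞ (fun γ : G => g * γ * g⁻¹) 1 :=
    (contMDiffAt_const.mul contMDiffAt_id).mul contMDiffAt_const
  refine Eq.trans ?_ e2
  have e3 := mfderiv_comp_apply_of_eq (I := J) (I' := J) (I'' := 𝓘(ℝ, 𝔸)) (g := (Θ : G → 𝔸))
    (f := fun γ : G => g * γ * g⁻¹) (y := 1) 1 h1 (hs.mdifferentiableAt (by simp)) (by simp) ξ
  exact e3.symm

/-- A linear map which intertwines the conjugations intertwines the commutators. -/
theorem map_commutator (hΘ : ContMDiff J 𝓘(ℝ, 𝔸) ∞ Θ) (hΘ' : ContMDiff J 𝓘(ℝ, 𝔹) ∞ Θ') (τ : 𝔸 →L[ℝ] 𝔹)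
    (hτ : ∀ g ξ, τ (Θ g * lieMap J Θ ξ * Θ g⁻¹) = Θ' g * lieMap J Θ' ξ * Θ' g⁻¹) (ξ ζ : 𝔤) :
    τ (lieMap J Θ ξ * lieMap J Θ ζ - lieMap J Θ ζ * lieMap J Θ ξ)
      = lieMap J Θ' ξ * lieMap J Θ' ζ - lieMap J Θ' ζ * lieMap J Θ' ξ := by
  obtain ⟨d1, e1⟩ := mvfderiv_conj hΘ (lieMap J Θ ζ) ξ
  obtain ⟨-, e2⟩ := mvfderiv_conj hΘ' (lieMap J Θ' ζ) ξ
  rw [← e1, ← e2, ← mvfderiv_clm_apply τ d1]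
  exact congrArg (fun f : G → 𝔹 => mvfderiv J f 1 ξ) (funext fun g => hτ g ζ)

end LieHom

section Blocks

variable {𝔤₁ 𝔤₂ : Type*} [NormedAddCommGroup 𝔤₁] [NormedSpace ℝ 𝔤₁] [NormedAddCommGroup 𝔤₂]
  [NormedSpace ℝ 𝔤₂] {G₁ G₂ : Type*} [TopologicalSpace G₁] [ChartedSpace 𝔤₁ G₁] [Group G₁]
  [TopologicalSpace G₂] [ChartedSpace 𝔤₂ G₂] [Group G₂]
  {𝔸 𝔸₁ 𝔸₂ : Type*} [NormedAddCommGroup 𝔸₁] [NormedSpace ℝ 𝔸₁] [NormedAddCommGroup 𝔸₂]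
  [NormedSpace ℝ 𝔸₂] [NormedRing 𝔸] [NormedAlgebra ℝ 𝔸]
  {Θ : G₁ × G₂ →* 𝔸} {f₁ : G₁ → 𝔸₁} {f₂ : G₂ → 𝔸₂} (i₁ : 𝔸₁ →L[ℝ] 𝔸) (i₂ : 𝔸₂ →L[ℝ] 𝔸)

theorem contMDiff_of_blocks (h : ∀ g, Θ g = i₁ (f₁ g.1) + i₂ (f₂ g.2))
    (h₁ : ContMDiff 𝓘(ℝ, 𝔤₁) 𝓘(ℝ, 𝔸₁) ∞ f₁) (h₂ : ContMDiff 𝓘(ℝ, 𝔤₂) 𝓘(ℝ, 𝔸₂) ∞ f₂) :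
    ContMDiff (𝓘(ℝ, 𝔤₁).prod 𝓘(ℝ, 𝔤₂)) 𝓘(ℝ, 𝔸) ∞ Θ := by
  rw [funext h]
  exact (i₁.contMDiff.comp (h₁.comp contMDiff_fst)).add (i₂.contMDiff.comp (h₂.comp contMDiff_snd))

theorem lieMap_of_blocks (h : ∀ g, Θ g = i₁ (f₁ g.1) + i₂ (f₂ g.2))
    (h₁ : ContMDiff 𝓘(ℝ, 𝔤₁) 𝓘(ℝ, 𝔸₁) ∞ f₁) (h₂ : ContMDiff 𝓘(ℝ, 𝔤₂) 𝓘(ℝ, 𝔸₂) ∞ f₂)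
    (a : 𝔤₁ × 𝔤₂) : lieMap (𝓘(ℝ, 𝔤₁).prod 𝓘(ℝ, 𝔤₂)) Θ a
      = i₁ (diffOne f₁ a.1) + i₂ (diffOne f₂ a.2) := by
  have k1 := (i₁.hasMFDerivAt (x := f₁ (1 : G₁ × G₂).1)).comp (1 : G₁ × G₂)
    ((((h₁ (1 : G₁ × G₂).1).mdifferentiableAt (by simp)).hasMFDerivAt).comp (1 : G₁ × G₂)
      (hasMFDerivAt_fst (I := 𝓘(ℝ, 𝔤₁)) (I' := 𝓘(ℝ, 𝔤₂)) (x := (1 : G₁ × G₂))))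
  have k2 := (i₂.hasMFDerivAt (x := f₂ (1 : G₁ × G₂).2)).comp (1 : G₁ × G₂)
    ((((h₂ (1 : G₁ × G₂).2).mdifferentiableAt (by simp)).hasMFDerivAt).comp (1 : G₁ × G₂)
      (hasMFDerivAt_snd (I := 𝓘(ℝ, 𝔤₁)) (I' := 𝓘(ℝ, 𝔤₂)) (x := (1 : G₁ × G₂))))
  have k3 := DFunLike.congr_fun (k1.add k2).mfderiv a
  refine Eq.trans ?_ k3
  exact congrArg (fun f : G₁ × G₂ → 𝔸 =>
    mvfderiv (𝓘(ℝ, 𝔤₁).prod 𝓘(ℝ, 𝔤₂)) f 1 a) (funext h)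

end Blocks

section Sandwich

variable {U Z : Type*} [NormedAddCommGroup U] [NormedSpace ℝ U] [NormedAddCommGroup Z]
  [NormedSpace ℝ Z]

/-- The map `A ↦ i ∘ A ∘ p`. -/
def sandwich (i : U →L[ℝ] Z) (p : Z →L[ℝ] U) : (U →L[ℝ] U) →L[ℝ] (Z →L[ℝ] Z) :=
  (ContinuousLinearMap.compL ℝ Z U Z i).comp ((ContinuousLinearMap.compL ℝ Z U U).flip p)

end Sandwich

section Homs

variable {k : ℕ} [NeZero k]
  {𝔤₁ : Type*} [NormedAddCommGroup 𝔤₁] [NormedSpace ℝ 𝔤₁]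
  {𝔤₂ : Type*} [NormedAddCommGroup 𝔤₂] [NormedSpace ℝ 𝔤₂]
  {Gc₁ : Type*} [TopologicalSpace Gc₁] [ChartedSpace 𝔤₁ Gc₁] [Group Gc₁]
  {G₁ : Type*} [TopologicalSpace G₁] [ChartedSpace 𝔤₁ G₁] [Group G₁]
  {Gc₂ : Type*} [TopologicalSpace Gc₂] [ChartedSpace 𝔤₂ Gc₂] [Group Gc₂]
  {G₂ : Type*} [TopologicalSpace G₂] [ChartedSpace 𝔤₂ G₂] [Group G₂]
  {ext₁ : CentralExtension k 𝔤₁ Gc₁ G₁} {ext₂ : CentralExtension k 𝔤₂ Gc₂ G₂} {q : ℤ}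

section Rep

variable {r₁ r₂ : ℕ} (ρ : DRep q ext₁ ext₂ r₁ r₂)

/-- Restriction of functions along `e`. -/
def restrictCoord {α β : Type*} [Fintype α] [Fintype β] (e : α → β) : (β → ℂ) →L[ℝ] (α → ℂ) :=
  ContinuousLinearMap.pi fun i => ContinuousLinearMap.proj (e i)

/-- The h-part of a vector. -/
def hIncl (r₁ r₂ : ℕ) : (Fin r₁ → ℂ) →L[ℝ] (Fin r₁ ⊕ Fin r₂ → ℂ) :=
  ContinuousLinearMap.pi (Sum.elim (fun i => ContinuousLinearMap.proj i) fun _ => 0)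

/-- The v-part of a vector. -/
def vIncl (r₁ r₂ : ℕ) : (Fin r₂ → ℂ) →L[ℝ] (Fin r₁ ⊕ Fin r₂ → ℂ) :=
  ContinuousLinearMap.pi (Sum.elim (fun _ => 0) fun i => ContinuousLinearMap.proj i)

theorem blocks_apply (A₁ : (Fin r₁ → ℂ) →L[ℂ] (Fin r₁ → ℂ)) (A₂ : (Fin r₂ → ℂ) →L[ℂ] (Fin r₂ → ℂ))
    (w : Fin r₁ ⊕ Fin r₂ → ℂ) :
    ((sandwich (hIncl r₁ r₂) (restrictCoord Sum.inl)).comp (restrictCLM r₁) A₁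
      + (sandwich (vIncl r₁ r₂) (restrictCoord Sum.inr)).comp (restrictCLM r₂) A₂) w
      = Sum.elim (A₁ (w ∘ Sum.inl)) (A₂ (w ∘ Sum.inr)) := by
  ext (i | i)
  · exact add_zero _
  · exact zero_add _

/-- The representation `ρ`, with values in the real algebra of endomorphisms. -/
def DRep.hom : Gc₁ × Gc₂ →* ((Fin r₁ ⊕ Fin r₂ → ℂ) →L[ℝ] (Fin r₁ ⊕ Fin r₂ → ℂ)) where
  toFun g := (sandwich (hIncl r₁ r₂) (restrictCoord Sum.inl)).comp (restrictCLM r₁) (ρ.rep₁ g.1)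
    + (sandwich (vIncl r₁ r₂) (restrictCoord Sum.inr)).comp (restrictCLM r₂) (ρ.rep₂ g.2)
  map_one' := ContinuousLinearMap.ext fun w => by
    rw [blocks_apply]
    ext (i | i) <;> simp
  map_mul' g g' := ContinuousLinearMap.ext fun w => by
    rw [mul_apply_eq_comp, blocks_apply, blocks_apply, blocks_apply]
    ext (i | i) <;> simp

theorem DRep.hom_apply (g : Gc₁ × Gc₂) (w : Fin r₁ ⊕ Fin r₂ → ℂ) : ρ.hom g w = ρ.act g w :=
  blocks_apply _ _ _

theorem DRep.contMDiff_hom : ContMDiff (𝓘(ℝ, 𝔤₁).prod 𝓘(ℝ, 𝔤₂))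
    𝓘(ℝ, (Fin r₁ ⊕ Fin r₂ → ℂ) →L[ℝ] (Fin r₁ ⊕ Fin r₂ → ℂ)) ∞ ρ.hom :=
  contMDiff_of_blocks _ _ (fun _ => rfl) ρ.smooth₁ ρ.smooth₂

theorem DRep.lieMap_hom (a : 𝔤₁ × 𝔤₂) (w : Fin r₁ ⊕ Fin r₂ → ℂ) :
    lieMap (𝓘(ℝ, 𝔤₁).prod 𝓘(ℝ, 𝔤₂)) ρ.hom a w = ρ.infinitesimal a w :=
  (DFunLike.congr_fun (lieMap_of_blocks _ _ (fun _ => rfl) ρ.smooth₁ ρ.smooth₂ a) w).trans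
    (blocks_apply _ _ _)

end Rep

section Orthogonal

theorem CentralExtension.mfderiv_proj_bijective {𝔤 Gc G : Type*} [NormedAddCommGroup 𝔤]
    [NormedSpace ℝ 𝔤] [TopologicalSpace Gc] [ChartedSpace 𝔤 Gc] [Group Gc] [TopologicalSpace G]
    [ChartedSpace 𝔤 G] [Group G] (ext : CentralExtension k 𝔤 Gc G) :
    Function.Bijective fun a : 𝔤 => (mfderiv 𝓘(ℝ, 𝔤) 𝓘(ℝ, 𝔤) ext.proj 1 a : 𝔤) :=
  (IsLocalDiffeomorphAt.mfderivToContinuousLinearEquiv (ext.isLocalDiffeomorph 1)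
    (by simp)).bijective

theorem CentralExtension.diffOne_comp_proj {𝔤 Gc G A : Type*} [NormedAddCommGroup 𝔤]
    [NormedSpace ℝ 𝔤] [TopologicalSpace Gc] [ChartedSpace 𝔤 Gc] [Group Gc] [TopologicalSpace G]
    [ChartedSpace 𝔤 G] [Group G] [NormedAddCommGroup A] [NormedSpace ℝ A]
    (ext : CentralExtension k 𝔤 Gc G) {f : G → A} (hf : ContMDiff 𝓘(ℝ, 𝔤) 𝓘(ℝ, A) ∞ f) (a : 𝔤) :
    diffOne (fun g => f (ext.proj g)) a
      = diffOne (𝔤 := 𝔤) f (mfderiv 𝓘(ℝ, 𝔤) 𝓘(ℝ, 𝔤) ext.proj 1 a : 𝔤) :=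
  mfderiv_comp_apply_of_eq (I := 𝓘(ℝ, 𝔤)) (I' := 𝓘(ℝ, 𝔤)) (I'' := 𝓘(ℝ, A)) (g := f)
    (f := ext.proj) (y := 1) 1 ((hf 1).mdifferentiableAt (by simp))
    ((ext.isLocalDiffeomorph.contMDiff 1).mdifferentiableAt (by simp)) (map_one _) a

variable {n : ℕ} {M : Type*} [TopologicalSpace M] [ChartedSpace (Eu n) M]
    [IsManifold (𝓡 n) ∞ M] {L : TM n M → ℝ}
  {EB : Type*} [NormedAddCommGroup EB] [NormedSpace ℝ EB]
  {B : Type*} [TopologicalSpace B] [ChartedSpace EB B] [MulAction (G₁ × G₂) B]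
  {pr : B → TM n M}
  (fr : AdaptedFrames L 𝔤₁ 𝔤₂ G₁ G₂ EB pr)
  (ext₁ : CentralExtension k 𝔤₁ Gc₁ G₁) (ext₂ : CentralExtension k 𝔤₂ Gc₂ G₂)

theorem sandwich_prod (A₁ A₂ : Eu n →L[ℝ] Eu n) (x : Eu n × Eu n) :
    (sandwich (ContinuousLinearMap.inl ℝ (Eu n) (Eu n)) (ContinuousLinearMap.fst ℝ (Eu n) (Eu n)) A₁
      + sandwich (ContinuousLinearMap.inr ℝ (Eu n) (Eu n))
        (ContinuousLinearMap.snd ℝ (Eu n) (Eu n)) A₂) x = (A₁ x.1, A₂ x.2) :=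
  Prod.ext (add_zero _) (zero_add _)

/-- The homomorphism from the extended group to the automorphisms of the model of the frames. -/
def AdaptedFrames.hom : Gc₁ × Gc₂ →* ((Eu n × Eu n) →L[ℝ] (Eu n × Eu n)) where
  toFun g := sandwich (ContinuousLinearMap.inl ℝ (Eu n) (Eu n))
      (ContinuousLinearMap.fst ℝ (Eu n) (Eu n)) (fr.σ₁ (ext₁.proj g.1))
    + sandwich (ContinuousLinearMap.inr ℝ (Eu n) (Eu n))
      (ContinuousLinearMap.snd ℝ (Eu n) (Eu n)) (fr.σ₂ (ext₂.proj g.2))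
  map_one' := ContinuousLinearMap.ext fun x => by
    rw [sandwich_prod]
    simp
  map_mul' g g' := ContinuousLinearMap.ext fun x => by
    rw [mul_apply_eq_comp, sandwich_prod, sandwich_prod, sandwich_prod]
    simp

theorem AdaptedFrames.hom_apply (g : Gc₁ × Gc₂) (x : Eu n × Eu n) :
    fr.hom ext₁ ext₂ g x = (fr.σ₁ (ext₁.proj g.1) x.1, fr.σ₂ (ext₂.proj g.2) x.2) :=
  sandwich_prod _ _ _

theorem AdaptedFrames.contMDiff_hom :
    ContMDiff (𝓘(ℝ, 𝔤₁).prod 𝓘(ℝ, 𝔤₂)) 𝓘(ℝ, (Eu n × Eu n) →L[ℝ] (Eu n × Eu n)) ∞ (fr.hom ext₁ ext₂) :=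
  contMDiff_of_blocks (f₁ := fun g => fr.σ₁ (ext₁.proj g)) (f₂ := fun g => fr.σ₂ (ext₂.proj g))
    _ _ (fun _ => rfl) (fr.smooth_σ₁.comp ext₁.isLocalDiffeomorph.contMDiff)
    (fr.smooth_σ₂.comp ext₂.isLocalDiffeomorph.contMDiff)

theorem AdaptedFrames.lieMap_hom (a : 𝔤₁ × 𝔤₂) (x : Eu n × Eu n) :
    lieMap (𝓘(ℝ, 𝔤₁).prod 𝓘(ℝ, 𝔤₂)) (fr.hom ext₁ ext₂) a x = fr.infinitesimal ext₁ ext₂ a x :=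
  (DFunLike.congr_fun (lieMap_of_blocks (f₁ := fun g => fr.σ₁ (ext₁.proj g))
    (f₂ := fun g => fr.σ₂ (ext₂.proj g)) _ _ (fun _ => rfl)
    (fr.smooth_σ₁.comp ext₁.isLocalDiffeomorph.contMDiff)
    (fr.smooth_σ₂.comp ext₂.isLocalDiffeomorph.contMDiff) a) x).trans (sandwich_prod _ _ _)

theorem AdaptedFrames.lieMap_hom_injective :
    Function.Injective (lieMap (𝓘(ℝ, 𝔤₁).prod 𝓘(ℝ, 𝔤₂)) (fr.hom ext₁ ext₂)) := by
  intro a a' h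
  have key : ∀ x, fr.infinitesimal ext₁ ext₂ a x = fr.infinitesimal ext₁ ext₂ a' x := fun x => by
    rw [← fr.lieMap_hom, ← fr.lieMap_hom, h]
  refine Prod.ext ?_ ?_
  · refine ext₁.mfderiv_proj_bijective.1 (fr.injective_σ₁ ?_)
    rw [← ext₁.diffOne_comp_proj fr.smooth_σ₁, ← ext₁.diffOne_comp_proj fr.smooth_σ₁]
    exact ContinuousLinearMap.ext fun x => congrArg Prod.fst (key (x, 0))
  · refine ext₂.mfderiv_proj_bijective.1 (fr.injective_σ₂ ?_)
    rw [← ext₂.diffOne_comp_proj fr.smooth_σ₂, ← ext₂.diffOne_comp_proj fr.smooth_σ₂]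
    exact ContinuousLinearMap.ext fun x => congrArg Prod.snd (key (0, x))

/-- The model metric of the frames. -/
def AdaptedFrames.metric (x y : Eu n × Eu n) : ℝ :=
  ∑ i, fr.ε i * x.1 i * y.1 i + ∑ i, fr.ε i * x.2 i * y.2 i

theorem AdaptedFrames.exists_lieMap_hom_eq {A : (Eu n × Eu n) →L[ℝ] (Eu n × Eu n)}
    (hA : ∀ x, A (0, x.2) = (0, (A x).2))
    (hm : ∀ x y, fr.metric (A x) y + fr.metric x (A y) = 0) :
    ∃ a, lieMap (𝓘(ℝ, 𝔤₁).prod 𝓘(ℝ, 𝔤₂)) (fr.hom ext₁ ext₂) a = A := by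
  have hA' : ∀ x, A (x.1, 0) = ((A x).1, 0) := fun x => by
    have h1 : x = (x.1, 0) + (0, x.2) := by simp
    have h2 : A x = A (x.1, 0) + (0, (A x).2) := by
      rw [← hA, ← map_add, ← h1]
    exact Prod.ext ((congrArg Prod.fst h2).trans (add_zero _)).symm
      (add_eq_right.1 (congrArg Prod.snd h2).symm)
  obtain ⟨b₁, h₁⟩ : (ContinuousLinearMap.fst ℝ (Eu n) (Eu n)).comp
      (A.comp (ContinuousLinearMap.inl ℝ (Eu n) (Eu n))) ∈ Set.range (diffOne (𝔤 := 𝔤₁) fr.σ₁) := by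
    rw [fr.range_σ₁]
    intro x y
    have := hm (x, 0) (y, 0)
    rw [hA' (x, 0), hA' (y, 0)] at this
    simpa [AdaptedFrames.metric] using this
  obtain ⟨b₂, h₂⟩ : (ContinuousLinearMap.snd ℝ (Eu n) (Eu n)).comp
      (A.comp (ContinuousLinearMap.inr ℝ (Eu n) (Eu n))) ∈ Set.range (diffOne (𝔤 := 𝔤₂) fr.σ₂) := by
    rw [fr.range_σ₂]
    intro x y
    have := hm (0, x) (0, y)
    rw [hA (0, x), hA (0, y)] at this
    simpa [AdaptedFrames.metric] using this
  obtain ⟨a₁, rfl⟩ := ext₁.mfderiv_proj_bijective.2 b₁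
  obtain ⟨a₂, rfl⟩ := ext₂.mfderiv_proj_bijective.2 b₂
  refine ⟨(a₁, a₂), ContinuousLinearMap.ext fun x => ?_⟩
  rw [fr.lieMap_hom, AdaptedFrames.infinitesimal, ext₁.diffOne_comp_proj fr.smooth_σ₁,
    ext₂.diffOne_comp_proj fr.smooth_σ₂]
  have e₁ := DFunLike.congr_fun h₁ x.1
  have e₂ := DFunLike.congr_fun h₂ x.2
  have e₃ := congrArg Prod.fst (hA' x)
  have e₄ := congrArg Prod.snd (hA x)
  exact Prod.ext (e₁.trans e₃) (e₂.trans e₄)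

end Orthogonal

end Homs

section FrameForm

variable {𝔤₁ : Type*} [NormedAddCommGroup 𝔤₁] [NormedSpace ℝ 𝔤₁]
  {𝔤₂ : Type*} [NormedAddCommGroup 𝔤₂] [NormedSpace ℝ 𝔤₂]
  {G₁ : Type*} [TopologicalSpace G₁] [ChartedSpace 𝔤₁ G₁] [Group G₁]
  {G₂ : Type*} [TopologicalSpace G₂] [ChartedSpace 𝔤₂ G₂] [Group G₂]
  {n : ℕ} {M : Type*} [TopologicalSpace M] [ChartedSpace (Eu n) M]
  [IsManifold (𝓡 n) ∞ M] {L : TM n M → ℝ}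
  {EB : Type*} [NormedAddCommGroup EB] [NormedSpace ℝ EB] [FiniteDimensional ℝ EB]
  {B : Type*} [TopologicalSpace B] [ChartedSpace EB B] [IsManifold 𝓘(ℝ, EB) ∞ B]
  [MulAction (G₁ × G₂) B]
  {pr : B → TM n M} (fr : AdaptedFrames L 𝔤₁ 𝔤₂ G₁ G₂ EB pr) (w : TM n M) {b : B}

theorem lagG_add (L : TM n M → ℝ) (u : TM n M) {P Q P' Q' : Eu n × Eu n}
    (hP : lagN L u P = 0) (hQ : lagN L u Q = Q) (hP' : lagN L u P' = 0) (hQ' : lagN L u Q' = Q') :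
    lagG L u (P + Q : Eu n × Eu n) (P' + Q' : Eu n × Eu n) = lagG L u P P' + lagG L u Q Q' := by
  have a := congrArg Prod.snd hP
  have a' := congrArg Prod.snd hP'
  have c := congrArg Prod.fst hQ
  have c' := congrArg Prod.fst hQ'
  replace a : vcomp (nLoc (funRep L u) (coord u u)) P = 0 := a
  replace a' : vcomp (nLoc (funRep L u) (coord u u)) P' = 0 := a'
  replace c : (0 : Eu n) = Q.1 := c
  replace c' : (0 : Eu n) = Q'.1 := c'
  unfold lagG sasakiLoc
  simp only [map_add, a, a', ← c, ← c', Prod.fst_add, zero_add, add_zero, PiLp.zero_apply, mul_zero,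
    Finset.sum_const_zero]

theorem AdaptedFrames.frame_eq_add (b : B) (x : Eu n × Eu n) :
    fr.frame b x = fr.frame b (x.1, 0) + fr.frame b (0, x.2) := by
  rw [← map_add]
  simp

theorem AdaptedFrames.lagN_frame (b : B) (x : Eu n × Eu n) :
    lagN L (pr b) (fr.frame b x) = fr.frame b (0, x.2) := by
  rw [fr.frame_eq_add, map_add, fr.horizontal, fr.vertical, zero_add]

theorem AdaptedFrames.lagG_frame (b : B) (x y : Eu n × Eu n) :
    lagG L (pr b) (fr.frame b x) (fr.frame b y) = fr.metric x y := by
  rw [fr.frame_eq_add b x, fr.frame_eq_add b y]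
  refine (lagG_add L (pr b) (fr.horizontal b _) (fr.vertical b _) (fr.horizontal b _)
    (fr.vertical b _)).trans ?_
  rw [fr.orthonormal_h, fr.orthonormal_v]
  rfl

theorem lagG_zero_left (L : TM n M → ℝ) (u : TM n M) (Y : TangentSpace (IT n) u) :
    lagG L u 0 Y = 0 := by
  unfold lagG sasakiLoc
  rw [show vcomp (nLoc (funRep L u) (coord u u)) (0 : TangentSpace (IT n) u) = 0 from map_zero _]
  have : ∀ i, (0 : TangentSpace (IT n) u).1 i = 0 := fun _ => rfl
  simp [this]

theorem AdaptedFrames.frame_injective (b : B) : Function.Injective (fr.frame b) := by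
  refine (injective_iff_map_eq_zero _).2 fun x hx => ?_
  have h : ∀ y, fr.metric x y = 0 := fun y => by
    rw [← fr.lagG_frame b, hx, lagG_zero_left]
  have hε : ∀ i, fr.ε i ≠ 0 := fun i => by
    rcases fr.sign_ε i with h | h <;> rw [h] <;> norm_num
  refine Prod.ext (PiLp.ext fun i => ?_) (PiLp.ext fun i => ?_)
  · have := h (EuclideanSpace.single i 1, 0)
    simpa [AdaptedFrames.metric, hε, PiLp.single_apply] using this
  · have := h (0, EuclideanSpace.single i 1)
    simpa [AdaptedFrames.metric, hε, PiLp.single_apply] using this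

/-- Tangent vectors of `TM` in the natural coordinates centred at `w`. -/
def fibreCoord (w u : TM n M) : TangentSpace (IT n) u →L[ℝ] Eu n × Eu n :=
  (trivializationAt (Eu n × Eu n) (TangentSpace (IT n)) w).continuousLinearMapAt ℝ u

theorem mem_trivializationAt_iff {w u : TM n M} :
    u ∈ (trivializationAt (Eu n × Eu n) (fun u : TM n M => TangentSpace (IT n) u) w).baseSet
      ↔ u ∈ (extChartAt (IT n) w).source := by
  rw [extChartAt_source]
  rfl

theorem fibreCoord_injective {w u : TM n M} (hu : u ∈ (extChartAt (IT n) w).source) :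
    Function.Injective (fibreCoord w u) := fun Y Z h => by
  have he := mem_trivializationAt_iff.2 hu
  have := congrArg ((trivializationAt (Eu n × Eu n) (TangentSpace (IT n)) w).symmL ℝ u) h
  exact (Trivialization.symmL_continuousLinearMapAt _ he Y).symm.trans
    (this.trans (Trivialization.symmL_continuousLinearMapAt _ he Z))

/-- The frames in natural coordinates. -/
def AdaptedFrames.frameRep (b : B) : (Eu n × Eu n) →L[ℝ] (Eu n × Eu n) :=
  (fibreCoord w (pr b)).comp (fr.frame b)

/-- The projection in natural coordinates. -/
def baseRep (pr : B → TM n M) (w : TM n M) (b : B) : Eu n × Eu n := extChartAt (IT n) w (pr b)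

variable {w}

theorem AdaptedFrames.contMDiffAt_frameRep (hb : pr b ∈ (extChartAt (IT n) w).source) :
    ContMDiffAt 𝓘(ℝ, EB) 𝓘(ℝ, (Eu n × Eu n) →L[ℝ] (Eu n × Eu n)) ∞ (fr.frameRep w) b := by
  have hs := mem_extChartAt_source (I := 𝓘(ℝ, EB)) b
  refine (contMDiffAt_iff_contDiffAt_chart hs).2 (contDiffAt_clm_of_apply fun x => ?_)
  refine (contMDiffAt_iff_contDiffAt_chart (f := fun c => fr.frameRep w c x) hs).1 ?_
  have he := mem_trivializationAt_iff.2 hb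
  have h1 := (((trivializationAt (Eu n × Eu n) (fun u : TM n M => TangentSpace (IT n) u)
    w).contMDiffAt_iff (f := fun c => (⟨pr c, fr.frame c x⟩ : TangentBundle (IT n) (TM n M)))
    (x₀ := b) ((Trivialization.mem_source _).2 he)).1 (fr.smooth x b))
  refine h1.2.congr_of_eventuallyEq ?_
  filter_upwards [h1.1.continuousAt.eventually ((Trivialization.open_baseSet _).mem_nhds he)]
    with c hc
  exact (trivializationAt (Eu n × Eu n) (fun u : TM n M => TangentSpace (IT n) u)
    w).continuousLinearMapAt_apply_of_mem ℝ hc _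

theorem contMDiffAt_baseRep (hb : pr b ∈ (extChartAt (IT n) w).source)
    (hpr : ContMDiffAt 𝓘(ℝ, EB) (IT n) ∞ pr b) :
    ContMDiffAt 𝓘(ℝ, EB) 𝓘(ℝ, Eu n × Eu n) ∞ (baseRep pr w) b :=
  (contMDiffAt_extChartAt' (by rwa [extChartAt_source] at hb)).comp b hpr

theorem AdaptedFrames.isUnit_frameRep (hb : pr b ∈ (extChartAt (IT n) w).source) :
    IsUnit (fr.frameRep w b) := by
  have h : Function.Injective (fr.frameRep w b) :=
    (fibreCoord_injective hb).comp (fr.frame_injective b)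
  rw [ContinuousLinearMap.isUnit_iff_bijective]
  exact ⟨h, (LinearMap.injective_iff_surjective (f := (fr.frameRep w b).toLinearMap)).1 h⟩

variable (w) in
/-- The connection form of the canonical d-connection in the frames, computed in the natural
coordinates centred at `w`. -/
def AdaptedFrames.connForm (b : B) (Y : EB) : (Eu n × Eu n) →L[ℝ] (Eu n × Eu n) :=
  Ring.inverse (fr.frameRep w b) * (mvfderiv 𝓘(ℝ, EB) (fr.frameRep w) b Y
    + covForm (funRep L w) (baseRep pr w b) (mvfderiv 𝓘(ℝ, EB) (baseRep pr w) b Y)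
      * fr.frameRep w b)

theorem AdaptedFrames.frameRep_mul_connForm (hb : pr b ∈ (extChartAt (IT n) w).source) (Y : EB) :
    fr.frameRep w b * fr.connForm w b Y = mvfderiv 𝓘(ℝ, EB) (fr.frameRep w) b Y
      + covForm (funRep L w) (baseRep pr w b) (mvfderiv 𝓘(ℝ, EB) (baseRep pr w) b Y)
        * fr.frameRep w b := by
  rw [AdaptedFrames.connForm, ← mul_assoc, Ring.mul_inverse_cancel _ (fr.isUnit_frameRep hb),
    one_mul]

theorem AdaptedFrames.connForm_eq (hb : pr b ∈ (extChartAt (IT n) w).source) {Y : EB}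
    {A : (Eu n × Eu n) →L[ℝ] (Eu n × Eu n)}
    (h : fr.frameRep w b * A = mvfderiv 𝓘(ℝ, EB) (fr.frameRep w) b Y
      + covForm (funRep L w) (baseRep pr w b) (mvfderiv 𝓘(ℝ, EB) (baseRep pr w) b Y)
        * fr.frameRep w b) : fr.connForm w b Y = A := by
  rw [AdaptedFrames.connForm, ← h, ← mul_assoc, Ring.inverse_mul_cancel _ (fr.isUnit_frameRep hb),
    one_mul]

theorem AdaptedFrames.connForm_add (b : B) (Y Z : EB) :
    fr.connForm w b (Y + Z) = fr.connForm w b Y + fr.connForm w b Z := by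
  have h1 : mvfderiv 𝓘(ℝ, EB) (fr.frameRep w) b (Y + Z)
    = mvfderiv 𝓘(ℝ, EB) (fr.frameRep w) b Y + mvfderiv 𝓘(ℝ, EB) (fr.frameRep w) b Z :=
    map_add (mvfderiv 𝓘(ℝ, EB) (fr.frameRep w) b) Y Z
  have h2 : mvfderiv 𝓘(ℝ, EB) (baseRep pr w) b (Y + Z)
    = mvfderiv 𝓘(ℝ, EB) (baseRep pr w) b Y + mvfderiv 𝓘(ℝ, EB) (baseRep pr w) b Z :=
    map_add (mvfderiv 𝓘(ℝ, EB) (baseRep pr w) b) Y Z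
  unfold AdaptedFrames.connForm
  rw [h1, h2, map_add, add_mul, ← mul_add]
  congr 1
  abel

/-- Along a local section of the frame bundle, the connection form is the matrix of the canonical
d-connection. -/
theorem AdaptedFrames.frame_connForm (hL : IsLagrangeSpace L)
    (hpr : ContMDiff 𝓘(ℝ, EB) (IT n) ∞ pr) {u : TM n M} (hu : u ∈ slit n M)
    (hw : u ∈ (extChartAt (IT n) w).source) {φ : TM n M → B}
    (hφ : MDifferentiableAt (IT n) 𝓘(ℝ, EB) φ u) (hφ' : ∀ᶠ y in 𝓝 u, pr (φ y) = y)
    {s : Π y : TM n M, TangentSpace (IT n) y} {x : Eu n × Eu n}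
    (hs : ∀ᶠ y in 𝓝 u, (s y : Eu n × Eu n) = fr.frame (φ y) x) (v : Eu n × Eu n) :
    (fr.frame (φ u) (fr.connForm w (φ u) (mfderiv (IT n) 𝓘(ℝ, EB) φ u v : EB) x) : Eu n × Eu n)
      = lagD L s u v := by
  have hu' := hφ'.self_of_nhds
  have hb : pr (φ u) ∈ (extChartAt (IT n) w).source := by rwa [hu']
  have cast : ∀ {y c : TM n M} (_ : c = y) (Y : TangentSpace (IT n) c),
      fibreCoord w y (Y : Eu n × Eu n) = fibreCoord w c Y := by
    rintro _ _ rfl _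
    rfl
  have he := mem_trivializationAt_iff.2 hw
  have dF := ((fr.contMDiffAt_frameRep hb).mdifferentiableAt (by simp))
  have dB := ((contMDiffAt_baseRep hb (hpr _)).mdifferentiableAt (by simp))
  have hs' : (fun y => fibreCoord w y (s y)) =ᶠ[𝓝 u] fun y => fr.frameRep w (φ y) x := by
    filter_upwards [hs, hφ'] with y hy hy'
    exact (congrArg (fibreCoord w y) hy).trans (cast hy' _)
  have dF' : MDifferentiableAt (IT n) 𝓘(ℝ, (Eu n × Eu n) →L[ℝ] (Eu n × Eu n))
    (fun y => fr.frameRep w (φ y)) u := dF.comp u hφ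
  have ds : MDifferentiableAt (IT n) ((IT n).prod 𝓘(ℝ, Eu n × Eu n))
      (fun y => TotalSpace.mk' (Eu n × Eu n) y (s y)) u := by
    refine (mdifferentiableAt_section_iff_clma he).2 ?_
    exact (MDifferentiableAt.clm_apply dF' mdifferentiableAt_const).congr_of_eventuallyEq hs'
  have h1 := (hasConnForm_lagD hL w).clma_apply hu he hw ds v
  have h2 : mvfderiv (IT n) (fun y => fibreCoord w y (s y)) u v
      = mvfderiv 𝓘(ℝ, EB) (fr.frameRep w) (φ u) (mfderiv (IT n) 𝓘(ℝ, EB) φ u v : EB) x :=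
    (mvfderiv_congr_apply hs' v).trans
      ((mvfderiv_clm_apply (ContinuousLinearMap.apply ℝ (Eu n × Eu n) x) dF' v).trans
        (DFunLike.congr_fun (mvfderiv_comp_apply dF hφ v).symm x))
  have h3 : mvfderiv 𝓘(ℝ, EB) (baseRep pr w) (φ u) (mfderiv (IT n) 𝓘(ℝ, EB) φ u v : EB)
      = dchart (IT n) w u v :=
    (mvfderiv_comp_apply dB hφ v).trans
      (mvfderiv_congr_apply (f := baseRep pr w ∘ φ) (g := extChartAt (IT n) w)
        (hφ'.mono fun y hy => congrArg (extChartAt (IT n) w) hy) v)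
  have h4 : baseRep pr w (φ u) = extChartAt (IT n) w u := congrArg (extChartAt (IT n) w) hu'
  have h5 := DFunLike.congr_fun (fr.frameRep_mul_connForm hb (mfderiv (IT n) 𝓘(ℝ, EB) φ u v : EB)) x
  rw [h3, h4, add_apply, mul_apply_eq_comp, mul_apply_eq_comp, ← h2] at h5
  have h6 : fibreCoord w u (s u) = fr.frameRep w (φ u) x := hs'.self_of_nhds
  rw [← h6] at h5
  refine fibreCoord_injective hw ?_
  exact (cast hu' _).trans (h5.trans h1.symm)

end FrameForm

theorem curvForm_comp {E 𝔸 𝔹 : Type*} [NormedAddCommGroup E] [NormedSpace ℝ E] [NormedRing 𝔸]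
    [NormedAlgebra ℝ 𝔸] [NormedRing 𝔹] [NormedAlgebra ℝ 𝔹] (ι : 𝔸 →L[ℝ] 𝔹) {A : E → E →L[ℝ] 𝔸}
    {z : E} (hA : DifferentiableAt ℝ A z) {a b : E}
    (hι : ι (A z a * A z b - A z b * A z a) = ι (A z a) * ι (A z b) - ι (A z b) * ι (A z a)) :
    curvForm (fun w => ι.comp (A w)) z a b = ι (curvForm A z a b) := by
  have h2 : fderiv ℝ (fun w => ι.comp (A w)) z
      = (ContinuousLinearMap.compL ℝ E 𝔸 𝔹 ι).comp (fderiv ℝ A z) :=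
    ((ContinuousLinearMap.compL ℝ E 𝔸 𝔹 ι).hasFDerivAt.comp z hA.hasFDerivAt).fderiv
  rw [curvForm_apply, curvForm_apply, h2, map_add, hι, map_sub]
  rfl

section FrameGroup

variable {k : ℕ} [NeZero k]
  {𝔤₁ : Type*} [NormedAddCommGroup 𝔤₁] [NormedSpace ℝ 𝔤₁] [FiniteDimensional ℝ 𝔤₁]
  {𝔤₂ : Type*} [NormedAddCommGroup 𝔤₂] [NormedSpace ℝ 𝔤₂] [FiniteDimensional ℝ 𝔤₂]
  {Gc₁ : Type*} [TopologicalSpace Gc₁] [ChartedSpace 𝔤₁ Gc₁] [Group Gc₁]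
  [LieGroup 𝓘(ℝ, 𝔤₁) ∞ Gc₁]
  {G₁ : Type*} [TopologicalSpace G₁] [ChartedSpace 𝔤₁ G₁] [Group G₁]
  [LieGroup 𝓘(ℝ, 𝔤₁) ∞ G₁]
  {Gc₂ : Type*} [TopologicalSpace Gc₂] [ChartedSpace 𝔤₂ Gc₂] [Group Gc₂]
  [LieGroup 𝓘(ℝ, 𝔤₂) ∞ Gc₂]
  {G₂ : Type*} [TopologicalSpace G₂] [ChartedSpace 𝔤₂ G₂] [Group G₂]
  [LieGroup 𝓘(ℝ, 𝔤₂) ∞ G₂]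
  (ext₁ : CentralExtension k 𝔤₁ Gc₁ G₁) (ext₂ : CentralExtension k 𝔤₂ Gc₂ G₂)
  {n : ℕ} {M : Type*} [TopologicalSpace M] [ChartedSpace (Eu n) M]
  [IsManifold (𝓡 n) ∞ M] {L : TM n M → ℝ}
  {EB : Type*} [NormedAddCommGroup EB] [NormedSpace ℝ EB] [FiniteDimensional ℝ EB]
  {B : Type*} [TopologicalSpace B] [ChartedSpace EB B] [IsManifold 𝓘(ℝ, EB) ∞ B]
  [MulAction (G₁ × G₂) B]
  {pr : B → TM n M} (fr : AdaptedFrames L 𝔤₁ 𝔤₂ G₁ G₂ EB pr) {w : TM n M} {b : B}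
  (hB : IsPrincipalBundle (G := G₁ × G₂) (EB := EB) (IT n) (𝓘(ℝ, 𝔤₁).prod 𝓘(ℝ, 𝔤₂))
        (slit n M) pr)

theorem AdaptedFrames.frameRep_smul (g : Gc₁ × Gc₂) (b : B) :
    fr.frameRep w (dProj ext₁ ext₂ g • b) = fr.frameRep w b * fr.hom ext₁ ext₂ g⁻¹ := by
  have h : fr.frameRep w (dProj ext₁ ext₂ g • b) * fr.hom ext₁ ext₂ g = fr.frameRep w b := by
    refine ContinuousLinearMap.ext fun x => ?_
    have h1 := congrArg (fun v : TangentBundle (IT n) (TM n M) => fibreCoord w v.1 v.2)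
      (fr.equivariant (dProj ext₁ ext₂ g) b x.1 x.2)
    rw [mul_apply_eq_comp, fr.hom_apply]
    exact h1
  rw [← h, mul_assoc, ← map_mul, mul_inv_cancel, map_one, mul_one]

include hB in
theorem baseRep_smul (g : G₁ × G₂) (b : B) : baseRep pr w (g • b) = baseRep pr w b :=
  congrArg (extChartAt (IT n) w) (hB.proj_smul g b)

include hB in
theorem AdaptedFrames.connForm_smul (hb : pr b ∈ (extChartAt (IT n) w).source) (g : Gc₁ × Gc₂)
    (Y : EB) : fr.connForm w (dProj ext₁ ext₂ g • b)
        (mfderiv 𝓘(ℝ, EB) 𝓘(ℝ, EB) (fun c : B => dProj ext₁ ext₂ g • c) b Y : EB)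
      = fr.hom ext₁ ext₂ g * fr.connForm w b Y * fr.hom ext₁ ext₂ g⁻¹ := by
  have hb' : pr (dProj ext₁ ext₂ g • b) ∈ (extChartAt (IT n) w).source := by rwa [hB.proj_smul]
  have dg : MDifferentiableAt 𝓘(ℝ, EB) 𝓘(ℝ, EB) (fun c : B => dProj ext₁ ext₂ g • c) b :=
    (hB.contMDiff_const_smul _ b).mdifferentiableAt (by simp)
  have h1 := (mvfderiv_comp_apply
    ((fr.contMDiffAt_frameRep hb').mdifferentiableAt (by simp)) dg Y).trans
      (mvfderiv_congr_apply (g := fun c => fr.frameRep w c * fr.hom ext₁ ext₂ g⁻¹)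
        (Filter.Eventually.of_forall fun c => fr.frameRep_smul ext₁ ext₂ g c) Y)
  have h2 := (mvfderiv_comp_apply
    ((contMDiffAt_baseRep hb' (hB.smooth_proj _)).mdifferentiableAt (by simp)) dg Y).trans
      (mvfderiv_congr_apply (g := baseRep pr w)
        (Filter.Eventually.of_forall fun c => baseRep_smul hB (dProj ext₁ ext₂ g) c) Y)
  refine fr.connForm_eq hb' ?_
  rw [mvfderiv_mul_apply ((fr.contMDiffAt_frameRep hb).mdifferentiableAt (by simp))
    mdifferentiableAt_const, mvfderiv_const_apply, mul_zero, zero_add] at h1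
  rw [fr.frameRep_smul, baseRep_smul hB, h1, h2, ← mul_assoc _ (fr.frameRep w b), ← add_mul,
    ← fr.frameRep_mul_connForm hb]
  simp only [mul_assoc]
  rw [← mul_assoc (fr.hom ext₁ ext₂ g⁻¹), ← map_mul, inv_mul_cancel, map_one, one_mul]

include hB in
theorem AdaptedFrames.connForm_vertical (hb : pr b ∈ (extChartAt (IT n) w).source) (ξ : 𝔤₁ × 𝔤₂) :
    fr.connForm w b (mfderiv (𝓘(ℝ, 𝔤₁).prod 𝓘(ℝ, 𝔤₂)) 𝓘(ℝ, EB)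
        (fun γ : Gc₁ × Gc₂ => dProj ext₁ ext₂ γ • b) 1 ξ : EB)
      = -lieMap (𝓘(ℝ, 𝔤₁).prod 𝓘(ℝ, 𝔤₂)) (fr.hom ext₁ ext₂) ξ := by
  have e1 : dProj ext₁ ext₂ 1 • b = b := by rw [map_one, one_smul]
  have dφ : MDifferentiableAt (𝓘(ℝ, 𝔤₁).prod 𝓘(ℝ, 𝔤₂)) 𝓘(ℝ, EB)
      (fun γ : Gc₁ × Gc₂ => dProj ext₁ ext₂ γ • b) 1 :=
    (((hB.contMDiff_dProj_smul ext₁ ext₂).comp (contMDiff_id.prodMk contMDiff_const)) 1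
      ).mdifferentiableAt (by simp)
  have key : ∀ {𝔸 : Type _} [NormedAddCommGroup 𝔸] [NormedSpace ℝ 𝔸] (f : B → 𝔸),
      MDifferentiableAt 𝓘(ℝ, EB) 𝓘(ℝ, 𝔸) f b →
      mvfderiv 𝓘(ℝ, EB) f b (mfderiv (𝓘(ℝ, 𝔤₁).prod 𝓘(ℝ, 𝔤₂)) 𝓘(ℝ, EB)
        (fun γ : Gc₁ × Gc₂ => dProj ext₁ ext₂ γ • b) 1 ξ : EB)
      = mvfderiv (𝓘(ℝ, 𝔤₁).prod 𝓘(ℝ, 𝔤₂)) (fun γ : Gc₁ × Gc₂ => f (dProj ext₁ ext₂ γ • b)) 1 ξ :=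
    fun f hf => (mfderiv_comp_apply_of_eq (I := 𝓘(ℝ, 𝔤₁).prod 𝓘(ℝ, 𝔤₂)) (I' := 𝓘(ℝ, EB))
      (I'' := 𝓘(ℝ, _)) (g := f) 1 hf dφ e1 ξ).symm
  have dF := (fr.contMDiffAt_frameRep hb).mdifferentiableAt (by simp : (∞ : WithTop ℕ∞) ≠ 0)
  have dB := (contMDiffAt_baseRep hb (hB.smooth_proj _)).mdifferentiableAt
    (by simp : (∞ : WithTop ℕ∞) ≠ 0)
  refine fr.connForm_eq hb ?_
  have h1 := (key _ dF).trans (mvfderiv_congr_apply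
    (g := fun γ => fr.frameRep w b * fr.hom ext₁ ext₂ γ⁻¹)
    (Filter.Eventually.of_forall fun γ => fr.frameRep_smul ext₁ ext₂ γ b) ξ)
  have h2 := (key _ dB).trans (mvfderiv_congr_apply (g := fun _ => baseRep pr w b)
    (Filter.Eventually.of_forall fun γ => baseRep_smul hB (dProj ext₁ ext₂ γ) b) ξ)
  rw [mvfderiv_const_apply] at h2
  have hσ := fr.contMDiff_hom ext₁ ext₂
  rw [mvfderiv_mul_apply mdifferentiableAt_const (mdifferentiableAt_hom_inv hσ 1),
    mvfderiv_const_apply, zero_mul, add_zero, mvfderiv_hom_inv hσ] at h1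
  rw [h1, h2, map_zero, zero_mul, add_zero]

include hB in
theorem exists_frameSection (b : B) : ∃ (φ : TM n M → B) (U : Set (TM n M)), IsOpen U ∧ pr b ∈ U ∧
    U ⊆ slit n M ∧ ContMDiffOn (IT n) 𝓘(ℝ, EB) ∞ φ U ∧ (∀ u ∈ U, pr (φ u) = u) ∧ φ (pr b) = b ∧
    ∀ Y : EB, ∃ (ξ : 𝔤₁ × 𝔤₂) (y z : EB), Y = y + z ∧
      y = mfderiv (𝓘(ℝ, 𝔤₁).prod 𝓘(ℝ, 𝔤₂)) 𝓘(ℝ, EB)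
        (fun γ : Gc₁ × Gc₂ => dProj ext₁ ext₂ γ • b) 1 ξ ∧
      z = mfderiv (IT n) 𝓘(ℝ, EB) φ (pr b) (mfderiv 𝓘(ℝ, EB) (IT n) pr b Y) := by
  obtain ⟨s, U, hUV, hU, hbU, -, -, h⟩ := exists_isLocalLifting (ext₁ := ext₁) (ext₂ := ext₂) hB
    (hB.proj_mem b)
  obtain ⟨κ, O, hbO, hκ⟩ := h U subset_rfl hU b hbU
  refine ⟨fun u => dProj ext₁ ext₂ (κ b) • s u, U, hU, hbU, hUV,
    (hB.contMDiff_const_smul _).comp_contMDiffOn hκ.smooth_section,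
    fun u hu => (hB.proj_smul _ _).trans (hκ.proj_section u hu), hκ.smul_eq b hbO,
    fun Y => hκ.exists_vertical_add hB hbO Y⟩

include hB in
theorem AdaptedFrames.connForm_congr (hL : IsLagrangeSpace L) {w' : TM n M}
    (hb : pr b ∈ (extChartAt (IT n) w).source) (hb' : pr b ∈ (extChartAt (IT n) w').source)
    (ext₁ : CentralExtension k 𝔤₁ Gc₁ G₁) (ext₂ : CentralExtension k 𝔤₂ Gc₂ G₂) (Y : EB) :
    fr.connForm w b Y = fr.connForm w' b Y := by
  obtain ⟨φ, U, hU, hbU, hUV, hφ, hpφ, hφb, h⟩ := exists_frameSection ext₁ ext₂ hB b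
  obtain ⟨ξ, y, z, rfl, hy, hz⟩ := h Y
  rw [fr.connForm_add, fr.connForm_add, hy, fr.connForm_vertical ext₁ ext₂ hB hb,
    fr.connForm_vertical ext₁ ext₂ hB hb']
  congr 1
  refine ContinuousLinearMap.ext fun x => fr.frame_injective b ?_
  have key : ∀ w'', pr b ∈ (extChartAt (IT n) w'').source →
      (fr.frame b (fr.connForm w'' b z x) : Eu n × Eu n)
        = lagD L (fun u => (fr.frame (φ u) x : Eu n × Eu n)) (pr b)
            (mfderiv 𝓘(ℝ, EB) (IT n) pr b (y + z)) := by
    intro w'' hw''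
    have h1 := fr.frame_connForm hL hB.smooth_proj (hUV hbU) hw''
      ((hφ.contMDiffAt (hU.mem_nhds hbU)).mdifferentiableAt (by simp))
      (Filter.eventually_of_mem (hU.mem_nhds hbU) hpφ)
      (s := fun u => (fr.frame (φ u) x : Eu n × Eu n))
      (Filter.Eventually.of_forall fun y => rfl) (mfderiv 𝓘(ℝ, EB) (IT n) pr b (y + z) : Eu n × Eu n)
    refine Eq.trans ?_ h1
    have h2 : ∀ c, c = b → (fr.frame b (fr.connForm w'' b z x) : Eu n × Eu n)
      = fr.frame c (fr.connForm w'' c z x) := by rintro _ rfl; rfl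
    exact (h2 _ hφb).trans (congrArg (fun t : EB =>
      (fr.frame (φ (pr b)) (fr.connForm w'' (φ (pr b)) t x) : Eu n × Eu n)) hz)
  exact (key w hb).trans (key w' hb').symm

include hB in
theorem AdaptedFrames.connForm_mem_range (hL : IsLagrangeSpace L)
    (hb : pr b ∈ (extChartAt (IT n) w).source) (Y : EB) :
    ∃ a, lieMap (𝓘(ℝ, 𝔤₁).prod 𝓘(ℝ, 𝔤₂)) (fr.hom ext₁ ext₂) a = fr.connForm w b Y := by
  obtain ⟨φ, U, hU, hbU, hUV, hφ, hpφ, hφb, h⟩ := exists_frameSection ext₁ ext₂ hB b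
  obtain ⟨ξ, y, z, rfl, hy, hz⟩ := h Y
  obtain ⟨ζ, hζ⟩ : ∃ ζ, lieMap (𝓘(ℝ, 𝔤₁).prod 𝓘(ℝ, 𝔤₂)) (fr.hom ext₁ ext₂) ζ
      = fr.connForm w b z := by
    let X : (Eu n × Eu n) → Π u : TM n M, TangentSpace (IT n) u :=
      fun x u => (fr.frame (φ u) x : Eu n × Eu n)
    let v : TangentSpace (IT n) (pr b) := mfderiv 𝓘(ℝ, EB) (IT n) pr b (y + z)
    have hX : ∀ x, SmoothFieldOn U (X x) := fun x => by
      refine ((fr.smooth x).comp_contMDiffOn hφ).congr fun u hu => ?_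
      have : ∀ (c : TM n M) (Z : TangentSpace (IT n) c) (_ : c = u),
        (⟨u, (Z : Eu n × Eu n)⟩ : TangentBundle (IT n) (TM n M)) = ⟨c, Z⟩ := by
          rintro _ _ rfl; rfl
      exact this _ _ (hpφ u hu)
    have hUn := hU.mem_nhds hbU
    have key : ∀ (x : Eu n × Eu n) (s : Π u : TM n M, TangentSpace (IT n) u),
        (∀ u ∈ U, s u = X x u) →
        (lagD L s (pr b) v : Eu n × Eu n) = fr.frame b (fr.connForm w b z x) := by
      intro x s hs
      have h1 := fr.frame_connForm hL hB.smooth_proj (hUV hbU) hb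
        ((hφ.contMDiffAt hUn).mdifferentiableAt (by simp)) (Filter.eventually_of_mem hUn hpφ)
        (s := s) (Filter.eventually_of_mem hUn hs) v
      refine h1.symm.trans ?_
      have h2 : ∀ c, c = b → (fr.frame b (fr.connForm w b z x) : Eu n × Eu n)
        = fr.frame c (fr.connForm w c z x) := by rintro _ rfl; rfl
      exact ((h2 _ hφb).trans (congrArg (fun t : EB =>
        (fr.frame (φ (pr b)) (fr.connForm w (φ (pr b)) t x) : Eu n × Eu n)) hz)).symm
    have hXb : ∀ x, X x (pr b) = fr.frame b x := fun x => by
      have : ∀ c, c = b → (fr.frame c x : Eu n × Eu n) = fr.frame b x := by rintro _ rfl; rfl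
      exact this _ hφb
    refine fr.exists_lieMap_hom_eq ext₁ ext₂ (fun x => ?_) (fun x x' => ?_)
    · have hN : ∀ u ∈ U, lagN L u (X x u) = X (0, x.2) u := fun u hu => by
        have : ∀ c, pr c = u → lagN L u (fr.frame c x : Eu n × Eu n)
          = (fr.frame c (0, x.2) : Eu n × Eu n) := by
            rintro c rfl; exact fr.lagN_frame c x
        exact this _ (hpφ u hu)
      have h1 := (isDConnection_lagD hL).adapted U hUV hU (X x) (hX x) _ hbU v
      have h2 := key (0, x.2) _ hN
      have h3 := key x (X x) fun _ _ => rfl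
      have h4 : (lagN L (pr b) (lagD L (X x) (pr b) v) : Eu n × Eu n)
          = fr.frame b (0, (fr.connForm w b z x).2) :=
        (congrArg (fun t : Eu n × Eu n => (lagN L (pr b) t : Eu n × Eu n)) h3).trans
          (fr.lagN_frame b _)
      exact fr.frame_injective b (h2.symm.trans (h1.trans h4))
    · have h1 := isMetricCompatible_lagD hL U hUV hU (X x) (X x') (hX x) (hX x') _ hbU v
      have h2 : (fun u => lagG L u (X x u) (X x' u)) =ᶠ[𝓝 (pr b)] fun _ => fr.metric x x' := by
        filter_upwards [hUn] with u hu
        have : ∀ c, pr c = u → lagG L u (fr.frame c x : Eu n × Eu n)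
          (fr.frame c x' : Eu n × Eu n) = fr.metric x x' := by
            rintro c rfl; exact fr.lagG_frame c x x'
        exact this _ (hpφ u hu)
      have h3 := (mvfderiv_congr_apply (J := IT n) h2 v).trans
        (mvfderiv_const_apply (J := IT n) (fr.metric x x') (pr b) v)
      have h4 := h1.symm.trans h3
      have e1 := congrArg₂ (fun t t' : Eu n × Eu n => lagG L (pr b) t t') (key x (X x) fun _ _ => rfl)
        (hXb x')
      have e2 := congrArg₂ (fun t t' : Eu n × Eu n => lagG L (pr b) t t') (hXb x)
        (key x' (X x') fun _ _ => rfl)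
      exact (congrArg₂ (· + ·) (e1.trans (fr.lagG_frame b _ _))
        (e2.trans (fr.lagG_frame b _ _))).symm.trans h4
  refine ⟨-ξ + ζ, ?_⟩
  rw [map_add, map_neg, fr.connForm_add, hy, fr.connForm_vertical ext₁ ext₂ hB hb, hζ]

variable {ext₁ ext₂}

variable {b₀ : B}

/-- The left multiplication of the values of a form by `h`. -/
def mulLeftForm {𝔸 : Type*} [NormedRing 𝔸] [NormedAlgebra ℝ 𝔸] (h : 𝔸) (A : EB →L[ℝ] 𝔸) :
    EB →L[ℝ] 𝔸 := (ContinuousLinearMap.mul ℝ 𝔸 h).comp A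

/-- The right multiplication of the values of a form by `h`. -/
def mulRightForm {𝔸 : Type*} [NormedRing 𝔸] [NormedAlgebra ℝ 𝔸] (A : EB →L[ℝ] 𝔸) (h : 𝔸) :
    EB →L[ℝ] 𝔸 := ((ContinuousLinearMap.mul ℝ 𝔸).flip h).comp A

theorem contDiffAt_mulLeftForm {𝔸 : Type*} [NormedRing 𝔸] [NormedAlgebra ℝ 𝔸] {h : EB → 𝔸}
    {A : EB → EB →L[ℝ] 𝔸} {z : EB} (hh : ContDiffAt ℝ ∞ h z) (hA : ContDiffAt ℝ ∞ A z) :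
    ContDiffAt ℝ ∞ (fun w => mulLeftForm (h w) (A w)) z :=
  ((contDiffAt_const (c := ContinuousLinearMap.mul ℝ 𝔸)).clm_apply hh).clm_comp hA

theorem contDiffAt_mulRightForm {𝔸 : Type*} [NormedRing 𝔸] [NormedAlgebra ℝ 𝔸] {h : EB → 𝔸}
    {A : EB → EB →L[ℝ] 𝔸} {z : EB} (hA : ContDiffAt ℝ ∞ A z) (hh : ContDiffAt ℝ ∞ h z) :
    ContDiffAt ℝ ∞ (fun w => mulRightForm (A w) (h w)) z :=
  ((contDiffAt_const (c := (ContinuousLinearMap.mul ℝ 𝔸).flip)).clm_apply hh).clm_comp hA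

/-- The frames in the chart at `b₀`. -/
def AdaptedFrames.frameChart (w : TM n M) (b₀ : B) (z : EB) : (Eu n × Eu n) →L[ℝ] (Eu n × Eu n) :=
  fr.frameRep w ((extChartAt 𝓘(ℝ, EB) b₀).symm z)

variable (L pr) in
/-- The pull-back of the connection form of the canonical d-connection, in the chart at `b₀`. -/
def pullForm (w : TM n M) (b₀ : B) (z : EB) : EB →L[ℝ] (Eu n × Eu n) →L[ℝ] (Eu n × Eu n) :=
  (covForm (funRep L w) (mapRep 𝓘(ℝ, EB) (IT n) b₀ w pr z)).comp
    (fderiv ℝ (mapRep 𝓘(ℝ, EB) (IT n) b₀ w pr) z)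

/-- The connection form in the frames, in the chart at `b₀`. -/
def AdaptedFrames.connRep (w : TM n M) (b₀ : B) (z : EB) :
    EB →L[ℝ] (Eu n × Eu n) →L[ℝ] (Eu n × Eu n) :=
  mulLeftForm (Ring.inverse (fr.frameChart w b₀ z)) (fderiv ℝ (fr.frameChart w b₀) z
    + mulRightForm (pullForm L pr w b₀ z) (fr.frameChart w b₀ z))

theorem AdaptedFrames.frameChart_chart (hc : b ∈ (extChartAt 𝓘(ℝ, EB) b₀).source) :
    fr.frameChart w b₀ (extChartAt 𝓘(ℝ, EB) b₀ b) = fr.frameRep w b :=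
  congrArg (fr.frameRep w) ((extChartAt 𝓘(ℝ, EB) b₀).left_inv hc)

theorem AdaptedFrames.contDiffAt_frameChart (hb : pr b ∈ (extChartAt (IT n) w).source)
    (hc : b ∈ (extChartAt 𝓘(ℝ, EB) b₀).source) :
    ContDiffAt ℝ ∞ (fr.frameChart w b₀) (extChartAt 𝓘(ℝ, EB) b₀ b) :=
  (contMDiffAt_iff_contDiffAt_chart hc).1 (fr.contMDiffAt_frameRep hb)

include hB in
theorem contDiffAt_pullForm (hL : IsLagrangeSpace L) (hb : pr b ∈ (extChartAt (IT n) w).source)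
    (hc : b ∈ (extChartAt 𝓘(ℝ, EB) b₀).source) :
    ContDiffAt ℝ ∞ (pullForm L pr w b₀) (extChartAt 𝓘(ℝ, EB) b₀ b) := by
  have h1 : ContDiffAt ℝ ∞ (mapRep 𝓘(ℝ, EB) (IT n) b₀ w pr) (extChartAt 𝓘(ℝ, EB) b₀ b) :=
    contDiffAt_mapRep hc hb (hB.smooth_proj b)
  have h2 := contDiffAt_covForm (isRegularNear_funRep hL (hB.proj_mem b) hb)
  rw [← mapRep_chart pr w hc] at h2
  exact (h2.comp _ h1).clm_comp (h1.fderiv_right (m := ∞) (by simp))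

include hB in
theorem AdaptedFrames.contDiffAt_connRep (hL : IsLagrangeSpace L)
    (hb : pr b ∈ (extChartAt (IT n) w).source) (hc : b ∈ (extChartAt 𝓘(ℝ, EB) b₀).source) :
    ContDiffAt ℝ ∞ (fr.connRep w b₀) (extChartAt 𝓘(ℝ, EB) b₀ b) := by
  have h1 := fr.contDiffAt_frameChart hb hc
  have h2 := contDiffAt_pullForm hB hL hb hc
  have h3 : IsUnit (fr.frameChart w b₀ (extChartAt 𝓘(ℝ, EB) b₀ b)) := by
    rw [fr.frameChart_chart hc]
    exact fr.isUnit_frameRep hb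
  obtain ⟨x, hx⟩ := h3
  have h4 := contDiffAt_ringInverse ℝ (n := ∞) x
  rw [hx] at h4
  exact contDiffAt_mulLeftForm (h4.comp _ h1) ((h1.fderiv_right (m := ∞) (by simp)).add
    (contDiffAt_mulRightForm h2 h1))

include hB in
theorem AdaptedFrames.connForm_eq_connRep (hb : pr b ∈ (extChartAt (IT n) w).source)
    (hc : b ∈ (extChartAt 𝓘(ℝ, EB) b₀).source) (Y : EB) :
    fr.connForm w b Y = fr.connRep w b₀ (extChartAt 𝓘(ℝ, EB) b₀ b) (dchart 𝓘(ℝ, EB) b₀ b Y) := by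
  have h1 := mvfderiv_eq_fderiv_chart hc
    ((fr.contMDiffAt_frameRep hb).mdifferentiableAt (by simp)) Y
  have h2 := mvfderiv_eq_fderiv_chart hc
    ((contMDiffAt_baseRep hb (hB.smooth_proj b)).mdifferentiableAt (by simp)) Y
  rw [AdaptedFrames.connForm, h1, h2]
  have h3 := (extChartAt 𝓘(ℝ, EB) b₀).left_inv hc
  unfold AdaptedFrames.connRep mulLeftForm mulRightForm pullForm
  rw [fr.frameChart_chart hc, mapRep_chart _ _ hc]
  rfl

theorem AdaptedFrames.frameChart_mul_connRep {z : EB}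
    (hz : pr ((extChartAt 𝓘(ℝ, EB) b₀).symm z) ∈ (extChartAt (IT n) w).source) (v : EB) :
    fr.frameChart w b₀ z * fr.connRep w b₀ z v
      = fderiv ℝ (fr.frameChart w b₀) z v + pullForm L pr w b₀ z v * fr.frameChart w b₀ z :=
  (mul_assoc _ _ _).symm.trans
    ((congrArg (· * _) (Ring.mul_inverse_cancel _ (fr.isUnit_frameRep hz))).trans (one_mul _))

include hB in
theorem eventually_proj_mem (hb : pr b ∈ (extChartAt (IT n) w).source)
    (hc : b ∈ (extChartAt 𝓘(ℝ, EB) b₀).source) :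
    ∀ᶠ z in 𝓝 (extChartAt 𝓘(ℝ, EB) b₀ b), z ∈ (extChartAt 𝓘(ℝ, EB) b₀).target ∧
      pr ((extChartAt 𝓘(ℝ, EB) b₀).symm z) ∈ (extChartAt (IT n) w).source := by
  refine eventually_chart (I := 𝓘(ℝ, EB)) (V := pr ⁻¹' (extChartAt (IT n) w).source)
    ((isOpen_extChartAt_source w).preimage hB.smooth_proj.continuous)
    ((extChartAt 𝓘(ℝ, EB) b₀).map_source hc) ?_
  rwa [(extChartAt 𝓘(ℝ, EB) b₀).left_inv hc]

include hB in
theorem curvForm_pullForm (hL : IsLagrangeSpace L) (hb : pr b ∈ (extChartAt (IT n) w).source)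
    (hc : b ∈ (extChartAt 𝓘(ℝ, EB) b₀).source) (Y Z : EB) :
    curvForm (pullForm L pr w b₀) (extChartAt 𝓘(ℝ, EB) b₀ b)
        (dchart 𝓘(ℝ, EB) b₀ b Y) (dchart 𝓘(ℝ, EB) b₀ b Z)
      = curvForm (covForm (funRep L w)) (extChartAt (IT n) w (pr b))
        (dchart (IT n) w (pr b) (mfderiv 𝓘(ℝ, EB) (IT n) pr b Y))
        (dchart (IT n) w (pr b) (mfderiv 𝓘(ℝ, EB) (IT n) pr b Z)) := by
  have dpr : MDifferentiableAt 𝓘(ℝ, EB) (IT n) pr b := (hB.smooth_proj b).mdifferentiableAt (by simp)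
  have h2 := curvForm_pullback (A := covForm (funRep L w))
    (S := mapRep 𝓘(ℝ, EB) (IT n) b₀ w pr) (z := extChartAt 𝓘(ℝ, EB) b₀ b) (by
      rw [mapRep_chart _ _ hc]
      exact (contDiffAt_covForm (isRegularNear_funRep hL (hB.proj_mem b) hb)).differentiableAt
        (by simp)) (contDiffAt_mapRep hc hb (hB.smooth_proj b))
  have h3 := DFunLike.congr_fun (DFunLike.congr_fun h2 (dchart 𝓘(ℝ, EB) b₀ b Y))
    (dchart 𝓘(ℝ, EB) b₀ b Z)
  rw [ContinuousLinearMap.bilinearComp_apply, fderiv_mapRep hc hb dpr, fderiv_mapRep hc hb dpr,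
    mapRep_chart _ _ hc] at h3
  exact h3

include hB in
theorem AdaptedFrames.curvForm_connRep (hL : IsLagrangeSpace L)
    (hb : pr b ∈ (extChartAt (IT n) w).source)
    (hc : b ∈ (extChartAt 𝓘(ℝ, EB) b₀).source) (Y Z : EB) :
    curvForm (covForm (funRep L w)) (extChartAt (IT n) w (pr b))
        (dchart (IT n) w (pr b) (mfderiv 𝓘(ℝ, EB) (IT n) pr b Y))
        (dchart (IT n) w (pr b) (mfderiv 𝓘(ℝ, EB) (IT n) pr b Z)) * fr.frameRep w b
      = fr.frameRep w b * curvForm (fr.connRep w b₀) (extChartAt 𝓘(ℝ, EB) b₀ b)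
        (dchart 𝓘(ℝ, EB) b₀ b Y) (dchart 𝓘(ℝ, EB) b₀ b Z) := by
  have d1 := (contDiffAt_pullForm hB hL hb hc).differentiableAt
    (by simp : (∞ : WithTop ℕ∞) ≠ 0)
  have d2 := (fr.contDiffAt_connRep hB hL hb hc).differentiableAt
    (by simp : (∞ : WithTop ℕ∞) ≠ 0)
  have h1 := curvForm_gauge d1 d2 (fr.contDiffAt_frameChart hb hc)
    ((eventually_proj_mem hB hb hc).mono fun z hz v => fr.frameChart_mul_connRep hz.2 v)
    (dchart 𝓘(ℝ, EB) b₀ b Y) (dchart 𝓘(ℝ, EB) b₀ b Z)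
  rwa [fr.frameChart_chart hc, curvForm_pullForm hB hL hb hc] at h1

section Representation

variable {r₁ r₂ : ℕ} {q : ℤ} (ρ : DRep q ext₁ ext₂ r₁ r₂)

variable (ext₁ ext₂) in
theorem AdaptedFrames.exists_lieInv : ∃ l : ((Eu n × Eu n) →L[ℝ] (Eu n × Eu n)) →L[ℝ] 𝔤₁ × 𝔤₂,
    ∀ a, l (lieMap (𝓘(ℝ, 𝔤₁).prod 𝓘(ℝ, 𝔤₂)) (fr.hom ext₁ ext₂) a) = a := by
  obtain ⟨l, hl⟩ := LinearMap.exists_leftInverse_of_injective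
    (lieMap (𝓘(ℝ, 𝔤₁).prod 𝓘(ℝ, 𝔤₂)) (fr.hom ext₁ ext₂)).toLinearMap
    (LinearMap.ker_eq_bot.2 (fr.lieMap_hom_injective ext₁ ext₂))
  exact ⟨LinearMap.toContinuousLinearMap l, fun a => DFunLike.congr_fun hl a⟩

variable (ext₁ ext₂) in
/-- The inverse of the infinitesimal action on the model of the frames. -/
def AdaptedFrames.lieInv : ((Eu n × Eu n) →L[ℝ] (Eu n × Eu n)) →L[ℝ] 𝔤₁ × 𝔤₂ :=
  (fr.exists_lieInv ext₁ ext₂).choose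

theorem AdaptedFrames.lieInv_lieMap (a : 𝔤₁ × 𝔤₂) :
    fr.lieInv ext₁ ext₂ (lieMap (𝓘(ℝ, 𝔤₁).prod 𝓘(ℝ, 𝔤₂)) (fr.hom ext₁ ext₂) a) = a :=
  (fr.exists_lieInv ext₁ ext₂).choose_spec a

/-- The infinitesimal representation, extended to the endomorphisms of the model of the frames. -/
def AdaptedFrames.repMap : ((Eu n × Eu n) →L[ℝ] (Eu n × Eu n)) →L[ℝ]
    ((Fin r₁ ⊕ Fin r₂ → ℂ) →L[ℝ] (Fin r₁ ⊕ Fin r₂ → ℂ)) :=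
  (lieMap (𝓘(ℝ, 𝔤₁).prod 𝓘(ℝ, 𝔤₂)) ρ.hom).comp (fr.lieInv ext₁ ext₂)

theorem AdaptedFrames.repMap_apply (X : (Eu n × Eu n) →L[ℝ] (Eu n × Eu n))
    (f : Fin r₁ ⊕ Fin r₂ → ℂ) :
    fr.repMap ρ X f = ρ.infinitesimal (fr.lieInv ext₁ ext₂ X) f := ρ.lieMap_hom _ _

theorem AdaptedFrames.repMap_lieMap (a : 𝔤₁ × 𝔤₂) :
    fr.repMap ρ (lieMap (𝓘(ℝ, 𝔤₁).prod 𝓘(ℝ, 𝔤₂)) (fr.hom ext₁ ext₂) a)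
      = lieMap (𝓘(ℝ, 𝔤₁).prod 𝓘(ℝ, 𝔤₂)) ρ.hom a :=
  congrArg _ (fr.lieInv_lieMap a)

theorem AdaptedFrames.repMap_conj (g : Gc₁ × Gc₂) (a : 𝔤₁ × 𝔤₂) :
    fr.repMap ρ (fr.hom ext₁ ext₂ g * lieMap (𝓘(ℝ, 𝔤₁).prod 𝓘(ℝ, 𝔤₂)) (fr.hom ext₁ ext₂) a
        * fr.hom ext₁ ext₂ g⁻¹)
      = ρ.hom g * lieMap (𝓘(ℝ, 𝔤₁).prod 𝓘(ℝ, 𝔤₂)) ρ.hom a * ρ.hom g⁻¹ := by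
  rw [← lieMap_adjointMap (fr.contMDiff_hom ext₁ ext₂), fr.repMap_lieMap,
    lieMap_adjointMap ρ.contMDiff_hom]

include hB in
theorem AdaptedFrames.connRep_mem_range (hL : IsLagrangeSpace L)
    (hb : pr b ∈ (extChartAt (IT n) w).source) (hc : b ∈ (extChartAt 𝓘(ℝ, EB) b₀).source) (Y : EB) :
    ∃ a, lieMap (𝓘(ℝ, 𝔤₁).prod 𝓘(ℝ, 𝔤₂)) (fr.hom ext₁ ext₂) a
      = fr.connRep w b₀ (extChartAt 𝓘(ℝ, EB) b₀ b) (dchart 𝓘(ℝ, EB) b₀ b Y) := by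
  rw [← fr.connForm_eq_connRep hB hb hc]
  exact fr.connForm_mem_range ext₁ ext₂ hB hL hb Y

include hB in
theorem AdaptedFrames.curvForm_repMap (hL : IsLagrangeSpace L)
    (hb : pr b ∈ (extChartAt (IT n) w).source) (hc : b ∈ (extChartAt 𝓘(ℝ, EB) b₀).source)
    (Y Z : EB) :
    curvForm (fun z => (fr.repMap ρ).comp (fr.connRep w b₀ z)) (extChartAt 𝓘(ℝ, EB) b₀ b)
        (dchart 𝓘(ℝ, EB) b₀ b Y) (dchart 𝓘(ℝ, EB) b₀ b Z)
      = fr.repMap ρ (curvForm (fr.connRep w b₀) (extChartAt 𝓘(ℝ, EB) b₀ b)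
        (dchart 𝓘(ℝ, EB) b₀ b Y) (dchart 𝓘(ℝ, EB) b₀ b Z)) := by
  obtain ⟨ξ, hξ⟩ := fr.connRep_mem_range (ext₁ := ext₁) (ext₂ := ext₂) hB hL hb hc Y
  obtain ⟨ζ, hζ⟩ := fr.connRep_mem_range (ext₁ := ext₁) (ext₂ := ext₂) hB hL hb hc Z
  refine curvForm_comp _ ((fr.contDiffAt_connRep hB hL hb hc).differentiableAt (by simp)) ?_
  rw [← hξ, ← hζ, fr.repMap_lieMap, fr.repMap_lieMap]
  exact map_commutator (fr.contMDiff_hom ext₁ ext₂) ρ.contMDiff_hom _ (fr.repMap_conj ρ) ξ ζ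

include hB in
/-- The matrix of the curvature in the frames is an element of the Lie algebra. -/
theorem AdaptedFrames.lieMap_curvForm (hL : IsLagrangeSpace L)
    (hb : pr b ∈ (extChartAt (IT n) w).source) (hc : b ∈ (extChartAt 𝓘(ℝ, EB) b₀).source)
    (ext₁ : CentralExtension k 𝔤₁ Gc₁ G₁) (ext₂ : CentralExtension k 𝔤₂ Gc₂ G₂) (Y Z : EB) :
    lieMap (𝓘(ℝ, 𝔤₁).prod 𝓘(ℝ, 𝔤₂)) (fr.hom ext₁ ext₂) (fr.lieInv ext₁ ext₂
        (curvForm (fr.connRep w b₀) (extChartAt 𝓘(ℝ, EB) b₀ b)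
          (dchart 𝓘(ℝ, EB) b₀ b Y) (dchart 𝓘(ℝ, EB) b₀ b Z)))
      = curvForm (fr.connRep w b₀) (extChartAt 𝓘(ℝ, EB) b₀ b)
          (dchart 𝓘(ℝ, EB) b₀ b Y) (dchart 𝓘(ℝ, EB) b₀ b Z) := by
  let J := 𝓘(ℝ, 𝔤₁).prod 𝓘(ℝ, 𝔤₂)
  let Θ := fr.hom ext₁ ext₂
  let τ : ((Eu n × Eu n) →L[ℝ] (Eu n × Eu n)) →L[ℝ] ((Eu n × Eu n) →L[ℝ] (Eu n × Eu n)) :=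
    (lieMap J Θ).comp (fr.lieInv ext₁ ext₂)
  have hσ := fr.contMDiff_hom ext₁ ext₂
  have hτ : ∀ a, τ (lieMap J Θ a) = lieMap J Θ a := fun a => congrArg _ (fr.lieInv_lieMap a)
  obtain ⟨ξ, hξ⟩ := fr.connRep_mem_range (ext₁ := ext₁) (ext₂ := ext₂) hB hL hb hc Y
  obtain ⟨ζ, hζ⟩ := fr.connRep_mem_range (ext₁ := ext₁) (ext₂ := ext₂) hB hL hb hc Z
  have d := (fr.contDiffAt_connRep hB hL hb hc).differentiableAt (by simp : (∞ : WithTop ℕ∞) ≠ 0)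
  have h1 := curvForm_comp τ d (a := dchart 𝓘(ℝ, EB) b₀ b Y) (b := dchart 𝓘(ℝ, EB) b₀ b Z) (by
    rw [← hξ, ← hζ]
    refine (map_commutator hσ hσ τ (fun g a => ?_) ξ ζ).trans ?_
    · rw [← lieMap_adjointMap hσ, hτ]
    · exact (congrArg₂ (fun A B => A * B - B * A) (hτ ξ) (hτ ζ)).symm)
  refine h1.symm.trans ?_
  have h2 : (fun z => τ.comp (fr.connRep w b₀ z)) =ᶠ[𝓝 (extChartAt 𝓘(ℝ, EB) b₀ b)]
      fr.connRep w b₀ := by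
    filter_upwards [eventually_proj_mem hB hb hc] with z hz
    refine ContinuousLinearMap.ext fun v => ?_
    have h3 := DFunLike.congr_fun (dchart_comp_dchartSymm (I := 𝓘(ℝ, EB)) hz.1) v
    obtain ⟨a, ha⟩ := fr.connRep_mem_range (ext₁ := ext₁) (ext₂ := ext₂) hB hL hz.2
      ((extChartAt 𝓘(ℝ, EB) b₀).map_target hz.1) (dchartSymm 𝓘(ℝ, EB) b₀ z v)
    have h4 : dchart 𝓘(ℝ, EB) b₀ ((extChartAt 𝓘(ℝ, EB) b₀).symm z)
      (dchartSymm 𝓘(ℝ, EB) b₀ z v) = v := h3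
    rw [h4, (extChartAt 𝓘(ℝ, EB) b₀).right_inv hz.1] at ha
    change τ (fr.connRep w b₀ z v) = _
    rw [← ha, hτ]
  have h5 : τ.comp (fr.connRep w b₀ (extChartAt 𝓘(ℝ, EB) b₀ b)) = _ := h2.self_of_nhds
  rw [curvForm_apply, curvForm_apply, h2.fderiv_eq, h5]

/-- The connection on the associated module induced by the canonical d-connection. -/
def AdaptedFrames.inducedD (s : Π b : B, AssocBundle B r₁ r₂ b) (b : B) :
    TangentSpace 𝓘(ℝ, EB) b →L[ℝ] AssocBundle B r₁ r₂ b :=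
  let d : EB →L[ℝ] (Fin r₁ ⊕ Fin r₂ → ℂ) :=
    mvfderiv 𝓘(ℝ, EB) (fun c => (s c : Fin r₁ ⊕ Fin r₂ → ℂ)) b
  d + (ContinuousLinearMap.apply ℝ (Fin r₁ ⊕ Fin r₂ → ℂ) (s b)).comp ((fr.repMap ρ).comp
      ((fr.connRep (pr b) b (extChartAt 𝓘(ℝ, EB) b b)).comp (dchart 𝓘(ℝ, EB) b b)))

include hB in
theorem AdaptedFrames.inducedD_apply (hL : IsLagrangeSpace L)
    (hb : pr b ∈ (extChartAt (IT n) w).source) (s : Π b : B, AssocBundle B r₁ r₂ b) (Y : EB) :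
    (fr.inducedD ρ s b Y : Fin r₁ ⊕ Fin r₂ → ℂ)
      = mvfderiv 𝓘(ℝ, EB) (fun c => (s c : Fin r₁ ⊕ Fin r₂ → ℂ)) b Y
        + fr.repMap ρ (fr.connForm w b Y) (s b) := by
  rw [fr.connForm_congr hB hL hb (mem_extChartAt_source (pr b)) ext₁ ext₂,
    fr.connForm_eq_connRep hB (mem_extChartAt_source (pr b)) (mem_extChartAt_source b)]
  rfl

theorem clma_trivial (e b : B) (f : Fin r₁ ⊕ Fin r₂ → ℂ) :
    (trivializationAt (Fin r₁ ⊕ Fin r₂ → ℂ) (AssocBundle B r₁ r₂) e).continuousLinearMapAt ℝ b f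
      = f :=
  DFunLike.congr_fun (Bundle.Trivial.continuousLinearMapAt_trivialization ℝ B
    (Fin r₁ ⊕ Fin r₂ → ℂ) b) f

theorem mdifferentiableAt_trivial {s : Π b : B, AssocBundle B r₁ r₂ b} :
    MDifferentiableAt 𝓘(ℝ, EB) (𝓘(ℝ, EB).prod 𝓘(ℝ, Fin r₁ ⊕ Fin r₂ → ℂ))
      (fun b => TotalSpace.mk' (Fin r₁ ⊕ Fin r₂ → ℂ) b (s b)) b ↔
    MDifferentiableAt 𝓘(ℝ, EB) 𝓘(ℝ, Fin r₁ ⊕ Fin r₂ → ℂ)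
      (fun c => (s c : Fin r₁ ⊕ Fin r₂ → ℂ)) b := by
  rw [mdifferentiableAt_section_iff_clma
    (mem_baseSet_trivializationAt (Fin r₁ ⊕ Fin r₂ → ℂ) (AssocBundle B r₁ r₂) b)]
  exact iff_of_eq (congrArg (fun f : B → (Fin r₁ ⊕ Fin r₂ → ℂ) =>
    MDifferentiableAt 𝓘(ℝ, EB) 𝓘(ℝ, Fin r₁ ⊕ Fin r₂ → ℂ) f b)
    (funext fun c => clma_trivial b c (s c)))

/-- The connection form of the induced connection, in the chart at `b₀`. -/
def AdaptedFrames.inducedForm (b₀ : B) (z : EB) :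
    EB →L[ℝ] (Fin r₁ ⊕ Fin r₂ → ℂ) →L[ℝ] (Fin r₁ ⊕ Fin r₂ → ℂ) :=
  (fr.repMap ρ).comp (fr.connRep (pr ((extChartAt 𝓘(ℝ, EB) b₀).symm z)) b₀ z)

include hB in
theorem AdaptedFrames.inducedForm_eventuallyEq (hL : IsLagrangeSpace L)
    (hb : pr b ∈ (extChartAt (IT n) w).source) (hc : b ∈ (extChartAt 𝓘(ℝ, EB) b₀).source) :
    fr.inducedForm ρ b₀ =ᶠ[𝓝 (extChartAt 𝓘(ℝ, EB) b₀ b)]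
      fun z => (fr.repMap ρ).comp (fr.connRep w b₀ z) := by
  filter_upwards [eventually_proj_mem hB hb hc] with z hz
  refine congrArg (fr.repMap ρ).comp (ContinuousLinearMap.ext fun v => ?_)
  have h1 : dchart 𝓘(ℝ, EB) b₀ ((extChartAt 𝓘(ℝ, EB) b₀).symm z) (dchartSymm 𝓘(ℝ, EB) b₀ z v) = v :=
    DFunLike.congr_fun (dchart_comp_dchartSymm (I := 𝓘(ℝ, EB)) hz.1) v
  have hc' := (extChartAt 𝓘(ℝ, EB) b₀).map_target hz.1
  have hs := mem_extChartAt_source (I := IT n) (pr ((extChartAt 𝓘(ℝ, EB) b₀).symm z))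
  have h2 := fr.connForm_congr hB hL hs hz.2 ext₁ ext₂ (dchartSymm 𝓘(ℝ, EB) b₀ z v)
  rwa [fr.connForm_eq_connRep hB hs hc', fr.connForm_eq_connRep hB hz.2 hc', h1,
    (extChartAt 𝓘(ℝ, EB) b₀).right_inv hz.1] at h2

include hB in
theorem AdaptedFrames.hasConnForm_inducedD (hL : IsLagrangeSpace L) (b₀ : B) :
    HasConnForm Set.univ (fr.inducedD ρ)
      (trivializationAt (Fin r₁ ⊕ Fin r₂ → ℂ) (AssocBundle B r₁ r₂) b₀) b₀
      (fr.inducedForm ρ b₀) := by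
  intro b _ he hc
  have hs := mem_extChartAt_source (I := IT n) (pr b)
  have h1 := fr.inducedForm_eventuallyEq hB ρ hL hs hc
  refine ⟨(contDiffAt_const_clm_comp _ (fr.contDiffAt_connRep hB hL hs hc)).congr_of_eventuallyEq
    h1, fun s hd Y => ?_⟩
  have h2 := mvfderiv_eq_fderiv_chart hc (mdifferentiableAt_trivial.1 hd) Y
  rw [clma_trivial, clma_trivial]
  refine (fr.inducedD_apply hB ρ hL hs s Y).trans (congrArg₂ (· + ·) (h2.trans ?_) ?_)
  · exact congrArg (fun f : EB → (Fin r₁ ⊕ Fin r₂ → ℂ) => fderiv ℝ f (extChartAt 𝓘(ℝ, EB) b₀ b)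
      (dchart 𝓘(ℝ, EB) b₀ b Y)) (funext fun z => (clma_trivial b₀ _ _).symm)
  · rw [h1.self_of_nhds, fr.connForm_eq_connRep hB hs hc]
    rfl

include hB in
theorem AdaptedFrames.inducedD_comp (hL : IsLagrangeSpace L)
    {s : Π b : B, AssocBundle B r₁ r₂ b}
    (hs : MDifferentiableAt 𝓘(ℝ, EB) 𝓘(ℝ, Fin r₁ ⊕ Fin r₂ → ℂ)
      (fun c => (s c : Fin r₁ ⊕ Fin r₂ → ℂ)) b)
    (T : (Fin r₁ ⊕ Fin r₂ → ℂ) →L[ℝ] (Fin r₁ ⊕ Fin r₂ → ℂ))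
    (hT : ∀ a f, ρ.infinitesimal a (T f) = T (ρ.infinitesimal a f)) (Y : EB) :
    (fr.inducedD ρ (fun c => T (s c)) b Y : Fin r₁ ⊕ Fin r₂ → ℂ) = T (fr.inducedD ρ s b Y) := by
  have h0 := mem_extChartAt_source (I := IT n) (pr b)
  have h1 := fr.inducedD_apply hB ρ hL h0 s Y
  have h2 := fr.inducedD_apply hB ρ hL h0 (fun c => T (s c)) Y
  refine h2.trans (Eq.trans ?_ (congrArg T h1).symm)
  rw [map_add, fr.repMap_apply, fr.repMap_apply, hT]
  exact congrArg (· + _) (mvfderiv_clm_apply T hs Y)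

theorem DRep.infinitesimal_I_smul (a : 𝔤₁ × 𝔤₂) (f : Fin r₁ ⊕ Fin r₂ → ℂ) :
    ρ.infinitesimal a (Complex.I • f) = Complex.I • ρ.infinitesimal a f := by
  ext (i | i)
  · exact congrFun (map_smul (diffOne ρ.rep₁ a.1) Complex.I (f ∘ Sum.inl)) i
  · exact congrFun (map_smul (diffOne ρ.rep₂ a.2) Complex.I (f ∘ Sum.inr)) i

theorem DRep.infinitesimal_hProj (a : 𝔤₁ × 𝔤₂) (f : Fin r₁ ⊕ Fin r₂ → ℂ) :
    ρ.infinitesimal a (hProj r₁ r₂ f) = hProj r₁ r₂ (ρ.infinitesimal a f) := by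
  ext (i | i)
  · rfl
  · exact congrFun (map_zero (diffOne ρ.rep₂ a.2)) i

include hB in
theorem AdaptedFrames.inducedD_smul (hL : IsLagrangeSpace L) (g : Gc₁ × Gc₂)
    {s s' : Π b : B, AssocBundle B r₁ r₂ b}
    (e1 : ∀ c, (s' (dProj ext₁ ext₂ g • c) : Fin r₁ ⊕ Fin r₂ → ℂ) = ρ.hom g (s c))
    (ds : MDifferentiableAt 𝓘(ℝ, EB) 𝓘(ℝ, Fin r₁ ⊕ Fin r₂ → ℂ)
      (fun c => (s c : Fin r₁ ⊕ Fin r₂ → ℂ)) b) (Y : EB) :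
    ρ.hom g (fr.inducedD ρ s b Y) = (fr.inducedD ρ s' (dProj ext₁ ext₂ g • b)
      (mfderiv 𝓘(ℝ, EB) 𝓘(ℝ, EB) (fun c : B => dProj ext₁ ext₂ g • c) b Y) :
        Fin r₁ ⊕ Fin r₂ → ℂ) := by
  have h0 := mem_extChartAt_source (I := IT n) (pr b)
  have h0' : pr (dProj ext₁ ext₂ g • b) ∈ (extChartAt (IT n) (pr b)).source := by
    rwa [hB.proj_smul]
  have dg : ∀ (γ : G₁ × G₂) c, MDifferentiableAt 𝓘(ℝ, EB) 𝓘(ℝ, EB) (fun c : B => γ • c) c :=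
    fun γ c => (hB.contMDiff_const_smul γ c).mdifferentiableAt (by simp)
  have ds' : MDifferentiableAt 𝓘(ℝ, EB) 𝓘(ℝ, Fin r₁ ⊕ Fin r₂ → ℂ)
      (fun c => (s' c : Fin r₁ ⊕ Fin r₂ → ℂ)) (dProj ext₁ ext₂ g • b) := by
    have e2 : (fun c => (s' c : Fin r₁ ⊕ Fin r₂ → ℂ))
        = fun c => ρ.hom g (s ((dProj ext₁ ext₂ g)⁻¹ • c)) := funext fun c => by
      rw [← e1, smul_inv_smul]
    rw [e2]
    refine ((ρ.hom g).hasMFDerivAt.mdifferentiableAt).comp _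
      (MDifferentiableAt.comp (I' := 𝓘(ℝ, EB)) _ ?_ (dg _ _))
    rwa [inv_smul_smul]
  have h1 := fr.inducedD_apply hB ρ hL h0 s Y
  have h2 := fr.inducedD_apply hB ρ hL h0' s'
    (mfderiv 𝓘(ℝ, EB) 𝓘(ℝ, EB) (fun c : B => dProj ext₁ ext₂ g • c) b Y)
  refine Eq.trans ?_ h2.symm
  refine (congrArg (ρ.hom g) h1).trans ?_
  rw [map_add]
  refine congrArg₂ (· + ·) ?_ ?_
  · refine (mvfderiv_clm_apply (ρ.hom g) ds Y).symm.trans ?_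
    refine Eq.trans ?_ (mvfderiv_comp_apply ds' (dg _ b) Y).symm
    exact congrArg (fun f : B → (Fin r₁ ⊕ Fin r₂ → ℂ) => mvfderiv 𝓘(ℝ, EB) f b Y)
      (funext fun c => (e1 c).symm)
  · obtain ⟨a, ha⟩ := fr.connForm_mem_range ext₁ ext₂ hB hL h0 Y
    rw [fr.connForm_smul ext₁ ext₂ hB h0 g Y, ← ha, fr.repMap_conj, fr.repMap_lieMap, e1,
      mul_apply_eq_comp, mul_apply_eq_comp, ← mul_apply_eq_comp (ρ.hom g⁻¹), ← map_mul,
      inv_mul_cancel, map_one]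
    rfl

theorem DRep.mvfderiv_hom_apply (f : Fin r₁ ⊕ Fin r₂ → ℂ) (ξ : 𝔤₁ × 𝔤₂) :
    mvfderiv (𝓘(ℝ, 𝔤₁).prod 𝓘(ℝ, 𝔤₂)) (fun γ => ρ.hom γ f) 1 ξ
      = lieMap (𝓘(ℝ, 𝔤₁).prod 𝓘(ℝ, 𝔤₂)) ρ.hom ξ f :=
  mvfderiv_clm_apply (ContinuousLinearMap.apply ℝ (Fin r₁ ⊕ Fin r₂ → ℂ) f)
    (mdifferentiableAt_hom ρ.contMDiff_hom 1) ξ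

include hB in
theorem AdaptedFrames.inducedD_vertical (hL : IsLagrangeSpace L)
    {s : Π b : B, AssocBundle B r₁ r₂ b}
    (ds : MDifferentiableAt 𝓘(ℝ, EB) 𝓘(ℝ, Fin r₁ ⊕ Fin r₂ → ℂ)
      (fun c => (s c : Fin r₁ ⊕ Fin r₂ → ℂ)) b)
    (hg : ∀ᶠ g in 𝓝 (1 : Gc₁ × Gc₂),
      (s (dProj ext₁ ext₂ g • b) : Fin r₁ ⊕ Fin r₂ → ℂ) = ρ.hom g (s b)) (ξ : 𝔤₁ × 𝔤₂) :
    (fr.inducedD ρ s (dProj ext₁ ext₂ 1 • b) (mfderiv (𝓘(ℝ, 𝔤₁).prod 𝓘(ℝ, 𝔤₂)) 𝓘(ℝ, EB)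
      (fun g : Gc₁ × Gc₂ => dProj ext₁ ext₂ g • b) 1 ξ) : Fin r₁ ⊕ Fin r₂ → ℂ) = 0 := by
  have e1 : dProj ext₁ ext₂ 1 • b = b := by rw [map_one, one_smul]
  have h0 := mem_extChartAt_source (I := IT n) (pr b)
  have dφ : MDifferentiableAt (𝓘(ℝ, 𝔤₁).prod 𝓘(ℝ, 𝔤₂)) 𝓘(ℝ, EB)
      (fun γ : Gc₁ × Gc₂ => dProj ext₁ ext₂ γ • b) 1 :=
    (((hB.contMDiff_dProj_smul ext₁ ext₂).comp (contMDiff_id.prodMk contMDiff_const)) 1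
      ).mdifferentiableAt (by simp)
  have cast : ∀ (c : B) (_ : c = b) (Y : EB), (fr.inducedD ρ s b Y : Fin r₁ ⊕ Fin r₂ → ℂ) = 0 →
      (fr.inducedD ρ s c Y : Fin r₁ ⊕ Fin r₂ → ℂ) = 0 := by
    rintro _ rfl _ h
    exact h
  let y : EB := mfderiv (𝓘(ℝ, 𝔤₁).prod 𝓘(ℝ, 𝔤₂)) 𝓘(ℝ, EB)
    (fun γ : Gc₁ × Gc₂ => dProj ext₁ ext₂ γ • b) 1 ξ
  have h1 : mvfderiv 𝓘(ℝ, EB) (fun c => (s c : Fin r₁ ⊕ Fin r₂ → ℂ)) b y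
      = mvfderiv (𝓘(ℝ, 𝔤₁).prod 𝓘(ℝ, 𝔤₂))
        (fun γ : Gc₁ × Gc₂ => (s (dProj ext₁ ext₂ γ • b) : Fin r₁ ⊕ Fin r₂ → ℂ)) 1 ξ :=
    (mfderiv_comp_apply_of_eq (I := 𝓘(ℝ, 𝔤₁).prod 𝓘(ℝ, 𝔤₂)) (I' := 𝓘(ℝ, EB))
      (I'' := 𝓘(ℝ, Fin r₁ ⊕ Fin r₂ → ℂ)) (g := fun c => (s c : Fin r₁ ⊕ Fin r₂ → ℂ)) 1 ds dφ
      e1 ξ).symm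
  have h2 : (fun γ : Gc₁ × Gc₂ => (s (dProj ext₁ ext₂ γ • b) : Fin r₁ ⊕ Fin r₂ → ℂ))
      =ᶠ[𝓝 1] fun γ => ρ.hom γ (s b) := hg
  have h3 := (mvfderiv_congr_apply (J := 𝓘(ℝ, 𝔤₁).prod 𝓘(ℝ, 𝔤₂)) h2 ξ).trans
    (ρ.mvfderiv_hom_apply (s b) ξ)
  have h4 : fr.connForm (pr b) b y = _ := fr.connForm_vertical ext₁ ext₂ hB h0 ξ
  have h5 : fr.repMap ρ (fr.connForm (pr b) b y)
      = -lieMap (𝓘(ℝ, 𝔤₁).prod 𝓘(ℝ, 𝔤₂)) ρ.hom ξ := by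
    rw [h4, map_neg, fr.repMap_lieMap]
  have h6 : mvfderiv 𝓘(ℝ, EB) (fun c => (s c : Fin r₁ ⊕ Fin r₂ → ℂ)) b y
      = lieMap (𝓘(ℝ, 𝔤₁).prod 𝓘(ℝ, 𝔤₂)) ρ.hom ξ (s b) := h1.trans h3
  have h7 := fr.inducedD_apply hB ρ hL h0 s y
  rw [h5, h6, neg_apply, add_neg_cancel] at h7
  exact cast _ e1 _ h7

theorem AdaptedFrames.isPsiConnection_inducedD (hL : IsLagrangeSpace L) :
    IsPsiConnection (assocModule hB.smooth_smul ρ) (fr.inducedD ρ) where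
  isConnection := isSmoothConnectionOn_of_hasConnForm fun b _ =>
    ⟨_, fr.hasConnForm_inducedD hB ρ hL b⟩
  complex _ _ hs Y := fr.inducedD_comp hB ρ hL (mdifferentiableAt_trivial.1 hs)
    (Complex.I • ContinuousLinearMap.id ℝ (Fin r₁ ⊕ Fin r₂ → ℂ)) ρ.infinitesimal_I_smul Y
  adapted _ _ hs Y := fr.inducedD_comp hB ρ hL (mdifferentiableAt_trivial.1 hs)
    (LinearMap.toContinuousLinearMap ((hProj r₁ r₂).restrictScalars ℝ)) ρ.infinitesimal_hProj Y
  equivariant g s _ hss _ hs Y := (ρ.hom_apply g _).symm.trans (fr.inducedD_smul hB ρ hL g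
    (fun c => (hss c).symm.trans (ρ.hom_apply g (s c)).symm) (mdifferentiableAt_trivial.1 hs) Y)
  flat s b hs hg ξ := fr.inducedD_vertical hB ρ hL (mdifferentiableAt_trivial.1 hs)
    (hg.mono fun g h => h.symm.trans (ρ.hom_apply g (s b)).symm) ξ

include hB in
theorem AdaptedFrames.isInducedConnection_inducedD (hL : IsLagrangeSpace L) :
    IsInducedConnection fr ρ (fr.inducedD ρ) := by
  intro U hUV hU s hs hps u hu Y
  have hw : pr (s u) ∈ (extChartAt (IT n) u).source := by
    rw [hps u hu]
    exact mem_extChartAt_source u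
  have ds : MDifferentiableAt (IT n) 𝓘(ℝ, EB) s u :=
    (hs.contMDiffAt (hU.mem_nhds hu)).mdifferentiableAt (by simp)
  obtain ⟨a, ha⟩ := fr.connForm_mem_range ext₁ ext₂ hB hL hw (mfderiv (IT n) 𝓘(ℝ, EB) s u Y : EB)
  refine ⟨a, fun x => ?_, fun f => ?_⟩
  · refine (fr.frame_connForm hL hB.smooth_proj (hUV hu) (mem_extChartAt_source u) ds
      (Filter.eventually_of_mem (hU.mem_nhds hu) hps)
      (s := fun v => (fr.frame (s v) x : Eu n × Eu n))
      (Filter.Eventually.of_forall fun _ => rfl) Y).symm.trans ?_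
    rw [← ha, fr.lieMap_hom]
  · refine (fr.inducedD_apply hB ρ hL hw (fun _ => f) _).trans ?_
    rw [← ha, fr.repMap_lieMap, ρ.lieMap_hom]
    exact (congrArg (· + _) (mvfderiv_const_apply (J := 𝓘(ℝ, EB)) f (s u) _)).trans (zero_add _)

include hB in
theorem AdaptedFrames.isInducedCurvature_inducedD (hL : IsLagrangeSpace L)
    {R₀ : Π u : TM n M, TangentSpace (IT n) u → TangentSpace (IT n) u →
      (TangentSpace (IT n) u →ₗ[ℝ] TangentSpace (IT n) u)}
    (h₀ : IsCurvatureOn (Eu n × Eu n) (slit n M) (lagD L) fun u Y Z => R₀ u Y Z)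
    {R : Π b : B, TangentSpace 𝓘(ℝ, EB) b → TangentSpace 𝓘(ℝ, EB) b →
      (AssocBundle B r₁ r₂ b →ₗ[ℂ] AssocBundle B r₁ r₂ b)}
    (h : IsCurvatureOn (Fin r₁ ⊕ Fin r₂ → ℂ) Set.univ (fr.inducedD ρ) fun b Y Z => R b Y Z) :
    IsInducedCurvature fr ρ R₀ R := by
  intro b Y Z
  have hw := mem_extChartAt_source (I := IT n) (pr b)
  have hc := mem_extChartAt_source (I := 𝓘(ℝ, EB)) b
  refine ⟨fr.lieInv ext₁ ext₂ (curvForm (fr.connRep (pr b) b) (extChartAt 𝓘(ℝ, EB) b b)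
      (dchart 𝓘(ℝ, EB) b b Y) (dchart 𝓘(ℝ, EB) b b Z)), fun x => ?_, fun f => ?_⟩
  · refine Eq.trans ?_ (congrArg (fr.frame b) ((DFunLike.congr_fun
      (fr.lieMap_curvForm hB hL hw hc ext₁ ext₂ Y Z) x).symm.trans (fr.lieMap_hom ext₁ ext₂ _ x)))
    have h1 := h₀.clma_apply isOpen_slit (isSmoothConnectionOn_lagD hL)
      (hasConnForm_lagD hL (pr b)) (hB.proj_mem b) (mem_trivializationAt_iff.2 hw) hw
      (mfderiv 𝓘(ℝ, EB) (IT n) pr b Y) (mfderiv 𝓘(ℝ, EB) (IT n) pr b Z) (fr.frame b x)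
    exact fibreCoord_injective hw (h1.trans
      (DFunLike.congr_fun (fr.curvForm_connRep hB hL hw hc Y Z) x))
  · have h1 := h.clma_apply isOpen_univ (fr.isPsiConnection_inducedD hB ρ hL).isConnection
      (fr.hasConnForm_inducedD hB ρ hL b) (Set.mem_univ b) (mem_baseSet_trivializationAt
        (Fin r₁ ⊕ Fin r₂ → ℂ) (AssocBundle B r₁ r₂) b) hc Y Z f
    rw [clma_trivial, clma_trivial] at h1
    have h2 := fr.inducedForm_eventuallyEq hB ρ hL hw hc
    refine h1.trans (Eq.trans ?_ ((DFunLike.congr_fun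
      (fr.curvForm_repMap hB ρ hL hw hc Y Z) f).trans (fr.repMap_apply ρ _ f)))
    have h3 : fr.inducedForm ρ b (extChartAt 𝓘(ℝ, EB) b b) = _ := h2.self_of_nhds
    rw [curvForm_apply, curvForm_apply, h2.fderiv_eq, h3]

end Representation

end FrameGroup

end NAnholonomic

end

theorem mainTheorem3 {n : ℕ} {M : Type*} [TopologicalSpace M] [T2Space M]
    [SecondCountableTopology M] [ChartedSpace (Eu n) M] [IsManifold (𝓡 n) ∞ M] (L : TM n M → ℝ)
    (hL : IsLagrangeSpace L ∨ ∃ F : TM n M → ℝ, IsFinslerSpace F ∧ L = fun u => F u ^ 2) :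
    -- the canonical N-connection, d-metric and d-connection
    IsGloballyDefined L ∧ IsNConnection (lagN L) ∧ IsDConnection (lagN L) (lagD L) ∧
    IsMetricCompatible (lagG L) (lagD L) ∧
    -- the curvature of the canonical d-connection
    ∃ R₀ : Π u : TM n M, TangentSpace (IT n) u → TangentSpace (IT n) u →
        (TangentSpace (IT n) u →ₗ[ℝ] TangentSpace (IT n) u),
    IsCurvatureOn (Eu n × Eu n) (slit n M) (lagD L) (fun u Y Z => R₀ u Y Z) ∧
    -- its Chern character, and those of the other d-connections on the slit tangent bundle
    (∃ c₀ : TotalForm (IT n) (TM n M), IsTangentChernCharacter R₀ c₀ ∧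
      IsClosedFormOn (slit n M) c₀ ∧
      ∀ D, IsDConnection (lagN L) D →
        ∀ R : Π u : TM n M, TangentSpace (IT n) u → TangentSpace (IT n) u →
          (TangentSpace (IT n) u →ₗ[ℝ] TangentSpace (IT n) u),
        IsCurvatureOn (Eu n × Eu n) (slit n M) D (fun u Y Z => R u Y Z) →
        ∃ c, IsTangentChernCharacter R c ∧ IsClosedFormOn (slit n M) c ∧
          CohomologousOn (slit n M) c c₀) ∧
    -- lifting bundle gerbes over the slit tangent bundle
    ∀ (k : ℕ) [NeZero k]
      (𝔤₁ : Type*) [NormedAddCommGroup 𝔤₁] [NormedSpace ℝ 𝔤₁] [FiniteDimensional ℝ 𝔤₁]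
      (𝔤₂ : Type*) [NormedAddCommGroup 𝔤₂] [NormedSpace ℝ 𝔤₂] [FiniteDimensional ℝ 𝔤₂]
      (Gc₁ : Type*) [TopologicalSpace Gc₁] [ChartedSpace 𝔤₁ Gc₁] [Group Gc₁]
      [LieGroup 𝓘(ℝ, 𝔤₁) ∞ Gc₁]
      (G₁ : Type*) [TopologicalSpace G₁] [ChartedSpace 𝔤₁ G₁] [Group G₁]
      [LieGroup 𝓘(ℝ, 𝔤₁) ∞ G₁]
      (Gc₂ : Type*) [TopologicalSpace Gc₂] [ChartedSpace 𝔤₂ Gc₂] [Group Gc₂]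
      [LieGroup 𝓘(ℝ, 𝔤₂) ∞ Gc₂]
      (G₂ : Type*) [TopologicalSpace G₂] [ChartedSpace 𝔤₂ G₂] [Group G₂]
      [LieGroup 𝓘(ℝ, 𝔤₂) ∞ G₂]
      (ext₁ : CentralExtension k 𝔤₁ Gc₁ G₁) (ext₂ : CentralExtension k 𝔤₂ Gc₂ G₂)
      (EB : Type*) [NormedAddCommGroup EB] [NormedSpace ℝ EB] [FiniteDimensional ℝ EB]
      (B : Type*) [TopologicalSpace B] [ChartedSpace EB B] [IsManifold 𝓘(ℝ, EB) ∞ B]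
      [MulAction (G₁ × G₂) B] (pr : B → TM n M)
      (hB : IsPrincipalBundle (G := G₁ × G₂) (EB := EB) (IT n) (𝓘(ℝ, 𝔤₁).prod 𝓘(ℝ, 𝔤₂))
        (slit n M) pr)
      (q : ℤ),
    -- the canonical twisted Chern character of the modules associated with the N-adapted frames
    (∀ (fr : AdaptedFrames L 𝔤₁ 𝔤₂ G₁ G₂ EB pr) (r₁ r₂ : ℕ) (ρ : DRep q ext₁ ext₂ r₁ r₂),
      ∃ (D₀ : (Π b : B, AssocBundle B r₁ r₂ b) →
          (Π b : B, TangentSpace 𝓘(ℝ, EB) b →L[ℝ] AssocBundle B r₁ r₂ b))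
        (R : Π b : B, TangentSpace 𝓘(ℝ, EB) b → TangentSpace 𝓘(ℝ, EB) b →
          (AssocBundle B r₁ r₂ b →ₗ[ℂ] AssocBundle B r₁ r₂ b))
        (c₀ : TotalForm (IT n) (TM n M)),
        IsPsiConnection (assocModule hB.smooth_smul ρ) D₀ ∧ IsInducedConnection fr ρ D₀ ∧
        IsCurvatureOn (Fin r₁ ⊕ Fin r₂ → ℂ) Set.univ D₀ (fun b Y Z => R b Y Z) ∧
        IsInducedCurvature fr ρ R₀ R ∧
        IsChernCharacter (slit n M) pr R c₀ ∧ IsClosedFormOn (slit n M) c₀ ∧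
        ∀ D, IsPsiConnection (assocModule hB.smooth_smul ρ) D →
          ∃ c : TotalForm (IT n) (TM n M), IsChernCharacterOf (Fin r₁ ⊕ Fin r₂ → ℂ) (slit n M) pr D c ∧
            IsClosedFormOn (slit n M) c ∧ CohomologousOn (slit n M) c c₀) ∧
    -- the Chern characters of arbitrary modules
    (∀ (F : Type*) [NormedAddCommGroup F] [NormedSpace ℝ F] [NormedSpace ℂ F]
      [IsScalarTower ℝ ℂ F] [FiniteDimensional ℂ F]
      (W : B → Type*) [TopologicalSpace (TotalSpace F W)]
      [∀ b, AddCommGroup (W b)] [∀ b, Module ℝ (W b)] [∀ b, Module ℂ (W b)]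
      [∀ b, IsScalarTower ℝ ℂ (W b)] [∀ b, TopologicalSpace (W b)]
      [∀ b, IsTopologicalAddGroup (W b)] [∀ b, ContinuousSMul ℝ (W b)]
      [FiberBundle F W] [VectorBundle ℝ F W] [VectorBundle ℂ F W]
      [ContMDiffVectorBundle ∞ F W 𝓘(ℝ, EB)] (P : PsiModule q ext₁ ext₂ EB F W),
      (∀ D, IsPsiConnection P D → ∃ c : TotalForm (IT n) (TM n M),
        IsChernCharacterOf F (slit n M) pr D c) ∧
      (∀ D (c : TotalForm (IT n) (TM n M)), IsPsiConnection P D → IsChernCharacterOf F (slit n M) pr D c →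
        IsClosedFormOn (slit n M) c) ∧
      (∀ D D' (c c' : TotalForm (IT n) (TM n M)), IsPsiConnection P D → IsPsiConnection P D' →
        IsChernCharacterOf F (slit n M) pr D c → IsChernCharacterOf F (slit n M) pr D' c' →
        CohomologousOn (slit n M) c c')) := by
  have hL : IsLagrangeSpace L := by
    rcases hL with h | ⟨F, hF, rfl⟩
    exacts [h, hF.lagrange]
  have h₀ := isSmoothConnectionOn_lagD hL
  obtain ⟨R₀, hR₀⟩ := exists_isCurvatureOn isOpen_slit h₀
  refine ⟨isGloballyDefined hL, isNConnection_lagN hL, isDConnection_lagD hL,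
    isMetricCompatible_lagD hL, R₀, hR₀, ?_, ?_⟩
  · obtain ⟨c₀, -, hc₀, -, hd₀, -⟩ := exists_tangentChernCharacters h₀ h₀ hR₀ hR₀
    refine ⟨c₀, hc₀, hd₀, fun D hD R hR => ?_⟩
    obtain ⟨C₀, c, hC₀, hc, -, hd, h⟩ :=
      exists_tangentChernCharacters h₀ hD.isConnection hR₀ hR
    exact ⟨c, hc, hd, h.congr (fun _ _ _ => rfl) fun u hu m => hc₀.eq hC₀ hu m⟩
  · intro k _ 𝔤₁ _ _ _ 𝔤₂ _ _ _ Gc₁ _ _ _ _ G₁ _ _ _ _ Gc₂ _ _ _ _ G₂ _ _ _ _ ext₁ ext₂ EB _ _ _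
      B _ _ _ _ pr hB q
    refine ⟨fun fr r₁ r₂ ρ => ?_, ?_⟩
    · have hD₀ := fr.isPsiConnection_inducedD hB ρ hL
      obtain ⟨R, hR⟩ := hD₀.exists_curvature
      obtain ⟨c₀, -, hc₀, -, hd₀, -⟩ := exists_moduleForms hB hD₀ hD₀ hR hR
      refine ⟨fr.inducedD ρ, R, c₀, hD₀, fr.isInducedConnection_inducedD hB ρ hL, hR,
        fr.isInducedCurvature_inducedD hB ρ hL hR₀ hR, hc₀, hd₀, fun D hD => ?_⟩
      obtain ⟨c, hc⟩ := hD.exists_isChernCharacterOf hB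
      exact ⟨c, hc, hc.isClosedFormOn hB hD, IsChernCharacterOf.cohomologousOn hB hD₀ hD ⟨R, hR, hc₀⟩ hc⟩
    · intro F _ _ _ _ _ W _ _ _ _ _ _ _ _ _ _ _ _ P
      exact ⟨fun D hD => hD.exists_isChernCharacterOf hB, fun D c hD hc => hc.isClosedFormOn hB hD,
        fun D D' c c' hD hD' hc hc' => hc'.cohomologousOn hB hD' hD hc⟩
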